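/- Let $n\ge 3$ and let $(M,g)$ be a complete smooth $n$-dimensional Riemannian manifold with boundary $\partial M$. Let $d_g$ be its Riemannian distance, $dv_g$ and $d\sigma_g$ the volume measures of $M$ and $\partial M$, and $\eta_g$ the unit normal of $\partial M$ pointing inwards. For $x\in\partial M$ and $r>0$ put $B_r^+(x)=\{y\in M:\ d_g(x,y)<r\}$ and $D_r(x)=B_r^+(x)\cap\partial M$. Norms on $B_r^+(x)$ and $D_r(x)$ are taken with respect to $dv_g$ and $d\sigma_g$ respectively and may be $+\infty$; $\sup$ and $\inf$ of an element of $H^1(M)$ are essential. Let $P,f$ be functions on $M$ and $\bar P,\bar f$ functions on $\partial M$, with $f$ and $\bar f$ locally integrable. A function $u\in H^1(M)$ is called a *subsolution* (resp. *supersolution*) of $$\Delta_g u+Pu=f\ \text{ in } M,\qquad \frac{\partial u}{\partial\eta_g}+\bar P u=\bar f\ \text{ on }\partial M, \tag{1}$$ if for every $0\le v\in C_c^1(M)$ (not required to vanish on $\partial M$) $$\int_M\big(\langle du,dv\rangle_g-Puv+fv\big)\,dv_g+\int_{\partial M}\big(-\bar Puv+\bar fv\big)\,d\sigma_g$$ is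 nonpositive (resp. nonnegative); in the boundary integral $u$ denotes its trace. Let $K\subset\partial M$ be compact (for compact $M$ one may take $K=\partial M$). Then there is $r_0=r_0(M,g,K)>0$ such that the following holds for all $q>n$, $s>n-1$ and $\Lambda\in\mathbb R$. (a) For every $p>1$ there is a constant $C>0$, depending only on $M,g,K,n,p,q,s,\Lambda$, such that $$\sup_{B_r^+(x)}u\le C r^{-\frac np}\|u\|_{L^p(B_{2r}^+(x))}+C r^{2-\frac{2n}{q}}\|f\|_{L^{q/2}(B_{4r}^+(x))}+C r^{1-\frac{n-1}{s}}\|\bar f\|_{L^s(D_{4r}(x))}$$ for all $P\in L^{q/2}(M)$ and $\bar P\in L^s(\partial M)$ with $\|P\|_{L^{q/2}(M)}+\|\bar P\|_{L^s(\partial M)}\le\Lambda$, all locally integrable $f$ and $\bar f$, all $x\in K$ and $0<r<r_0$, and every subsolution $u\in H^1(M)$ of (1) with $u\ge 0$. (b) For every $1\le p<\frac n{n-2}$ there is a constant $C>0$, depending only on $M,g,K,n,p,q,s,\Lambda$, such that $$r^{-\frac np}\|u\|_{L^p(B_{2r}^+(x))}\le C\inf_{B_r^+(x)}u+C r^{2-\frac{2n}{q}}\|f\|_{L^{q/2}(B_{4r}^+(x))}+C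 r^{1-\frac{n-1}{s}}\|\bar f\|_{L^s(D_{4r}(x))}$$ for all $P,\bar P,f,\bar f,x,r$ as in (a), and every supersolution $u\in H^1(M)$ of (1) with $u\ge 0$. -/

import Mathlib

open Bundle MeasureTheory Set Filter Topology Manifold
open scoped ENNReal ContDiff

noncomputable section

namespace RobinMoser

section Geometry

variable {n : ℕ} [NeZero n] {M : Type*} [EMetricSpace M] [MeasurableSpace M] [BorelSpace M]
  [ChartedSpace (EuclideanHalfSpace n) M]

/-- The Riemannian volume measure `dv_g` of an `n`-dimensional Riemannian manifold: the
`n`-dimensional Hausdorff measure of the Riemannian distance, normalised so that it is Lebesgue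
measure on Euclidean `n`-space. -/
def volM (n : ℕ) (M : Type*) [EMetricSpace M] [MeasurableSpace M] [BorelSpace M] : Measure M :=
  μHE[n]

/-- The boundary volume measure `dσ_g`, seen as a measure on `M` carried by `∂M`: the normalised
`(n-1)`-dimensional Hausdorff measure restricted to `∂M` (here `1 ≤ n`). -/
def volBoundary (n : ℕ) [NeZero n] (M : Type*) [EMetricSpace M] [MeasurableSpace M]
    [BorelSpace M] [ChartedSpace (EuclideanHalfSpace n) M] : Measure M :=
  (μHE[n - 1] : Measure M).restrict ((𝓡∂ n).boundary M)

/-- The half-ball `B_r^+(x)`: all points of `M` at Riemannian distance less than `r` from `x`. -/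
def ballPlus (x : M) (r : ℝ) : Set M := Metric.eball x (ENNReal.ofReal r)

/-- The boundary piece `D_r(x) = B_r^+(x) ∩ ∂M`. -/
def ballBoundary (n : ℕ) [NeZero n] {M : Type*} [EMetricSpace M]
    [ChartedSpace (EuclideanHalfSpace n) M] (x : M) (r : ℝ) : Set M :=
  ballPlus x r ∩ (𝓡∂ n).boundary M

end Geometry

section Sobolev

variable {n : ℕ} [NeZero n] {M : Type*} [EMetricSpace M]
  [ChartedSpace (EuclideanHalfSpace n) M]
  [RiemannianBundle (fun x : M ↦ TangentSpace (𝓡∂ n) x)]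

instance tangentSpace_finiteDimensional (x : M) :
    FiniteDimensional ℝ (TangentSpace (𝓡∂ n) x) :=
  inferInstanceAs (FiniteDimensional ℝ (EuclideanSpace ℝ (Fin n)))

instance tangentSpace_completeSpace (x : M) : CompleteSpace (TangentSpace (𝓡∂ n) x) :=
  FiniteDimensional.complete ℝ _

/-- The Riemannian gradient: the vector representing the differential `dφ` through `g`. -/
def grad (φ : M → ℝ) (x : M) : TangentSpace (𝓡∂ n) x :=
  (InnerProductSpace.toDual ℝ (TangentSpace (𝓡∂ n) x)).symm (mfderiv (𝓡∂ n) 𝓘(ℝ, ℝ) φ x)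

lemma inner_grad (φ : M → ℝ) (x : M) (w : TangentSpace (𝓡∂ n) x) :
    inner ℝ (grad φ x) w = (mfderiv (𝓡∂ n) 𝓘(ℝ, ℝ) φ x w : ℝ) :=
  InnerProductSpace.toDual_symm_apply

variable [MeasurableSpace M] [BorelSpace M]

/-- `u` belongs to `H¹(M)`, the completion of the smooth functions (smooth up to the boundary)
in the norm `(∫ |u|² + |du|²)^{1/2}`; `G` is its weak gradient and `τ` its trace on `∂M`
(only the values of `τ` on `∂M` matter). The trace is the continuous extension of the
restriction map, with values in `L²_loc(∂M)`. -/
structure IsH1 (u : M → ℝ) (G : ∀ x : M, TangentSpace (𝓡∂ n) x) (τ : M → ℝ) : Prop where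
  memLp : MemLp u 2 (volM n M)
  memLp_grad : MemLp (fun x ↦ ‖G x‖) 2 (volM n M)
  aestronglyMeasurable_trace : AEStronglyMeasurable τ (volBoundary n M)
  approx : ∃ φ : ℕ → M → ℝ,
    (∀ k, ContMDiff (𝓡∂ n) 𝓘(ℝ, ℝ) ∞ (φ k)) ∧
    Tendsto (fun k ↦ eLpNorm (fun x ↦ φ k x - u x) 2 (volM n M)) atTop (𝓝 0) ∧
    (∀ k, AEStronglyMeasurable (fun x ↦ ‖grad (φ k) x - G x‖) (volM n M)) ∧
    Tendsto (fun k ↦ eLpNorm (fun x ↦ ‖grad (φ k) x - G x‖) 2 (volM n M)) atTop (𝓝 0) ∧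
    ∀ K : Set M, IsCompact K →
      Tendsto (fun k ↦ eLpNorm (fun x ↦ φ k x - τ x) 2 ((volBoundary n M).restrict K))
        atTop (𝓝 0)

/-- The quantity
`∫_M (⟨du, dv⟩ - P u v + f v) dv_g + ∫_{∂M} (- Pb u v + fb v) dσ_g`,
for `u` with weak gradient `G` and trace `τ`. -/
def weakForm (P f Pb fb u : M → ℝ) (G : ∀ x : M, TangentSpace (𝓡∂ n) x) (τ v : M → ℝ) : ℝ :=
  (∫ x, (inner ℝ (G x) (grad v x) - P x * u x * v x + f x * v x) ∂(volM n M)) +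
    ∫ x, (-(Pb x * τ x * v x) + fb x * v x) ∂(volBoundary n M)

/-- `v` is a nonnegative element of `C_c^1(M)`; it need not vanish on `∂M`. -/
structure IsTest (n : ℕ) [NeZero n] {M : Type*} [EMetricSpace M]
    [ChartedSpace (EuclideanHalfSpace n) M] (v : M → ℝ) : Prop where
  contMDiff : ContMDiff (𝓡∂ n) 𝓘(ℝ, ℝ) 1 v
  hasCompactSupport : HasCompactSupport v
  nonneg : ∀ x, 0 ≤ v x

/-- `u ∈ H¹(M)` is a (weak) subsolution of `Δu + P u = f` in `M`, `∂u/∂η + Pb u = fb` on `∂M`,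
with `η` the inward unit normal. -/
def IsSubsolution (n : ℕ) [NeZero n] {M : Type*} [EMetricSpace M]
    [ChartedSpace (EuclideanHalfSpace n) M]
    [RiemannianBundle (fun x : M ↦ TangentSpace (𝓡∂ n) x)] [MeasurableSpace M] [BorelSpace M]
    (P f Pb fb u : M → ℝ) : Prop :=
  ∃ (G : ∀ x : M, TangentSpace (𝓡∂ n) x) (τ : M → ℝ), IsH1 u G τ ∧
    ∀ v : M → ℝ, IsTest n v → weakForm P f Pb fb u G τ v ≤ 0

/-- `u ∈ H¹(M)` is a (weak) supersolution of `Δu + P u = f` in `M`, `∂u/∂η + Pb u = fb` on `∂M`,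
with `η` the inward unit normal. -/
def IsSupersolution (n : ℕ) [NeZero n] {M : Type*} [EMetricSpace M]
    [ChartedSpace (EuclideanHalfSpace n) M]
    [RiemannianBundle (fun x : M ↦ TangentSpace (𝓡∂ n) x)] [MeasurableSpace M] [BorelSpace M]
    (P f Pb fb u : M → ℝ) : Prop :=
  ∃ (G : ∀ x : M, TangentSpace (𝓡∂ n) x) (τ : M → ℝ), IsH1 u G τ ∧
    ∀ v : M → ℝ, IsTest n v → 0 ≤ weakForm P f Pb fb u G τ v

end Sobolev

section Bounds

variable {M : Type*} [EMetricSpace M] [MeasurableSpace M] [BorelSpace M]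

/-- The norm `‖h‖_{L^p(A)}` with respect to `dv_g`, for a real exponent `p`, in `[0, ∞]`. -/
def normM (n : ℕ) (h : M → ℝ) (p : ℝ) (A : Set M) : ℝ≥0∞ :=
  eLpNorm h (ENNReal.ofReal p) ((volM n M).restrict A)

/-- The norm `‖h‖_{L^s(A)}` with respect to `dσ_g`, for a real exponent `s`, in `[0, ∞]`. -/
def normBoundary (n : ℕ) [NeZero n] [ChartedSpace (EuclideanHalfSpace n) M]
    (h : M → ℝ) (s : ℝ) (A : Set M) : ℝ≥0∞ :=
  eLpNorm h (ENNReal.ofReal s) ((volBoundary n M).restrict A)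

/-- The coefficients `P ∈ L^{q/2}(M)`, `Pb ∈ L^s(∂M)` have norms with sum at most `Λ`, and `f`, `fb`
are locally integrable. -/
structure Admissible (n : ℕ) [NeZero n] [ChartedSpace (EuclideanHalfSpace n) M]
    (q s Λ : ℝ) (P f Pb fb : M → ℝ) : Prop where
  memLp : MemLp P (ENNReal.ofReal (q / 2)) (volM n M)
  memLp_boundary : MemLp Pb (ENNReal.ofReal s) (volBoundary n M)
  norm_le : normM n P (q / 2) univ + normBoundary n Pb s univ ≤ ENNReal.ofReal Λ
  locallyIntegrable : LocallyIntegrable f (volM n M)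
  locallyIntegrable_boundary : LocallyIntegrable fb (volBoundary n M)

/-- The data term
`C r^{2-2n/q} ‖f‖_{L^{q/2}(B_{4r}^+(x))} + C r^{1-(n-1)/s} ‖fb‖_{L^s(D_{4r}(x))}`. -/
def dataTerm (n : ℕ) [NeZero n] [ChartedSpace (EuclideanHalfSpace n) M]
    (q s C r : ℝ) (f fb : M → ℝ) (x : M) : ℝ≥0∞ :=
  ENNReal.ofReal (C * r ^ (2 - 2 * (n : ℝ) / q)) * normM n f (q / 2) (ballPlus x (4 * r)) +
    ENNReal.ofReal (C * r ^ (1 - ((n : ℝ) - 1) / s)) *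
      normBoundary n fb s (ballBoundary n x (4 * r))

end Bounds

end RobinMoser

end

/-!
Both inequalities come from Moser's iteration, carried out in a chart and on balls that the boundary
may cut.

*Reduction to potentials.* For a solution `u ≥ 0` let `w = u + k`, where `k > 0` is at least the
scaled norms of the data `f` and `fb` on the ball of radius `4 r`. Then `|P| + |f| / k` and
`|Pb| + |fb| / k` act as potentials on `w`, and `k` decreases to the size of the data at the end.
Since `q > n` and `s > n - 1`, these potentials have an arbitrarily small relative bound with
respect to the Dirichlet form (`exists_form_bound`), uniformly over all scales `r ≤ 1`.

*Geometry.* Near every point there is a chart in which the metric is within a factor `11/10` of a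
constant one (`exists_isAlmostFlat`). The volumes are Hausdorff measures, so the Lipschitz bounds
for the chart and its inverse compare them with the measures of the Euclidean half-space. In this
way the Sobolev inequality, the trace inequality, the Poincaré inequality and cutoff functions with
bounded gradient pass from the half-space to `M`. In the half-space, the Sobolev inequality for
functions that do not vanish on the boundary is that of the whole space, after folding.

*The energy inequality.* Testing the equation with `η² Φ(w)` bounds the energy of `η H(w)`, for
suitable pairs of functions `Φ`, `H` (`TestPair`, `LocalSolution.caccioppoli`). Such test functions
are not `C¹`; they are reached through `C¹` functions that converge to `u` in `H¹` so fast that the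
limits can be taken by dominated convergence (`H1Approx`, `H1Approx.weak_inequality`). After
rescaling to unit size, everything that the iteration needs is collected in `HarnackData`, which
`IsAlmostFlat.exists_harnackData` establishes.

*Subsolutions.* The powers of a subsolution satisfy reverse Hölder inequalities, whose iteration
bounds it by its `L^p` norm for every `p > 1` (`HarnackData.exists_sub_bound`).

*Supersolutions.* The test function `1/w` bounds the energy of `log w`, so by the Poincaré
inequality `log (w/m)` is bounded in `L²` for some number `m` (`HarnackData.exists_log_bound`). The
function `1 + log (1 + m/w)` is then a subsolution which is bounded in `L²`, hence bounded, and this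
bounds `w` from below by a multiple of `m`. On the other side, the reverse Hölder inequalities for
the small powers of `w/m` and the bound for its logarithm give `‖w‖_p ≤ C m` for `p < n/(n-2)`, by
the lemma of Bombieri and Giusti (`exists_lintegral_rpow_le_of_log_tail`), which takes the place of
the John–Nirenberg inequality (`HarnackData.exists_super_bound`).

Finally, finitely many such charts cover the compact set, so one `r₀` and one `C` serve all points.
-/

open Bundle MeasureTheory Set Filter Topology Manifold
open scoped ENNReal ContDiff
open ENNReal (ofReal)

local notation "𝔼" n:max => EuclideanSpace ℝ (Fin n)

noncomputable section

namespace RobinMoser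

/-! ### Iteration lemmas -/

section Iteration

variable {X : Type*} [MeasurableSpace X] {μ : Measure X} {E : ℝ → Set X}

/-- A function whose `L^{2κ^j}` norms are bounded, in the normalised sense
`∫ V^{2κ^j} ≤ L^{κ^j}`, is bounded by `√L`. -/
lemma ae_le_of_lintegral_rpow_le {V : X → ℝ≥0∞} {κ : ℝ} (hκ : 1 < κ) (hV : AEMeasurable V μ)
    {L : ℝ≥0∞} (h : ∀ j : ℕ, ∫⁻ x, V x ^ (2 * κ ^ j) ∂μ ≤ L ^ (κ ^ j)) :
    ∀ᵐ x ∂μ, V x ≤ L ^ (1 / 2 : ℝ) := by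
  have hκ0 : 0 < κ := by linarith
  by_cases hL : L = ⊤
  · simp [hL]
  have key : ∀ t : ℝ≥0∞, L ^ (1 / 2 : ℝ) < t → t ≠ ⊤ → ∀ᵐ x ∂μ, V x < t := by
    intro t ht ht'
    have ht0 : t ≠ 0 := (lt_of_le_of_lt zero_le ht).ne'
    have hLt : L < t ^ (2 : ℝ) := by
      have := ENNReal.rpow_lt_rpow ht (show (0 : ℝ) < 2 by norm_num)
      rwa [← ENNReal.rpow_mul, show (1 / 2 : ℝ) * 2 = 1 by norm_num, ENNReal.rpow_one] at this
    have ht2 : t ^ (2 : ℝ) ≠ ⊤ := ENNReal.rpow_ne_top_of_nonneg (by norm_num) ht'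
    have ht20 : t ^ (2 : ℝ) ≠ 0 := by
      simp [ht0]
    set q : ℝ≥0∞ := L / t ^ (2 : ℝ) with hq
    have hq1 : q < 1 := by
      rw [hq, ENNReal.div_lt_iff (Or.inl ht20) (Or.inl ht2)]; simpa using hLt
    have hm : ∀ j : ℕ, μ {x | t ≤ V x} ≤ q ^ (κ ^ j) := by
      intro j
      have hj : 0 < κ ^ j := pow_pos hκ0 j
      have h1 := mul_meas_ge_le_lintegral₀ (hV.pow_const (2 * κ ^ j)) (t ^ (2 * κ ^ j))
      have h2 : {x | t ≤ V x} ⊆ {x | t ^ (2 * κ ^ j) ≤ V x ^ (2 * κ ^ j)} := by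
        intro x hx
        exact ENNReal.rpow_le_rpow hx (by positivity)
      have h3 : t ^ (2 * κ ^ j) * μ {x | t ≤ V x} ≤ L ^ (κ ^ j) :=
        (mul_le_mul_right (measure_mono h2) _).trans (h1.trans (h j))
      rw [hq, ENNReal.div_rpow_of_nonneg _ _ hj.le, ← ENNReal.rpow_mul,
        ENNReal.le_div_iff_mul_le, mul_comm]
      · exact h3
      · left; simp [ENNReal.rpow_eq_zero_iff, ht0, ht']
      · left; exact ENNReal.rpow_ne_top_of_nonneg (by positivity) ht'
    have hlim : Tendsto (fun j : ℕ ↦ q ^ (κ ^ j)) atTop (𝓝 0) := by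
      have hk : Tendsto (fun j : ℕ ↦ κ ^ j) atTop atTop := tendsto_pow_atTop_atTop_of_one_lt hκ
      exact (ENNReal.tendsto_rpow_atTop_of_base_lt_one hq1).comp hk
    have h0 : μ {x | t ≤ V x} = 0 :=
      le_antisymm (ge_of_tendsto' hlim hm) zero_le
    rw [ae_iff]
    simpa [not_lt] using h0
  have hL2 : L ^ (1 / 2 : ℝ) ≠ ⊤ := ENNReal.rpow_ne_top_of_nonneg (by norm_num) hL
  have hall : ∀ᵐ x ∂μ, ∀ m : ℕ, V x < L ^ (1 / 2 : ℝ) + ((m : ℝ≥0∞) + 1)⁻¹ := by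
    rw [ae_all_iff]
    intro m
    refine key _ ?_ ?_
    · exact ENNReal.lt_add_right hL2 (by simp)
    · simp [hL]
  filter_upwards [hall] with x hx
  have hl : Tendsto (fun m : ℕ ↦ L ^ (1 / 2 : ℝ) + ((m : ℝ≥0∞) + 1)⁻¹) atTop
      (𝓝 (L ^ (1 / 2 : ℝ) + 0)) := by
    refine Tendsto.add tendsto_const_nhds ?_
    have := (tendsto_add_atTop_iff_nat 1).2 ENNReal.tendsto_inv_nat_nhds_zero
    simpa using this
  rw [add_zero] at hl
  exact ge_of_tendsto' hl fun m ↦ (hx m).le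

/-- Moser's iteration: the reverse Hölder inequality is applied on the radii
`ρ₀ + (ρ₁ - ρ₀) / 2^j` with the exponents `2 κ^j`. Its constant grows only geometrically in `j`,
so the product of the constants, the `j`-th taken to the power `1 / κ^j`, converges. -/
lemma exists_ae_le_of_reverse_holder {κ B ρ₀ ρ₁ : ℝ} (hκ : 1 < κ) (hB : 0 < B) (d : ℕ)
    (hρ : ρ₀ < ρ₁) : ∃ C : ℝ, 0 < C ∧ ∀ (μ : Measure X) (E : ℝ → Set X), Monotone E →
      ∀ V : X → ℝ≥0∞, AEMeasurable V (μ.restrict (E ρ₁)) →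
      (∀ (j : ℕ) (ρ ρ' : ℝ), ρ₀ ≤ ρ → ρ < ρ' → ρ' ≤ ρ₁ →
        (∫⁻ x in E ρ, V x ^ (2 * κ ^ (j + 1)) ∂μ) ^ (1 / κ) ≤
          ofReal (B * (κ ^ j) ^ d / (ρ' - ρ) ^ 2) *
            ∫⁻ x in E ρ', V x ^ (2 * κ ^ j) ∂μ) →
      ∀ᵐ x ∂μ.restrict (E ρ₀), V x ≤
        ofReal C * (∫⁻ x in E ρ₁, V x ^ (2 : ℝ) ∂μ) ^ (1 / 2 : ℝ) := by
  have hκ0 : 0 < κ := by linarith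
  have hD : 0 < ρ₁ - ρ₀ := by linarith
  set K : ℝ := max 1 (B / (ρ₁ - ρ₀) ^ 2) * (4 * κ ^ d) with hK
  have hK1 : 1 ≤ K := by
    have h1 : (1 : ℝ) ≤ κ ^ d := one_le_pow₀ hκ.le
    have h2 : (1 : ℝ) ≤ max 1 (B / (ρ₁ - ρ₀) ^ 2) := le_max_left _ _
    nlinarith
  have hKj : ∀ j : ℕ, B * (κ ^ j) ^ d / ((ρ₁ - ρ₀) / 2 ^ (j + 1)) ^ 2 ≤ K ^ (j + 1) := by
    intro j
    have e : B * (κ ^ j) ^ d / ((ρ₁ - ρ₀) / 2 ^ (j + 1)) ^ 2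
        = (B / (ρ₁ - ρ₀) ^ 2) * (4 * (4 * κ ^ d) ^ j) := by
      rw [mul_pow, ← pow_mul, ← pow_mul, mul_comm d j, show (4 : ℝ) ^ j = (2 ^ j) ^ 2 by
        rw [← pow_mul, mul_comm, pow_mul]; norm_num]
      field_simp
      ring
    have h1 : (1 : ℝ) ≤ κ ^ d := one_le_pow₀ hκ.le
    set m : ℝ := max 1 (B / (ρ₁ - ρ₀) ^ 2)
    have hm : 1 ≤ m := le_max_left _ _
    have hm' : B / (ρ₁ - ρ₀) ^ 2 ≤ m := le_max_right _ _
    rw [e, hK]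
    have h4 : (4 : ℝ) * (4 * κ ^ d) ^ j ≤ (4 * κ ^ d) ^ (j + 1) := by
      rw [pow_succ, mul_comm]
      gcongr
      linarith
    calc _ ≤ m * (4 * (4 * κ ^ d) ^ j) := by gcongr
      _ ≤ m ^ (j + 1) * (4 * κ ^ d) ^ (j + 1) := by
        have := le_self_pow₀ hm (Nat.succ_ne_zero j)
        gcongr
      _ = _ := (mul_pow _ _ _).symm
  have hsum : Summable fun i : ℕ ↦ ((i : ℝ) + 1) * (κ⁻¹) ^ i := by
    have hlt : ‖κ⁻¹‖ < 1 := by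
      rw [Real.norm_of_nonneg (by positivity)]; exact inv_lt_one_of_one_lt₀ hκ
    have h1 := summable_pow_mul_geometric_of_norm_lt_one 1 hlt
    have h2 := summable_geometric_of_norm_lt_one hlt
    simpa [add_mul] using h1.add h2
  set S : ℝ := ∑' i : ℕ, ((i : ℝ) + 1) * (κ⁻¹) ^ i with hS
  refine ⟨K ^ (S / 2), by positivity, ?_⟩
  intro μ E hE V hV h
  set 𝒦 : ℝ≥0∞ := ofReal K with h𝒦
  have h𝒦1 : 1 ≤ 𝒦 := by rw [h𝒦]; simpa using hK1
  set I₀ : ℝ≥0∞ := ∫⁻ x in E ρ₁, V x ^ (2 : ℝ) ∂μ with hI₀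
  set R : ℕ → ℝ := fun j ↦ ρ₀ + (ρ₁ - ρ₀) / 2 ^ j with hR
  have hR1 : ∀ j, ρ₀ < R j := fun j ↦ by simp only [hR]; linarith [div_pos hD (pow_pos two_pos j)]
  have hR2 : ∀ j, R j ≤ ρ₁ := fun j ↦ by
    have : (ρ₁ - ρ₀) / 2 ^ j ≤ ρ₁ - ρ₀ := div_le_self hD.le (one_le_pow₀ (by norm_num))
    simp only [hR]; linarith
  have hR3 : ∀ j, R j - R (j + 1) = (ρ₁ - ρ₀) / 2 ^ (j + 1) := fun j ↦ by
    simp only [hR]; rw [pow_succ]; field_simp; ring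
  have hI : ∀ j : ℕ, ∫⁻ x in E (R j), V x ^ (2 * κ ^ j) ∂μ ≤
      (𝒦 ^ (∑ i ∈ Finset.range j, ((i : ℝ) + 1) * (κ⁻¹) ^ i) * I₀) ^ (κ ^ j) := by
    intro j
    induction j with
    | zero => simp [hR, hI₀]
    | succ j ih =>
      have hj : 0 < κ ^ j := pow_pos hκ0 j
      have h1 := h j (R (j + 1)) (R j) (hR1 _).le
        (by have := hR3 j; have : 0 < (ρ₁ - ρ₀) / 2 ^ (j + 1) := by positivity
            linarith) (hR2 j)
      rw [hR3] at h1
      have h2 : ofReal (B * (κ ^ j) ^ d / ((ρ₁ - ρ₀) / 2 ^ (j + 1)) ^ 2) ≤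
          𝒦 ^ (((j : ℝ) + 1)) := by
        have : ((j : ℝ) + 1) = ((j + 1 : ℕ) : ℝ) := by push_cast; ring
        rw [this, ENNReal.rpow_natCast, h𝒦, ← ENNReal.ofReal_pow (by linarith)]
        exact ENNReal.ofReal_le_ofReal (hKj j)
      have h3 := h1.trans (mul_le_mul' h2 ih)
      have h4 := ENNReal.rpow_le_rpow h3 hκ0.le
      rw [← ENNReal.rpow_mul, one_div, inv_mul_cancel₀ hκ0.ne', ENNReal.rpow_one] at h4
      refine h4.trans (le_of_eq ?_)
      have hs : 𝒦 ^ (∑ i ∈ Finset.range (j + 1), ((i : ℝ) + 1) * (κ⁻¹) ^ i) * I₀ =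
          𝒦 ^ (((j : ℝ) + 1) * (κ⁻¹) ^ j) *
            (𝒦 ^ (∑ i ∈ Finset.range j, ((i : ℝ) + 1) * (κ⁻¹) ^ i) * I₀) := by
        rw [Finset.sum_range_succ, ENNReal.rpow_add _ _ (by positivity) (by simp [h𝒦])]
        ring
      rw [hs]
      generalize 𝒦 ^ (∑ i ∈ Finset.range j, ((i : ℝ) + 1) * (κ⁻¹) ^ i) * I₀ = Y
      rw [ENNReal.mul_rpow_of_nonneg _ _ hκ0.le, ENNReal.mul_rpow_of_nonneg _ _ (by positivity),
        ← ENNReal.rpow_mul, ← ENNReal.rpow_mul, ← ENNReal.rpow_mul, ← pow_succ]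
      congr 2
      rw [pow_succ, inv_pow]
      field_simp
  have hfin := ae_le_of_lintegral_rpow_le (μ := μ.restrict (E ρ₀)) (V := V) (L := 𝒦 ^ S * I₀) hκ
    (hV.mono_measure (Measure.restrict_mono (hE hρ.le) le_rfl)) ?_
  · filter_upwards [hfin] with x hx
    refine hx.trans (le_of_eq ?_)
    rw [ENNReal.mul_rpow_of_nonneg _ _ (by norm_num), ← ENNReal.rpow_mul, h𝒦,
      ENNReal.ofReal_rpow_of_pos (by linarith)]
    congr 4
    ring
  · intro j
    refine (lintegral_mono_set (hE (hR1 j).le)).trans ((hI j).trans ?_)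
    refine ENNReal.rpow_le_rpow ?_ (by positivity)
    gcongr
    · exact hsum.sum_le_tsum _ (fun i _ ↦ by positivity)

end Iteration

/-! ### The lemma of Bombieri and Giusti -/

section BombieriGiusti

variable {X : Type*} [MeasurableSpace X]

/-- Iterating a reverse Hölder inequality between consecutive exponents `p / κ^(j+1)`, `p / κ^j`,
with a constant that does not depend on `j`, bounds the `L^p` norm by every `L^{p/κ^j}` norm. -/
lemma exists_chain_reverse_holder {κ B ρ₀ ρ₁ : ℝ} (p : ℝ) (hκ : 1 < κ) (hB : 0 < B)
    (hρ : ρ₀ < ρ₁) : ∃ C γ : ℝ, 0 < C ∧ 0 < γ ∧ (∀ δ, 0 < δ → δ ≤ ρ₁ - ρ₀ → 1 ≤ C * δ ^ (-γ)) ∧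
      ∀ (μ : Measure X) (E : ℝ → Set X), Monotone E → ∀ f : X → ℝ≥0∞,
      (∀ (j : ℕ) (ρ ρ' : ℝ), ρ₀ ≤ ρ → ρ < ρ' → ρ' ≤ ρ₁ →
        (∫⁻ x in E ρ, f x ^ (p / κ ^ j) ∂μ) ^ (1 / κ) ≤
          ofReal (B / (ρ' - ρ) ^ 2) * ∫⁻ x in E ρ', f x ^ (p / κ ^ (j + 1)) ∂μ) →
      ∀ (j : ℕ) (ρ ρ' : ℝ), ρ₀ ≤ ρ → ρ < ρ' → ρ' ≤ ρ₁ →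
        ∫⁻ x in E ρ, f x ^ p ∂μ ≤
          (ofReal (C * (ρ' - ρ) ^ (-γ)) * ∫⁻ x in E ρ', f x ^ (p / κ ^ j) ∂μ) ^ (κ ^ j) := by
  have hκ0 : 0 < κ := by linarith
  have hκ1 : 0 < κ - 1 := by linarith
  have hD : 0 < ρ₁ - ρ₀ := by linarith
  set γ : ℝ := 2 * κ / (κ - 1) with hγ
  have hγ0 : 0 < γ := by positivity
  set C : ℝ := max ((ρ₁ - ρ₀) ^ γ) ((4 * B * 2 ^ (γ / κ)) ^ (κ / (κ - 1))) with hC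
  have hC0 : 0 < C := lt_of_lt_of_le (by positivity) (le_max_left _ _)
  have hone : ∀ δ, 0 < δ → δ ≤ ρ₁ - ρ₀ → 1 ≤ C * δ ^ (-γ) := by
    intro δ h0 h1
    rw [Real.rpow_neg h0.le, ← div_eq_mul_inv, one_le_div (by positivity)]
    exact (Real.rpow_le_rpow h0.le h1 hγ0.le).trans (le_max_left _ _)
  have hN : ∀ δ, 0 < δ → (C * (δ / 2) ^ (-γ)) ^ (1 / κ) * (B / (δ / 2) ^ 2) ≤ C * δ ^ (-γ) := by
    intro δ h0
    have e1 : 4 * B * 2 ^ (γ / κ) ≤ C ^ ((κ - 1) / κ) := by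
      have h2 : ((4 * B * 2 ^ (γ / κ)) ^ (κ / (κ - 1))) ^ ((κ - 1) / κ) ≤ C ^ ((κ - 1) / κ) :=
        Real.rpow_le_rpow (by positivity) (le_max_right _ _) (by positivity)
      rwa [← Real.rpow_mul (by positivity), div_mul_div_comm, mul_comm κ, div_self (by positivity),
        Real.rpow_one] at h2
    have e2 : (C * (δ / 2) ^ (-γ)) ^ (1 / κ) * (B / (δ / 2) ^ 2) =
        (4 * B * 2 ^ (γ / κ)) * C ^ (1 / κ) * δ ^ (-γ) := by
      rw [Real.mul_rpow hC0.le (by positivity), ← Real.rpow_mul (by positivity),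
        Real.div_rpow h0.le (by norm_num)]
      have h3 : (2 : ℝ) ^ (-γ * (1 / κ)) = (2 ^ (γ / κ))⁻¹ := by
        rw [← Real.rpow_neg (by norm_num)]; congr 1; ring
      have h4 : δ ^ (-γ) = δ ^ (-γ * (1 / κ)) / δ ^ 2 := by
        rw [← Real.rpow_natCast δ 2, ← Real.rpow_sub h0]
        congr 1
        rw [hγ]
        field_simp
        push_cast
        ring
      rw [h3, h4]
      field_simp
      ring
    rw [e2]
    have e3 : C = C ^ ((κ - 1) / κ) * C ^ (1 / κ) := by
      rw [← Real.rpow_add hC0]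
      conv_lhs => rw [← Real.rpow_one C]
      congr 1
      field_simp
      ring
    calc _ ≤ C ^ ((κ - 1) / κ) * C ^ (1 / κ) * δ ^ (-γ) := by gcongr
      _ = _ := by rw [← e3]
  refine ⟨C, γ, hC0, hγ0, hone, ?_⟩
  intro μ E hE f h j
  induction j with
  | zero =>
    intro ρ ρ' h1 h2 h3
    simp only [pow_zero, div_one, ENNReal.rpow_one]
    calc _ ≤ ∫⁻ x in E ρ', f x ^ p ∂μ := lintegral_mono_set (hE h2.le)
      _ = 1 * ∫⁻ x in E ρ', f x ^ p ∂μ := (one_mul _).symm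
      _ ≤ _ := by
        gcongr
        rw [ENNReal.one_le_ofReal]
        exact hone _ (by linarith) (by linarith)
  | succ j ih =>
    intro ρ ρ' h1 h2 h3
    have hm := ih ρ ((ρ + ρ') / 2) h1 (by linarith) (by linarith)
    have hs := h j ((ρ + ρ') / 2) ρ' (by linarith) (by linarith) h3
    rw [show (ρ + ρ') / 2 - ρ = (ρ' - ρ) / 2 by ring] at hm
    rw [show ρ' - (ρ + ρ') / 2 = (ρ' - ρ) / 2 by ring] at hs
    have hs2 := ENNReal.rpow_le_rpow hs hκ0.le
    rw [← ENNReal.rpow_mul, one_div, inv_mul_cancel₀ hκ0.ne', ENNReal.rpow_one] at hs2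
    have hN' := hN (ρ' - ρ) (by linarith)
    have hpos : 0 < C * ((ρ' - ρ) / 2) ^ (-γ) := by
      have : 0 < ρ' - ρ := by linarith
      positivity
    refine hm.trans ?_
    rw [pow_succ κ j, mul_comm (κ ^ j) κ, ENNReal.rpow_mul _ κ]
    refine ENNReal.rpow_le_rpow ?_ (by positivity)
    have e : ofReal (C * ((ρ' - ρ) / 2) ^ (-γ)) =
        (ofReal ((C * ((ρ' - ρ) / 2) ^ (-γ)) ^ (1 / κ))) ^ κ := by
      rw [ENNReal.ofReal_rpow_of_nonneg (by positivity) hκ0.le, ← Real.rpow_mul hpos.le, one_div,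
        inv_mul_cancel₀ hκ0.ne', Real.rpow_one]
    rw [e]
    refine (mul_le_mul_right hs2 _).trans ?_
    rw [← ENNReal.mul_rpow_of_nonneg _ _ hκ0.le]
    refine ENNReal.rpow_le_rpow ?_ hκ0.le
    rw [← mul_assoc, ← ENNReal.ofReal_mul (by positivity), mul_comm κ (κ ^ j), ← pow_succ]
    gcongr

/-- Splitting at the level `e^{ψ/2}`: if `∫ f^p ≤ e^{pψ}` and `log f` has a weak `L¹` tail, then
small powers of `f` are bounded by those of `e^{ψ/2}`. -/
lemma lintegral_rpow_le_of_log_tail {ν : Measure X} {f : X → ℝ≥0∞} (hf : AEMeasurable f ν)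
    {p q A B ψ : ℝ} (hp : 0 < p) (hq : 1 < q) (hA : ν univ ≤ ofReal A) (hA0 : 0 ≤ A)
    (hB : 0 < B) (hψ : 2 * B < ψ)
    (hlog : ∀ t : ℝ, 0 < t → ν {x | ofReal (Real.exp t) < f x} ≤ ofReal (B / t))
    (hF : ∫⁻ x, f x ^ p ∂ν ≤ ofReal (Real.exp (p * ψ)))
    (hqψ : p * ψ / 2 ≤ (q - 1) * Real.log (ψ / (2 * B))) :
    ∫⁻ x, f x ^ (p / q) ∂ν ≤ ofReal ((A + 1) * Real.exp (p / q * (ψ / 2))) := by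
  have hq0 : 0 < q := by linarith
  have hψ0 : 0 < ψ := by linarith
  set S : Set X := {x | ofReal (Real.exp (ψ / 2)) < f x} with hS
  have hSm : NullMeasurableSet S ν := nullMeasurableSet_lt aemeasurable_const hf
  have hpt : ∀ x, f x ^ (p / q) ≤ ofReal (Real.exp (p / q * (ψ / 2))) +
      f x ^ (p / q) * S.indicator 1 x := by
    intro x
    by_cases hx : x ∈ S
    · simp [hx]
    · have hx' : f x ≤ ofReal (Real.exp (ψ / 2)) := not_lt.1 hx
      refine le_trans ?_ le_self_add
      refine (ENNReal.rpow_le_rpow hx' (by positivity)).trans (le_of_eq ?_)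
      rw [ENNReal.ofReal_rpow_of_pos (Real.exp_pos _), ← Real.exp_mul, mul_comm]
  have hconj : q.HolderConjugate (q / (q - 1)) := by
    rw [Real.holderConjugate_iff]
    refine ⟨hq, ?_⟩
    have : q - 1 ≠ 0 := by linarith
    field_simp
    ring
  have hind : AEMeasurable (S.indicator (1 : X → ℝ≥0∞)) ν :=
    (aemeasurable_const (b := (1 : ℝ≥0∞))).indicator₀ hSm
  -- above the level, Hölder trades the large `L^p` norm against the small measure of the set
  have hhol := ENNReal.lintegral_mul_le_Lp_mul_Lq ν hconj (hf.pow_const (p / q)) hind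
  have e1 : ∫⁻ x, (f x ^ (p / q)) ^ q ∂ν = ∫⁻ x, f x ^ p ∂ν := by
    refine lintegral_congr fun x ↦ ?_
    rw [← ENNReal.rpow_mul, div_mul_cancel₀ _ hq0.ne']
  have e2 : ∫⁻ x, (S.indicator (1 : X → ℝ≥0∞) x) ^ (q / (q - 1)) ∂ν = ν S := by
    rw [← lintegral_indicator_one₀ hSm]
    refine lintegral_congr fun x ↦ ?_
    have : 0 < q / (q - 1) := div_pos hq0 (by linarith)
    by_cases hx : x ∈ S <;> simp [hx, this]
  rw [e1, e2] at hhol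
  have hSle : ν S ≤ ofReal (2 * B / ψ) := by
    refine (hlog (ψ / 2) (by positivity)).trans (le_of_eq ?_)
    congr 1; field_simp
  have hbound : ofReal (Real.exp (p * ψ)) ^ (1 / q) *
      ofReal (2 * B / ψ) ^ (1 / (q / (q - 1))) ≤
        ofReal (Real.exp (p / q * (ψ / 2))) := by
    rw [ENNReal.ofReal_rpow_of_pos (Real.exp_pos _), ENNReal.ofReal_rpow_of_pos (by positivity),
      ← ENNReal.ofReal_mul (by positivity), ← Real.exp_mul]
    refine ENNReal.ofReal_le_ofReal ?_
    rw [Real.rpow_def_of_pos (by positivity), ← Real.exp_add, Real.exp_le_exp]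
    have e3 : Real.log (2 * B / ψ) = -Real.log (ψ / (2 * B)) := by
      rw [← Real.log_inv, inv_div]
    rw [e3]
    have e4 : p * ψ * (1 / q) + -Real.log (ψ / (2 * B)) * (1 / (q / (q - 1))) =
        (p * ψ - (q - 1) * Real.log (ψ / (2 * B))) / q := by
      have : q - 1 ≠ 0 := by linarith
      field_simp
      ring
    rw [e4, div_mul_eq_mul_div, div_le_div_iff_of_pos_right hq0]
    linarith
  calc ∫⁻ x, f x ^ (p / q) ∂ν ≤ ∫⁻ x, (ofReal (Real.exp (p / q * (ψ / 2))) +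
        f x ^ (p / q) * S.indicator 1 x) ∂ν := lintegral_mono hpt
    _ = ofReal (Real.exp (p / q * (ψ / 2))) * ν univ +
        ∫⁻ x, f x ^ (p / q) * S.indicator 1 x ∂ν := by
      rw [lintegral_add_left measurable_const, lintegral_const]
    _ ≤ ofReal (Real.exp (p / q * (ψ / 2))) * ofReal A +
        ofReal (Real.exp (p / q * (ψ / 2))) := by
      gcongr
      refine hhol.trans (le_trans ?_ hbound)
      have : 0 < q / (q - 1) := div_pos hq0 (by linarith)
      gcongr
    _ = _ := by
      rw [← ENNReal.ofReal_mul (by positivity), ← ENNReal.ofReal_add (by positivity) (by positivity)]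
      congr 1; ring

/-- The lemma of Bombieri and Giusti: reverse Hölder inequalities between all the exponents
`p / κ^j` and a weak `L¹` bound for `(log f)⁺` together bound the `L^p` norm of `f`. -/
lemma exists_lintegral_rpow_le_of_log_tail {κ B A p ρ₀ ρ₁ : ℝ} (hp : 0 < p) (hκ : 1 < κ)
    (hB : 0 < B) (hA : 0 < A) (hρ : ρ₀ < ρ₁) : ∃ C : ℝ, 0 < C ∧
      ∀ (μ : Measure X) (E : ℝ → Set X), Monotone E → ∀ f : X → ℝ≥0∞,
      AEMeasurable f (μ.restrict (E ρ₁)) → μ (E ρ₁) ≤ ofReal A →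
      ∫⁻ x in E ρ₁, f x ^ p ∂μ ≠ ⊤ →
      (∀ t : ℝ, 0 < t →
        μ.restrict (E ρ₁) {x | ofReal (Real.exp t) < f x} ≤ ofReal (B / t)) →
      (∀ (j : ℕ) (ρ ρ' : ℝ), ρ₀ ≤ ρ → ρ < ρ' → ρ' ≤ ρ₁ →
        (∫⁻ x in E ρ, f x ^ (p / κ ^ j) ∂μ) ^ (1 / κ) ≤
          ofReal (B / (ρ' - ρ) ^ 2) * ∫⁻ x in E ρ', f x ^ (p / κ ^ (j + 1)) ∂μ) →
      ∫⁻ x in E ρ₀, f x ^ p ∂μ ≤ ofReal C := by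
  have hκ0 : 0 < κ := by linarith
  have hD : 0 < ρ₁ - ρ₀ := by linarith
  obtain ⟨C₁, γ, hC₁, hγ, hone, hchain⟩ := exists_chain_reverse_holder (X := X) p hκ hB hρ
  set Z : ℝ → ℝ := fun δ ↦ C₁ * (A + 1) * δ ^ (-γ) with hZ
  have hZ1 : ∀ δ, 0 < δ → δ ≤ ρ₁ - ρ₀ → 1 ≤ Z δ := by
    intro δ h0 h1
    have := hone δ h0 h1
    simp only [hZ]
    nlinarith
  set c : ℝ → ℝ := fun δ ↦ (2 * B + κ / p + (2 * B + 1)) * Z δ ^ (2 * κ) with hc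
  -- one step: the exponent `ψ` contracts by the factor `3/4`
  have step : ∀ (μ : Measure X) (E : ℝ → Set X), Monotone E → ∀ f : X → ℝ≥0∞,
      AEMeasurable f (μ.restrict (E ρ₁)) → μ (E ρ₁) ≤ ofReal A →
      (∀ t : ℝ, 0 < t →
        μ.restrict (E ρ₁) {x | ofReal (Real.exp t) < f x} ≤ ofReal (B / t)) →
      (∀ (j : ℕ) (ρ ρ' : ℝ), ρ₀ ≤ ρ → ρ < ρ' → ρ' ≤ ρ₁ →
        (∫⁻ x in E ρ, f x ^ (p / κ ^ j) ∂μ) ^ (1 / κ) ≤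
          ofReal (B / (ρ' - ρ) ^ 2) * ∫⁻ x in E ρ', f x ^ (p / κ ^ (j + 1)) ∂μ) →
      ∀ ρ ρ', ρ₀ ≤ ρ → ρ < ρ' → ρ' ≤ ρ₁ → ∀ ψ, 2 * B + 1 ≤ ψ →
      ∫⁻ x in E ρ', f x ^ p ∂μ ≤ ofReal (Real.exp (p * ψ)) →
      ∫⁻ x in E ρ, f x ^ p ∂μ ≤ ofReal (Real.exp (p * (3 / 4 * ψ + c (ρ' - ρ)))) := by
    intro μ E hE f hf hμ hlog hrh ρ ρ' h1 h2 h3 ψ hψ hF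
    have hδ : 0 < ρ' - ρ := by linarith
    have hz := hZ1 (ρ' - ρ) hδ (by linarith)
    set z := Z (ρ' - ρ) with hzdef
    have hψ0 : 0 < ψ := by linarith
    set L := Real.log (ψ / (2 * B)) with hL
    have hL0 : 0 < L := Real.log_pos (by rw [one_lt_div (by positivity)]; linarith)
    set G := Real.log z with hG
    have hG0 : 0 ≤ G := Real.log_nonneg hz
    have hzk : 1 ≤ z ^ (2 * κ) := Real.one_le_rpow hz (by positivity)
    have hzk' : z ≤ z ^ (2 * κ) := by
      conv_lhs => rw [← Real.rpow_one z]
      exact Real.rpow_le_rpow_of_exponent_le hz (by linarith)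
    have hmono : ∫⁻ x in E ρ, f x ^ p ∂μ ≤ ∫⁻ x in E ρ', f x ^ p ∂μ := lintegral_mono_set (hE h2.le)
    have hκp : 0 < κ / p := by positivity
    rcases le_or_gt (2 * κ * G) L with hcase | hcase
    · obtain ⟨m, hm1, hm2⟩ := exists_nat_pow_near (x := 1 + p * ψ / (2 * L)) (y := κ)
        (by have : 0 ≤ p * ψ / (2 * L) := by positivity
            linarith) hκ
      have hq1 : 1 < κ ^ (m + 1) := one_lt_pow₀ hκ (by omega)
      have hrestr : μ.restrict (E ρ') ≤ μ.restrict (E ρ₁) := Measure.restrict_mono (hE h3) le_rfl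
      have htail := lintegral_rpow_le_of_log_tail (ν := μ.restrict (E ρ')) (f := f)
        (hf.mono_measure hrestr) hp hq1
        (by rw [Measure.restrict_apply_univ]; exact (measure_mono (hE h3)).trans hμ) hA.le hB
        (by linarith) (fun t ht ↦ (hrestr _).trans (hlog t ht)) hF (by
          have : p * ψ / (2 * L) < κ ^ (m + 1) - 1 := by linarith
          rw [div_lt_iff₀ (by positivity)] at this
          nlinarith)
      refine (hchain μ E hE f hrh (m + 1) ρ ρ' h1 h2 h3).trans ?_
      have hδγ : 0 < (ρ' - ρ) ^ (-γ) := Real.rpow_pos_of_pos hδ _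
      calc _ ≤ (ofReal (C₁ * (ρ' - ρ) ^ (-γ)) *
            ofReal ((A + 1) * Real.exp (p / κ ^ (m + 1) * (ψ / 2)))) ^ (κ ^ (m + 1)) := by
            gcongr
        _ = ofReal ((z * Real.exp (p / κ ^ (m + 1) * (ψ / 2))) ^ (κ ^ (m + 1))) := by
            rw [← ENNReal.ofReal_mul (by positivity), ENNReal.ofReal_rpow_of_nonneg (by positivity)
              (by positivity)]
            congr 2
            simp only [hzdef, hZ]; ring
        _ ≤ _ := by
            refine ENNReal.ofReal_le_ofReal ?_
            have hz0 : 0 < z := by linarith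
            rw [show z = Real.exp G by rw [hG, Real.exp_log hz0], ← Real.exp_add, ← Real.exp_mul,
              Real.exp_le_exp]
            have e1 : (G + p / κ ^ (m + 1) * (ψ / 2)) * κ ^ (m + 1) =
                κ ^ (m + 1) * G + p * ψ / 2 := by
              have : κ ^ (m + 1) ≠ 0 := by positivity
              field_simp
            have e2 : κ ^ (m + 1) * G ≤ κ * (1 + p * ψ / (2 * L)) * G := by
              rw [pow_succ, mul_comm (κ ^ m) κ]
              gcongr
            have e3 : κ * (1 + p * ψ / (2 * L)) * G = κ * G + p * ψ / 4 * (2 * κ * G / L) := by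
              field_simp
              ring
            have e4 : p * ψ / 4 * (2 * κ * G / L) ≤ p * ψ / 4 * 1 := by
              gcongr
              rw [div_le_one hL0]; exact hcase
            have e5 : κ * G ≤ p * c (ρ' - ρ) := by
              have h5 : G ≤ z := (Real.log_le_sub_one_of_pos hz0).trans (by linarith)
              have h6 : κ / p * z ≤ c (ρ' - ρ) := by
                simp only [hc, ← hzdef]
                have : 0 ≤ (2 * B + (2 * B + 1)) * z ^ (2 * κ) := by positivity
                nlinarith
              calc κ * G ≤ κ * z := by gcongr
                _ = p * (κ / p * z) := by field_simp
                _ ≤ _ := by gcongr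
            rw [e1]
            linarith
    · refine hmono.trans (hF.trans (ENNReal.ofReal_le_ofReal ?_))
      rw [Real.exp_le_exp]
      have h7 : ψ ≤ 2 * B * z ^ (2 * κ) := by
        have hz0 : 0 < z := by linarith
        have : ψ / (2 * B) ≤ z ^ (2 * κ) := by
          rw [Real.rpow_def_of_pos hz0, ← Real.log_le_iff_le_exp (by positivity)]
          linarith
        rwa [div_le_iff₀ (by positivity), mul_comm] at this
      have h8 : 2 * B * z ^ (2 * κ) ≤ c (ρ' - ρ) := by
        simp only [hc, ← hzdef]
        have : 0 ≤ (κ / p + (2 * B + 1)) * z ^ (2 * κ) := by positivity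
        nlinarith
      gcongr
      linarith
  -- radii `ρ₁ - (ρ₁ - ρ₀) τ^j`, with `τ` so close to `1` that the errors are summable
  have hγ3 : 0 < 2 * κ * γ := by positivity
  set τ : ℝ := (7 / 8 : ℝ) ^ (1 / (2 * κ * γ)) with hτ
  have hτ0 : 0 < τ := by positivity
  have hτ1 : τ < 1 := Real.rpow_lt_one (by norm_num) (by norm_num) (by positivity)
  have hτγ : τ ^ (2 * κ * γ) = 7 / 8 := by
    rw [hτ, ← Real.rpow_mul (by norm_num), one_div, inv_mul_cancel₀ hγ3.ne', Real.rpow_one]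
  set R : ℕ → ℝ := fun j ↦ ρ₁ - (ρ₁ - ρ₀) * τ ^ j with hR
  have hRgap : ∀ j, R (j + 1) - R j = (ρ₁ - ρ₀) * (1 - τ) * τ ^ j := fun j ↦ by
    simp only [hR]; ring
  have hgap0 : ∀ j, 0 < (ρ₁ - ρ₀) * (1 - τ) * τ ^ j := fun j ↦ by
    have : 0 < 1 - τ := by linarith
    positivity
  have hR0 : R 0 = ρ₀ := by simp [hR]
  have hRge : ∀ j, ρ₀ ≤ R j := fun j ↦ by
    have : τ ^ j ≤ 1 := pow_le_one₀ hτ0.le hτ1.le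
    simp only [hR]; nlinarith
  have hRle : ∀ j, R j ≤ ρ₁ := fun j ↦ by
    have : 0 < τ ^ j := by positivity
    simp only [hR]; nlinarith
  set c₀ : ℝ := c ((ρ₁ - ρ₀) * (1 - τ)) with hc₀
  have hcj : ∀ j, c (R (j + 1) - R j) = c₀ * (8 / 7) ^ j := by
    intro j
    have h1τ : 0 < (ρ₁ - ρ₀) * (1 - τ) := by simpa using hgap0 0
    rw [hRgap, hc₀]
    simp only [hc, hZ]
    rw [mul_assoc _ _ (((8 : ℝ) / 7) ^ j), Real.mul_rpow h1τ.le (by positivity), ← mul_assoc,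
      Real.mul_rpow (x := _ * _ ^ (-γ)) (by positivity) (by positivity)]
    congr 2
    rw [← Real.rpow_natCast τ j, ← Real.rpow_mul hτ0.le, ← Real.rpow_mul hτ0.le,
      show (j : ℝ) * -γ * (2 * κ) = (2 * κ * γ) * (-(j : ℝ)) by ring, Real.rpow_mul hτ0.le, hτγ,
      Real.rpow_neg (by norm_num), Real.rpow_natCast, ← inv_pow]
    norm_num
  have hc₀0 : 0 ≤ c₀ := by
    have h1τ : 0 < (ρ₁ - ρ₀) * (1 - τ) := by simpa using hgap0 0
    simp only [hc₀, hc, hZ]; positivity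
  refine ⟨Real.exp (p * (1 + c₀ * 7)), Real.exp_pos _, ?_⟩
  intro μ E hE f hf hμ hfin hlog hrh
  have iter : ∀ (J : ℕ) (ψ : ℝ), 2 * B + 1 ≤ ψ →
      ∫⁻ x in E (R J), f x ^ p ∂μ ≤ ofReal (Real.exp (p * ψ)) →
      ∫⁻ x in E (R 0), f x ^ p ∂μ ≤ ofReal (Real.exp (p * ((3 / 4) ^ J * ψ +
        ∑ j ∈ Finset.range J, c₀ * (6 / 7) ^ j))) := by
    intro J
    induction J with
    | zero => intro ψ _ h; simpa using h
    | succ J ih =>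
      intro ψ hψ h
      have hlt : R J < R (J + 1) := by linarith [hRgap J, hgap0 J]
      have h1 := step μ E hE f hf hμ hlog hrh (R J) (R (J + 1)) (hRge J) hlt (hRle _) ψ hψ h
      have hge : 2 * B + 1 ≤ 3 / 4 * ψ + c (R (J + 1) - R J) := by
        have hz := hZ1 (R (J + 1) - R J) (by linarith) (by linarith [hRle (J + 1), hRge J])
        have hzk : 1 ≤ Z (R (J + 1) - R J) ^ (2 * κ) := Real.one_le_rpow hz (by positivity)
        have hκp : 0 < κ / p := by positivity
        have : 2 * B + 1 ≤ c (R (J + 1) - R J) := by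
          simp only [hc]; nlinarith
        linarith
      refine (ih _ hge h1).trans (le_of_eq ?_)
      rw [hcj, Finset.sum_range_succ]
      congr 3
      rw [pow_succ, show (6 / 7 : ℝ) = 3 / 4 * (8 / 7) by norm_num, mul_pow]
      ring
  -- start from any finite bound
  set F := ∫⁻ x in E ρ₁, f x ^ p ∂μ with hF
  obtain ⟨ψ, hψ1, hψ2⟩ : ∃ ψ : ℝ, 2 * B + 1 ≤ ψ ∧ F ≤ ofReal (Real.exp (p * ψ)) := by
    refine ⟨max (2 * B + 1) (F.toReal / p), le_max_left _ _, ?_⟩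
    refine (ENNReal.le_ofReal_iff_toReal_le hfin (Real.exp_pos _).le).2 ?_
    have h1 : F.toReal ≤ p * max (2 * B + 1) (F.toReal / p) := by
      rw [mul_comm, ← div_le_iff₀ hp]; exact le_max_right _ _
    linarith [Real.add_one_le_exp (p * max (2 * B + 1) (F.toReal / p))]
  have hψ0 : 0 < ψ := by linarith
  obtain ⟨J, hJ⟩ := exists_pow_lt_of_lt_one (show 0 < 1 / ψ by positivity) (by norm_num : (3 / 4 : ℝ) < 1)
  have hfinal := iter J ψ hψ1 ((lintegral_mono_set (hE (hRle J))).trans hψ2)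
  rw [hR0] at hfinal
  refine hfinal.trans (ENNReal.ofReal_le_ofReal ?_)
  rw [Real.exp_le_exp]
  have h1 : (3 / 4 : ℝ) ^ J * ψ ≤ 1 := by
    rw [lt_div_iff₀ hψ0] at hJ; exact hJ.le
  have h2 : ∑ j ∈ Finset.range J, c₀ * (6 / 7 : ℝ) ^ j ≤ c₀ * 7 := by
    rw [← Finset.mul_sum]
    gcongr
    have := Summable.sum_le_tsum (f := fun j : ℕ ↦ (6 / 7 : ℝ) ^ j) (Finset.range J)
      (fun i _ ↦ by positivity) (summable_geometric_of_lt_one (by norm_num) (by norm_num))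
    rw [tsum_geometric_of_lt_one (by norm_num) (by norm_num)] at this
    norm_num at this ⊢
    exact this
  gcongr

end BombieriGiusti

/-! ### Energy estimates in abstract form -/

/-- `F` is `C¹` on the positive half-line with derivative `F'`, and `F'` is bounded on
`[k/2, ∞)`. -/
structure C1Bdd (k : ℝ) (F F' : ℝ → ℝ) : Prop where
  hasDerivAt : ∀ t, 0 < t → HasDerivAt F (F' t) t
  continuousOn : ContinuousOn F' (Ioi 0)
  bounded : ∃ B, ∀ t, k / 2 ≤ t → |F' t| ≤ B

/-- A pair of nonlinearities `Φ`, `H`: testing the equation for `w ≥ k` with `η² Φ(w)` controls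
the energy of `η H(w)`. Here `s = 1` for subsolutions and `s = -1` for supersolutions, and `T`
measures the size of the resulting constant. -/
structure TestPair (s k a b c T : ℝ) (Φ Φ' H H' : ℝ → ℝ) : Prop where
  test : C1Bdd k Φ Φ'
  power : C1Bdd k H H'
  nonneg : ∀ t, 0 < t → 0 ≤ Φ t
  sign : ∀ t, k ≤ t → 0 ≤ s * Φ' t
  sq_deriv_le : ∀ t, k ≤ t → H' t ^ 2 ≤ a * (s * Φ' t)
  sq_test_le : ∀ t, k ≤ t → Φ t ^ 2 ≤ b * (s * Φ' t) * H t ^ 2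
  mul_test_le : ∀ t, k ≤ t → t * Φ t ≤ c * H t ^ 2
  a_pos : 0 < a
  b_nonneg : 0 ≤ b
  c_nonneg : 0 ≤ c
  one_le : 1 ≤ T
  ab_le : a * b ≤ T
  ac_le : a * c ≤ T

/-- What the equation and the geometry provide for `w = u + k` on the scale of a fixed ball: `E ρ`
are concentric half-balls of radius proportional to `ρ`, `g` is the length of the gradient of
`w`, and the measure and the gradient are normalised by the radius. -/
structure HarnackData {X : Type*} [MeasurableSpace X] (μ : Measure X) (E : ℝ → Set X)
    (s k κ A : ℝ) (d : ℕ) (w g : X → ℝ) : Prop where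
  mono : Monotone E
  measure_le : μ (E (18 / 5)) ≤ ofReal A
  one_le_measure : 1 ≤ ofReal A * μ (E 1)
  le_w : ∀ᵐ x ∂μ.restrict (E (18 / 5)), k ≤ w x
  aemeasurable : AEMeasurable w (μ.restrict (E (18 / 5)))
  sq_lt_top : ∫⁻ x in E (18 / 5), ofReal (w x ^ 2) ∂μ < ⊤
  reverse_holder : ∀ {a b c T : ℝ} {Φ Φ' H H' : ℝ → ℝ}, TestPair s k a b c T Φ Φ' H H' →
    ∀ ρ ρ', 1 ≤ ρ → ρ < ρ' → ρ' ≤ 18 / 5 →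
      (∫⁻ x in E ρ, ofReal |H (w x)| ^ (2 * κ) ∂μ) ^ (1 / κ) ≤
        ofReal (A * T ^ d / (ρ' - ρ) ^ 2) *
          ∫⁻ x in E ρ', ofReal (H (w x) ^ 2) ∂μ
  energy : ∀ {a b c T : ℝ} {Φ Φ' H H' : ℝ → ℝ}, TestPair s k a b c T Φ Φ' H H' →
    ∀ ρ ρ', 1 ≤ ρ → ρ < ρ' → ρ' ≤ 18 / 5 →
      ofReal a * ∫⁻ x in E ρ, ofReal (s * Φ' (w x) * g x ^ 2) ∂μ ≤
        ofReal (A * T ^ d / (ρ' - ρ) ^ 2) *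
          ∫⁻ x in E ρ', ofReal (H (w x) ^ 2) ∂μ
  poincare : ∀ {F F' : ℝ → ℝ}, C1Bdd k F F' →
    ∫⁻ y in E 3, ∫⁻ z in E 3, ofReal ((F (w y) - F (w z)) ^ 2) ∂μ ∂μ ≤
      ofReal A * ∫⁻ x in E 3, ofReal (F' (w x) ^ 2 * g x ^ 2) ∂μ

section Families

variable {k : ℝ}

lemma c1Bdd_rpow (hk : 0 < k) (q : ℝ) {e : ℝ} (he : e ≤ 1) :
    C1Bdd k (fun t ↦ q * t ^ e) (fun t ↦ q * (e * t ^ (e - 1))) where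
  hasDerivAt t ht := (Real.hasDerivAt_rpow_const (Or.inl ht.ne')).const_mul q
  continuousOn := by
    refine continuousOn_const.mul (continuousOn_const.mul ?_)
    exact fun t ht ↦ (Real.continuousAt_rpow_const _ _ (Or.inl (ne_of_gt ht))).continuousWithinAt
  bounded := by
    refine ⟨|q| * (|e| * (k / 2) ^ (e - 1)), fun t ht ↦ ?_⟩
    have ht0 : 0 < t := by linarith
    rw [abs_mul, abs_mul, abs_of_pos (Real.rpow_pos_of_pos ht0 _)]
    have := Real.rpow_le_rpow_of_nonpos (z := e - 1) (by positivity : 0 < k / 2) ht (by linarith)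
    gcongr

/-- Powers `(t/m)^{γ/2}` with `0 < γ < 1`, tested by `t^{γ-1}`. -/
lemma testPair_super_rpow (hk : 0 < k) (m : ℝ) {γ ε : ℝ} (hm : 0 < m) (hγ : 0 < γ)
    (hε : 0 < ε) (hγε : γ ≤ 1 - ε) :
    TestPair (-1) k (1 / ε) (1 / ε) 1 (1 / ε ^ 2)
      (fun t ↦ m ^ (-γ) * t ^ (γ - 1)) (fun t ↦ m ^ (-γ) * ((γ - 1) * t ^ (γ - 1 - 1)))
      (fun t ↦ m ^ (-γ / 2) * t ^ (γ / 2)) (fun t ↦ m ^ (-γ / 2) * (γ / 2 * t ^ (γ / 2 - 1))) := by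
  have hε1 : ε ≤ 1 := by linarith
  have hm2 : (m ^ (-γ / 2)) ^ 2 = m ^ (-γ) := by
    rw [← Real.rpow_natCast, ← Real.rpow_mul hm.le]; congr 1; push_cast; ring
  have hmp : 0 < m ^ (-γ) := Real.rpow_pos_of_pos hm _
  have ht2 : ∀ t : ℝ, 0 < t → ∀ e : ℝ, (t ^ e) ^ 2 = t ^ (2 * e) := fun t ht e ↦ by
    rw [← Real.rpow_natCast, ← Real.rpow_mul ht.le]; congr 1; push_cast; ring
  refine ⟨c1Bdd_rpow hk _ (by linarith), c1Bdd_rpow hk _ (by linarith), fun t ht ↦ by positivity,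
    fun t ht ↦ ?_, fun t ht ↦ ?_, fun t ht ↦ ?_, fun t ht ↦ ?_, by positivity, by positivity,
    zero_le_one, ?_, ?_, ?_⟩
  · have ht0 : 0 < t := by linarith
    have : 0 ≤ m ^ (-γ) * ((1 - γ) * t ^ (γ - 1 - 1)) := by
      have : 0 ≤ 1 - γ := by linarith
      positivity
    linarith
  · have ht0 : 0 < t := by linarith
    rw [mul_pow, mul_pow, hm2, ht2 t ht0, show 2 * (γ / 2 - 1) = γ - 1 - 1 by ring]
    have h1 : (γ / 2) ^ 2 ≤ 1 / ε * (1 - γ) := by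
      rw [div_mul_eq_mul_div, one_mul, le_div_iff₀ hε]
      have : (γ / 2) ^ 2 ≤ 1 := pow_le_one₀ (by positivity) (by linarith)
      nlinarith
    calc m ^ (-γ) * ((γ / 2) ^ 2 * t ^ (γ - 1 - 1))
        ≤ m ^ (-γ) * ((1 / ε * (1 - γ)) * t ^ (γ - 1 - 1)) := by gcongr
      _ = _ := by ring
  · have ht0 : 0 < t := by linarith
    rw [mul_pow, mul_pow, hm2, ht2 t ht0, ht2 t ht0, show 2 * (γ - 1) = γ - 1 - 1 + γ by ring,
      Real.rpow_add ht0, show 2 * (γ / 2) = γ by ring]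
    have h1 : 1 ≤ 1 / ε * (1 - γ) := by
      rw [div_mul_eq_mul_div, one_mul, le_div_iff₀ hε]; linarith
    calc (m ^ (-γ)) ^ 2 * (t ^ (γ - 1 - 1) * t ^ γ)
        = 1 * ((m ^ (-γ)) ^ 2 * (t ^ (γ - 1 - 1) * t ^ γ)) := by ring
      _ ≤ (1 / ε * (1 - γ)) * ((m ^ (-γ)) ^ 2 * (t ^ (γ - 1 - 1) * t ^ γ)) := by gcongr
      _ = _ := by ring
  · have ht0 : 0 < t := by linarith
    rw [mul_pow, hm2, ht2 t ht0, show 2 * (γ / 2) = 1 + (γ - 1) by ring, Real.rpow_add ht0,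
      Real.rpow_one]
    exact le_of_eq (by ring)
  · rw [one_le_div (by positivity)]; exact pow_le_one₀ hε.le hε1
  · exact le_of_eq (by ring)
  · rw [mul_one]
    gcongr
    nlinarith

/-- Powers `t^β` with `1/2 < β ≤ 1`, tested by `t^{2β-1}`. -/
lemma testPair_sub_rpow (hk : 0 < k) {β ε : ℝ} (hε : 0 < ε) (hε1 : ε ≤ 1)
    (hβε : ε ≤ 2 * β - 1) (hβ : β ≤ 1) :
    TestPair 1 k (1 / ε) (1 / ε) 1 (1 / ε ^ 2)
      (fun t ↦ 1 * t ^ (2 * β - 1)) (fun t ↦ 1 * ((2 * β - 1) * t ^ (2 * β - 1 - 1)))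
      (fun t ↦ 1 * t ^ β) (fun t ↦ 1 * (β * t ^ (β - 1))) := by
  have ht2 : ∀ t : ℝ, 0 < t → ∀ e : ℝ, (t ^ e) ^ 2 = t ^ (2 * e) := fun t ht e ↦ by
    rw [← Real.rpow_natCast, ← Real.rpow_mul ht.le]; congr 1; push_cast; ring
  have hr : 1 ≤ 1 / ε * (2 * β - 1) := by
    rw [div_mul_eq_mul_div, one_mul, le_div_iff₀ hε]; linarith
  have hβ0 : 0 < 2 * β - 1 := by linarith
  refine ⟨c1Bdd_rpow hk _ (by linarith), c1Bdd_rpow hk _ (by linarith), fun t ht ↦ by positivity,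
    fun t ht ↦ ?_, fun t ht ↦ ?_, fun t ht ↦ ?_, fun t ht ↦ ?_, by positivity, by positivity,
    zero_le_one, ?_, ?_, ?_⟩
  · have ht0 : 0 < t := by linarith
    positivity
  · have ht0 : 0 < t := by linarith
    rw [one_mul, one_mul, one_mul, mul_pow, ht2 t ht0, show 2 * (β - 1) = 2 * β - 1 - 1 by ring,
      ← mul_assoc]
    gcongr
    nlinarith
  · have ht0 : 0 < t := by linarith
    simp only [one_mul]
    rw [ht2 t ht0, ht2 t ht0, show 2 * (2 * β - 1) = 2 * β - 1 - 1 + 2 * β by ring,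
      Real.rpow_add ht0, ← mul_assoc]
    gcongr
    have : 0 < t ^ (2 * β - 1 - 1) := by positivity
    nlinarith
  · have ht0 : 0 < t := by linarith
    simp only [one_mul]
    rw [ht2 t ht0]
    conv_rhs => rw [show 2 * β = 1 + (2 * β - 1) by ring, Real.rpow_add ht0, Real.rpow_one]
  · rw [one_le_div (by positivity)]; exact pow_le_one₀ hε.le hε1
  · exact le_of_eq (by ring)
  · rw [mul_one]
    gcongr
    nlinarith

/-- The function `t (t / (1 + t/N))^e`, a substitute for `t^{1+e}` with linear growth. -/
def truncPow (N e t : ℝ) : ℝ := t * (N * t / (N + t)) ^ e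

/-- The derivative of `truncPow N e`. -/
def truncPowDeriv (N e t : ℝ) : ℝ := (N * t / (N + t)) ^ e * (1 + e * (N / (N + t)))

lemma c1Bdd_truncPow (hk : 0 < k) {N : ℝ} (hN : 0 < N) (e : ℝ) :
    C1Bdd k (truncPow N e) (truncPowDeriv N e) where
  hasDerivAt t ht := by
    have hNt : N + t ≠ 0 := by positivity
    have h1 : HasDerivAt (fun t ↦ N * t / (N + t)) ((N * (N + t) - N * t * 1) / (N + t) ^ 2) t := by
      exact (((hasDerivAt_id' t).const_mul N).div ((hasDerivAt_id' t).const_add N) hNt).congr_deriv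
        (by simp)
    have hs : N * t / (N + t) ≠ 0 := by positivity
    have h2 := (hasDerivAt_id t).mul (h1.rpow_const (p := e) (Or.inl hs))
    refine h2.congr_deriv ?_
    simp only [truncPowDeriv, id]
    rw [Real.rpow_sub_one hs]
    field_simp
    ring
  continuousOn := by
    intro t ht
    have ht0 : 0 < t := ht
    have hNt : N + t ≠ 0 := by positivity
    have hs : N * t / (N + t) ≠ 0 := by positivity
    refine ContinuousAt.continuousWithinAt ?_
    unfold truncPowDeriv
    refine ContinuousAt.mul (ContinuousAt.rpow_const ?_ (Or.inl hs)) ?_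
    · exact ContinuousAt.div (by fun_prop) (by fun_prop) hNt
    · exact continuousAt_const.add (continuousAt_const.mul
        (ContinuousAt.div (by fun_prop) (by fun_prop) hNt))
  bounded := by
    set l := N * (k / 2) / (N + k / 2) with hl
    have hl0 : 0 < l := by positivity
    refine ⟨(l ^ e + N ^ e) * (1 + |e|), fun t ht ↦ ?_⟩
    have ht0 : 0 < t := by linarith
    have hle : l ≤ N * t / (N + t) := by
      rw [hl, div_le_div_iff₀ (by positivity) (by positivity)]
      nlinarith [mul_pos hN hN]
    have hleN : N * t / (N + t) ≤ N := by
      rw [div_le_iff₀ (by positivity)]; nlinarith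
    have h1 : (N * t / (N + t)) ^ e ≤ l ^ e + N ^ e := by
      have p1 : 0 < l ^ e := by positivity
      have p2 : 0 < N ^ e := by positivity
      rcases le_or_gt 0 e with he | he
      · have := Real.rpow_le_rpow (by positivity) hleN he
        linarith
      · have := Real.rpow_le_rpow_of_nonpos hl0 hle he.le
        linarith
    have h2 : |1 + e * (N / (N + t))| ≤ 1 + |e| := by
      refine (abs_add_le _ _).trans ?_
      rw [abs_one, abs_mul]
      have : |N / (N + t)| ≤ 1 := by
        rw [abs_of_pos (by positivity), div_le_one (by positivity)]; linarith
      nlinarith [abs_nonneg e]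
    have hs : 0 ≤ (N * t / (N + t)) ^ e := by positivity
    rw [truncPowDeriv, abs_mul, abs_of_nonneg hs]
    gcongr

/-- Truncated powers of exponent `β ≥ 1`; the test function `t (t / (1 + t/N))^{2β-2}` has linear
growth. -/
lemma testPair_truncPow (hk : 0 < k) {N β : ℝ} (hN : 0 < N) (hβ : 1 ≤ β) :
    TestPair 1 k (β ^ 2) 1 1 (β ^ 2) (truncPow N (2 * β - 2)) (truncPowDeriv N (2 * β - 2))
      (truncPow N (β - 1)) (truncPowDeriv N (β - 1)) := by
  have hsq : ∀ t : ℝ, 0 < t → (N * t / (N + t)) ^ (2 * β - 2) =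
      ((N * t / (N + t)) ^ (β - 1)) ^ 2 := fun t ht ↦ by
    have hs : 0 < N * t / (N + t) := by positivity
    rw [← Real.rpow_natCast, ← Real.rpow_mul hs.le]; congr 1; push_cast; ring
  have hθ : ∀ t : ℝ, 0 < t → 0 ≤ N / (N + t) ∧ N / (N + t) ≤ 1 := fun t ht ↦
    ⟨by positivity, by rw [div_le_one (by positivity)]; linarith⟩
  refine ⟨c1Bdd_truncPow hk hN _, c1Bdd_truncPow hk hN _, fun t ht ↦ ?_, fun t ht ↦ ?_,
    fun t ht ↦ ?_, fun t ht ↦ ?_, fun t ht ↦ ?_, by positivity, zero_le_one, zero_le_one,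
    one_le_pow₀ hβ, by simp, by simp⟩
  · unfold truncPow; positivity
  · have ht0 : 0 < t := by linarith
    obtain ⟨h0, h1⟩ := hθ t ht0
    have : 0 ≤ 2 * β - 2 := by linarith
    unfold truncPowDeriv; positivity
  · have ht0 : 0 < t := by linarith
    obtain ⟨h0, h1⟩ := hθ t ht0
    simp only [truncPowDeriv, one_mul]
    rw [hsq t ht0]
    generalize (N * t / (N + t)) ^ (β - 1) = y
    generalize N / (N + t) = θ at h0 h1
    have h2 : (1 + (β - 1) * θ) ^ 2 ≤ β ^ 2 := by
      have : (1 + (β - 1) * θ) ≤ β := by nlinarith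
      have : 0 ≤ 1 + (β - 1) * θ := by nlinarith
      gcongr
    have h3 : 1 ≤ 1 + (2 * β - 2) * θ := by nlinarith
    calc (y * (1 + (β - 1) * θ)) ^ 2 = y ^ 2 * (1 + (β - 1) * θ) ^ 2 := by ring
      _ ≤ y ^ 2 * (β ^ 2 * (1 + (2 * β - 2) * θ)) := by
          gcongr
          nlinarith
      _ = _ := by ring
  · have ht0 : 0 < t := by linarith
    obtain ⟨h0, h1⟩ := hθ t ht0
    simp only [truncPowDeriv, truncPow, one_mul]
    rw [hsq t ht0]
    generalize (N * t / (N + t)) ^ (β - 1) = y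
    generalize N / (N + t) = θ at h0 h1
    have h3 : 1 ≤ 1 + (2 * β - 2) * θ := by nlinarith
    calc (t * y ^ 2) ^ 2 = (t * y ^ 2) ^ 2 * 1 := by ring
      _ ≤ (t * y ^ 2) ^ 2 * (1 + (2 * β - 2) * θ) := by gcongr
      _ = _ := by ring
  · have ht0 : 0 < t := by linarith
    simp only [truncPow, one_mul]
    rw [hsq t ht0]
    exact le_of_eq (by ring)

/-- The test function `1/w` of a supersolution `w`. As `-(1/w)' = (1/w)²`, it bounds the energy of
`log w` by that of the cutoff, which is why the power `H` is constant here. -/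
lemma testPair_inv (hk : 0 < k) :
    TestPair (-1) k 1 1 1 1 (fun t ↦ 1 * t ^ (-1 : ℝ)) (fun t ↦ 1 * ((-1) * t ^ ((-1 : ℝ) - 1)))
      (fun _ ↦ 1) (fun _ ↦ 0) := by
  have e : ∀ t : ℝ, 0 < t → t ^ ((-1 : ℝ) - 1) = (t⁻¹) ^ 2 := fun t ht ↦ by
    rw [Real.rpow_sub ht, Real.rpow_neg_one, Real.rpow_one]; field_simp
  refine ⟨c1Bdd_rpow hk _ (by norm_num), ⟨fun t _ ↦ hasDerivAt_const _ _, continuousOn_const,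
    ⟨0, by simp⟩⟩, fun t ht ↦ by positivity, fun t ht ↦ ?_, fun t ht ↦ ?_, fun t ht ↦ ?_,
    fun t ht ↦ ?_, one_pos, zero_le_one, zero_le_one, le_rfl, by simp, by simp⟩
  all_goals have ht0 : 0 < t := by linarith
  · rw [e t ht0]; nlinarith [sq_nonneg t⁻¹]
  · rw [e t ht0]; nlinarith [sq_nonneg t⁻¹]
  · rw [e t ht0, Real.rpow_neg_one]; nlinarith [sq_nonneg t⁻¹]
  · rw [Real.rpow_neg_one]; field_simp; norm_num

lemma c1Bdd_log (hk : 0 < k) : C1Bdd k Real.log (fun t ↦ t⁻¹) where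
  hasDerivAt t ht := Real.hasDerivAt_log ht.ne'
  continuousOn := continuousOn_inv₀.mono fun t ht ↦ ne_of_gt ht
  bounded := by
    refine ⟨(k / 2)⁻¹, fun t ht ↦ ?_⟩
    have ht0 : 0 < t := by linarith
    rw [abs_of_pos (by positivity)]
    gcongr

/-- For a supersolution `w`, the function `1 + log (1 + m/w)` is a positive subsolution. -/
def logTerm (m t : ℝ) : ℝ := 1 + Real.log (1 + m / t)

lemma one_le_logTerm {m t : ℝ} (hm : 0 < m) (ht : 0 < t) : 1 ≤ logTerm m t := by
  have : 0 ≤ Real.log (1 + m / t) := Real.log_nonneg (by have : 0 < m / t := by positivity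
                                                         linarith)
  unfold logTerm; linarith

lemma hasDerivAt_logTerm {m t : ℝ} (hm : 0 < m) (ht : 0 < t) :
    HasDerivAt (logTerm m) (-(m / (t * (t + m)))) t := by
  have h1 : HasDerivAt (fun t ↦ 1 + m / t) (-(m / t ^ 2)) t := by
    have := ((hasDerivAt_inv ht.ne').const_mul m).const_add 1
    refine this.congr_deriv ?_
    field_simp
  have hne : 1 + m / t ≠ 0 := by positivity
  have h2 := (h1.log hne).const_add 1
  refine h2.congr_deriv ?_
  field_simp

/-- Powers `v^β` of the subsolution `v = logTerm m w`. The test function is that of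
`testPair_truncPow`, here `v^(2β-1)`, times `-dv/dw`, so it tests the inequality for `w`; no
truncation is needed because `v` is bounded on `w ≥ k`. -/
lemma testPair_logTerm (hk : 0 < k) {m β : ℝ} (hm : 0 < m) (hβ : 1 ≤ β) :
    TestPair (-1) k (β ^ 2) 1 1 (β ^ 2)
      (fun t ↦ logTerm m t ^ (2 * β - 1) * (m / (t * (t + m))))
      (fun t ↦ -((2 * β - 1) * logTerm m t ^ (2 * β - 2) * (m / (t * (t + m))) ^ 2 +
        logTerm m t ^ (2 * β - 1) * (m * (2 * t + m) / (t * (t + m)) ^ 2)))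
      (fun t ↦ logTerm m t ^ β)
      (fun t ↦ -(β * logTerm m t ^ (β - 1) * (m / (t * (t + m))))) := by
  have hv : ∀ t, 0 < t → 1 ≤ logTerm m t := fun t ht ↦ one_le_logTerm hm ht
  have hvle : ∀ t, k / 2 ≤ t → logTerm m t ≤ logTerm m (k / 2) := by
    intro t ht
    have ht0 : 0 < t := by linarith
    unfold logTerm
    gcongr
  have hvc : ContinuousOn (logTerm m) (Ioi 0) := fun t ht ↦
    (hasDerivAt_logTerm hm ht).continuousAt.continuousWithinAt
  have hvp : ∀ e : ℝ, ContinuousOn (fun t ↦ logTerm m t ^ e) (Ioi 0) := fun e ↦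
    hvc.rpow_const fun t ht ↦ Or.inl (by have := hv t ht; positivity)
  have hDc : ContinuousOn (fun t ↦ m / (t * (t + m))) (Ioi 0) :=
    ContinuousOn.div (by fun_prop) (by fun_prop) fun t ht ↦ by
      have : 0 < t := ht
      positivity
  have hD0 : ∀ t, 0 < t → 0 < m / (t * (t + m)) := fun t ht ↦ by positivity
  have hDle : ∀ t, k / 2 ≤ t → m / (t * (t + m)) ≤ 2 / k := by
    intro t ht
    have ht0 : 0 < t := by linarith
    rw [div_le_div_iff₀ (by positivity) hk]
    nlinarith
  have hD'le : ∀ t, k / 2 ≤ t → m * (2 * t + m) / (t * (t + m)) ^ 2 ≤ 2 * (2 / k) ^ 2 := by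
    intro t ht
    have ht0 : 0 < t := by linarith
    have h1 : m * (2 * t + m) / (t * (t + m)) ^ 2 ≤ 2 * (1 / t) ^ 2 := by
      rw [div_pow, mul_div_assoc', div_le_div_iff₀ (by positivity) (by positivity)]
      have : m * (2 * t + m) ≤ 2 * (t + m) ^ 2 := by nlinarith
      calc m * (2 * t + m) * t ^ 2 ≤ 2 * (t + m) ^ 2 * t ^ 2 := by gcongr
        _ = _ := by ring
    refine h1.trans ?_
    gcongr 2 * ?_ ^ 2
    rw [div_le_div_iff₀ ht0 hk]; linarith
  have hrp : ∀ t e : ℝ, k / 2 ≤ t → 0 ≤ e → logTerm m t ^ e ≤ logTerm m (k / 2) ^ e := by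
    intro t e ht he
    have := hv t (by linarith)
    exact Real.rpow_le_rpow (by linarith) (hvle t ht) he
  have ht2 : ∀ v : ℝ, 0 < v → ∀ e : ℝ, (v ^ e) ^ 2 = v ^ (2 * e) := fun t ht e ↦ by
    rw [← Real.rpow_natCast, ← Real.rpow_mul ht.le]; congr 1; push_cast; ring
  refine ⟨⟨fun t ht ↦ ?_, ?_, ?_⟩, ⟨fun t ht ↦ ?_, ?_, ?_⟩, fun t ht ↦ ?_, fun t ht ↦ ?_,
    fun t ht ↦ ?_, fun t ht ↦ ?_, fun t ht ↦ ?_, by positivity, zero_le_one, zero_le_one,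
    one_le_pow₀ hβ, by simp, by simp⟩
  · have hv0 : logTerm m t ≠ 0 := by have := hv t ht; positivity
    have h1 := (hasDerivAt_logTerm hm ht).rpow_const (p := 2 * β - 1) (Or.inl hv0)
    have hne : t * (t + m) ≠ 0 := by positivity
    have h2 : HasDerivAt (fun t ↦ m / (t * (t + m))) (-(m * (2 * t + m) / (t * (t + m)) ^ 2)) t := by
      have := (hasDerivAt_const t m).div
        ((hasDerivAt_id t).mul ((hasDerivAt_id t).add_const m)) hne
      refine this.congr_deriv ?_
      simp only [id, Pi.mul_apply]
      field_simp
      ring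
    refine (h1.mul h2).congr_deriv ?_
    rw [show 2 * β - 1 - 1 = 2 * β - 2 by ring]
    ring
  · refine ContinuousOn.neg (ContinuousOn.add ?_ ?_)
    · exact (continuousOn_const.mul (hvp _)).mul (hDc.pow 2)
    · refine (hvp _).mul (ContinuousOn.div (by fun_prop) (by fun_prop) fun t ht ↦ ?_)
      have : 0 < t := ht
      positivity
  · refine ⟨(2 * β - 1) * logTerm m (k / 2) ^ (2 * β - 2) * (2 / k) ^ 2 +
      logTerm m (k / 2) ^ (2 * β - 1) * (2 * (2 / k) ^ 2), fun t ht ↦ ?_⟩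
    have ht0 : 0 < t := by linarith
    have hv0 := hv t ht0
    have hβ' : 0 ≤ 2 * β - 1 := by linarith
    have hv1 := hv (k / 2) (by positivity)
    rw [abs_neg, abs_of_nonneg (by positivity)]
    have p1 := hrp t (2 * β - 2) ht (by linarith)
    have p2 := hrp t (2 * β - 1) ht (by linarith)
    have p3 := hDle t ht
    have p4 := hD'le t ht
    gcongr
  · have hv0 : logTerm m t ≠ 0 := by have := hv t ht; positivity
    refine ((hasDerivAt_logTerm hm ht).rpow_const (p := β) (Or.inl hv0)).congr_deriv ?_
    ring
  · exact ContinuousOn.neg ((continuousOn_const.mul (hvp _)).mul hDc)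
  · refine ⟨β * logTerm m (k / 2) ^ (β - 1) * (2 / k), fun t ht ↦ ?_⟩
    have ht0 : 0 < t := by linarith
    have hv0 := hv t ht0
    have hv1 := hv (k / 2) (by positivity)
    rw [abs_neg, abs_of_nonneg (by positivity)]
    have p1 := hrp t (β - 1) ht (by linarith)
    have p3 := hDle t ht
    gcongr
  · have := hv t ht
    positivity
  · have ht0 : 0 < t := by linarith
    have := hv t ht0
    have hβ' : 0 ≤ 2 * β - 1 := by linarith
    rw [neg_one_mul, neg_neg]
    positivity
  · have ht0 : 0 < t := by linarith
    have hv0 := hv t ht0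
    have hβ' : 1 ≤ 2 * β - 1 := by linarith
    rw [neg_one_mul, neg_neg, neg_sq, mul_pow, mul_pow, ht2 _ (by linarith),
      show 2 * (β - 1) = 2 * β - 2 by ring, mul_assoc]
    gcongr
    have h1 : 0 ≤ logTerm m t ^ (2 * β - 2) * (m / (t * (t + m))) ^ 2 := by positivity
    have h2 : 0 ≤ logTerm m t ^ (2 * β - 1) * (m * (2 * t + m) / (t * (t + m)) ^ 2) := by positivity
    nlinarith
  · have ht0 : 0 < t := by linarith
    have hv0 := hv t ht0
    have hβ' : 1 ≤ 2 * β - 1 := by linarith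
    rw [neg_one_mul, neg_neg, one_mul, mul_pow, ht2 _ (by linarith), ht2 _ (by linarith),
      show 2 * (2 * β - 1) = 2 * β - 2 + 2 * β by ring, Real.rpow_add (by linarith)]
    have h1 : 0 ≤ logTerm m t ^ (2 * β - 2) * (m / (t * (t + m))) ^ 2 := by positivity
    have h2 : 0 ≤ logTerm m t ^ (2 * β - 1) * (m * (2 * t + m) / (t * (t + m)) ^ 2) := by positivity
    have h3 : 0 ≤ logTerm m t ^ (2 * β) := by positivity
    rw [mul_right_comm]
    gcongr
    nlinarith
  · have ht0 : 0 < t := by linarith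
    have hv0 := hv t ht0
    rw [one_mul, ht2 _ (by linarith)]
    have h1 : t * (m / (t * (t + m))) ≤ 1 := by
      rw [mul_div_mul_left _ _ ht0.ne' |> fun h ↦ (mul_div_assoc t m _).symm.trans h,
        div_le_one (by positivity)]
      linarith
    have h2 : logTerm m t ^ (2 * β - 1) ≤ logTerm m t ^ (2 * β) :=
      Real.rpow_le_rpow_of_exponent_le hv0 (by linarith)
    have h3 : 0 ≤ logTerm m t ^ (2 * β - 1) := by positivity
    calc t * (logTerm m t ^ (2 * β - 1) * (m / (t * (t + m))))
        = logTerm m t ^ (2 * β - 1) * (t * (m / (t * (t + m)))) := by ring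
      _ ≤ logTerm m t ^ (2 * β - 1) * 1 := by gcongr
      _ ≤ _ := by rw [mul_one]; exact h2

end Families

/-! ### Local boundedness and the weak Harnack inequality in abstract form -/

section AbstractHarnack

variable {X : Type*} [MeasurableSpace X]

lemma lintegral_le_of_ae_tendsto {ν : Measure X} {F : ℕ → X → ℝ≥0∞} {f : X → ℝ≥0∞} {C : ℝ≥0∞}
    (hF : ∀ n, AEMeasurable (F n) ν) (h : ∀ᵐ x ∂ν, Tendsto (fun n ↦ F n x) atTop (𝓝 (f x)))
    (hC : ∀ n, ∫⁻ x, F n x ∂ν ≤ C) : ∫⁻ x, f x ∂ν ≤ C :=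
  calc ∫⁻ x, f x ∂ν = ∫⁻ x, liminf (fun n ↦ F n x) atTop ∂ν :=
        lintegral_congr_ae (h.mono fun _ hx ↦ hx.liminf_eq.symm)
    _ ≤ liminf (fun n ↦ ∫⁻ x, F n x ∂ν) atTop := lintegral_liminf_le' hF
    _ ≤ C := liminf_le_of_le (by isBoundedDefault) fun b hb ↦ by
        obtain ⟨n, hn⟩ := hb.exists
        exact hn.trans (hC n)

variable {μ : Measure X} {E : ℝ → Set X} {s k κ A : ℝ} {d : ℕ} {w g : X → ℝ}

lemma HarnackData.restrict_le (h : HarnackData μ E s k κ A d w g) {ρ : ℝ} (hρ : ρ ≤ 18 / 5) :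
    μ.restrict (E ρ) ≤ μ.restrict (E (18 / 5)) :=
  Measure.restrict_mono (h.mono hρ) le_rfl

lemma HarnackData.aemeasurable_restrict (h : HarnackData μ E s k κ A d w g) {ρ : ℝ}
    (hρ : ρ ≤ 18 / 5) : AEMeasurable w (μ.restrict (E ρ)) :=
  h.aemeasurable.mono_measure (h.restrict_le hρ)

lemma HarnackData.le_w_restrict (h : HarnackData μ E s k κ A d w g) {ρ : ℝ}
    (hρ : ρ ≤ 18 / 5) : ∀ᵐ x ∂μ.restrict (E ρ), k ≤ w x :=
  (Measure.absolutelyContinuous_of_le (h.restrict_le hρ)).ae_le h.le_w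

/-- Powers of a positive subsolution satisfy a reverse Hölder inequality. -/
lemma HarnackData.reverse_holder_sub (h : HarnackData μ E 1 k κ A d w g) (hk : 0 < k)
    (hκ : 1 < κ) (hA : 0 < A) {β ε : ℝ} (hε : 0 < ε) (hε1 : ε ≤ 1) (hβε : ε ≤ 2 * β - 1)
    {ρ ρ' : ℝ} (h1 : 1 ≤ ρ) (h2 : ρ < ρ') (h3 : ρ' ≤ 18 / 5) :
    (∫⁻ x in E ρ, ofReal (w x) ^ (2 * β * κ) ∂μ) ^ (1 / κ) ≤
      ofReal (A * ((1 + β) ^ 2 / ε ^ 2) ^ d / (ρ' - ρ) ^ 2) *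
        ∫⁻ x in E ρ', ofReal (w x) ^ (2 * β) ∂μ := by
  have hβ0 : 0 < β := by linarith
  have hκ0 : 0 < κ := by linarith
  have hε2 : ε ^ 2 ≤ 1 := pow_le_one₀ hε.le hε1
  have hw := h.le_w_restrict (ρ := ρ) (by linarith)
  have hw' := h.le_w_restrict h3
  have hT : ∀ T : ℝ, 0 ≤ T → T ≤ (1 + β) ^ 2 / ε ^ 2 →
      ofReal (A * T ^ d / (ρ' - ρ) ^ 2) ≤
      ofReal (A * ((1 + β) ^ 2 / ε ^ 2) ^ d / (ρ' - ρ) ^ 2) := fun T h0 hT ↦ by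
    gcongr
  rcases le_or_gt β 1 with hβ | hβ
  · have := h.reverse_holder (testPair_sub_rpow hk hε hε1 hβε hβ) ρ ρ' h1 h2 h3
    refine le_trans (le_of_eq ?_) (this.trans (mul_le_mul' (hT _ (by positivity) ?_) (le_of_eq ?_)))
    · congr 1
      refine lintegral_congr_ae (hw.mono fun x hx ↦ ?_)
      have hx0 : 0 < w x := by linarith
      dsimp only
      rw [one_mul, abs_of_pos (by positivity), ← ENNReal.ofReal_rpow_of_pos hx0, ← ENNReal.rpow_mul]
      congr 1; ring
    · gcongr
      nlinarith
    · refine lintegral_congr_ae (hw'.mono fun x hx ↦ ?_)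
      have hx0 : 0 < w x := by linarith
      dsimp only
      rw [one_mul, ENNReal.ofReal_rpow_of_pos hx0, ← Real.rpow_natCast, ← Real.rpow_mul hx0.le]
      congr 2; push_cast; ring
  · -- the truncation parameter tends to infinity
    have hN : ∀ N : ℕ, (0 : ℝ) < (N : ℝ) + 1 := fun N ↦ by positivity
    have hle : ∀ (N : ℕ) (t : ℝ), 0 < t → truncPow (N + 1) (β - 1) t ≤ t ^ β := by
      intro N t ht
      have hN' := hN N
      have h4 : (N + 1) * t / (N + 1 + t) ≤ t := by
        rw [div_le_iff₀ (by positivity)]; nlinarith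
      calc truncPow (N + 1) (β - 1) t ≤ t * t ^ (β - 1) := by
            unfold truncPow
            have : 0 ≤ β - 1 := by linarith
            gcongr
        _ = t ^ β := by
            rw [Real.rpow_sub_one ht.ne']; field_simp
    have hlim : ∀ t : ℝ, 0 < t →
        Tendsto (fun N : ℕ ↦ truncPow ((N : ℝ) + 1) (β - 1) t) atTop (𝓝 (t ^ β)) := by
      intro t ht
      have e1 : t ^ β = t * t ^ (β - 1) := by rw [Real.rpow_sub_one ht.ne']; field_simp
      rw [e1]
      unfold truncPow
      refine Tendsto.mul tendsto_const_nhds (Tendsto.rpow_const ?_ (Or.inl ht.ne'))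
      have h5 : Tendsto (fun N : ℕ ↦ t / (1 + t / ((N : ℝ) + 1))) atTop (𝓝 (t / (1 + 0))) := by
        refine Tendsto.div tendsto_const_nhds (tendsto_const_nhds.add ?_) (by norm_num)
        exact Tendsto.div_atTop tendsto_const_nhds
          (tendsto_atTop_add_const_right _ _ tendsto_natCast_atTop_atTop)
      rw [add_zero, div_one] at h5
      refine h5.congr fun N ↦ ?_
      have := hN N
      field_simp
    have hbound : ∀ N : ℕ, ∫⁻ x in E ρ, ofReal |truncPow ((N : ℝ) + 1) (β - 1) (w x)| ^ (2 * κ) ∂μ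
        ≤ (ofReal (A * ((1 + β) ^ 2 / ε ^ 2) ^ d / (ρ' - ρ) ^ 2) *
        ∫⁻ x in E ρ', ofReal (w x) ^ (2 * β) ∂μ) ^ κ := by
      intro N
      have := h.reverse_holder (testPair_truncPow hk (hN N) hβ.le) ρ ρ' h1 h2 h3
      have h6 := this.trans (mul_le_mul' (hT _ (by positivity) ?_) (lintegral_mono_ae
        (g := fun x ↦ ofReal (w x) ^ (2 * β)) (hw'.mono fun x hx ↦ ?_)))
      · have h7 := ENNReal.rpow_le_rpow h6 hκ0.le
        rwa [← ENNReal.rpow_mul, one_div, inv_mul_cancel₀ hκ0.ne', ENNReal.rpow_one] at h7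
      · rw [le_div_iff₀ (by positivity)]
        nlinarith [sq_nonneg β]
      · have hx0 : 0 < w x := by linarith
        have h8 := hle N (w x) hx0
        have h9 : 0 ≤ truncPow ((N : ℝ) + 1) (β - 1) (w x) := by
          have := hN N
          unfold truncPow; positivity
        rw [ENNReal.ofReal_rpow_of_pos hx0]
        refine ENNReal.ofReal_le_ofReal ?_
        calc _ ≤ (w x ^ β) ^ 2 := by gcongr
          _ = _ := by
            rw [← Real.rpow_natCast, ← Real.rpow_mul hx0.le]; congr 1; push_cast; ring
    have hfin := lintegral_le_of_ae_tendsto (ν := μ.restrict (E ρ))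
      (f := fun x ↦ ofReal (w x) ^ (2 * β * κ)) (fun N ↦ ?_) ?_ hbound
    · have h7 := ENNReal.rpow_le_rpow hfin (show 0 ≤ 1 / κ by positivity)
      rwa [← ENNReal.rpow_mul, mul_one_div_cancel hκ0.ne', ENNReal.rpow_one] at h7
    · have : AEMeasurable w (μ.restrict (E ρ)) := h.aemeasurable_restrict (by linarith)
      unfold truncPow
      fun_prop
    · refine hw.mono fun x hx ↦ ?_
      have hx0 : 0 < w x := by linarith
      have e2 : ofReal (w x) ^ (2 * β * κ) = ofReal |w x ^ β| ^ (2 * κ) := by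
        rw [abs_of_pos (by positivity), ← ENNReal.ofReal_rpow_of_pos hx0, ← ENNReal.rpow_mul]
        congr 1; ring
      rw [e2]
      exact (ENNReal.continuous_rpow_const.tendsto _).comp
        ((ENNReal.continuous_ofReal.tendsto _).comp ((continuous_abs.tendsto _).comp
          (hlim _ hx0)))

/-- Local boundedness of subsolutions. -/
theorem HarnackData.exists_sub_bound {κ A p : ℝ} (d : ℕ) (hκ : 1 < κ) (hA : 0 < A) (hp : 1 < p) :
    ∃ C : ℝ, 0 < C ∧ ∀ (μ : Measure X) (E : ℝ → Set X) (k : ℝ) (w g : X → ℝ), 0 < k →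
      HarnackData μ E 1 k κ A d w g →
      ∀ᵐ x ∂μ.restrict (E (11 / 10)), ofReal (w x) ≤
        ofReal C * (∫⁻ x in E (9 / 5), ofReal (w x) ^ p ∂μ) ^ (1 / p) := by
  have hκ0 : 0 < κ := by linarith
  set ε : ℝ := min 1 (p - 1) with hε
  have hε0 : 0 < ε := lt_min one_pos (by linarith)
  have hε1 : ε ≤ 1 := min_le_left _ _
  have hεp : ε ≤ p - 1 := min_le_right _ _
  obtain ⟨C, hC, hmain⟩ := exists_ae_le_of_reverse_holder (X := X) (κ := κ)
    (B := A * ((1 + p) ^ 2 / ε ^ 2) ^ d) (ρ₀ := 11 / 10) (ρ₁ := 9 / 5) hκ (by positivity) (2 * d)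
    (by norm_num)
  refine ⟨C ^ (2 / p), by positivity, ?_⟩
  intro μ E k w g hk h
  have hwm : AEMeasurable w (μ.restrict (E (9 / 5))) := h.aemeasurable_restrict (by norm_num)
  have hV := hmain μ E h.mono (fun x ↦ ofReal (w x) ^ (p / 2)) (by fun_prop) ?_
  · filter_upwards [hV] with x hx
    have := ENNReal.rpow_le_rpow hx (show 0 ≤ 2 / p by positivity)
    rw [← ENNReal.rpow_mul, ENNReal.mul_rpow_of_nonneg _ _ (by positivity), ← ENNReal.rpow_mul,
      ENNReal.ofReal_rpow_of_pos hC] at this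
    have e1 : p / 2 * (2 / p) = 1 := by field_simp
    have e2 : (1 / 2 : ℝ) * (2 / p) = 1 / p := by field_simp
    rw [e1, e2, ENNReal.rpow_one] at this
    refine this.trans (le_of_eq ?_)
    simp_rw [← ENNReal.rpow_mul]
    congr 4
    ext x; congr 1; ring
  · intro j ρ ρ' h1 h2 h3
    have hκj : 1 ≤ κ ^ j := one_le_pow₀ hκ.le
    have := h.reverse_holder_sub hk hκ hA (β := p / 2 * κ ^ j) hε0 hε1 (by nlinarith)
      (by linarith : 1 ≤ ρ) h2 (by linarith)
    simp_rw [← ENNReal.rpow_mul]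
    rw [show p / 2 * (2 * κ ^ (j + 1)) = 2 * (p / 2 * κ ^ j) * κ by ring,
      show p / 2 * (2 * κ ^ j) = 2 * (p / 2 * κ ^ j) by ring]
    refine this.trans ?_
    gcongr ofReal (?_ / _) * _
    rw [mul_assoc A, pow_mul (κ ^ j) 2 d, ← mul_pow,
      show (1 + p) ^ 2 / ε ^ 2 * (κ ^ j) ^ 2 = ((1 + p) * κ ^ j) ^ 2 / ε ^ 2 by ring]
    gcongr
    nlinarith

/-- Small powers of a positive supersolution satisfy a reverse Hölder inequality whose constant
does not depend on the exponent. -/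
lemma HarnackData.reverse_holder_super (h : HarnackData μ E (-1) k κ A d w g) (hk : 0 < k)
    {m γ ε : ℝ} (hm : 0 < m) (hγ : 0 < γ)
    (hε : 0 < ε) (hγε : γ ≤ 1 - ε) {ρ ρ' : ℝ} (h1 : 1 ≤ ρ) (h2 : ρ < ρ') (h3 : ρ' ≤ 18 / 5) :
    (∫⁻ x in E ρ, ofReal (w x / m) ^ (γ * κ) ∂μ) ^ (1 / κ) ≤
      ofReal (A * (1 / ε ^ 2) ^ d / (ρ' - ρ) ^ 2) *
        ∫⁻ x in E ρ', ofReal (w x / m) ^ γ ∂μ := by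
  have hw := h.le_w_restrict (ρ := ρ) (by linarith)
  have hw' := h.le_w_restrict h3
  have e : ∀ t : ℝ, 0 < t → m ^ (-γ / 2) * t ^ (γ / 2) = (t / m) ^ (γ / 2) := fun t ht ↦ by
    rw [Real.div_rpow ht.le hm.le, neg_div, Real.rpow_neg hm.le]; field_simp
  have := h.reverse_holder (testPair_super_rpow hk m hm hγ hε hγε) ρ ρ' h1 h2 h3
  refine le_trans (le_of_eq ?_) (this.trans (le_of_eq ?_))
  · congr 1
    refine lintegral_congr_ae (hw.mono fun x hx ↦ ?_)
    have hx0 : 0 < w x := by linarith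
    dsimp only
    rw [e _ hx0, abs_of_pos (by positivity), ← ENNReal.ofReal_rpow_of_pos (by positivity),
      ← ENNReal.rpow_mul]
    congr 1; ring
  · congr 1
    refine lintegral_congr_ae (hw'.mono fun x hx ↦ ?_)
    have hx0 : 0 < w x := by linarith
    have hxm : 0 < w x / m := by positivity
    dsimp only
    rw [e _ hx0, ENNReal.ofReal_rpow_of_pos hxm, ← Real.rpow_natCast, ← Real.rpow_mul hxm.le]
    congr 2; push_cast; ring

/-- The logarithm of a positive supersolution has bounded mean oscillation; here in the form of a
number `m` such that `log (w/m)` is bounded in `L²`. -/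
lemma HarnackData.exists_log_bound (h : HarnackData μ E (-1) k κ A d w g) (hk : 0 < k)
    (hA : 0 < A) : ∃ m, 0 < m ∧
      ∫⁻ x in E 3, ofReal ((Real.log (w x) - Real.log m) ^ 2) ∂μ ≤
        ofReal (3 * A ^ 4) := by
  have hwm : AEMeasurable w (μ.restrict (E 3)) := h.aemeasurable_restrict (by norm_num)
  have hw := h.le_w_restrict (ρ := 3) (by norm_num)
  have hμ3 : μ (E 3) ≤ ofReal A := (measure_mono (h.mono (by norm_num))).trans h.measure_le
  have hμ1 : 1 ≤ ofReal A * μ (E 3) := h.one_le_measure.trans (by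
    gcongr; exact h.mono (by norm_num))
  have hE3 : μ (E 3) ≠ 0 := fun h0 ↦ by simp [h0] at hμ1
  have hE3' : μ (E 3) ≠ ⊤ := (hμ3.trans_lt ENNReal.ofReal_lt_top).ne
  have hen := h.energy (testPair_inv hk) 3 (18 / 5) (by norm_num) (by norm_num) le_rfl
  have hgrad : ∫⁻ x in E 3, ofReal ((w x)⁻¹ ^ 2 * g x ^ 2) ∂μ ≤
      ofReal (3 * A ^ 2) := by
    calc ∫⁻ x in E 3, ofReal ((w x)⁻¹ ^ 2 * g x ^ 2) ∂μ = _ := by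
          rw [← one_mul (∫⁻ x in E 3, ofReal ((w x)⁻¹ ^ 2 * g x ^ 2) ∂μ),
            ← ENNReal.ofReal_one]
          congr 1
          refine lintegral_congr_ae (hw.mono fun x hx ↦ ?_)
          have hx0 : 0 < w x := by linarith
          dsimp only
          rw [Real.rpow_sub hx0, Real.rpow_neg_one, Real.rpow_one]
          congr 1
          field_simp
      _ ≤ _ := hen
      _ ≤ ofReal (A * 1 ^ d / (18 / 5 - 3) ^ 2) * ofReal A := by
          gcongr
          simpa using h.measure_le
      _ ≤ _ := by
          rw [← ENNReal.ofReal_mul (by positivity)]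
          refine ENNReal.ofReal_le_ofReal ?_
          rw [one_pow]
          norm_num
          nlinarith [sq_nonneg A]
  have hpo := (h.poincare (c1Bdd_log hk)).trans (mul_le_mul_right hgrad _)
  set I : X → ℝ≥0∞ := fun y ↦
    ∫⁻ z in E 3, ofReal ((Real.log (w y) - Real.log (w z)) ^ 2) ∂μ with hI
  set ν := μ.restrict (E 3) with hν
  have hν0 : ν ≠ 0 := by
    rw [hν, Ne, Measure.restrict_eq_zero]; exact hE3
  have : IsFiniteMeasure ν := ⟨by rw [hν, Measure.restrict_apply_univ]; exact hE3'.lt_top⟩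
  have hIm : AEMeasurable I ν := by
    have hw1 : AEMeasurable (fun z : X × X ↦
        ofReal ((Real.log (w z.1) - Real.log (w z.2)) ^ 2)) (ν.prod ν) := by
      have a1 : AEMeasurable (fun z : X × X ↦ w z.1) (ν.prod ν) := hwm.comp_fst
      have a2 : AEMeasurable (fun z : X × X ↦ w z.2) (ν.prod ν) := hwm.comp_snd
      exact (((Real.measurable_log.comp_aemeasurable a1).sub
        (Real.measurable_log.comp_aemeasurable a2)).pow_const 2).ennreal_ofReal
    exact hw1.lintegral_prod_right'
  -- the double integral of `(log w(y) - log w(z))²` is bounded, so some `y` has a partial integral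
  -- that is at most the mean; `m` is the value of `w` there
  obtain ⟨y, hy1, hy2⟩ := exists_notMem_null_le_laverage hν0 hIm (N := {x | ¬ k ≤ w x}) hw
  have hy1' : k ≤ w y := by simpa using hy1
  refine ⟨w y, by linarith, ?_⟩
  rw [laverage_eq] at hy2
  calc ∫⁻ x in E 3, ofReal ((Real.log (w x) - Real.log (w y)) ^ 2) ∂μ = I y := by
        refine lintegral_congr fun x ↦ ?_
        congr 1; ring
    _ ≤ _ := hy2
    _ ≤ (ofReal A * ofReal (3 * A ^ 2)) / (ν univ) := by
        gcongr
    _ ≤ (ofReal A * ofReal (3 * A ^ 2)) * ofReal A := by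
        rw [hν, Measure.restrict_apply_univ]
        refine ENNReal.div_le_of_le_mul ?_
        rw [mul_assoc]
        conv_lhs => rw [← mul_one (ofReal A * ofReal (3 * A ^ 2))]
        gcongr
    _ = _ := by
        rw [← ENNReal.ofReal_mul hA.le, ← ENNReal.ofReal_mul (by positivity)]
        congr 1; ring

/-- The weak Harnack inequality for supersolutions. Both halves compare `w` with the number `m` for
which `log (w/m)` is bounded in `L²`. From below, `logTerm m w` is a subsolution that is bounded in
`L²`, hence bounded. From above, `w/m` satisfies the hypotheses of the lemma of Bombieri and
Giusti. -/
theorem HarnackData.exists_super_bound {κ A p : ℝ} (d : ℕ) (hκ : 1 < κ) (hA : 0 < A) (hp : 0 < p)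
    (hpκ : p < κ) :
    ∃ C : ℝ, 0 < C ∧ ∀ (μ : Measure X) (E : ℝ → Set X) (k : ℝ) (w g : X → ℝ), 0 < k →
      HarnackData μ E (-1) k κ A d w g → ∃ m : ℝ, 0 < m ∧
      (∀ᵐ x ∂μ.restrict (E (11 / 10)), m ≤ C * w x) ∧
      (∫⁻ x in E (11 / 5), ofReal (w x) ^ p ∂μ) ^ (1 / p) ≤ ofReal (C * m) := by
  have hκ0 : 0 < κ := by linarith
  set ε : ℝ := 1 - p / κ with hε
  have hpκ' : p / κ < 1 := by rw [div_lt_one hκ0]; exact hpκ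
  have hε0 : 0 < ε := by linarith
  obtain ⟨C₁, hC₁, hsup⟩ := exists_ae_le_of_reverse_holder (X := X) (κ := κ)
    (B := A) (ρ₀ := 11 / 10) (ρ₁ := 3) hκ hA (2 * d) (by norm_num)
  set B : ℝ := A * (1 / ε ^ 2) ^ d + 3 * A ^ 4 + A with hB
  have hB0 : 0 < B := by positivity
  obtain ⟨C₂, hC₂, hLp⟩ := exists_lintegral_rpow_le_of_log_tail (X := X) (κ := κ) (B := B)
    (A := A) (p := p) (ρ₀ := 11 / 5) (ρ₁ := 3) hp hκ hB0 hA (by norm_num)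
  set C₃ : ℝ := C₁ * (8 * A + 2 * (3 * A ^ 4)) ^ (1 / 2 : ℝ) with hC₃
  refine ⟨Real.exp C₃ + C₂ ^ (1 / p), by positivity, ?_⟩
  intro μ E k w g hk h
  have hwm : AEMeasurable w (μ.restrict (E 3)) := h.aemeasurable_restrict (by norm_num)
  have hw := h.le_w_restrict (ρ := 3) (by norm_num)
  have hμ3 : μ (E 3) ≤ ofReal A := (measure_mono (h.mono (by norm_num))).trans h.measure_le
  obtain ⟨m, hm, hlog⟩ := h.exists_log_bound hk hA
  refine ⟨m, hm, ?_, ?_⟩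
  · -- the subsolution `logTerm m w` is bounded
    have hVm : AEMeasurable (fun x ↦ ofReal (logTerm m (w x))) (μ.restrict (E 3)) := by
      unfold logTerm
      exact ((Real.measurable_log.comp_aemeasurable
        ((hwm.const_div m).const_add 1)).const_add 1).ennreal_ofReal
    have hV := hsup μ E h.mono _ hVm ?_
    · have hint : ∫⁻ x in E 3, ofReal (logTerm m (w x)) ^ (2 : ℝ) ∂μ ≤
          ofReal (8 * A + 2 * (3 * A ^ 4)) := by
        calc ∫⁻ x in E 3, ofReal (logTerm m (w x)) ^ (2 : ℝ) ∂μ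
            ≤ ∫⁻ x in E 3, (ofReal 8 + ofReal 2 *
              ofReal ((Real.log (w x) - Real.log m) ^ 2)) ∂μ := by
              refine lintegral_mono_ae (hw.mono fun x hx ↦ ?_)
              have hx0 : 0 < w x := by linarith
              have hv := one_le_logTerm hm hx0
              rw [ENNReal.ofReal_rpow_of_pos (by linarith), ← ENNReal.ofReal_mul (by norm_num),
                ← ENNReal.ofReal_add (by norm_num) (by positivity)]
              refine ENNReal.ofReal_le_ofReal ?_
              rw [show ((2 : ℝ)) = ((2 : ℕ) : ℝ) by norm_num, Real.rpow_natCast]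
              have hv2 : logTerm m (w x) ≤ 2 + |Real.log (w x) - Real.log m| := by
                unfold logTerm
                have hl2 : Real.log 2 ≤ 1 := by linarith [Real.log_two_lt_d9]
                rcases le_or_gt (m / w x) 1 with hc | hc
                · have : Real.log (1 + m / w x) ≤ Real.log 2 :=
                    Real.log_le_log (by positivity) (by linarith)
                  linarith [abs_nonneg (Real.log (w x) - Real.log m)]
                · have h5 : Real.log (1 + m / w x) ≤ Real.log (2 * (m / w x)) :=
                    Real.log_le_log (by positivity) (by linarith)
                  rw [Real.log_mul (by norm_num) (by positivity),
                    Real.log_div hm.ne' hx0.ne'] at h5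
                  linarith [neg_abs_le (Real.log (w x) - Real.log m)]
              have h6 := sq_abs (Real.log (w x) - Real.log m)
              push_cast
              nlinarith [sq_nonneg (2 - |Real.log (w x) - Real.log m|)]
          _ ≤ ofReal 8 * ofReal A + ofReal 2 * ofReal (3 * A ^ 4) := by
              rw [lintegral_add_left measurable_const, lintegral_const_mul' _ _ (by simp),
                lintegral_const, Measure.restrict_apply_univ]
              gcongr
          _ = _ := by
              rw [← ENNReal.ofReal_mul (by norm_num), ← ENNReal.ofReal_mul (by norm_num),
                ← ENNReal.ofReal_add (by positivity) (by positivity)]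
      have hw1 := h.le_w_restrict (ρ := 11 / 10) (by norm_num)
      filter_upwards [hV, hw1] with x hx hx1
      have hx0 : 0 < w x := by linarith
      have h7 : logTerm m (w x) ≤ C₃ := by
        have h8 := hx.trans (mul_le_mul_right (ENNReal.rpow_le_rpow hint (by norm_num)) _)
        rw [ENNReal.ofReal_rpow_of_pos (by positivity), ← ENNReal.ofReal_mul hC₁.le] at h8
        exact (ENNReal.ofReal_le_ofReal_iff (by positivity)).1 h8
      have h9 : m / w x ≤ Real.exp C₃ := by
        have h10 : Real.log (1 + m / w x) ≤ C₃ := by unfold logTerm at h7; linarith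
        rw [Real.log_le_iff_le_exp (by positivity)] at h10
        linarith
      rw [div_le_iff₀ hx0] at h9
      have : 0 ≤ C₂ ^ (1 / p) * w x := by positivity
      linarith
    · intro j ρ ρ' h1 h2 h3
      have hκj : 1 ≤ κ ^ j := one_le_pow₀ hκ.le
      have hrh := h.reverse_holder (testPair_logTerm hk hm hκj) ρ ρ' (by linarith) h2 (by linarith)
      rw [← pow_mul] at hrh
      refine le_trans (le_of_eq ?_) (hrh.trans (le_of_eq ?_))
      · congr 1
        refine lintegral_congr_ae ((h.le_w_restrict (ρ := ρ) (by linarith)).mono fun x hx ↦ ?_)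
        have hx0 : 0 < w x := by linarith
        have hv := one_le_logTerm hm hx0
        dsimp only
        rw [abs_of_nonneg (by positivity), ← ENNReal.ofReal_rpow_of_pos (by linarith),
          ← ENNReal.rpow_mul]
        congr 1; ring
      · congr 1
        refine lintegral_congr_ae ((h.le_w_restrict (ρ := ρ') (by linarith)).mono fun x hx ↦ ?_)
        have hx0 : 0 < w x := by linarith
        have hv := one_le_logTerm hm hx0
        dsimp only
        rw [ENNReal.ofReal_rpow_of_pos (by linarith), ← Real.rpow_natCast,
          ← Real.rpow_mul (by linarith)]
        congr 2; push_cast; ring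
  · have hfm : AEMeasurable (fun x ↦ ofReal (w x / m)) (μ.restrict (E 3)) :=
      (hwm.div_const m).ennreal_ofReal
    have hγ : ∀ j : ℕ, 0 < p / κ ^ (j + 1) ∧ p / κ ^ (j + 1) ≤ 1 - ε := fun j ↦ by
      refine ⟨by positivity, ?_⟩
      rw [hε, sub_sub_cancel]
      gcongr
      exact le_self_pow₀ hκ.le (by omega)
    have hγκ : ∀ j : ℕ, p / κ ^ (j + 1) * κ = p / κ ^ j := fun j ↦ by
      rw [pow_succ]; field_simp
    have hmain := hLp μ E h.mono (fun x ↦ ofReal (w x / m)) hfm hμ3 ?_ ?_ ?_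
    · have h4 : ∫⁻ x in E (11 / 5), ofReal (w x) ^ p ∂μ =
          ofReal (m ^ p) * ∫⁻ x in E (11 / 5), ofReal (w x / m) ^ p ∂μ := by
        rw [← lintegral_const_mul' _ _ (by simp)]
        refine lintegral_congr fun x ↦ ?_
        rw [← ENNReal.ofReal_rpow_of_pos hm, ← ENNReal.mul_rpow_of_nonneg _ _ hp.le,
          ← ENNReal.ofReal_mul hm.le, mul_div_cancel₀ _ hm.ne']
      rw [h4]
      calc _ ≤ (ofReal (m ^ p) * ofReal C₂) ^ (1 / p) := by gcongr
        _ = ofReal (C₂ ^ (1 / p) * m) := by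
            rw [← ENNReal.ofReal_mul (by positivity), ENNReal.ofReal_rpow_of_pos (by positivity),
              Real.mul_rpow (by positivity) hC₂.le, ← Real.rpow_mul hm.le,
              mul_one_div_cancel hp.ne', Real.rpow_one, mul_comm]
        _ ≤ _ := by
            refine ENNReal.ofReal_le_ofReal ?_
            have := Real.exp_pos C₃
            gcongr
            linarith
    · -- finiteness, from the reverse Hölder inequality with the exponent `p / κ < 1`
      have hrh := h.reverse_holder_super hk hm (hγ 0).1 hε0 (hγ 0).2 (ρ := 3) (ρ' := 18 / 5)
        (by norm_num) (by norm_num) le_rfl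
      rw [hγκ, pow_zero, div_one] at hrh
      have hfin : ∫⁻ x in E (18 / 5), ofReal (w x / m) ^ (p / κ ^ (0 + 1)) ∂μ < ⊤ := by
        calc _ ≤ ∫⁻ x in E (18 / 5), (ofReal 1 + ofReal (1 / m ^ 2) *
                ofReal (w x ^ 2)) ∂μ := by
              refine lintegral_mono_ae (h.le_w.mono fun x hx ↦ ?_)
              have hx0 : 0 < w x := by linarith
              rw [ENNReal.ofReal_rpow_of_pos (by positivity), ← ENNReal.ofReal_mul (by positivity),
                ← ENNReal.ofReal_add (by norm_num) (by positivity)]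
              refine ENNReal.ofReal_le_ofReal ?_
              have e3 : 1 / m ^ 2 * w x ^ 2 = (w x / m) ^ 2 := by field_simp
              rw [e3]
              rcases le_or_gt (w x / m) 1 with hc | hc
              · have := Real.rpow_le_one (by positivity) hc (hγ 0).1.le
                nlinarith [sq_nonneg (w x / m)]
              · have := Real.rpow_le_rpow_of_exponent_le hc.le ((hγ 0).2.trans
                  (by push_cast; linarith : 1 - ε ≤ ((2 : ℕ) : ℝ)))
                rw [Real.rpow_natCast] at this
                linarith
          _ < ⊤ := by
              rw [lintegral_add_left measurable_const, lintegral_const_mul' _ _ (by simp),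
                lintegral_const, Measure.restrict_apply_univ]
              refine ENNReal.add_lt_top.2 ⟨ENNReal.mul_lt_top (by simp)
                (h.measure_le.trans_lt (by simp)), ENNReal.mul_lt_top (by simp) h.sq_lt_top⟩
      have h5 : (∫⁻ x in E 3, ofReal (w x / m) ^ p ∂μ) ^ (1 / κ) < ⊤ :=
        hrh.trans_lt (ENNReal.mul_lt_top (by simp) hfin)
      intro htop
      rw [htop, ENNReal.top_rpow_of_pos (by positivity)] at h5
      exact lt_irrefl _ h5
    · intro t ht
      rcases le_or_gt t 1 with ht1 | ht1
      · calc _ ≤ μ.restrict (E 3) univ := measure_mono (subset_univ _)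
          _ ≤ ofReal A := by rw [Measure.restrict_apply_univ]; exact hμ3
          _ ≤ _ := by
              refine ENNReal.ofReal_le_ofReal ?_
              rw [le_div_iff₀ ht]
              have : 0 < A * (1 / ε ^ 2) ^ d + 3 * A ^ 4 := by positivity
              nlinarith
      · have hmk := mul_meas_ge_le_lintegral₀ (μ := μ.restrict (E 3))
          (f := fun x ↦ ofReal ((Real.log (w x) - Real.log m) ^ 2))
          ((((Real.measurable_log.comp_aemeasurable hwm).sub_const _).pow_const 2).ennreal_ofReal)
          (ofReal (t ^ 2))
        have hsub : μ.restrict (E 3) {x | ofReal (Real.exp t) < ofReal (w x / m)} ≤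
            μ.restrict (E 3) {x | ofReal (t ^ 2) ≤
              ofReal ((Real.log (w x) - Real.log m) ^ 2)} := by
          refine measure_mono_ae (hw.mono fun x hx hxt ↦ ?_)
          have hx0 : 0 < w x := by linarith
          have hxt' : Real.exp t < w x / m := (ENNReal.ofReal_lt_ofReal_iff (by positivity)).1 hxt
          have h11 : t < Real.log (w x) - Real.log m := by
            rw [← Real.log_div hx0.ne' hm.ne']
            exact (Real.lt_log_iff_exp_lt (by positivity)).2 hxt'
          show ofReal (t ^ 2) ≤ _
          refine ENNReal.ofReal_le_ofReal ?_
          gcongr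
        refine hsub.trans ?_
        have h12 := hmk.trans hlog
        have h13 : μ.restrict (E 3) {x | ofReal (t ^ 2) ≤
              ofReal ((Real.log (w x) - Real.log m) ^ 2)} ≤
            ofReal (3 * A ^ 4) / ofReal (t ^ 2) := by
          rw [ENNReal.le_div_iff_mul_le (Or.inl (by simp; positivity)) (Or.inl (by simp)), mul_comm]
          exact h12
        refine h13.trans ?_
        rw [← ENNReal.ofReal_div_of_pos (by positivity)]
        refine ENNReal.ofReal_le_ofReal ?_
        rw [div_le_div_iff₀ (by positivity) ht]
        have h14 : 0 < A * (1 / ε ^ 2) ^ d + A := by positivity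
        have h15 : 3 * A ^ 4 ≤ B := by linarith
        have h16 : t ≤ t ^ 2 := by nlinarith
        have : 0 < 3 * A ^ 4 := by positivity
        calc 3 * A ^ 4 * t ≤ B * t := by gcongr
          _ ≤ _ := by gcongr
    · intro j ρ ρ' h1 h2 h3
      have hrh := h.reverse_holder_super hk hm (hγ j).1 hε0 (hγ j).2 (by linarith : 1 ≤ ρ) h2
        (by linarith)
      rw [hγκ] at hrh
      refine hrh.trans ?_
      gcongr
      rw [hB]
      have : 0 < 3 * A ^ 4 + A := by positivity
      linarith

end AbstractHarnack

/-! ### Inequalities in the Euclidean half-space -/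

section Flat

variable {n : ℕ} [NeZero n]

/-- The closed half-space `{y | 0 ≤ y 0}` of `ℝⁿ`, on which manifolds with boundary are modelled. -/
def halfSpace (n : ℕ) [NeZero n] : Set (𝔼 n) := {y | 0 ≤ y 0}

lemma range_model_eq_halfSpace : range (𝓡∂ n) = halfSpace n :=
  range_modelWithCornersEuclideanHalfSpace n

lemma continuous_coord_zero : Continuous fun y : 𝔼 n ↦ y 0 :=
  (EuclideanSpace.proj (0 : Fin n)).continuous

lemma isClosed_halfSpace : IsClosed (halfSpace n) :=
  isClosed_le continuous_const continuous_coord_zero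

lemma measurableSet_halfSpace : MeasurableSet (halfSpace n) := isClosed_halfSpace.measurableSet

lemma convex_halfSpace : Convex ℝ (halfSpace n) := by
  intro x hx y hy a b ha hb _
  simp only [halfSpace, mem_ofPred_eq, PiLp.add_apply, PiLp.smul_apply, smul_eq_mul] at *
  positivity

lemma uniqueDiffOn_halfSpace : UniqueDiffOn ℝ (halfSpace n) := by
  rw [← range_model_eq_halfSpace]
  exact (𝓡∂ n).uniqueDiffOn

omit [NeZero n] in
/-- The Gagliardo–Nirenberg–Sobolev inequality with exponent `2`, in integral form. -/
lemma exists_sobolev_whole_space (hn : 3 ≤ n) : ∃ C : ℝ≥0∞, C ≠ ⊤ ∧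
    ∀ u : 𝔼 n → ℝ, ContDiff ℝ 1 u → HasCompactSupport u →
      (∫⁻ y, ‖u y‖ₑ ^ (2 * ((n : ℝ) / ((n : ℝ) - 2)))) ^ (1 / ((n : ℝ) / ((n : ℝ) - 2))) ≤
        C * ∫⁻ y, ‖fderiv ℝ u y‖ₑ ^ 2 := by
  have hn' : (3 : ℝ) ≤ n := by exact_mod_cast hn
  set κ : ℝ := (n : ℝ) / ((n : ℝ) - 2) with hκ
  have hκ0 : 0 < κ := div_pos (by linarith) (by linarith)
  set c := SNormLESNormFDerivOfEqConst ℝ (volume : Measure (𝔼 n)) (2 : NNReal)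
  refine ⟨(c : ℝ≥0∞) ^ 2, by simp, fun u hu hsupp ↦ ?_⟩
  have h := eLpNorm_le_eLpNorm_fderiv_of_eq (μ := (volume : Measure (𝔼 n)))
    hu hsupp (p := 2) (p' := (2 * κ).toNNReal) (by norm_num) (by simp; omega) (by
      rw [Real.coe_toNNReal _ (by positivity), finrank_euclideanSpace_fin, hκ]
      have : (n : ℝ) - 2 ≠ 0 := by linarith
      have : (n : ℝ) ≠ 0 := by linarith
      push_cast
      field_simp)
  rw [eLpNorm_eq_lintegral_rpow_enorm_toReal (by simp [hκ0]) (by simp),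
    eLpNorm_eq_lintegral_rpow_enorm_toReal (by simp) (by simp)] at h
  simp only [ENNReal.coe_toReal, Real.coe_toNNReal _ (show (0 : ℝ) ≤ 2 * κ by positivity)] at h
  have h2 := ENNReal.rpow_le_rpow h (z := 2) (by norm_num)
  rw [ENNReal.mul_rpow_of_nonneg _ _ (by norm_num), ← ENNReal.rpow_mul, ← ENNReal.rpow_mul] at h2
  convert h2 using 2
  · field_simp
  · norm_num [c]
  · norm_num

/-- The smooth map `y ↦ (√(y₀² + ε²), y')`, which sends `ℝⁿ` into the half-space and tends to the
even reflection as `ε → 0`. -/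
def smoothFold (ε : ℝ) (y : 𝔼 n) : 𝔼 n :=
  y + (√(y 0 ^ 2 + ε ^ 2) - y 0) • EuclideanSpace.single 0 1

lemma smoothFold_zero (ε : ℝ) (y : 𝔼 n) :
    smoothFold ε y 0 = √(y 0 ^ 2 + ε ^ 2) := by
  simp [smoothFold]

lemma smoothFold_mem (ε : ℝ) (y : 𝔼 n) : smoothFold ε y ∈ halfSpace n := by
  simp only [halfSpace, mem_ofPred_eq, smoothFold_zero]; positivity

lemma norm_le_norm_smoothFold (ε : ℝ) (y : 𝔼 n) :
    ‖y‖ ≤ ‖smoothFold ε y‖ := by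
  rw [EuclideanSpace.norm_eq, EuclideanSpace.norm_eq]
  gcongr with i
  by_cases hi : i = 0
  · subst hi
    rw [smoothFold_zero]
    rw [Real.norm_eq_abs, Real.norm_eq_abs, abs_of_nonneg (Real.sqrt_nonneg _)]
    rw [← Real.sqrt_sq_eq_abs]
    exact Real.sqrt_le_sqrt (by nlinarith [sq_nonneg ε])
  · simp [smoothFold, hi]

lemma contDiff_smoothFold {ε : ℝ} (hε : 0 < ε) :
    ContDiff ℝ 1 (smoothFold ε : 𝔼 n → _) := by
  unfold smoothFold
  have h0 : ContDiff ℝ 1 fun y : 𝔼 n ↦ y 0 :=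
    (EuclideanSpace.proj (0 : Fin n) : 𝔼 n →L[ℝ] ℝ).contDiff
  exact contDiff_id.add ((((h0.pow 2).add contDiff_const).sqrt
    (fun y ↦ by positivity)).sub h0 |>.smul contDiff_const)

lemma enorm_fderiv_smoothFold_le {ε : ℝ} (hε : 0 < ε) (y : 𝔼 n) :
    ‖fderiv ℝ (smoothFold ε) y‖ₑ ≤ 3 := by
  set π₀ : 𝔼 n →L[ℝ] ℝ := EuclideanSpace.proj (0 : Fin n) with hπ
  have h0 : HasFDerivAt (fun y : 𝔼 n ↦ y 0) π₀ y := π₀.hasFDerivAt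
  have hpos : 0 < y 0 ^ 2 + ε ^ 2 := by positivity
  have h1 := ((h0.pow 2).add_const (ε ^ 2)).sqrt hpos.ne'
  have h3 : HasFDerivAt (smoothFold ε) _ y := (hasFDerivAt_id y).add
    ((h1.sub h0).smul_const (EuclideanSpace.single (0 : Fin n) (1 : ℝ)))
  rw [h3.fderiv, ← ofReal_norm, show (3 : ℝ≥0∞) = ofReal 3 by simp]
  refine ENNReal.ofReal_le_ofReal (ContinuousLinearMap.opNorm_le_bound _ (by norm_num) fun v ↦ ?_)
  have hv : |v 0| ≤ ‖v‖ := PiLp.norm_apply_le v 0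
  have hs : |y 0| ≤ √(y 0 ^ 2 + ε ^ 2) := by
    rw [← Real.sqrt_sq_eq_abs]
    exact Real.sqrt_le_sqrt (by nlinarith [sq_nonneg ε])
  have hs0 : 0 < √(y 0 ^ 2 + ε ^ 2) := Real.sqrt_pos.2 hpos
  have hd : |y 0 / √(y 0 ^ 2 + ε ^ 2)| ≤ 1 := by
    rw [abs_div, abs_of_pos hs0]
    exact div_le_one_of_le₀ hs hs0.le
  calc _ = ‖v + (y 0 / √(y 0 ^ 2 + ε ^ 2) * v 0 - v 0) • EuclideanSpace.single (0 : Fin n) (1 : ℝ)‖ := by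
        congr 1
        simp only [hπ, _root_.add_apply, ContinuousLinearMap.id_apply,
          ContinuousLinearMap.smulRight_apply, _root_.sub_apply,
          _root_.smul_apply, smul_eq_mul, nsmul_eq_mul, Nat.cast_ofNat]
        congr 3
        field_simp
        simp
    _ ≤ ‖v‖ + (|y 0 / √(y 0 ^ 2 + ε ^ 2) * v 0| + |v 0|) := by
        refine (norm_add_le _ _).trans ?_
        rw [norm_smul]
        simp only [PiLp.norm_single, norm_one, mul_one, Real.norm_eq_abs]
        gcongr
        exact abs_sub _ _
    _ ≤ ‖v‖ + (1 * ‖v‖ + ‖v‖) := by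
        rw [abs_mul]
        gcongr
    _ = 3 * ‖v‖ := by ring

/-- Away from a bounded set the derivative of `h` vanishes together with `h`. -/
lemma fderivWithin_halfSpace_eq_zero {h : 𝔼 n → ℝ} {R : ℝ}
    (hR : ∀ y ∈ halfSpace n, R < ‖y‖ → h y = 0) {y : 𝔼 n}
    (hy : y ∈ halfSpace n) (hy' : R < ‖y‖) : fderivWithin ℝ h (halfSpace n) y = 0 := by
  have : h =ᶠ[𝓝[halfSpace n] y] fun _ ↦ 0 := by
    filter_upwards [self_mem_nhdsWithin,
      nhdsWithin_le_nhds ((isOpen_lt continuous_const continuous_norm).mem_nhds hy')] with z hz hz'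
    exact hR z hz hz'
  rw [this.fderivWithin_eq (hR y hy hy')]
  simp

/-- The reflection `y₀ ↦ -y₀`. -/
def reflectZero : 𝔼 n ≃ₗᵢ[ℝ] 𝔼 n :=
  (ℝ ∙ (EuclideanSpace.single (0 : Fin n) (1 : ℝ)))ᗮ.reflection

lemma reflectZero_apply (y : 𝔼 n) :
    reflectZero y = y - (2 * y 0) • EuclideanSpace.single 0 1 := by
  rw [reflectZero, Submodule.reflection_orthogonal_apply, Submodule.reflection_singleton_apply]
  simp [EuclideanSpace.inner_single_left, two_smul, two_mul, add_smul]

lemma smoothFold_zero_of_mem {y : 𝔼 n} (hy : y ∈ halfSpace n) :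
    smoothFold 0 y = y := by
  have : √(y 0 ^ 2) = y 0 := Real.sqrt_sq hy
  simp [smoothFold, this]

lemma smoothFold_zero_of_notMem {y : 𝔼 n} (hy : y ∉ halfSpace n) :
    smoothFold 0 y = reflectZero y := by
  have : √(y 0 ^ 2) = -y 0 := by
    rw [Real.sqrt_sq_eq_abs, abs_of_neg (not_le.1 hy)]
  rw [reflectZero_apply]
  simp only [smoothFold, this, ne_eq, OfNat.ofNat_ne_zero, not_false_eq_true, zero_pow, add_zero]
  rw [sub_eq_add_neg y, ← neg_smul]
  congr 2
  ring

/-- Folding the space onto the half-space along the boundary hyperplane covers it twice. -/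
lemma lintegral_comp_fold_le (G : 𝔼 n → ℝ≥0∞) :
    ∫⁻ y, G (smoothFold 0 y) ≤ 2 * ∫⁻ y in halfSpace n, G y := by
  rw [← lintegral_add_compl _ (measurableSet_halfSpace (n := n)), two_mul]
  gcongr ?_ + ?_
  · exact (setLIntegral_congr_fun measurableSet_halfSpace
      fun y hy ↦ by simp only [smoothFold_zero_of_mem hy]).le
  · rw [setLIntegral_congr_fun (g := fun y ↦ G (reflectZero y)) measurableSet_halfSpace.compl
      fun y hy ↦ by simp only [smoothFold_zero_of_notMem hy]]
    rw [← (reflectZero (n := n)).measurePreserving.setLIntegral_comp_preimage_emb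
      (reflectZero (n := n)).toHomeomorph.measurableEmbedding G]
    refine lintegral_mono_set fun y hy ↦ ?_
    simp only [mem_compl_iff, halfSpace, mem_ofPred_eq, not_le, mem_preimage,
      reflectZero_apply, PiLp.sub_apply, PiLp.smul_apply, PiLp.single_apply,
      smul_eq_mul, if_true] at hy ⊢
    linarith

lemma exists_forall_fderivWithin_le {h : 𝔼 n → ℝ} {R : ℝ}
    (hh : ContDiffOn ℝ 1 h (halfSpace n)) (hR : ∀ y ∈ halfSpace n, R < ‖y‖ → h y = 0) :
    ∃ B : ℝ, ∀ y ∈ halfSpace n, ‖fderivWithin ℝ h (halfSpace n) y‖ ≤ B := by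
  have hc := hh.continuousOn_fderivWithin uniqueDiffOn_halfSpace le_rfl
  obtain ⟨B, hB⟩ := ((isCompact_closedBall (0 : 𝔼 n) R).inter_left
    isClosed_halfSpace).exists_bound_of_continuousOn (hc.mono inter_subset_left)
  refine ⟨max B 0, fun y hy ↦ ?_⟩
  by_cases hyR : ‖y‖ ≤ R
  · exact (hB y ⟨hy, by simpa using hyR⟩).trans (le_max_left _ _)
  · rw [fderivWithin_halfSpace_eq_zero hR hy (not_le.1 hyR)]
    simp

/-- The Sobolev inequality in the half-space, for functions which need not vanish on its boundary.
It follows from the inequality in the whole space applied to `h ∘ smoothFold ε`, as `ε → 0`. -/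
lemma exists_sobolev_halfSpace (hn : 3 ≤ n) : ∃ C : ℝ≥0∞, C ≠ ⊤ ∧
    ∀ (h : 𝔼 n → ℝ) (R : ℝ), ContDiffOn ℝ 1 h (halfSpace n) →
      (∀ y ∈ halfSpace n, R < ‖y‖ → h y = 0) →
      (∫⁻ y in halfSpace n, ‖h y‖ₑ ^ (2 * ((n : ℝ) / ((n : ℝ) - 2)))) ^
          (1 / ((n : ℝ) / ((n : ℝ) - 2))) ≤
        C * ∫⁻ y in halfSpace n, ‖fderivWithin ℝ h (halfSpace n) y‖ₑ ^ 2 := by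
  obtain ⟨C, hC, hsob⟩ := exists_sobolev_whole_space hn
  have hn' : (3 : ℝ) ≤ n := by exact_mod_cast hn
  set κ : ℝ := (n : ℝ) / ((n : ℝ) - 2) with hκ
  have hκ0 : 0 < κ := div_pos (by linarith) (by linarith)
  refine ⟨C * 18, ENNReal.mul_ne_top hC (by norm_num), fun h R hh hR ↦ ?_⟩
  set ε : ℕ → ℝ := fun j ↦ 1 / ((j : ℝ) + 1) with hε
  have hεpos : ∀ j, 0 < ε j := fun j ↦ by positivity
  have hεlim : Tendsto ε atTop (𝓝 0) := tendsto_one_div_add_atTop_nhds_zero_nat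
  have hfold : ∀ y : 𝔼 n,
      Tendsto (fun j ↦ smoothFold (ε j) y) atTop (𝓝[halfSpace n] (smoothFold 0 y)) := by
    intro y
    refine tendsto_nhdsWithin_iff.2 ⟨?_, Eventually.of_forall fun j ↦ smoothFold_mem _ _⟩
    have : Continuous fun e : ℝ ↦ smoothFold e y := by unfold smoothFold; fun_prop
    exact (this.tendsto 0).comp hεlim
  have hfoldc : ∀ j, Continuous (smoothFold (ε j) : 𝔼 n → _) :=
    fun j ↦ (contDiff_smoothFold (hεpos j)).continuous
  have hGc : ContinuousOn (fun y ↦ ‖fderivWithin ℝ h (halfSpace n) y‖ₑ ^ 2) (halfSpace n) :=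
    (ENNReal.continuous_pow 2).comp_continuousOn
      (hh.continuousOn_fderivWithin uniqueDiffOn_halfSpace le_rfl).enorm
  obtain ⟨B, hB⟩ := exists_forall_fderivWithin_le hh hR
  -- the inequality for the folded functions
  have hj : ∀ j, (∫⁻ y, ‖h (smoothFold (ε j) y)‖ₑ ^ (2 * κ)) ^ (1 / κ) ≤
      C * (9 * ∫⁻ y, ‖fderivWithin ℝ h (halfSpace n) (smoothFold (ε j) y)‖ₑ ^ 2) := by
    intro j
    have hcd : ContDiff ℝ 1 (h ∘ smoothFold (ε j)) := by
      rw [← contDiffOn_univ]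
      exact hh.comp (contDiff_smoothFold (hεpos j)).contDiffOn fun y _ ↦ smoothFold_mem _ _
    refine (hsob _ hcd ?_).trans ?_
    · refine HasCompactSupport.of_support_subset_isCompact
        (isCompact_closedBall (0 : 𝔼 n) R) fun y hy ↦ ?_
      by_contra hyR
      simp only [Metric.mem_closedBall, dist_zero_right, not_le] at hyR
      exact hy (hR _ (smoothFold_mem _ _) (hyR.trans_le (norm_le_norm_smoothFold _ _)))
    · gcongr
      rw [← lintegral_const_mul' _ _ (by norm_num)]
      refine lintegral_mono fun y ↦ ?_
      have hd : HasFDerivAt (h ∘ smoothFold (ε j))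
          ((fderivWithin ℝ h (halfSpace n) (smoothFold (ε j) y)).comp
            (fderiv ℝ (smoothFold (ε j)) y)) y :=
        HasFDerivWithinAt.comp_hasFDerivAt y
          ((hh.differentiableOn one_ne_zero _ (smoothFold_mem _ _)).hasFDerivWithinAt)
          ((contDiff_smoothFold (hεpos j)).differentiable one_ne_zero y).hasFDerivAt
          (Eventually.of_forall fun z ↦ smoothFold_mem _ _)
      rw [hd.fderiv]
      calc _ ≤ (‖fderivWithin ℝ h (halfSpace n) (smoothFold (ε j) y)‖ₑ * 3) ^ 2 := by
            gcongr
            refine (ContinuousLinearMap.opENorm_comp_le _ _).trans ?_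
            gcongr
            exact enorm_fderiv_smoothFold_le (hεpos j) y
        _ = _ := by rw [mul_pow, mul_comm]; norm_num
  -- the right-hand sides converge
  have hlim : Tendsto (fun j ↦ ∫⁻ y, ‖fderivWithin ℝ h (halfSpace n) (smoothFold (ε j) y)‖ₑ ^ 2)
      atTop (𝓝 (∫⁻ y, ‖fderivWithin ℝ h (halfSpace n) (smoothFold 0 y)‖ₑ ^ 2)) := by
    refine tendsto_lintegral_of_dominated_convergence
      ((Metric.closedBall (0 : 𝔼 n) R).indicator
        fun _ ↦ ofReal B ^ 2) (fun j ↦ ?_) (fun j ↦ ?_) ?_ ?_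
    · exact (hGc.comp_continuous (hfoldc j) fun y ↦ smoothFold_mem _ _).measurable
    · refine Eventually.of_forall fun y ↦ ?_
      beta_reduce
      by_cases hyR : y ∈ Metric.closedBall (0 : 𝔼 n) R
      · rw [indicator_of_mem hyR]
        gcongr
        rw [← ofReal_norm]
        exact ENNReal.ofReal_le_ofReal (hB _ (smoothFold_mem _ _))
      · simp only [Metric.mem_closedBall, dist_zero_right, not_le] at hyR
        rw [← ofReal_norm, fderivWithin_halfSpace_eq_zero hR (smoothFold_mem _ _)
          (hyR.trans_le (norm_le_norm_smoothFold _ _)), norm_zero, ENNReal.ofReal_zero,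
          zero_pow two_ne_zero]
        exact zero_le
    · rw [lintegral_indicator Metric.isClosed_closedBall.measurableSet, setLIntegral_const]
      exact ENNReal.mul_ne_top (by simp) (measure_closedBall_lt_top.ne)
    · exact Eventually.of_forall fun y ↦
        (hGc _ (smoothFold_mem 0 y)).tendsto.comp (hfold y)
  have hleft : (∫⁻ y in halfSpace n, ‖h y‖ₑ ^ (2 * κ)) ^ (1 / κ) ≤
      liminf (fun j ↦ (∫⁻ y, ‖h (smoothFold (ε j) y)‖ₑ ^ (2 * κ)) ^ (1 / κ)) atTop := by
    have h1 : ∫⁻ y in halfSpace n, ‖h y‖ₑ ^ (2 * κ) ≤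
        liminf (fun j ↦ ∫⁻ y, ‖h (smoothFold (ε j) y)‖ₑ ^ (2 * κ)) atTop := by
      calc _ = ∫⁻ y in halfSpace n,
            liminf (fun j ↦ ‖h (smoothFold (ε j) y)‖ₑ ^ (2 * κ)) atTop := by
            refine setLIntegral_congr_fun measurableSet_halfSpace fun y hy ↦ ?_
            have ht : Tendsto (fun j ↦ ‖h (smoothFold (ε j) y)‖ₑ ^ (2 * κ)) atTop
                (𝓝 (‖h (smoothFold 0 y)‖ₑ ^ (2 * κ))) :=
              ((((hh.continuousOn).enorm _ (smoothFold_mem 0 y)).tendsto.comp (hfold y))).ennrpow_const _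
            rw [smoothFold_zero_of_mem hy] at ht
            exact ht.liminf_eq.symm
        _ ≤ ∫⁻ y, liminf (fun j ↦ ‖h (smoothFold (ε j) y)‖ₑ ^ (2 * κ)) atTop :=
            setLIntegral_le_lintegral _ _
        _ ≤ _ := by
            refine lintegral_liminf_le fun j ↦ ?_
            exact ((hh.continuousOn.enorm.comp_continuous (hfoldc j)
              fun y ↦ smoothFold_mem _ _).measurable.pow_const _)
    refine (ENNReal.rpow_le_rpow h1 (by positivity)).trans (le_of_eq ?_)
    exact ((ENNReal.monotone_rpow_of_nonneg (by positivity : (0 : ℝ) ≤ 1 / κ)).map_liminf_of_continuousAt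
      _ (ENNReal.continuous_rpow_const.continuousAt))
  calc _ ≤ _ := hleft
    _ ≤ liminf (fun j ↦ C * (9 * ∫⁻ y,
          ‖fderivWithin ℝ h (halfSpace n) (smoothFold (ε j) y)‖ₑ ^ 2)) atTop :=
        liminf_le_liminf (Eventually.of_forall hj)
    _ = C * (9 * ∫⁻ y, ‖fderivWithin ℝ h (halfSpace n) (smoothFold 0 y)‖ₑ ^ 2) :=
        (ENNReal.Tendsto.const_mul (ENNReal.Tendsto.const_mul hlim (Or.inr (by norm_num)))
          (Or.inr hC)).liminf_eq
    _ ≤ C * (9 * (2 * ∫⁻ y in halfSpace n, ‖fderivWithin ℝ h (halfSpace n) y‖ₑ ^ 2)) := by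
        gcongr
        exact lintegral_comp_fold_le fun y ↦ ‖fderivWithin ℝ h (halfSpace n) y‖ₑ ^ 2
    _ = _ := by rw [← mul_assoc 9, ← mul_assoc]; norm_num

end Flat

section Flat

lemma measurable_indicator_of_continuousOn {X : Type*} [TopologicalSpace X] [MeasurableSpace X]
    [BorelSpace X] {s : Set X} (hs : MeasurableSet s) {G : X → ℝ≥0∞} (hG : ContinuousOn G s) :
    Measurable (s.indicator G) := by
  classical
  rw [← piecewise_eq_indicator]
  exact hG.measurable_piecewise continuousOn_const hs

/-- Splitting off the zeroth coordinate of `ℝ^{m+1}`. -/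
def consCoord {m : ℕ} (p : ℝ × EuclideanSpace ℝ (Fin m)) : EuclideanSpace ℝ (Fin (m + 1)) :=
  WithLp.toLp 2 (Fin.cons p.1 p.2)

lemma measurePreserving_consCoord {m : ℕ} :
    MeasurePreserving (consCoord : ℝ × EuclideanSpace ℝ (Fin m) → _) := by
  have h1 := (volume_preserving_piFinSuccAbove (fun _ : Fin (m + 1) ↦ ℝ) 0).symm
  have h2 : MeasurePreserving (Prod.map id (WithLp.ofLp (p := 2) (V := Fin m → ℝ)))
      (volume : Measure (ℝ × EuclideanSpace ℝ (Fin m))) volume :=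
    (MeasurePreserving.id volume).prod (PiLp.volume_preserving_ofLp (Fin m))
  have h3 := (PiLp.volume_preserving_toLp (Fin (m + 1))).comp (h1.comp h2)
  refine (congrArg (fun f ↦ MeasurePreserving f volume volume) ?_).mp h3
  funext p
  simp only [Function.comp_apply, consCoord]
  congr 1
  exact Fin.insertNth_zero' _ _

lemma norm_sq_consCoord {m : ℕ} (p : ℝ × EuclideanSpace ℝ (Fin m)) :
    ‖consCoord p‖ ^ 2 = p.1 ^ 2 + ‖p.2‖ ^ 2 := by
  rw [EuclideanSpace.norm_sq_eq, EuclideanSpace.norm_sq_eq, Fin.sum_univ_succ]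
  simp [consCoord]

lemma consCoord_sub {m : ℕ} (p p' : ℝ × EuclideanSpace ℝ (Fin m)) :
    consCoord p - consCoord p' = consCoord (p - p') := by
  ext i
  refine Fin.cases ?_ (fun i ↦ ?_) i <;> simp [consCoord]

lemma isometry_consCoord_zero {m : ℕ} :
    Isometry fun z : EuclideanSpace ℝ (Fin m) ↦ consCoord (0, z) := by
  refine Isometry.of_dist_eq fun z z' ↦ ?_
  rw [dist_eq_norm, dist_eq_norm, consCoord_sub]
  have := norm_sq_consCoord ((0, z) - (0, z') : ℝ × EuclideanSpace ℝ (Fin m))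
  simp only [Prod.mk_sub_mk, sub_self, ne_eq, OfNat.ofNat_ne_zero, not_false_eq_true, zero_pow,
    zero_add] at this
  simpa using (sq_eq_sq₀ (norm_nonneg _) (norm_nonneg _)).1 this

/-- The trace inequality in the half-space: integrate the derivative along the normal direction. -/
lemma lintegral_trace_halfSpace_le {n : ℕ} [NeZero n] (h : 𝔼 n → ℝ) (R : ℝ)
    (hh : ContDiffOn ℝ 1 h (halfSpace n)) (hR : ∀ y ∈ halfSpace n, R < ‖y‖ → h y = 0) :
    ∫⁻ y in {y | y 0 = 0}, ‖h y‖ₑ ∂(μHE[n - 1] : Measure (𝔼 n)) ≤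
      ∫⁻ y in halfSpace n, ‖fderivWithin ℝ h (halfSpace n) y‖ₑ := by
  obtain ⟨m, rfl⟩ : ∃ m, n = m + 1 := ⟨n - 1, by have := NeZero.pos n; omega⟩
  have hGc : ContinuousOn (fun y ↦ ‖fderivWithin ℝ h (halfSpace (m + 1)) y‖ₑ)
      (halfSpace (m + 1)) :=
    (hh.continuousOn_fderivWithin uniqueDiffOn_halfSpace le_rfl).enorm
  have hGm : Measurable ((halfSpace (m + 1)).indicator
      fun y ↦ ‖fderivWithin ℝ h (halfSpace (m + 1)) y‖ₑ) :=
    measurable_indicator_of_continuousOn measurableSet_halfSpace hGc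
  -- the boundary term, over the parametrised hyperplane
  have hsub : {y : EuclideanSpace ℝ (Fin (m + 1)) | y 0 = 0} ⊆
      range fun z : EuclideanSpace ℝ (Fin m) ↦ consCoord (0, z) := by
    intro y hy
    refine ⟨WithLp.toLp 2 fun i ↦ y i.succ, ?_⟩
    ext i
    refine Fin.cases ?_ (fun i ↦ ?_) i
    · exact (show y 0 = 0 from hy).symm
    · simp [consCoord]
  calc _ ≤ ∫⁻ y in range fun z : EuclideanSpace ℝ (Fin m) ↦ consCoord (0, z), ‖h y‖ₑ
          ∂(μHE[m] : Measure (EuclideanSpace ℝ (Fin (m + 1)))) := lintegral_mono_set hsub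
    _ ≤ ∫⁻ z : EuclideanSpace ℝ (Fin m), ‖h (consCoord (0, z))‖ₑ := by
        rw [← isometry_consCoord_zero.map_euclideanHausdorffMeasure,
          EuclideanSpace.euclideanHausdorffMeasure_eq_volume]
        exact lintegral_map_le _ _
    _ ≤ ∫⁻ z : EuclideanSpace ℝ (Fin m), ∫⁻ t : ℝ, (halfSpace (m + 1)).indicator
          (fun y ↦ ‖fderivWithin ℝ h (halfSpace (m + 1)) y‖ₑ) (consCoord (t, z)) := by
        refine lintegral_mono fun z ↦ ?_
        set T : ℝ := |R| + 1
        have hT : 0 < T := by positivity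
        have hγ : ∀ t : ℝ, HasDerivAt (fun t : ℝ ↦ consCoord (t, z))
            (EuclideanSpace.single 0 1) t := by
          intro t
          have : (fun t : ℝ ↦ consCoord (t, z)) = fun t ↦
              t • (EuclideanSpace.single (0 : Fin (m + 1)) (1 : ℝ)) + consCoord (0, z) := by
            funext t
            ext i
            refine Fin.cases ?_ (fun i ↦ ?_) i <;> simp [consCoord]
          rw [this]
          simpa using ((hasDerivAt_id' t).smul_const
            (EuclideanSpace.single (0 : Fin (m + 1)) (1 : ℝ))).add_const (consCoord (0, z))
        have hmaps : MapsTo (fun t : ℝ ↦ consCoord (t, z)) (Icc 0 T) (halfSpace (m + 1)) :=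
          fun t ht ↦ ht.1
        have hcd : ContDiffOn ℝ 1 (fun t : ℝ ↦ h (consCoord (t, z))) (Icc 0 T) := by
          refine hh.comp (ContDiff.contDiffOn ?_) hmaps
          exact contDiff_one_iff_deriv.2 ⟨fun t ↦ (hγ t).differentiableAt, by
            rw [show deriv (fun t : ℝ ↦ consCoord (t, z)) = fun _ ↦ EuclideanSpace.single 0 1 from
              funext fun t ↦ (hγ t).deriv]
            exact continuous_const⟩
        have hend : h (consCoord (T, z)) = 0 := by
          refine hR _ hT.le ?_
          have : T ^ 2 ≤ ‖consCoord (T, z)‖ ^ 2 := by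
            rw [norm_sq_consCoord]; nlinarith [sq_nonneg ‖z‖]
          have h2 := abs_le_of_sq_le_sq this (norm_nonneg _)
          linarith [le_abs_self R, le_abs_self T, show T = |R| + 1 from rfl, h2]
        have hftc := enorm_sub_le_lintegral_derivWithin_Icc_of_contDiffOn_Icc hcd hT.le
        simp only [hend, zero_sub, enorm_neg] at hftc
        refine hftc.trans ?_
        rw [← lintegral_indicator measurableSet_Icc]
        refine lintegral_mono fun t ↦ ?_
        by_cases ht : t ∈ Icc 0 T
        · rw [indicator_of_mem ht, indicator_of_mem (hmaps ht)]
          have hd := ((hh.differentiableOn one_ne_zero _ (hmaps ht)).hasFDerivWithinAt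
            |>.comp_hasDerivWithinAt t (hγ t).hasDerivWithinAt hmaps).derivWithin
              (uniqueDiffOn_Icc hT t ht)
          have hd' : derivWithin (fun t : ℝ ↦ h (consCoord (t, z))) (Icc 0 T) t = _ := hd
          rw [hd']
          refine (ContinuousLinearMap.le_opENorm _ _).trans ?_
          have : ‖(EuclideanSpace.single (0 : Fin (m + 1)) (1 : ℝ))‖ₑ = 1 := by
            rw [← ofReal_norm]; simp
          rw [this, mul_one]
        · rw [indicator_of_notMem ht]
          exact zero_le
    _ = ∫⁻ y in halfSpace (m + 1), ‖fderivWithin ℝ h (halfSpace (m + 1)) y‖ₑ := by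
        rw [← lintegral_indicator measurableSet_halfSpace,
          ← (measurePreserving_consCoord (m := m)).lintegral_comp hGm]
        exact (lintegral_prod_symm _
          (hGm.comp (measurePreserving_consCoord (m := m)).measurable).aemeasurable).symm

section Poincare

variable {n : ℕ}

lemma lintegral_comp_smul_add_le {g : 𝔼 n → ℝ≥0∞} (hg : Measurable g)
    {t : ℝ} (ht : 1 / 2 ≤ t) (c : 𝔼 n) :
    ∫⁻ y, g (t • y + c) ≤ 2 ^ n * ∫⁻ y, g y := by
  have ht0 : t ≠ 0 := by linarith
  have h1 : ∫⁻ y, g (t • y + c) = ∫⁻ y, g (y + c) ∂(volume.map fun y ↦ t • y) :=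
    (lintegral_map (hg.comp (measurable_add_const c)) (measurable_const_smul t)).symm
  rw [h1, Measure.map_addHaar_smul _ ht0, lintegral_smul_measure,
    lintegral_add_right_eq_self g c, smul_eq_mul]
  gcongr
  rw [finrank_euclideanSpace_fin]
  have : (2 : ℝ≥0∞) ^ n = ofReal (2 ^ n) := by
    rw [ENNReal.ofReal_pow (by norm_num)]; simp
  rw [this]
  refine ENNReal.ofReal_le_ofReal ?_
  rw [abs_of_nonneg (by positivity), ← inv_pow]
  gcongr
  rw [inv_le_comm₀ (by linarith) (by norm_num)]
  linarith

/-- The Poincaré inequality on a bounded convex set, for all pairs of points: the difference of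
the values is the integral of the derivative along the segment, and at each time of the segment
one of the two endpoints can be exchanged for the running point at bounded cost. -/
lemma lintegral_sub_sq_le_of_convex {D : Set (𝔼 n)} (hD : Convex ℝ D)
    (hDm : MeasurableSet D) {δ : ℝ} (hδ : ∀ y ∈ D, ∀ z ∈ D, ‖z - y‖ ≤ δ)
    {h : 𝔼 n → ℝ}
    {h' : 𝔼 n → 𝔼 n →L[ℝ] ℝ}
    (hh : ∀ y ∈ D, HasFDerivWithinAt h (h' y) D y) (hh' : ContinuousOn h' D) :
    ∫⁻ y in D, ∫⁻ z in D, ‖h y - h z‖ₑ ^ 2 ≤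
      2 ^ n * ofReal (δ ^ 2) * volume D * ∫⁻ y in D, ‖h' y‖ₑ ^ 2 := by
  set g : 𝔼 n → ℝ≥0∞ := D.indicator fun y ↦ ‖h' y‖ₑ ^ 2 with hg
  have hgm : Measurable g := measurable_indicator_of_continuousOn hDm
    ((ENNReal.continuous_pow 2).comp_continuousOn hh'.enorm)
  have hpt : ∀ y ∈ D, ∀ z ∈ D, ‖h y - h z‖ₑ ^ 2 ≤
      ofReal (δ ^ 2) * ∫⁻ t in Icc (0 : ℝ) 1, g ((1 - t) • y + t • z) := by
    intro y hy z hz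
    have hmaps : MapsTo (fun t : ℝ ↦ (1 - t) • y + t • z) (Icc 0 1) D :=
      fun t ht ↦ hD hy hz (by linarith [ht.2]) ht.1 (by ring)
    have hγ : ∀ t : ℝ, HasDerivAt (fun t : ℝ ↦ (1 - t) • y + t • z) (z - y) t := by
      intro t
      have h1 := (((hasDerivAt_id' t).const_sub 1).smul_const y).add
        ((hasDerivAt_id' t).smul_const z)
      have h2 : HasDerivAt (fun t : ℝ ↦ (1 - t) • y + t • z) ((-1 : ℝ) • y + (1 : ℝ) • z) t := h1
      rwa [show (-1 : ℝ) • y + (1 : ℝ) • z = z - y by rw [neg_one_smul, one_smul]; abel] at h2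
    have hder : ∀ t ∈ Icc (0 : ℝ) 1, HasDerivWithinAt (fun t : ℝ ↦ h ((1 - t) • y + t • z))
        (h' ((1 - t) • y + t • z) (z - y)) (Icc 0 1) t := fun t ht ↦
      (hh _ (hmaps ht)).comp_hasDerivWithinAt t (hγ t).hasDerivWithinAt hmaps
    have hγc : Continuous fun t : ℝ ↦ (1 - t) • y + t • z := by fun_prop
    have hcd : ContDiffOn ℝ 1 (fun t : ℝ ↦ h ((1 - t) • y + t • z)) (Icc 0 1) := by
      refine (contDiffOn_one_iff_derivWithin (uniqueDiffOn_Icc one_pos)).2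
        ⟨fun t ht ↦ (hder t ht).differentiableWithinAt, ?_⟩
      refine ContinuousOn.congr (f := fun t ↦ h' ((1 - t) • y + t • z) (z - y)) ?_
        fun t ht ↦ (hder t ht).derivWithin (uniqueDiffOn_Icc one_pos t ht)
      exact (hh'.comp hγc.continuousOn hmaps).clm_apply continuousOn_const
    have hftc := enorm_sub_le_lintegral_derivWithin_Icc_of_contDiffOn_Icc hcd zero_le_one
    simp only [sub_self, zero_smul, one_smul, zero_add, sub_zero, add_zero] at hftc
    rw [← enorm_neg, neg_sub]
    calc ‖h z - h y‖ₑ ^ 2 ≤ (∫⁻ t in Icc (0 : ℝ) 1,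
          ofReal δ * ‖h' ((1 - t) • y + t • z)‖ₑ) ^ 2 := by
          gcongr
          refine hftc.trans (setLIntegral_mono' measurableSet_Icc fun t ht ↦ ?_)
          rw [(hder t ht).derivWithin (uniqueDiffOn_Icc one_pos t ht), mul_comm]
          refine (ContinuousLinearMap.le_opENorm _ _).trans ?_
          gcongr
          rw [← ofReal_norm]
          exact ENNReal.ofReal_le_ofReal (hδ y hy z hz)
      _ ≤ ofReal (δ ^ 2) * (∫⁻ t in Icc (0 : ℝ) 1, ‖h' ((1 - t) • y + t • z)‖ₑ) ^ 2 := by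
          rw [lintegral_const_mul' _ _ (by simp), mul_pow,
            ENNReal.ofReal_pow ((norm_nonneg _).trans (hδ y hy z hz))]
      _ ≤ _ := by
          gcongr
          have hcs := ENNReal.lintegral_mul_le_Lp_mul_Lq (volume.restrict (Icc (0 : ℝ) 1))
            (show Real.HolderConjugate 2 2 from Real.HolderConjugate.two_two)
            (f := fun t ↦ ‖h' ((1 - t) • y + t • z)‖ₑ) (g := fun _ ↦ 1)
            ((hh'.comp hγc.continuousOn hmaps).enorm.aemeasurable measurableSet_Icc)
            aemeasurable_const
          simp only [Pi.mul_apply, mul_one, ENNReal.one_rpow, lintegral_const,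
            Measure.restrict_apply_univ, Real.volume_Icc, sub_zero, ENNReal.ofReal_one] at hcs
          calc _ ≤ ((∫⁻ t in Icc (0 : ℝ) 1, ‖h' ((1 - t) • y + t • z)‖ₑ ^ (2 : ℝ)) ^
                (1 / 2 : ℝ)) ^ 2 := by gcongr
            _ = ∫⁻ t in Icc (0 : ℝ) 1, ‖h' ((1 - t) • y + t • z)‖ₑ ^ (2 : ℝ) := by
                rw [← ENNReal.rpow_natCast, ← ENNReal.rpow_mul]; norm_num
            _ ≤ _ := by
                refine setLIntegral_mono' measurableSet_Icc fun t ht ↦ ?_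
                rw [hg, indicator_of_mem (hmaps ht)]
                norm_num
  have hF : Measurable fun p : ℝ × 𝔼 n × 𝔼 n ↦
      g ((1 - p.1) • p.2.1 + p.1 • p.2.2) := hgm.comp (by fun_prop)
  calc _ ≤ ∫⁻ y in D, ∫⁻ z in D,
        ofReal (δ ^ 2) * ∫⁻ t in Icc (0 : ℝ) 1, g ((1 - t) • y + t • z) := by
        refine setLIntegral_mono' hDm fun y hy ↦ setLIntegral_mono' hDm fun z hz ↦ hpt y hy z hz
    _ = ofReal (δ ^ 2) * ∫⁻ y in D, ∫⁻ z in D, ∫⁻ t in Icc (0 : ℝ) 1,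
          g ((1 - t) • y + t • z) := by
        simp_rw [lintegral_const_mul' _ _ ENNReal.ofReal_ne_top]
    _ = ofReal (δ ^ 2) * ∫⁻ t in Icc (0 : ℝ) 1, ∫⁻ y in D, ∫⁻ z in D,
          g ((1 - t) • y + t • z) := by
        congr 1
        have h1 : ∀ y, ∫⁻ z in D, ∫⁻ t in Icc (0 : ℝ) 1, g ((1 - t) • y + t • z) =
            ∫⁻ t in Icc (0 : ℝ) 1, ∫⁻ z in D, g ((1 - t) • y + t • z) := fun y ↦
          lintegral_lintegral_swap (hgm.comp (by fun_prop)).aemeasurable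
        simp_rw [h1]
        refine lintegral_lintegral_swap (Measurable.aemeasurable ?_)
        exact Measurable.lintegral_prod_right' (f := fun q : (𝔼 n × ℝ) ×
          𝔼 n ↦ g ((1 - q.1.2) • q.1.1 + q.1.2 • q.2))
          (hgm.comp (by fun_prop))
    _ ≤ ofReal (δ ^ 2) * ∫⁻ t in Icc (0 : ℝ) 1, volume D * (2 ^ n * ∫⁻ y, g y) := by
        gcongr with t
        rcases le_total t (1 / 2) with ht | ht
        · rw [lintegral_lintegral_swap (f := fun y z ↦ g ((1 - t) • y + t • z))
            (hgm.comp (by fun_prop)).aemeasurable]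
          calc _ ≤ ∫⁻ z in D, 2 ^ n * ∫⁻ y, g y := by
                refine lintegral_mono fun z ↦ (setLIntegral_le_lintegral _ _).trans ?_
                exact lintegral_comp_smul_add_le hgm (by linarith) _
            _ = _ := by rw [setLIntegral_const, mul_comm]
        · calc _ ≤ ∫⁻ y in D, 2 ^ n * ∫⁻ y, g y := by
                refine lintegral_mono fun y ↦ (setLIntegral_le_lintegral _ _).trans ?_
                simp_rw [add_comm ((1 - t) • y)]
                exact lintegral_comp_smul_add_le hgm ht _
            _ = _ := by rw [setLIntegral_const, mul_comm]
    _ = _ := by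
        rw [setLIntegral_const, Real.volume_Icc, hg, lintegral_indicator hDm]
        simp only [sub_zero, ENNReal.ofReal_one, mul_one]
        ring

end Poincare

end Flat

/-! ### Charts in which the metric is almost constant -/

section Chart

variable {n : ℕ} [NeZero n] {M : Type*} [EMetricSpace M]
  [ChartedSpace (EuclideanHalfSpace n) M] [IsManifold (𝓡∂ n) 1 M]
  [RiemannianBundle (fun x : M ↦ TangentSpace (𝓡∂ n) x)]
  [IsContinuousRiemannianBundle (𝔼 n) (fun x : M ↦ TangentSpace (𝓡∂ n) x)]

/-- The derivative at `x` of the chart at `x₀`, with values in the model space. -/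
def chartDeriv (x₀ x : M) : TangentSpace (𝓡∂ n) x →L[ℝ] 𝔼 n :=
  mfderiv (𝓡∂ n) 𝓘(ℝ, 𝔼 n) (extChartAt (𝓡∂ n) x₀) x

/-- The derivative at `y` of the inverse of the chart at `x₀`. -/
def chartSymmDeriv (x₀ : M) (y : 𝔼 n) :
    𝔼 n →L[ℝ] TangentSpace (𝓡∂ n) ((extChartAt (𝓡∂ n) x₀).symm y) :=
  mfderivWithin 𝓘(ℝ, 𝔼 n) (𝓡∂ n) (extChartAt (𝓡∂ n) x₀).symm
    (range (𝓡∂ n)) y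

lemma norm_tangent_congr {x z : M} (h : z = x) (w : 𝔼 n) :
    ‖(show TangentSpace (𝓡∂ n) z from w)‖ = ‖(show TangentSpace (𝓡∂ n) x from w)‖ := by
  subst h; rfl

/-- Near `x₀` the metric read in the chart at `x₀` differs from its value at `x₀`, which is
`v ↦ ‖A v‖²` for some linear isomorphism `A`, by a factor as close to one as desired. -/
lemma exists_linear_equiv_almost_isometric (x₀ : M) :
    ∃ A : 𝔼 n ≃L[ℝ] 𝔼 n,
      (∀ᶠ x in 𝓝 x₀, ∀ v : TangentSpace (𝓡∂ n) x, ‖A (chartDeriv x₀ x v)‖ ≤ 11 / 10 * ‖v‖) ∧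
      ∀ᶠ x in 𝓝 x₀, ∀ v : 𝔼 n,
        ‖chartSymmDeriv x₀ (extChartAt (𝓡∂ n) x₀ x) v‖ ≤ 11 / 10 * ‖A v‖ := by
  set T := trivializationAt (𝔼 n)
    (fun x : M ↦ TangentSpace (𝓡∂ n) x) x₀ with hT
  have hx₀ : x₀ ∈ T.baseSet := FiberBundle.mem_baseSet_trivializationAt' x₀
  have hfin : Module.finrank ℝ (TangentSpace (𝓡∂ n) x₀) = n := by
    have : Module.finrank ℝ (TangentSpace (𝓡∂ n) x₀) =
        Module.finrank ℝ (𝔼 n) :=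
      (T.continuousLinearEquivAt ℝ x₀ hx₀).toLinearEquiv.finrank_eq
    rw [this, finrank_euclideanSpace_fin]
  let b := ((stdOrthonormalBasis ℝ (TangentSpace (𝓡∂ n) x₀)).reindex (finCongr hfin)).repr
  let A : 𝔼 n ≃L[ℝ] 𝔼 n :=
    (T.continuousLinearEquivAt ℝ x₀ hx₀).symm.trans b.toContinuousLinearEquiv
  have hA : ∀ v : 𝔼 n, ‖A v‖ = ‖T.symmL ℝ x₀ v‖ := fun v ↦ by
    rw [← T.symm_continuousLinearEquivAt_eq hx₀]
    exact b.norm_map _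
  have hsource : (chartAt (EuclideanHalfSpace n) x₀).source ∈ 𝓝 x₀ := chart_source_mem_nhds _ x₀
  refine ⟨A, ?_, ?_⟩
  · filter_upwards [eventually_norm_symmL_trivializationAt_self_comp_lt (𝔼 n)
      (fun x : M ↦ TangentSpace (𝓡∂ n) x) x₀ (show (1 : ℝ) < 11 / 10 by norm_num), hsource]
      with x hx hxs v
    have h1 := ContinuousLinearMap.le_of_opNorm_le _ hx.le v
    have h2 : T.continuousLinearMapAt ℝ x v = chartDeriv x₀ x v :=
      DFunLike.congr_fun (TangentBundle.continuousLinearMapAt_trivializationAt hxs) v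
    rw [hA, ← h2]
    exact h1
  · filter_upwards [eventually_norm_symmL_trivializationAt_comp_self_lt
      (𝔼 n) (fun x : M ↦ TangentSpace (𝓡∂ n) x) x₀
      (show (1 : ℝ) < 11 / 10 by norm_num), hsource] with x hx hxs v
    have h1 := ContinuousLinearMap.le_of_opNorm_le _ hx.le (T.symmL ℝ x₀ v)
    rw [← hA, ContinuousLinearMap.comp_apply, T.continuousLinearMapAt_symmL hx₀ v] at h1
    have h2 := DFunLike.congr_fun (TangentBundle.symmL_trivializationAt (I := 𝓡∂ n) hxs) v
    have h4 : ‖T.symmL ℝ x v‖ ≤ 11 / 10 * ‖A v‖ := h1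
    have hl : (extChartAt (𝓡∂ n) x₀).symm (extChartAt (𝓡∂ n) x₀ x) = x :=
      (extChartAt (𝓡∂ n) x₀).left_inv (by simpa using hxs)
    refine le_trans (le_of_eq ?_) h4
    refine (norm_tangent_congr hl (chartSymmDeriv x₀ (extChartAt (𝓡∂ n) x₀ x) v)).trans ?_
    exact congrArg (fun w : TangentSpace (𝓡∂ n) x ↦ ‖w‖) h2.symm

end Chart

section Chart

variable {n : ℕ} [NeZero n] 

/-- The trace on the half-space of the ellipsoid `{‖A (y - c)‖ < R}`. -/
def halfBall (A : 𝔼 n ≃L[ℝ] 𝔼 n)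
    (c : 𝔼 n) (R : ℝ) : Set (𝔼 n) :=
  halfSpace n ∩ {y | ‖A (y - c)‖ < R}

lemma convex_halfBall (A : 𝔼 n ≃L[ℝ] 𝔼 n)
    (c : 𝔼 n) (R : ℝ) : Convex ℝ (halfBall A c R) := by
  refine convex_halfSpace.inter fun x hx y hy a b ha hb hab ↦ ?_
  have h : a • x + b • y - c = a • (x - c) + b • (y - c) := by
    rw [smul_sub, smul_sub, sub_add_sub_comm, ← add_smul, hab, one_smul]
  have := convex_ball (0 : 𝔼 n) R
    (x := A (x - c)) (by simpa using hx) (y := A (y - c)) (by simpa using hy) ha hb hab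
  rw [mem_ofPred_eq, h, map_add, map_smul, map_smul]
  simpa using this

lemma isOpen_norm_sub_lt (A : 𝔼 n ≃L[ℝ] 𝔼 n)
    (c : 𝔼 n) (R : ℝ) : IsOpen {y | ‖A (y - c)‖ < R} :=
  isOpen_lt (by fun_prop) continuous_const

lemma measurableSet_halfBall (A : 𝔼 n ≃L[ℝ] 𝔼 n)
    (c : 𝔼 n) (R : ℝ) : MeasurableSet (halfBall A c R) :=
  measurableSet_halfSpace.inter (isOpen_norm_sub_lt A c R).measurableSet

variable {M : Type*} [EMetricSpace M]
  [ChartedSpace (EuclideanHalfSpace n) M] [RiemannianBundle (fun x : M ↦ TangentSpace (𝓡∂ n) x)]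

/-- The chart at `x₀` is defined on the part over `halfBall A (ψ x₀) R`, and there the Riemannian
metric and distance agree up to the factor `11 / 10` with the constant metric `v ↦ ‖A v‖²` and
its distance; moreover the chart is Lipschitz, with the corresponding constant, on the ball of
radius `ρ` around `x₀`, which contains all these points. -/
structure IsAlmostFlat (x₀ : M) (A : 𝔼 n ≃L[ℝ] 𝔼 n)
    (R ρ : ℝ) : Prop where
  radius_pos : 0 < R
  radius_le : 11 / 10 * R ≤ ρ
  subset_target : halfBall A (extChartAt (𝓡∂ n) x₀ x₀) R ⊆ (extChartAt (𝓡∂ n) x₀).target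
  norm_chartDeriv_le : ∀ y ∈ halfBall A (extChartAt (𝓡∂ n) x₀ x₀) R,
    ∀ v : TangentSpace (𝓡∂ n) ((extChartAt (𝓡∂ n) x₀).symm y),
      ‖A (chartDeriv x₀ ((extChartAt (𝓡∂ n) x₀).symm y) v)‖ ≤ 11 / 10 * ‖v‖
  norm_chartSymmDeriv_le : ∀ y ∈ halfBall A (extChartAt (𝓡∂ n) x₀ x₀) R,
    ∀ v : 𝔼 n, ‖chartSymmDeriv x₀ y v‖ ≤ 11 / 10 * ‖A v‖
  edist_le : ∀ y ∈ halfBall A (extChartAt (𝓡∂ n) x₀ x₀) R,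
    ∀ z ∈ halfBall A (extChartAt (𝓡∂ n) x₀ x₀) R,
      edist ((extChartAt (𝓡∂ n) x₀).symm y) ((extChartAt (𝓡∂ n) x₀).symm z) ≤
        ofReal (11 / 10 * ‖A (z - y)‖)
  mem_source : ∀ x ∈ Metric.eball x₀ (ofReal ρ), x ∈ (extChartAt (𝓡∂ n) x₀).source
  le_edist : ∀ x ∈ Metric.eball x₀ (ofReal ρ), ∀ z ∈ Metric.eball x₀ (ofReal ρ),
    ofReal ‖A (extChartAt (𝓡∂ n) x₀ z - extChartAt (𝓡∂ n) x₀ x)‖ ≤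
      ofReal (11 / 10) * edist x z

variable [IsManifold (𝓡∂ n) 1 M] [IsRiemannianManifold (𝓡∂ n) M]

/-- The image under the inverse chart of a segment bounds the Riemannian distance from above. -/
lemma edist_chart_symm_le {x₀ : M}
    {A : 𝔼 n ≃L[ℝ] 𝔼 n} {R : ℝ}
    (hsub : halfBall A (extChartAt (𝓡∂ n) x₀ x₀) R ⊆ (extChartAt (𝓡∂ n) x₀).target)
    (hle : ∀ y ∈ halfBall A (extChartAt (𝓡∂ n) x₀ x₀) R,
      ∀ v : 𝔼 n, ‖chartSymmDeriv x₀ y v‖ ≤ 11 / 10 * ‖A v‖)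
    {y z : 𝔼 n} (hy : y ∈ halfBall A (extChartAt (𝓡∂ n) x₀ x₀) R)
    (hz : z ∈ halfBall A (extChartAt (𝓡∂ n) x₀ x₀) R) :
    edist ((extChartAt (𝓡∂ n) x₀).symm y) ((extChartAt (𝓡∂ n) x₀).symm z) ≤
        ofReal (11 / 10 * ‖A (z - y)‖) := by
  let η := ContinuousAffineMap.lineMap (R := ℝ) y z
  have hη : ∀ t ∈ Icc (0 : ℝ) 1, η t ∈ halfBall A (extChartAt (𝓡∂ n) x₀ x₀) R := by
    intro t ht
    refine (convex_halfBall A _ R).segment_subset hy hz ?_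
    rw [segment_eq_image_lineMap]
    exact ⟨t, ht, by simp [η, ContinuousAffineMap.coe_lineMap_eq]⟩
  have hη' : Icc (0 : ℝ) 1 ⊆ η ⁻¹' (extChartAt (𝓡∂ n) x₀).target := fun t ht ↦ hsub (hη t ht)
  have η_smooth : ContMDiffOn 𝓘(ℝ, ℝ) 𝓘(ℝ, 𝔼 n) 1 η (Icc 0 1) := by
    apply ContMDiff.contMDiffOn
    rw [contMDiff_iff_contDiff]
    exact ContinuousAffineMap.contDiff _
  rw [IsRiemannianManifold.out (I := 𝓡∂ n)]
  refine (riemannianEDist_le_pathELength (γ := (extChartAt (𝓡∂ n) x₀).symm ∘ η) (a := 0) (b := 1)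
    ((contMDiffOn_extChartAt_symm x₀).comp η_smooth hη') ?_ ?_ zero_le_one).trans ?_
  · simp [η, ContinuousAffineMap.coe_lineMap_eq]
  · simp [η, ContinuousAffineMap.coe_lineMap_eq]
  rw [pathELength_eq_lintegral_mfderivWithin_Icc]
  calc _ ≤ ∫⁻ t in Icc (0 : ℝ) 1, ofReal (11 / 10 * ‖A (z - y)‖) := by
        refine setLIntegral_mono' measurableSet_Icc fun t ht ↦ ?_
        have h1 : mfderivWithin 𝓘(ℝ, ℝ) (𝓡∂ n) ((extChartAt (𝓡∂ n) x₀).symm ∘ η) (Icc 0 1) t =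
            (chartSymmDeriv x₀ (η t)) ∘L
              (mfderivWithin 𝓘(ℝ, ℝ) 𝓘(ℝ, 𝔼 n) η (Icc 0 1) t) := by
          apply mfderivWithin_comp
          · exact mdifferentiableWithinAt_extChartAt_symm (hη' ht)
          · exact η_smooth.mdifferentiableOn one_ne_zero t ht
          · exact hη'.trans (preimage_mono (extChartAt_target_subset_range x₀))
          · rw [uniqueMDiffWithinAt_iff_uniqueDiffWithinAt]
            exact uniqueDiffOn_Icc zero_lt_one t ht
        have h2 : mfderivWithin 𝓘(ℝ, ℝ) 𝓘(ℝ, 𝔼 n) η (Icc 0 1) t (1 : ℝ) =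
            z - y := by
          rw [mfderivWithin_eq_fderivWithin,
            fderivWithin_eq_fderiv (uniqueDiffOn_Icc zero_lt_one t ht)
              (ContinuousAffineMap.differentiableAt _)]
          exact (show z - y = fderiv ℝ (ContinuousAffineMap.lineMap (R := ℝ) y z) t 1 by simp).symm
        have h3 := DFunLike.congr_fun h1 (1 : ℝ)
        refine (congrArg (fun w : TangentSpace (𝓡∂ n) ((extChartAt (𝓡∂ n) x₀).symm (η t)) ↦ ‖w‖ₑ)
          (h3.trans (congrArg (chartSymmDeriv x₀ (η t)) h2))).trans_le ?_
        rw [← ofReal_norm]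
        exact ENNReal.ofReal_le_ofReal (hle _ (hη t ht) _)
    _ = _ := by simp

/-- Along a path the chart moves at most as fast as the Riemannian length allows, so that it is
Lipschitz near `x₀`: short paths between points close to `x₀` stay close to `x₀`. -/
lemma norm_chart_sub_le_edist {x₀ : M}
    {A : 𝔼 n ≃L[ℝ] 𝔼 n} {ρ : ℝ} (hρ : 0 < ρ)
    (hs : ∀ x ∈ Metric.eball x₀ (ofReal (4 * ρ)), x ∈ (extChartAt (𝓡∂ n) x₀).source)
    (hle : ∀ x ∈ Metric.eball x₀ (ofReal (4 * ρ)), ∀ v : TangentSpace (𝓡∂ n) x,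
      ‖A (chartDeriv x₀ x v)‖ ≤ 11 / 10 * ‖v‖) {x z : M}
    (hx : x ∈ Metric.eball x₀ (ofReal ρ)) (hz : z ∈ Metric.eball x₀ (ofReal ρ)) :
    ofReal ‖A (extChartAt (𝓡∂ n) x₀ z - extChartAt (𝓡∂ n) x₀ x)‖ ≤
      ofReal (11 / 10) * edist x z := by
  have hxz : edist x z < ofReal (2 * ρ) := by
    calc _ ≤ edist x x₀ + edist z x₀ := edist_triangle_right _ _ _
      _ < ofReal ρ + ofReal ρ := ENNReal.add_lt_add hx hz
      _ = _ := by rw [← ENNReal.ofReal_add hρ.le hρ.le]; ring_nf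
  -- it suffices to bound by the length of an almost minimizing path
  suffices h : ∀ L : ℝ≥0∞, edist x z < L → L < ofReal (2 * ρ) →
      ofReal ‖A (extChartAt (𝓡∂ n) x₀ z - extChartAt (𝓡∂ n) x₀ x)‖ ≤
        ofReal (11 / 10) * L by
    have h1 : ofReal ‖A (extChartAt (𝓡∂ n) x₀ z - extChartAt (𝓡∂ n) x₀ x)‖ /
        ofReal (11 / 10) ≤ edist x z := by
      refine le_of_forall_gt_imp_ge_of_dense fun L hL ↦ ?_
      rcases lt_or_ge L (ofReal (2 * ρ)) with h2 | h2
      · exact ENNReal.div_le_of_le_mul' (h L hL h2)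
      · obtain ⟨L', hL', hL''⟩ := exists_between hxz
        exact (ENNReal.div_le_of_le_mul' (h L' hL' hL'')).trans (hL''.le.trans h2)
    rwa [ENNReal.div_le_iff' (by simp) (by simp)] at h1
  intro L hL hL2
  rw [IsRiemannianManifold.out (I := 𝓡∂ n)] at hL
  obtain ⟨γ, hγ0, hγ1, γ_smooth, hγ⟩ := exists_lt_of_riemannianEDist_lt hL
  -- the path stays where the chart is controlled, since it is shorter than `2 ρ`
  have hmem : ∀ t ∈ Icc (0 : ℝ) 1, γ t ∈ Metric.eball x₀ (ofReal (4 * ρ)) := by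
    intro t ht
    have h1 : edist x (γ t) ≤ pathELength (𝓡∂ n) γ 0 t := by
      rw [IsRiemannianManifold.out (I := 𝓡∂ n)]
      exact riemannianEDist_le_pathELength (γ_smooth.mono (Icc_subset_Icc le_rfl ht.2)) hγ0 rfl ht.1
    have h2 : pathELength (𝓡∂ n) γ 0 t ≤ pathELength (𝓡∂ n) γ 0 1 := pathELength_mono le_rfl ht.2
    rw [Metric.mem_eball]
    calc edist (γ t) x₀ ≤ edist (γ t) x + edist x x₀ := edist_triangle _ _ _
      _ < ofReal (2 * ρ) + ofReal ρ := by
          refine ENNReal.add_lt_add ?_ hx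
          rw [edist_comm]
          exact ((h1.trans h2).trans_lt hγ).trans hL2
      _ ≤ _ := by
          rw [← ENNReal.ofReal_add (by positivity) hρ.le]
          exact ENNReal.ofReal_le_ofReal (by linarith)
  have hmaps : MapsTo γ (Icc 0 1) (chartAt (EuclideanHalfSpace n) x₀).source := fun t ht ↦ by
    simpa using hs _ (hmem t ht)
  set γ' : ℝ → 𝔼 n := fun t ↦ A (extChartAt (𝓡∂ n) x₀ (γ t)) with hγ'
  have hψ : ContMDiffOn 𝓘(ℝ, ℝ) 𝓘(ℝ, 𝔼 n) 1
      (fun t ↦ extChartAt (𝓡∂ n) x₀ (γ t)) (Icc 0 1) :=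
    (contMDiffOn_extChartAt (I := 𝓡∂ n) (n := 1) (x := x₀)).comp γ_smooth hmaps
  have hcd : ContDiffOn ℝ 1 γ' (Icc 0 1) :=
    (A : 𝔼 n →L[ℝ] 𝔼 n).contDiff.comp_contDiffOn
      (contMDiffOn_iff_contDiffOn.1 hψ)
  have hftc := enorm_sub_le_lintegral_derivWithin_Icc_of_contDiffOn_Icc hcd zero_le_one
  simp only [hγ', hγ0, hγ1, ← map_sub] at hftc
  rw [ofReal_norm]
  refine hftc.trans ?_
  calc _ ≤ ∫⁻ t in Icc (0 : ℝ) 1, ofReal (11 / 10) *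
        ‖mfderivWithin 𝓘(ℝ, ℝ) (𝓡∂ n) γ (Icc 0 1) t 1‖ₑ := by
        refine setLIntegral_mono' measurableSet_Icc fun t ht ↦ ?_
        have h1 : mfderivWithin 𝓘(ℝ, ℝ) 𝓘(ℝ, 𝔼 n)
            (fun t ↦ extChartAt (𝓡∂ n) x₀ (γ t)) (Icc 0 1) t =
            (chartDeriv x₀ (γ t)) ∘L (mfderivWithin 𝓘(ℝ, ℝ) (𝓡∂ n) γ (Icc 0 1) t) := by
          apply mfderiv_comp_mfderivWithin
          · exact mdifferentiableAt_extChartAt (hmaps ht)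
          · exact γ_smooth.mdifferentiableOn one_ne_zero _ ht
          · rw [uniqueMDiffWithinAt_iff_uniqueDiffWithinAt]
            exact uniqueDiffOn_Icc one_pos _ ht
        rw [mfderivWithin_eq_fderivWithin] at h1
        have hu := uniqueDiffOn_Icc (one_pos : (0 : ℝ) < 1) t ht
        have h2 : derivWithin γ' (Icc 0 1) t =
            A (chartDeriv x₀ (γ t) (mfderivWithin 𝓘(ℝ, ℝ) (𝓡∂ n) γ (Icc 0 1) t 1)) := by
          have hd : HasFDerivWithinAt (fun t ↦ extChartAt (𝓡∂ n) x₀ (γ t))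
              (fderivWithin ℝ (fun t ↦ extChartAt (𝓡∂ n) x₀ (γ t)) (Icc 0 1) t) (Icc 0 1) t :=
            ((contMDiffOn_iff_contDiffOn.1 hψ).differentiableOn one_ne_zero t ht).hasFDerivWithinAt
          have hd2 := ((A : 𝔼 n →L[ℝ] 𝔼 n).hasFDerivAt
            (x := extChartAt (𝓡∂ n) x₀ (γ t))).comp_hasFDerivWithinAt t hd
          have hd3 := hd2.hasDerivWithinAt.derivWithin hu
          refine hd3.trans ?_
          have h4 := DFunLike.congr_fun h1 (1 : ℝ)
          rw [ContinuousLinearMap.comp_apply]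
          exact congrArg A h4
        have h3 : derivWithin (fun t ↦ A (extChartAt (𝓡∂ n) x₀ (γ t))) (Icc 0 1) t = _ := h2
        rw [h3, ← ofReal_norm, ← ofReal_norm, ← ENNReal.ofReal_mul (by norm_num)]
        exact ENNReal.ofReal_le_ofReal (hle _ (hmem t ht) _)
    _ = ofReal (11 / 10) * pathELength (𝓡∂ n) γ 0 1 := by
        rw [lintegral_const_mul' _ _ ENNReal.ofReal_ne_top,
          pathELength_eq_lintegral_mfderivWithin_Icc]
    _ ≤ _ := by gcongr

variable [IsContinuousRiemannianBundle (𝔼 n)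
  (fun x : M ↦ TangentSpace (𝓡∂ n) x)]

/-- Every point has a chart in which the metric is almost constant. -/
lemma exists_isAlmostFlat (x₀ : M) :
    ∃ (A : 𝔼 n ≃L[ℝ] 𝔼 n) (R ρ : ℝ),
      IsAlmostFlat x₀ A R ρ := by
  obtain ⟨A, hA1, hA2⟩ := exists_linear_equiv_almost_isometric (n := n) x₀
  set c := extChartAt (𝓡∂ n) x₀ x₀ with hc
  have hev : ∀ᶠ y in 𝓝[range (𝓡∂ n)] c, y ∈ (extChartAt (𝓡∂ n) x₀).target ∧
      (∀ v : TangentSpace (𝓡∂ n) ((extChartAt (𝓡∂ n) x₀).symm y),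
        ‖A (chartDeriv x₀ ((extChartAt (𝓡∂ n) x₀).symm y) v)‖ ≤ 11 / 10 * ‖v‖) ∧
      ∀ v : 𝔼 n, ‖chartSymmDeriv x₀ y v‖ ≤ 11 / 10 * ‖A v‖ := by
    have hcont : ContinuousAt (extChartAt (𝓡∂ n) x₀).symm c := continuousAt_extChartAt_symm _
    have h0 : Tendsto (extChartAt (𝓡∂ n) x₀).symm (𝓝[range (𝓡∂ n)] c) (𝓝 x₀) := by
      have := hcont.tendsto
      rw [extChartAt_to_inv] at this
      exact this.mono_left nhdsWithin_le_nhds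
    filter_upwards [h0.eventually hA1, h0.eventually hA2, extChartAt_target_mem_nhdsWithin x₀]
      with y hy1 hy2 hy
    refine ⟨hy, hy1, ?_⟩
    rwa [(extChartAt (𝓡∂ n) x₀).right_inv hy] at hy2
  obtain ⟨r, hr, hball⟩ := Metric.mem_nhdsWithin_iff.1 hev
  set R : ℝ := r / (‖(A.symm : 𝔼 n →L[ℝ] 𝔼 n)‖ + 1)
    with hRdef
  have hR : 0 < R := by positivity
  have hsub : ∀ y ∈ halfBall A c R, y ∈ (extChartAt (𝓡∂ n) x₀).target ∧
      (∀ v : TangentSpace (𝓡∂ n) ((extChartAt (𝓡∂ n) x₀).symm y),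
        ‖A (chartDeriv x₀ ((extChartAt (𝓡∂ n) x₀).symm y) v)‖ ≤ 11 / 10 * ‖v‖) ∧
      ∀ v : 𝔼 n, ‖chartSymmDeriv x₀ y v‖ ≤ 11 / 10 * ‖A v‖ := by
    intro y hy
    refine hball ⟨?_, by rw [range_model_eq_halfSpace]; exact hy.1⟩
    rw [Metric.mem_ball, dist_eq_norm]
    have h1 := (A.symm : 𝔼 n →L[ℝ] 𝔼 n).le_opNorm
      (A (y - c))
    simp only [ContinuousLinearEquiv.coe_coe, ContinuousLinearEquiv.symm_apply_apply] at h1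
    have h2 : ‖A (y - c)‖ < R := hy.2
    calc _ ≤ _ := h1
      _ ≤ (‖(A.symm : 𝔼 n →L[ℝ] 𝔼 n)‖ + 1) *
          ‖A (y - c)‖ := by gcongr; linarith
      _ < (‖(A.symm : 𝔼 n →L[ℝ] 𝔼 n)‖ + 1) * R := by
          gcongr
      _ = r := by rw [hRdef]; field_simp
  have hev2 : ∀ᶠ x in 𝓝 x₀, x ∈ (extChartAt (𝓡∂ n) x₀).source ∧
      ∀ v : TangentSpace (𝓡∂ n) x, ‖A (chartDeriv x₀ x v)‖ ≤ 11 / 10 * ‖v‖ :=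
    (eventually_mem_set.2 (extChartAt_source_mem_nhds (I := 𝓡∂ n) x₀)).and hA1
  obtain ⟨ε, hε, hεball⟩ := EMetric.mem_nhds_iff.1 hev2
  obtain ⟨ρ, hρ, hρε⟩ : ∃ ρ : ℝ, 0 < ρ ∧ ofReal (4 * ρ) ≤ ε := by
    rcases eq_or_ne ε ⊤ with rfl | h
    · exact ⟨1, one_pos, le_top⟩
    · refine ⟨ε.toReal / 4, div_pos (ENNReal.toReal_pos hε.ne' h) (by norm_num), ?_⟩
      rw [mul_div_cancel₀ _ (by norm_num), ENNReal.ofReal_toReal h]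
  have h4 : ∀ x ∈ Metric.eball x₀ (ofReal (4 * ρ)),
      x ∈ (extChartAt (𝓡∂ n) x₀).source ∧
      ∀ v : TangentSpace (𝓡∂ n) x, ‖A (chartDeriv x₀ x v)‖ ≤ 11 / 10 * ‖v‖ := fun x hx ↦
    hεball (Metric.eball_subset_eball hρε hx)
  have hmono : ∀ x ∈ Metric.eball x₀ (ofReal ρ),
      x ∈ Metric.eball x₀ (ofReal (4 * ρ)) := fun x hx ↦
    Metric.eball_subset_eball (ENNReal.ofReal_le_ofReal (by linarith)) hx
  have hsub' : ∀ y ∈ halfBall A c (min R (ρ / 2)), y ∈ halfBall A c R := fun y hy ↦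
    ⟨hy.1, (show ‖A (y - c)‖ < min R (ρ / 2) from hy.2).trans_le (min_le_left _ _)⟩
  refine ⟨A, min R (ρ / 2), ρ, by positivity, ?_, fun y hy ↦ (hsub y (hsub' y hy)).1,
    fun y hy ↦ (hsub y (hsub' y hy)).2.1, fun y hy ↦ (hsub y (hsub' y hy)).2.2,
    fun y hy z hz ↦ edist_chart_symm_le (fun y hy ↦ (hsub y hy).1) (fun y hy ↦ (hsub y hy).2.2)
      (hsub' y hy) (hsub' z hz), fun x hx ↦ (h4 x (hmono x hx)).1, fun x hx z hz ↦
      norm_chart_sub_le_edist hρ (fun x hx ↦ (h4 x hx).1) (fun x hx ↦ (h4 x hx).2) hx hz⟩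
  linarith [min_le_right R (ρ / 2)]

end Chart

/-! ### Comparison of measures in a chart -/

section Chart

/-- Change of variables, as an inequality, for the Hausdorff measure and a Lipschitz map. It replaces
the area formula: an almost isometric chart has Lipschitz constants close to those of the constant
linear map, for itself and for its inverse. -/
lemma lintegral_hausdorff_le_of_lipschitzOnWith {X Y : Type*} [EMetricSpace X] [EMetricSpace Y]
    [MeasurableSpace X] [BorelSpace X] [MeasurableSpace Y] [BorelSpace Y] {K : NNReal}
    {e : X → Y} {s : Set X} {t : Set Y} (d : ℕ) (hs : MeasurableSet s)
    (he : LipschitzOnWith K e s) (ht : t ⊆ e '' s) (f : Y → ℝ≥0∞) :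
    ∫⁻ y in t, f y ∂μHE[d] ≤ (K : ℝ≥0∞) ^ d * ∫⁻ x in s, f (e x) ∂μHE[d] := by
  have hm : AEMeasurable e ((μHE[d] : Measure X).restrict s) :=
    he.continuousOn.aemeasurable hs
  have hle : (μHE[d] : Measure Y).restrict t ≤
      (K : ℝ≥0∞) ^ d • ((μHE[d] : Measure X).restrict s).map e := by
    refine Measure.le_iff.2 fun u hu ↦ ?_
    rw [Measure.restrict_apply hu, Measure.smul_apply, Measure.map_apply_of_aemeasurable hm hu,
      Measure.restrict_apply' hs, smul_eq_mul]
    calc (μHE[d] : Measure Y) (u ∩ t) ≤ μHE[d] (e '' (e ⁻¹' u ∩ s)) := by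
          refine measure_mono fun y hy ↦ ?_
          obtain ⟨x, hx, rfl⟩ := ht hy.2
          exact ⟨x, ⟨hy.1, hx⟩, rfl⟩
      _ ≤ _ := by
          have h := (he.mono (inter_subset_right (s := e ⁻¹' u))).hausdorffMeasure_image_le
            (d := (d : ℝ)) (Nat.cast_nonneg d)
          rw [ENNReal.rpow_natCast] at h
          rw [Measure.euclideanHausdorffMeasure_def, Measure.euclideanHausdorffMeasure_def]
          simp only [Measure.smul_apply, ENNReal.smul_def, smul_eq_mul]
          calc _ ≤ _ := mul_le_mul_right h _
            _ = _ := by ring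
  calc _ ≤ ∫⁻ y, f y ∂((K : ℝ≥0∞) ^ d • ((μHE[d] : Measure X).restrict s).map e) :=
        lintegral_mono' hle le_rfl
    _ = (K : ℝ≥0∞) ^ d * ∫⁻ y, f y ∂((μHE[d] : Measure X).restrict s).map e := by
        rw [lintegral_smul_measure, smul_eq_mul]
    _ ≤ _ := by
        gcongr
        exact lintegral_map_le _ _

variable {n : ℕ} [NeZero n] {M : Type*} [EMetricSpace M]
  [ChartedSpace (EuclideanHalfSpace n) M]

/-- The part of `M` over the ellipsoid `{‖A (y - p)‖ < t}` in the chart at `x₀`. -/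
def chartBall (x₀ : M) (A : 𝔼 n ≃L[ℝ] 𝔼 n)
    (p : 𝔼 n) (t : ℝ) : Set M :=
  (extChartAt (𝓡∂ n) x₀).source ∩ extChartAt (𝓡∂ n) x₀ ⁻¹' {y | ‖A (y - p)‖ < t}

lemma isOpen_chartBall (x₀ : M) (A : 𝔼 n ≃L[ℝ] 𝔼 n)
    (p : 𝔼 n) (t : ℝ) : IsOpen (chartBall x₀ A p t) :=
  (continuousOn_extChartAt x₀).isOpen_inter_preimage (isOpen_extChartAt_source x₀)
    (isOpen_norm_sub_lt A p t)

lemma chartBall_mono (x₀ : M) (A : 𝔼 n ≃L[ℝ] 𝔼 n)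
    (p : 𝔼 n) {t t' : ℝ} (h : t ≤ t') :
    chartBall x₀ A p t ⊆ chartBall x₀ A p t' := fun _ hx ↦ ⟨hx.1, lt_of_lt_of_le hx.2 h⟩

lemma extChartAt_mem_halfSpace {x₀ x : M} (hx : x ∈ (extChartAt (𝓡∂ n) x₀).source) :
    extChartAt (𝓡∂ n) x₀ x ∈ halfSpace n := by
  rw [← range_model_eq_halfSpace]
  exact extChartAt_target_subset_range x₀ ((extChartAt (𝓡∂ n) x₀).map_source hx)

lemma extChartAt_mem_halfBall {x₀ x : M}
    {A : 𝔼 n ≃L[ℝ] 𝔼 n}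
    {p : 𝔼 n} {t : ℝ} (hx : x ∈ chartBall x₀ A p t) :
    extChartAt (𝓡∂ n) x₀ x ∈ halfBall A p t :=
  ⟨extChartAt_mem_halfSpace hx.1, hx.2⟩

/-- A point is a boundary point exactly if its zeroth coordinate vanishes, in any chart. -/
lemma extChartAt_zero_of_mem_boundary [IsManifold (𝓡∂ n) 1 M] {x₀ x : M}
    (hx : x ∈ (extChartAt (𝓡∂ n) x₀).source) (hb : x ∈ (𝓡∂ n).boundary M) :
    extChartAt (𝓡∂ n) x₀ x 0 = 0 := by
  have hxs : x ∈ (chartAt (EuclideanHalfSpace n) x₀).source := by simpa using hx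
  by_contra hne
  have hpos : 0 < extChartAt (𝓡∂ n) x₀ x 0 :=
    lt_of_le_of_ne (extChartAt_mem_halfSpace hx) (Ne.symm hne)
  have hint : (𝓡∂ n).IsInteriorPoint x := by
    rw [(𝓡∂ n).isInteriorPoint_iff_of_mem_atlas (n := 1) one_ne_zero (chart_mem_atlas _ x₀) hxs]
    refine OpenPartialHomeomorph.mem_interior_extend_target _ ?_ ?_
    · simpa using (chartAt (EuclideanHalfSpace n) x₀).map_source hxs
    · rw [interior_range_modelWithCornersEuclideanHalfSpace]
      exact hpos
  exact ((𝓡∂ n).isBoundaryPoint_iff_not_isInteriorPoint x).1 hb hint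

variable [RiemannianBundle (fun x : M ↦ TangentSpace (𝓡∂ n) x)]
  {x₀ : M} {A : 𝔼 n ≃L[ℝ] 𝔼 n} {R ρ : ℝ}

lemma coe_mul_nnnorm (B : 𝔼 n →L[ℝ] 𝔼 n) :
    ((11 / 10 * ‖B‖₊ : NNReal) : ℝ≥0∞) = ofReal (11 / 10 * ‖B‖) := by
  rw [← ENNReal.ofReal_coe_nnreal]
  simp

namespace IsAlmostFlat

lemma center_mem (h : IsAlmostFlat x₀ A R ρ) :
    extChartAt (𝓡∂ n) x₀ x₀ ∈ halfBall A (extChartAt (𝓡∂ n) x₀ x₀) R :=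
  ⟨extChartAt_mem_halfSpace (mem_extChartAt_source x₀), by simp [h.radius_pos]⟩

lemma symm_mem_ball (h : IsAlmostFlat x₀ A R ρ) {y : 𝔼 n}
    (hy : y ∈ halfBall A (extChartAt (𝓡∂ n) x₀ x₀) R) :
    (extChartAt (𝓡∂ n) x₀).symm y ∈ Metric.eball x₀ (ofReal ρ) := by
  have h1 := h.edist_le _ h.center_mem y hy
  rw [extChartAt_to_inv, edist_comm] at h1
  refine h1.trans_lt ((ENNReal.ofReal_lt_ofReal_iff ?_).2 ?_)
  · linarith [h.radius_pos, h.radius_le]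
  · have : ‖A (y - extChartAt (𝓡∂ n) x₀ x₀)‖ < R := hy.2
    linarith [h.radius_le]

lemma symm_mem_chartBall (h : IsAlmostFlat x₀ A R ρ) {p y : 𝔼 n} {t : ℝ}
    (hy : y ∈ halfBall A (extChartAt (𝓡∂ n) x₀ x₀) R) (hy' : ‖A (y - p)‖ < t) :
    (extChartAt (𝓡∂ n) x₀).symm y ∈ chartBall x₀ A p t := by
  refine ⟨(extChartAt (𝓡∂ n) x₀).map_target (h.subset_target hy), ?_⟩
  rw [mem_preimage, (extChartAt (𝓡∂ n) x₀).right_inv (h.subset_target hy)]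
  exact hy'

lemma lipschitzOnWith_symm (h : IsAlmostFlat x₀ A R ρ) :
    LipschitzOnWith (11 / 10 * ‖(A : 𝔼 n →L[ℝ] 𝔼 n)‖₊)
      (extChartAt (𝓡∂ n) x₀).symm (halfBall A (extChartAt (𝓡∂ n) x₀ x₀) R) := by
  intro y hy z hz
  refine (h.edist_le y hy z hz).trans ?_
  rw [edist_comm, edist_eq_enorm_sub, ← ofReal_norm, coe_mul_nnnorm,
    ← ENNReal.ofReal_mul (by positivity)]
  refine ENNReal.ofReal_le_ofReal ?_
  rw [mul_assoc]
  gcongr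
  exact (A : 𝔼 n →L[ℝ] 𝔼 n).le_opNorm _

lemma lipschitzOnWith_chart (h : IsAlmostFlat x₀ A R ρ) :
    LipschitzOnWith
      (11 / 10 * ‖(A.symm : 𝔼 n →L[ℝ] 𝔼 n)‖₊)
      (extChartAt (𝓡∂ n) x₀) (Metric.eball x₀ (ofReal ρ)) := by
  intro x hx z hz
  have h1 := h.le_edist x hx z hz
  have h2 := (A.symm : 𝔼 n →L[ℝ] 𝔼 n).le_opNorm
    (A (extChartAt (𝓡∂ n) x₀ z - extChartAt (𝓡∂ n) x₀ x))
  simp only [ContinuousLinearEquiv.coe_coe, ContinuousLinearEquiv.symm_apply_apply] at h2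
  rw [edist_comm, edist_eq_enorm_sub, ← ofReal_norm]
  refine (ENNReal.ofReal_le_ofReal h2).trans ?_
  rw [ENNReal.ofReal_mul (norm_nonneg _)]
  refine (mul_le_mul_right h1 _).trans (le_of_eq ?_)
  rw [← mul_assoc, ← ENNReal.ofReal_mul (norm_nonneg _), mul_comm ‖_‖, coe_mul_nnnorm]

variable [MeasurableSpace M] [BorelSpace M]

lemma lintegral_chartBall_le (h : IsAlmostFlat x₀ A R ρ) {p : 𝔼 n} {t : ℝ}
    (hsub : halfBall A p t ⊆ halfBall A (extChartAt (𝓡∂ n) x₀ x₀) R) (f : M → ℝ≥0∞) :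
    ∫⁻ x in chartBall x₀ A p t, f x ∂volM n M ≤
      ((11 / 10 * ‖(A : 𝔼 n →L[ℝ] 𝔼 n)‖₊ : NNReal) :
        ℝ≥0∞) ^ n * ∫⁻ y in halfBall A p t, f ((extChartAt (𝓡∂ n) x₀).symm y) := by
  have := lintegral_hausdorff_le_of_lipschitzOnWith (t := chartBall x₀ A p t) n
    (measurableSet_halfBall A p t) (h.lipschitzOnWith_symm.mono hsub) (fun x hx ↦
      ⟨_, extChartAt_mem_halfBall hx, (extChartAt (𝓡∂ n) x₀).left_inv hx.1⟩) f
  rwa [EuclideanSpace.euclideanHausdorffMeasure_eq_volume] at this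

lemma lintegral_halfBall_le (h : IsAlmostFlat x₀ A R ρ) {p : 𝔼 n} {t : ℝ}
    (hsub : halfBall A p t ⊆ halfBall A (extChartAt (𝓡∂ n) x₀ x₀) R)
    (g : 𝔼 n → ℝ≥0∞) :
    ∫⁻ y in halfBall A p t, g y ≤
      ((11 / 10 * ‖(A.symm : 𝔼 n →L[ℝ] 𝔼 n)‖₊ : NNReal) :
        ℝ≥0∞) ^ n * ∫⁻ x in chartBall x₀ A p t, g (extChartAt (𝓡∂ n) x₀ x) ∂volM n M := by
  have := lintegral_hausdorff_le_of_lipschitzOnWith (t := halfBall A p t) n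
    (isOpen_chartBall x₀ A p t).measurableSet (h.lipschitzOnWith_chart.mono fun x hx ↦ ?_)
    (fun y hy ↦ ⟨(extChartAt (𝓡∂ n) x₀).symm y, h.symm_mem_chartBall (hsub hy) hy.2,
      (extChartAt (𝓡∂ n) x₀).right_inv (h.subset_target (hsub hy))⟩) g
  · rwa [EuclideanSpace.euclideanHausdorffMeasure_eq_volume] at this
  · have := h.symm_mem_ball (hsub (extChartAt_mem_halfBall hx))
    rwa [(extChartAt (𝓡∂ n) x₀).left_inv hx.1] at this

lemma lintegral_boundary_chartBall_le [IsManifold (𝓡∂ n) 1 M] (h : IsAlmostFlat x₀ A R ρ)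
    {p : 𝔼 n} {t : ℝ}
    (hsub : halfBall A p t ⊆ halfBall A (extChartAt (𝓡∂ n) x₀ x₀) R) (f : M → ℝ≥0∞) :
    ∫⁻ x in chartBall x₀ A p t, f x ∂volBoundary n M ≤
      ((11 / 10 * ‖(A : 𝔼 n →L[ℝ] 𝔼 n)‖₊ : NNReal) :
        ℝ≥0∞) ^ (n - 1) * ∫⁻ y in halfBall A p t ∩ {y | y 0 = 0},
          f ((extChartAt (𝓡∂ n) x₀).symm y) ∂(μHE[n - 1] : Measure (𝔼 n)) := by
  rw [volBoundary, Measure.restrict_restrict (isOpen_chartBall x₀ A p t).measurableSet]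
  exact lintegral_hausdorff_le_of_lipschitzOnWith (t := chartBall x₀ A p t ∩ _) (n - 1)
    ((measurableSet_halfBall A p t).inter
      (isClosed_singleton.preimage continuous_coord_zero).measurableSet)
    (h.lipschitzOnWith_symm.mono (inter_subset_left.trans hsub)) (fun x hx ↦
      ⟨_, ⟨extChartAt_mem_halfBall hx.1, extChartAt_zero_of_mem_boundary hx.1.1 hx.2⟩,
        (extChartAt (𝓡∂ n) x₀).left_inv hx.1.1⟩) f

end IsAlmostFlat

end Chart

/-! ### Gradients and cutoff functions in a chart -/

section Gradient

variable {n : ℕ} [NeZero n] {M : Type*} [EMetricSpace M]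
  [ChartedSpace (EuclideanHalfSpace n) M]
  [RiemannianBundle (fun x : M ↦ TangentSpace (𝓡∂ n) x)]

/-- The differential of a function, with values in `ℝ`. -/
def differential (φ : M → ℝ) (x : M) : TangentSpace (𝓡∂ n) x →L[ℝ] ℝ :=
  mfderiv (𝓡∂ n) 𝓘(ℝ, ℝ) φ x

lemma inner_grad_eq_differential (φ : M → ℝ) (x : M) (w : TangentSpace (𝓡∂ n) x) :
    inner ℝ (grad (n := n) φ x) w = differential φ x w := inner_grad φ x w

lemma abs_differential_le (φ : M → ℝ) (x : M) (v : TangentSpace (𝓡∂ n) x) :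
    |differential φ x v| ≤ ‖grad (n := n) φ x‖ * ‖v‖ := by
  rw [← inner_grad_eq_differential]
  exact abs_real_inner_le_norm _ _

lemma norm_grad_le {φ : M → ℝ} {x : M} {B : ℝ}
    (h : ∀ v : TangentSpace (𝓡∂ n) x, |differential φ x v| ≤ B * ‖v‖) :
    ‖grad (n := n) φ x‖ ≤ B := by
  have h1 := h (grad (n := n) φ x)
  rw [← inner_grad_eq_differential, real_inner_self_eq_norm_sq, abs_of_nonneg (sq_nonneg _), sq] at h1
  rcases eq_or_lt_of_le (norm_nonneg (grad (n := n) φ x)) with h0 | h0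
  · rw [← h0]
    -- the bound is nonnegative because the model space is nontrivial
    by_contra hB
    have h2 := h (show TangentSpace (𝓡∂ n) x from EuclideanSpace.single (0 : Fin n) (1 : ℝ))
    have h3 : 0 < ‖(show TangentSpace (𝓡∂ n) x from EuclideanSpace.single (0 : Fin n) (1 : ℝ))‖ := by
      refine norm_pos_iff.2 fun h4 ↦ ?_
      have h5 : (EuclideanSpace.single (0 : Fin n) (1 : ℝ)) = 0 := h4
      simpa using congrArg (fun w : 𝔼 n ↦ w 0) h5
    have := abs_nonneg (differential φ x
      (show TangentSpace (𝓡∂ n) x from EuclideanSpace.single (0 : Fin n) (1 : ℝ)))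
    nlinarith [mul_neg_of_neg_of_pos (not_le.1 hB) h3]
  · exact le_of_mul_le_mul_right h1 h0

lemma grad_comp {F : ℝ → ℝ} {F' : ℝ} {φ : M → ℝ} {x : M} (hF : HasDerivAt F F' (φ x))
    (hφ : MDifferentiableAt (𝓡∂ n) 𝓘(ℝ, ℝ) φ x) :
    grad (n := n) (fun z ↦ F (φ z)) x = F' • grad (n := n) φ x := by
  have h1 : HasMFDerivAt 𝓘(ℝ, ℝ) 𝓘(ℝ, ℝ) F (φ x) (ContinuousLinearMap.toSpanSingleton ℝ F') :=
    hF.hasFDerivAt.hasMFDerivAt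
  have h2 := h1.comp x hφ.hasMFDerivAt
  refine ext_inner_right ℝ fun v ↦ ?_
  rw [inner_grad, real_inner_smul_left, inner_grad]
  have h3 : mfderiv (𝓡∂ n) 𝓘(ℝ, ℝ) (fun z ↦ F (φ z)) x = _ := h2.mfderiv
  rw [h3]
  change differential φ x v • F' = _
  exact mul_comm _ _

lemma grad_mul {φ ζ : M → ℝ} {x : M} (hφ : MDifferentiableAt (𝓡∂ n) 𝓘(ℝ, ℝ) φ x)
    (hζ : MDifferentiableAt (𝓡∂ n) 𝓘(ℝ, ℝ) ζ x) :
    grad (n := n) (fun z ↦ φ z * ζ z) x = φ x • grad (n := n) ζ x + ζ x • grad (n := n) φ x := by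
  have h2 := hφ.hasMFDerivAt.mul hζ.hasMFDerivAt
  refine ext_inner_right ℝ fun v ↦ ?_
  rw [inner_grad, inner_add_left, real_inner_smul_left, real_inner_smul_left, inner_grad,
    inner_grad]
  exact DFunLike.congr_fun h2.mfderiv v

lemma grad_eq_zero {φ : M → ℝ} {x : M} (h : φ =ᶠ[𝓝 x] fun _ ↦ 0) : grad (n := n) φ x = 0 := by
  have h1 : differential (n := n) φ x = 0 := by
    rw [differential, h.mfderiv_eq]
    exact mfderiv_const
  refine ext_inner_right ℝ fun v ↦ ?_
  rw [inner_grad_eq_differential, h1]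
  simp

variable {x₀ : M} {A : 𝔼 n ≃L[ℝ] 𝔼 n} {R ρ : ℝ}
  [IsManifold (𝓡∂ n) 1 M]

lemma hasFDerivWithinAt_comp_symm {φ : M → ℝ} {y : 𝔼 n}
    (hy : y ∈ (extChartAt (𝓡∂ n) x₀).target)
    (hφ : MDifferentiableAt (𝓡∂ n) 𝓘(ℝ, ℝ) φ ((extChartAt (𝓡∂ n) x₀).symm y)) :
    HasFDerivWithinAt (fun z ↦ φ ((extChartAt (𝓡∂ n) x₀).symm z))
      (differential φ ((extChartAt (𝓡∂ n) x₀).symm y) ∘L chartSymmDeriv x₀ y)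
      (halfSpace n) y := by
  rw [← range_model_eq_halfSpace]
  exact hasMFDerivWithinAt_iff_hasFDerivWithinAt.1 <| HasMFDerivAt.comp_hasMFDerivWithinAt y hφ.hasMFDerivAt
    (mdifferentiableWithinAt_extChartAt_symm hy).hasMFDerivWithinAt

namespace IsAlmostFlat

lemma norm_fderivWithin_le (h : IsAlmostFlat x₀ A R ρ) {φ : M → ℝ}
    {y : 𝔼 n} (hy : y ∈ halfBall A (extChartAt (𝓡∂ n) x₀ x₀) R)
    (hφ : MDifferentiableAt (𝓡∂ n) 𝓘(ℝ, ℝ) φ ((extChartAt (𝓡∂ n) x₀).symm y)) :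
    ‖fderivWithin ℝ (fun z ↦ φ ((extChartAt (𝓡∂ n) x₀).symm z)) (halfSpace n) y‖ ≤
      11 / 10 * ‖(A : 𝔼 n →L[ℝ] 𝔼 n)‖ *
        ‖grad (n := n) φ ((extChartAt (𝓡∂ n) x₀).symm y)‖ := by
  rw [(hasFDerivWithinAt_comp_symm (h.subset_target hy) hφ).fderivWithin
    (uniqueDiffOn_halfSpace y hy.1)]
  refine ContinuousLinearMap.opNorm_le_bound _ (by positivity) fun v ↦ ?_
  rw [ContinuousLinearMap.comp_apply, Real.norm_eq_abs]
  calc _ ≤ ‖grad (n := n) φ ((extChartAt (𝓡∂ n) x₀).symm y)‖ * ‖chartSymmDeriv x₀ y v‖ :=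
        abs_differential_le _ _ _
    _ ≤ ‖grad (n := n) φ ((extChartAt (𝓡∂ n) x₀).symm y)‖ * (11 / 10 *
        (‖(A : 𝔼 n →L[ℝ] 𝔼 n)‖ * ‖v‖)) := by
        gcongr
        refine (h.norm_chartSymmDeriv_le y hy v).trans ?_
        gcongr
        exact (A : 𝔼 n →L[ℝ] 𝔼 n).le_opNorm v
    _ = _ := by ring

/-- The part of `M` over a closed ellipsoid well inside the domain of the chart is compact. -/
lemma isCompact_closedChartBall (h : IsAlmostFlat x₀ A R ρ) {p : 𝔼 n}
    {t t' : ℝ} (ht : t < t') (hsub : halfBall A p t' ⊆ halfBall A (extChartAt (𝓡∂ n) x₀ x₀) R) :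
    IsCompact ((extChartAt (𝓡∂ n) x₀).source ∩
      extChartAt (𝓡∂ n) x₀ ⁻¹' {y | ‖A (y - p)‖ ≤ t}) := by
  have hc : IsCompact (halfSpace n ∩ {y | ‖A (y - p)‖ ≤ t}) := by
    refine Metric.isCompact_of_isClosed_isBounded (isClosed_halfSpace.inter
      (isClosed_le (by fun_prop) continuous_const)) ?_
    have h1 : Bornology.IsBounded ((fun w ↦ A.symm w + p) '' Metric.closedBall 0 t) :=
      ((isCompact_closedBall (0 : 𝔼 n) t).image (by fun_prop)).isBounded
    refine h1.subset fun y hy ↦ ⟨A (y - p), by simpa using hy.2, by simp⟩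
  have hD : halfSpace n ∩ {y | ‖A (y - p)‖ ≤ t} ⊆ (extChartAt (𝓡∂ n) x₀).target := fun y hy ↦
    h.subset_target (hsub ⟨hy.1, lt_of_le_of_lt hy.2 ht⟩)
  convert hc.image_of_continuousOn ((continuousOn_extChartAt_symm x₀).mono hD) using 1
  ext x
  constructor
  · rintro ⟨hx, hx'⟩
    exact ⟨_, ⟨extChartAt_mem_halfSpace hx, hx'⟩, (extChartAt (𝓡∂ n) x₀).left_inv hx⟩
  · rintro ⟨y, hy, rfl⟩
    refine ⟨(extChartAt (𝓡∂ n) x₀).map_target (hD hy), ?_⟩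
    rw [mem_preimage, (extChartAt (𝓡∂ n) x₀).right_inv (hD hy)]
    exact hy.2

end IsAlmostFlat

lemma exists_deriv_smoothTransition_le : ∃ B : ℝ, 0 < B ∧ ∀ t,
    |deriv Real.smoothTransition t| ≤ B := by
  have hc : Continuous (deriv Real.smoothTransition) :=
    (Real.smoothTransition.contDiff (n := 1)).continuous_deriv le_rfl
  obtain ⟨B, hB⟩ := isCompact_Icc.exists_bound_of_continuousOn
    (s := Icc (0 : ℝ) 1) hc.continuousOn
  refine ⟨max B 1, by positivity, fun t ↦ ?_⟩
  rcases lt_or_ge t 0 with h0 | h0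
  · have : Real.smoothTransition =ᶠ[𝓝 t] fun _ ↦ 0 := by
      filter_upwards [gt_mem_nhds h0] with z hz
      exact Real.smoothTransition.zero_of_nonpos hz.le
    rw [this.deriv_eq]
    simp
  rcases lt_or_ge 1 t with h1 | h1
  · have : Real.smoothTransition =ᶠ[𝓝 t] fun _ ↦ 1 := by
      filter_upwards [lt_mem_nhds h1] with z hz
      exact Real.smoothTransition.one_of_one_le hz.le
    rw [this.deriv_eq]
    simp
  · exact (hB t ⟨h0, h1⟩).trans (le_max_left _ _)

/-- The `C¹` function `η` is a cutoff function for `S` inside `U`: it takes values in `[0, 1]`, is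
`1` on `S`, vanishes off the compact set `K ⊆ U`, and its gradient is at most `L`. The set `K` may
meet the boundary of the manifold, where `η` is not required to vanish. -/
structure IsCutoff (n : ℕ) [NeZero n] {M : Type*} [EMetricSpace M]
    [ChartedSpace (EuclideanHalfSpace n) M]
    [RiemannianBundle (fun x : M ↦ TangentSpace (𝓡∂ n) x)] (η : M → ℝ) (S U K : Set M) (L : ℝ) : Prop where
  contMDiff : ContMDiff (𝓡∂ n) 𝓘(ℝ, ℝ) 1 η
  nonneg : ∀ x, 0 ≤ η x
  le_one : ∀ x, η x ≤ 1
  eq_one : ∀ x ∈ S, η x = 1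
  isCompact : IsCompact K
  subset : K ⊆ U
  eq_zero : ∀ x ∉ K, η x = 0
  norm_grad_le : ∀ x, ‖grad (n := n) η x‖ ≤ L

/-- Cutoff functions between concentric chart balls, with a gradient bound whose constant depends
neither on the chart nor on the balls. -/
lemma IsAlmostFlat.exists_cutoff : ∃ B : ℝ, 0 < B ∧
    ∀ {x₀ : M} {A : 𝔼 n ≃L[ℝ] 𝔼 n} {R ρ : ℝ},
      IsAlmostFlat x₀ A R ρ → ∀ (p : 𝔼 n) (t t' : ℝ), 0 < t → t < t' →
      halfBall A p t' ⊆ halfBall A (extChartAt (𝓡∂ n) x₀ x₀) R →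
      ∃ (η : M → ℝ) (K : Set M), IsCutoff n η (chartBall x₀ A p t) (chartBall x₀ A p t') K
        (B / (t' - t)) := by
  obtain ⟨B, hB, hder⟩ := exists_deriv_smoothTransition_le
  refine ⟨5 * B, by positivity, fun {x₀ A R ρ} h p t t' ht htt' hsub ↦ ?_⟩
  classical
  set T : ℝ := (t + t') / 2 with hT
  have htT : t < T := by linarith
  have hTt' : T < t' := by linarith
  have hT0 : 0 < T := by linarith
  set K : Set M := (extChartAt (𝓡∂ n) x₀).source ∩
      extChartAt (𝓡∂ n) x₀ ⁻¹' {y | ‖A (y - p)‖ ≤ T} with hK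
  have hKc : IsCompact K := h.isCompact_closedChartBall hTt' hsub
  have hden : 0 < T ^ 2 - t ^ 2 := by nlinarith
  set χ : 𝔼 n → ℝ := fun y ↦
    Real.smoothTransition ((T ^ 2 - ‖A (y - p)‖ ^ 2) / (T ^ 2 - t ^ 2)) with hχ
  have hin : ContDiff ℝ 1 fun y ↦ (T ^ 2 - ‖A (y - p)‖ ^ 2) / (T ^ 2 - t ^ 2) := by
    refine (contDiff_const.sub (ContDiff.norm_sq ℝ ?_)).div_const _
    exact (A : 𝔼 n →L[ℝ] 𝔼 n).contDiff.comp
      (contDiff_id.sub contDiff_const)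
  have hχc : ContDiff ℝ 1 χ := (Real.smoothTransition.contDiff (n := 1)).comp hin
  have hχ0 : ∀ y, T ≤ ‖A (y - p)‖ → χ y = 0 := fun y hy ↦
    Real.smoothTransition.zero_of_nonpos (div_nonpos_of_nonpos_of_nonneg (by nlinarith) hden.le)
  set η : M → ℝ := fun x ↦ if x ∈ (extChartAt (𝓡∂ n) x₀).source then
    χ (extChartAt (𝓡∂ n) x₀ x) else 0 with hη
  have hηsource : ∀ x ∈ (extChartAt (𝓡∂ n) x₀).source, η =ᶠ[𝓝 x] χ ∘ extChartAt (𝓡∂ n) x₀ := by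
    intro x hx
    filter_upwards [(isOpen_extChartAt_source x₀).mem_nhds hx] with z hz
    exact if_pos hz
  have hη0 : ∀ x ∉ K, η x = 0 := by
    intro x hx
    by_cases hxs : x ∈ (extChartAt (𝓡∂ n) x₀).source
    · simp only [hη, if_pos hxs]
      refine hχ0 _ ?_
      by_contra hlt
      exact hx ⟨hxs, (not_le.1 hlt).le⟩
    · exact if_neg hxs
  have hψ : ∀ x ∈ (extChartAt (𝓡∂ n) x₀).source,
      ContMDiffAt (𝓡∂ n) 𝓘(ℝ, 𝔼 n) 1 (extChartAt (𝓡∂ n) x₀) x := fun x hx ↦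
    contMDiffAt_extChartAt' (by simpa using hx)
  have hout : ∀ x ∉ K, η =ᶠ[𝓝 x] fun _ ↦ 0 := fun x hx ↦ by
    filter_upwards [hKc.isClosed.isOpen_compl.mem_nhds hx] with z hz using hη0 z hz
  refine ⟨η, K, ?_, ?_, ?_, ?_, hKc, ?_, hη0, ?_⟩
  · intro x
    by_cases hx : x ∈ K
    · exact ((hχc.contMDiff.contMDiffAt).comp x (hψ x hx.1)).congr_of_eventuallyEq
        (hηsource x hx.1)
    · exact contMDiffAt_const.congr_of_eventuallyEq (hout x hx)
  · intro x
    simp only [hη]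
    split_ifs
    · exact Real.smoothTransition.nonneg _
    · exact le_rfl
  · intro x
    simp only [hη]
    split_ifs
    · exact Real.smoothTransition.le_one _
    · exact zero_le_one
  · intro x hx
    simp only [hη, if_pos hx.1, hχ]
    refine Real.smoothTransition.one_of_one_le ((one_le_div hden).2 ?_)
    have : ‖A (extChartAt (𝓡∂ n) x₀ x - p)‖ < t := hx.2
    nlinarith [norm_nonneg (A (extChartAt (𝓡∂ n) x₀ x - p))]
  · exact fun x hx ↦ ⟨hx.1, lt_of_le_of_lt hx.2 hTt'⟩
  · intro x
    have hpos : 0 < t' - t := by linarith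
    by_cases hx : x ∈ K
    swap
    · rw [grad_eq_zero (hout x hx), norm_zero]
      positivity
    refine RobinMoser.norm_grad_le fun v ↦ ?_
    have hxs := hx.1
    have hd : HasFDerivAt χ _ (extChartAt (𝓡∂ n) x₀ x) :=
      (hχc.differentiable one_ne_zero _).hasFDerivAt
    have hm := hd.hasMFDerivAt.comp x ((hψ x hxs).mdifferentiableAt one_ne_zero).hasMFDerivAt
    have hm' : differential η x v = fderiv ℝ χ (extChartAt (𝓡∂ n) x₀ x) (chartDeriv x₀ x v) :=
      DFunLike.congr_fun ((hηsource x hxs).mfderiv_eq.trans hm.mfderiv) v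
    rw [hm']
    change |fderiv ℝ χ (extChartAt (𝓡∂ n) x₀ x) (chartDeriv x₀ x v)| ≤ _
    set y := extChartAt (𝓡∂ n) x₀ x with hy
    have hyT : ‖A (y - p)‖ ≤ T := hx.2
    -- the derivative of the radial profile
    have hfd : fderiv ℝ χ y (chartDeriv x₀ x v) =
        deriv Real.smoothTransition ((T ^ 2 - ‖A (y - p)‖ ^ 2) / (T ^ 2 - t ^ 2)) *
          (-(2 * inner ℝ (A (y - p)) (A (chartDeriv x₀ x v))) / (T ^ 2 - t ^ 2)) := by
      have h1 : HasFDerivAt (fun y ↦ A (y - p))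
          (A : 𝔼 n →L[ℝ] 𝔼 n) y :=
        (A : 𝔼 n →L[ℝ] 𝔼 n).hasFDerivAt.comp y
          ((hasFDerivAt_id y).sub_const p)
      set L₀ : 𝔼 n →L[ℝ] ℝ := (innerSL ℝ (A (y - p))).comp
        (A : 𝔼 n →L[ℝ] 𝔼 n) with hL₀
      have h2 : HasFDerivAt (fun y ↦ (T ^ 2 - ‖A (y - p)‖ ^ 2) / (T ^ 2 - t ^ 2))
          ((T ^ 2 - t ^ 2)⁻¹ • -((2 : ℕ) • L₀) : 𝔼 n →L[ℝ] ℝ) y := by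
        simpa only [div_eq_mul_inv] using
          ((h1.norm_sq).const_sub (T ^ 2)).mul_const ((T ^ 2 - t ^ 2)⁻¹)
      have h3 : HasDerivAt Real.smoothTransition _
          ((T ^ 2 - ‖A (y - p)‖ ^ 2) / (T ^ 2 - t ^ 2)) :=
        ((Real.smoothTransition.contDiff (n := 1)).differentiable one_ne_zero _).hasDerivAt
      have h4 := h3.comp_hasFDerivAt y h2
      have h5 : fderiv ℝ χ y = _ := h4.fderiv
      rw [h5]
      have h6 : inner ℝ (A (y - p)) (A (chartDeriv x₀ x v)) = L₀ (chartDeriv x₀ x v) := rfl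
      rw [h6]
      change deriv Real.smoothTransition ((T ^ 2 - ‖A (y - p)‖ ^ 2) / (T ^ 2 - t ^ 2)) *
        ((T ^ 2 - t ^ 2)⁻¹ * -((2 : ℕ) • L₀ (chartDeriv x₀ x v))) = _
      rw [nsmul_eq_mul]
      push_cast
      ring
    rw [hfd, abs_mul, abs_div, abs_neg, abs_mul, abs_of_pos hden, abs_two]
    have hv : ‖A (chartDeriv x₀ x v)‖ ≤ 11 / 10 * ‖v‖ := by
      have h5 := h.norm_chartDeriv_le y (hsub ⟨extChartAt_mem_halfSpace hxs,
        lt_of_le_of_lt hyT hTt'⟩)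
      rw [(extChartAt (𝓡∂ n) x₀).left_inv hxs] at h5
      exact h5 v
    calc _ ≤ B * (2 * (T * (11 / 10 * ‖v‖)) / (T ^ 2 - t ^ 2)) := by
          gcongr
          · exact hder _
          · refine (abs_real_inner_le_norm _ _).trans ?_
            gcongr
      _ = 22 / 10 * B * T / (T + t) / (T - t) * ‖v‖ := by
          rw [show T ^ 2 - t ^ 2 = (T + t) * (T - t) by ring]
          have : T - t ≠ 0 := by linarith
          have : T + t ≠ 0 := by linarith
          field_simp
          ring
      _ ≤ 5 * B / (t' - t) * ‖v‖ := by
          gcongr ?_ * _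
          have h6 : T - t = (t' - t) / 2 := by rw [hT]; ring
          rw [h6, div_div, div_le_div_iff₀ (by positivity) hpos]
          have h7 : T ≤ T + t := by linarith
          have h8 : B * (t' - t) * T ≤ B * (t' - t) * (T + t) := by gcongr
          have h9 : 0 ≤ B * (t' - t) * (T + t) := by positivity
          nlinarith

end Gradient

/-! ### Sobolev, trace and Poincaré inequalities in a chart -/

section LocalInequalities

variable {n : ℕ} [NeZero n]

lemma norm_sub_le_of_mem_halfBall {A : 𝔼 n ≃L[ℝ] 𝔼 n}
    {p y : 𝔼 n} {t : ℝ} (hy : ‖A (y - p)‖ < t) :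
    ‖y - p‖ ≤ ‖(A.symm : 𝔼 n →L[ℝ] 𝔼 n)‖ * t := by
  have h1 := (A.symm : 𝔼 n →L[ℝ] 𝔼 n).le_opNorm
    (A (y - p))
  simp only [ContinuousLinearEquiv.coe_coe, ContinuousLinearEquiv.symm_apply_apply] at h1
  exact h1.trans (by gcongr)

lemma exists_volume_halfBall_bounds
    (A : 𝔼 n ≃L[ℝ] 𝔼 n) :
    ∃ C : ℝ, 0 < C ∧ ∀ p ∈ halfSpace n, ∀ t : ℝ, 0 < t →
      volume (halfBall A p t) ≤ ofReal (C * t ^ n) ∧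
      ofReal (t ^ n) ≤ ofReal C * volume (halfBall A p t) := by
  set a := ‖(A : 𝔼 n →L[ℝ] 𝔼 n)‖ with ha
  set b := ‖(A.symm : 𝔼 n →L[ℝ] 𝔼 n)‖ with hb
  set v₁ : ℝ := (volume (Metric.ball (0 : 𝔼 n) 1)).toReal with hv₁
  have hv₁e : volume (Metric.ball (0 : 𝔼 n) 1) = ofReal v₁ :=
    (ENNReal.ofReal_toReal measure_ball_lt_top.ne).symm
  have hv₁0 : 0 < v₁ := ENNReal.toReal_pos (Metric.measure_ball_pos _ _ one_pos).ne'
    measure_ball_lt_top.ne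
  have hball : ∀ (x : 𝔼 n) (s : ℝ), 0 ≤ s →
      volume (Metric.ball x s) = ofReal (s ^ n * v₁) := fun x s hs ↦ by
    rw [Measure.addHaar_ball _ x hs, hv₁e, finrank_euclideanSpace_fin,
      ← ENNReal.ofReal_mul (by positivity)]
  refine ⟨max ((b + 1) ^ n * v₁) ((2 * (a + 1)) ^ n / v₁), by positivity, fun p hp t ht ↦ ⟨?_, ?_⟩⟩
  · calc _ ≤ volume (Metric.ball p ((b + 1) * t)) := by
          refine measure_mono fun y hy ↦ ?_
          rw [Metric.mem_ball, dist_eq_norm]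
          refine (norm_sub_le_of_mem_halfBall hy.2).trans_lt ?_
          rw [← hb]
          nlinarith
      _ = ofReal ((b + 1) ^ n * v₁ * t ^ n) := by
          rw [hball _ _ (by positivity), mul_pow]
          congr 1
          ring
      _ ≤ _ := ENNReal.ofReal_le_ofReal (by gcongr; exact le_max_left _ _)
  · have ha1 : a + 1 ≠ 0 := by positivity
    set s : ℝ := t / (a + 1) with hs
    have hs0 : 0 < s := by positivity
    -- a ball of half the radius, tangent to the boundary hyperplane in the worst case
    have hsub : Metric.ball (p + (s / 2) • EuclideanSpace.single (0 : Fin n) (1 : ℝ)) (s / 2) ⊆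
        halfBall A p t := by
      intro y hy
      rw [Metric.mem_ball, dist_eq_norm] at hy
      constructor
      · have h1 := PiLp.norm_apply_le
          (y - (p + (s / 2) • EuclideanSpace.single (0 : Fin n) (1 : ℝ))) 0
        rw [Real.norm_eq_abs] at h1
        have h2 : (y - (p + (s / 2) • EuclideanSpace.single (0 : Fin n) (1 : ℝ))) 0 =
            y 0 - (p 0 + s / 2) := by simp
        rw [h2] at h1
        have hp' : 0 ≤ p 0 := hp
        have := (abs_le.1 (h1.trans hy.le)).1
        change 0 ≤ y 0
        linarith
      · have h1 : ‖y - p‖ < s := by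
          calc ‖y - p‖ = ‖(y - (p + (s / 2) • EuclideanSpace.single (0 : Fin n) (1 : ℝ))) +
                (s / 2) • EuclideanSpace.single (0 : Fin n) (1 : ℝ)‖ := by congr 1; abel
            _ ≤ _ := norm_add_le _ _
            _ < s / 2 + s / 2 := by
                refine add_lt_add_of_lt_of_le hy ?_
                rw [norm_smul, PiLp.norm_single, norm_one, mul_one, Real.norm_eq_abs,
                  abs_of_pos (by positivity)]
            _ = s := by ring
        change ‖A (y - p)‖ < t
        calc ‖A (y - p)‖ ≤ a * ‖y - p‖ :=
              (A : 𝔼 n →L[ℝ] 𝔼 n).le_opNorm _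
          _ ≤ a * s := by gcongr
          _ < (a + 1) * s := by nlinarith
          _ = t := by rw [hs]; field_simp
    calc ofReal (t ^ n) = ofReal ((2 * (a + 1)) ^ n / v₁) *
          ofReal ((s / 2) ^ n * v₁) := by
          rw [← ENNReal.ofReal_mul (by positivity)]
          have h1 : t = 2 * (a + 1) * (s / 2) := by rw [hs]; field_simp
          congr 1
          rw [h1, mul_pow]
          field_simp
      _ ≤ _ := by
          rw [← hball (p + (s / 2) • EuclideanSpace.single (0 : Fin n) (1 : ℝ)) (s / 2)
            (by positivity)]
          gcongr
          exact le_max_right _ _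

variable {M : Type*} [EMetricSpace M] [ChartedSpace (EuclideanHalfSpace n) M]
  [RiemannianBundle (fun x : M ↦ TangentSpace (𝓡∂ n) x)]
  {x₀ : M} {A : 𝔼 n ≃L[ℝ] 𝔼 n} {R ρ : ℝ}

/-- A function on `M`, read in the chart and extended by zero. -/
def chartExtend (x₀ : M) (A : 𝔼 n ≃L[ℝ] 𝔼 n) (R : ℝ)
    (φ : M → ℝ) : 𝔼 n → ℝ :=
  (halfBall A (extChartAt (𝓡∂ n) x₀ x₀) R).indicator fun y ↦ φ ((extChartAt (𝓡∂ n) x₀).symm y)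

namespace IsAlmostFlat

lemma halfBall_mem_nhdsWithin {c y : 𝔼 n}
    (hy : y ∈ halfBall A c R) : halfBall A c R ∈ 𝓝[halfSpace n] y := by
  rw [halfBall, inter_comm]
  exact inter_mem_nhdsWithin' hy.2
where
  inter_mem_nhdsWithin' {c y : 𝔼 n} (hy : ‖A (y - c)‖ < R) :
      {y | ‖A (y - c)‖ < R} ∩ halfSpace n ∈ 𝓝[halfSpace n] y := by
    rw [inter_comm]
    exact inter_mem_nhdsWithin _ ((isOpen_norm_sub_lt A c R).mem_nhds hy)

lemma chartExtend_eventuallyEq (φ : M → ℝ) {y : 𝔼 n}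
    (hy : y ∈ halfBall A (extChartAt (𝓡∂ n) x₀ x₀) R) :
    chartExtend x₀ A R φ =ᶠ[𝓝[halfSpace n] y] fun z ↦ φ ((extChartAt (𝓡∂ n) x₀).symm z) := by
  filter_upwards [halfBall_mem_nhdsWithin hy] with z hz using indicator_of_mem hz _

lemma chartExtend_eventuallyEq_zero (h : IsAlmostFlat x₀ A R ρ) {φ : M → ℝ} {K : Set M}
    (hK : IsCompact K) (hKW : K ⊆ chartBall x₀ A (extChartAt (𝓡∂ n) x₀ x₀) R)
    (hφ : ∀ x ∉ K, φ x = 0) {y : 𝔼 n}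
    (hy : y ∉ halfBall A (extChartAt (𝓡∂ n) x₀ x₀) R) :
    chartExtend x₀ A R φ =ᶠ[𝓝[halfSpace n] y] fun _ ↦ 0 := by
  have hc : IsCompact (extChartAt (𝓡∂ n) x₀ '' K) :=
    hK.image_of_continuousOn ((continuousOn_extChartAt x₀).mono fun x hx ↦ (hKW hx).1)
  have hyK : y ∉ extChartAt (𝓡∂ n) x₀ '' K := by
    rintro ⟨x, hx, rfl⟩
    exact hy (extChartAt_mem_halfBall (hKW hx))
  filter_upwards [nhdsWithin_le_nhds (hc.isClosed.isOpen_compl.mem_nhds hyK)] with z hz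
  by_cases hzD : z ∈ halfBall A (extChartAt (𝓡∂ n) x₀ x₀) R
  · rw [chartExtend, indicator_of_mem hzD]
    refine hφ _ fun hzK ↦ hz ⟨_, hzK, (extChartAt (𝓡∂ n) x₀).right_inv (h.subset_target hzD)⟩
  · exact indicator_of_notMem hzD _

lemma chartExtend_eq_zero_of_norm (φ : M → ℝ) {y : 𝔼 n}
    (hy : ‖extChartAt (𝓡∂ n) x₀ x₀‖ +
      ‖(A.symm : 𝔼 n →L[ℝ] 𝔼 n)‖ * R < ‖y‖) :
    chartExtend x₀ A R φ y = 0 := by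
  refine indicator_of_notMem (fun hyD ↦ ?_) _
  have h1 := norm_sub_le_of_mem_halfBall hyD.2
  have h2 := norm_le_norm_add_norm_sub' y (extChartAt (𝓡∂ n) x₀ x₀)
  linarith

variable [IsManifold (𝓡∂ n) 1 M]

lemma contDiffOn_comp_symm (h : IsAlmostFlat x₀ A R ρ) {φ : M → ℝ}
    (hφc : ContMDiff (𝓡∂ n) 𝓘(ℝ, ℝ) 1 φ) :
    ContDiffOn ℝ 1 (fun z ↦ φ ((extChartAt (𝓡∂ n) x₀).symm z))
      (halfBall A (extChartAt (𝓡∂ n) x₀ x₀) R) :=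
  (contMDiffOn_iff_contDiffOn.1 (hφc.comp_contMDiffOn (contMDiffOn_extChartAt_symm x₀))).mono
    h.subset_target

lemma contDiffOn_chartExtend (h : IsAlmostFlat x₀ A R ρ) {φ : M → ℝ} {K : Set M}
    (hφc : ContMDiff (𝓡∂ n) 𝓘(ℝ, ℝ) 1 φ)
    (hK : IsCompact K) (hKW : K ⊆ chartBall x₀ A (extChartAt (𝓡∂ n) x₀ x₀) R)
    (hφ : ∀ x ∉ K, φ x = 0) : ContDiffOn ℝ 1 (chartExtend x₀ A R φ) (halfSpace n) := by
  intro y hy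
  by_cases hyD : y ∈ halfBall A (extChartAt (𝓡∂ n) x₀ x₀) R
  · exact ((h.contDiffOn_comp_symm hφc y hyD).mono_of_mem_nhdsWithin
      (halfBall_mem_nhdsWithin hyD)).congr_of_eventuallyEq (chartExtend_eventuallyEq φ hyD)
      (indicator_of_mem hyD _)
  · exact contDiffWithinAt_const.congr_of_eventuallyEq
      (h.chartExtend_eventuallyEq_zero hK hKW hφ hyD) (indicator_of_notMem hyD _)

lemma enorm_fderivWithin_chartExtend_le (h : IsAlmostFlat x₀ A R ρ) {φ : M → ℝ} {K : Set M}
    (hφc : ContMDiff (𝓡∂ n) 𝓘(ℝ, ℝ) 1 φ)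
    (hK : IsCompact K) (hKW : K ⊆ chartBall x₀ A (extChartAt (𝓡∂ n) x₀ x₀) R)
    (hφ : ∀ x ∉ K, φ x = 0) (y : 𝔼 n) (hy : y ∈ halfSpace n) :
    ‖fderivWithin ℝ (chartExtend x₀ A R φ) (halfSpace n) y‖ₑ ≤
      (halfBall A (extChartAt (𝓡∂ n) x₀ x₀) R).indicator (fun y ↦ ofReal
        (11 / 10 * ‖(A : 𝔼 n →L[ℝ] 𝔼 n)‖) *
          ‖grad (n := n) φ ((extChartAt (𝓡∂ n) x₀).symm y)‖ₑ) y := by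
  by_cases hyD : y ∈ halfBall A (extChartAt (𝓡∂ n) x₀ x₀) R
  · rw [indicator_of_mem hyD, (chartExtend_eventuallyEq φ hyD).fderivWithin_eq
      (indicator_of_mem hyD _), ← ofReal_norm, ← ofReal_norm,
      ← ENNReal.ofReal_mul (by positivity)]
    exact ENNReal.ofReal_le_ofReal (h.norm_fderivWithin_le hyD
      (hφc.mdifferentiable one_ne_zero _))
  · rw [indicator_of_notMem hyD, (h.chartExtend_eventuallyEq_zero hK hKW hφ hyD).fderivWithin_eq
      (indicator_of_notMem hyD _), ← ofReal_norm]
    simp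

variable [MeasurableSpace M] [BorelSpace M]

/-- The gradient terms in the chart are controlled by those on the manifold. -/
lemma exists_lintegral_fderivWithin_le (h : IsAlmostFlat x₀ A R ρ) (k : ℕ) (hk : k ≠ 0) :
    ∃ C : ℝ≥0∞, C ≠ ⊤ ∧ ∀ (φ : M → ℝ) (K : Set M), ContMDiff (𝓡∂ n) 𝓘(ℝ, ℝ) 1 φ → IsCompact K →
      K ⊆ chartBall x₀ A (extChartAt (𝓡∂ n) x₀ x₀) R → (∀ x ∉ K, φ x = 0) →
      ∫⁻ y in halfSpace n, ‖fderivWithin ℝ (chartExtend x₀ A R φ) (halfSpace n) y‖ₑ ^ k ≤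
        C * ∫⁻ x, ‖grad (n := n) φ x‖ₑ ^ k ∂volM n M := by
  set a : ℝ≥0∞ := ofReal
    (11 / 10 * ‖(A : 𝔼 n →L[ℝ] 𝔼 n)‖) with ha
  set b : ℝ≥0∞ := ((11 / 10 *
    ‖(A.symm : 𝔼 n →L[ℝ] 𝔼 n)‖₊ : NNReal) : ℝ≥0∞) with hb
  have ha' : a ^ k ≠ ⊤ := ENNReal.pow_ne_top ENNReal.ofReal_ne_top
  refine ⟨a ^ k * b ^ n, ENNReal.mul_ne_top ha' (ENNReal.pow_ne_top ENNReal.coe_ne_top),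
    fun φ K hφc hK hKW hφ ↦ ?_⟩
  calc _ ≤ ∫⁻ y in halfSpace n, (halfBall A (extChartAt (𝓡∂ n) x₀ x₀) R).indicator (fun y ↦
        a ^ k * ‖grad (n := n) φ ((extChartAt (𝓡∂ n) x₀).symm y)‖ₑ ^ k) y := by
        refine setLIntegral_mono' measurableSet_halfSpace fun y hy ↦ ?_
        have h1 := h.enorm_fderivWithin_chartExtend_le hφc hK hKW hφ y hy
        refine (pow_le_pow_left' h1 k).trans ?_
        by_cases hyD : y ∈ halfBall A (extChartAt (𝓡∂ n) x₀ x₀) R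
        · rw [indicator_of_mem hyD, indicator_of_mem hyD, mul_pow]
        · rw [indicator_of_notMem hyD, indicator_of_notMem hyD, zero_pow hk]
    _ ≤ _ := setLIntegral_le_lintegral _ _
    _ = a ^ k * ∫⁻ y in halfBall A (extChartAt (𝓡∂ n) x₀ x₀) R,
        ‖grad (n := n) φ ((extChartAt (𝓡∂ n) x₀).symm y)‖ₑ ^ k := by
        rw [lintegral_indicator (measurableSet_halfBall _ _ _), lintegral_const_mul' _ _ ha']
    _ ≤ a ^ k * (b ^ n * ∫⁻ x in chartBall x₀ A (extChartAt (𝓡∂ n) x₀ x₀) R,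
        ‖grad (n := n) φ ((extChartAt (𝓡∂ n) x₀).symm (extChartAt (𝓡∂ n) x₀ x))‖ₑ ^ k
          ∂volM n M) := by
        gcongr
        exact h.lintegral_halfBall_le le_rfl
          fun y ↦ ‖grad (n := n) φ ((extChartAt (𝓡∂ n) x₀).symm y)‖ₑ ^ k
    _ = a ^ k * (b ^ n * ∫⁻ x in chartBall x₀ A (extChartAt (𝓡∂ n) x₀ x₀) R,
        ‖grad (n := n) φ x‖ₑ ^ k ∂volM n M) := by
        congr 2
        refine setLIntegral_congr_fun (isOpen_chartBall _ _ _ _).measurableSet fun x hx ↦ ?_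
        rw [(extChartAt (𝓡∂ n) x₀).left_inv hx.1]
    _ ≤ _ := by
        rw [← mul_assoc]
        exact mul_le_mul_right (setLIntegral_le_lintegral _ _) _

lemma lintegral_eq_setLIntegral {X : Type*} [MeasurableSpace X] {μ : Measure X} {W : Set X}
    (hW : MeasurableSet W) {f : X → ℝ≥0∞} (hf : ∀ x ∉ W, f x = 0) :
    ∫⁻ x, f x ∂μ = ∫⁻ x in W, f x ∂μ := by
  rw [← lintegral_indicator hW]
  congr 1
  exact (indicator_eq_self.2 fun x hx ↦ by_contra fun hxW ↦ hx (hf x hxW)).symm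

/-- The Sobolev inequality for functions supported in the chart. -/
lemma exists_sobolev (hn : 3 ≤ n) (h : IsAlmostFlat x₀ A R ρ) : ∃ C : ℝ≥0∞, C ≠ ⊤ ∧
    ∀ (φ : M → ℝ) (K : Set M), ContMDiff (𝓡∂ n) 𝓘(ℝ, ℝ) 1 φ → IsCompact K →
      K ⊆ chartBall x₀ A (extChartAt (𝓡∂ n) x₀ x₀) R → (∀ x ∉ K, φ x = 0) →
      (∫⁻ x, ‖φ x‖ₑ ^ (2 * ((n : ℝ) / ((n : ℝ) - 2))) ∂volM n M) ^
          (1 / ((n : ℝ) / ((n : ℝ) - 2))) ≤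
        C * ∫⁻ x, ‖grad (n := n) φ x‖ₑ ^ 2 ∂volM n M := by
  obtain ⟨C₁, hC₁, hsob⟩ := exists_sobolev_halfSpace hn
  obtain ⟨C₂, hC₂, hgrad⟩ := h.exists_lintegral_fderivWithin_le 2 two_ne_zero
  have hn' : (3 : ℝ) ≤ n := by exact_mod_cast hn
  set κ : ℝ := (n : ℝ) / ((n : ℝ) - 2) with hκ
  have hκ0 : 0 < κ := div_pos (by linarith) (by linarith)
  set L : ℝ≥0∞ := ((11 / 10 * ‖(A : 𝔼 n →L[ℝ] 𝔼 n)‖₊ :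
    NNReal) : ℝ≥0∞) ^ n with hL
  refine ⟨L ^ (1 / κ) * (C₁ * C₂), ENNReal.mul_ne_top (ENNReal.rpow_ne_top_of_nonneg
    (by positivity) (ENNReal.pow_ne_top ENNReal.coe_ne_top)) (ENNReal.mul_ne_top hC₁ hC₂),
    fun φ K hφc hK hKW hφ ↦ ?_⟩
  have h1 : ∫⁻ x, ‖φ x‖ₑ ^ (2 * κ) ∂volM n M ≤
      L * ∫⁻ y in halfSpace n, ‖chartExtend x₀ A R φ y‖ₑ ^ (2 * κ) := by
    rw [lintegral_eq_setLIntegral (isOpen_chartBall x₀ A (extChartAt (𝓡∂ n) x₀ x₀) R).measurableSet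
      fun x hx ↦ by rw [hφ x fun hxK ↦ hx (hKW hxK), enorm_zero,
        ENNReal.zero_rpow_of_pos (by positivity)]]
    refine (h.lintegral_chartBall_le le_rfl _).trans ?_
    refine mul_le_mul_right ?_ _
    calc ∫⁻ y in halfBall A (extChartAt (𝓡∂ n) x₀ x₀) R,
          ‖φ ((extChartAt (𝓡∂ n) x₀).symm y)‖ₑ ^ (2 * κ)
        = ∫⁻ y in halfBall A (extChartAt (𝓡∂ n) x₀ x₀) R,
          ‖chartExtend x₀ A R φ y‖ₑ ^ (2 * κ) := by
          refine setLIntegral_congr_fun (measurableSet_halfBall _ _ _) fun y hy ↦ ?_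
          rw [chartExtend, indicator_of_mem hy]
      _ ≤ _ := lintegral_mono_set inter_subset_left
  calc _ ≤ (L * ∫⁻ y in halfSpace n, ‖chartExtend x₀ A R φ y‖ₑ ^ (2 * κ)) ^ (1 / κ) := by gcongr
    _ = L ^ (1 / κ) * (∫⁻ y in halfSpace n, ‖chartExtend x₀ A R φ y‖ₑ ^ (2 * κ)) ^ (1 / κ) :=
        ENNReal.mul_rpow_of_nonneg _ _ (by positivity)
    _ ≤ L ^ (1 / κ) * (C₁ * (C₂ * ∫⁻ x, ‖grad (n := n) φ x‖ₑ ^ 2 ∂volM n M)) := by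
        gcongr
        refine (hsob _ _ (h.contDiffOn_chartExtend hφc hK hKW hφ)
          fun y _ hy ↦ chartExtend_eq_zero_of_norm φ hy).trans ?_
        gcongr
        exact hgrad φ K hφc hK hKW hφ
    _ = _ := by ring

/-- The trace inequality for functions supported in the chart. -/
lemma exists_trace (h : IsAlmostFlat x₀ A R ρ) : ∃ C : ℝ≥0∞, C ≠ ⊤ ∧
    ∀ (φ : M → ℝ) (K : Set M), ContMDiff (𝓡∂ n) 𝓘(ℝ, ℝ) 1 φ → IsCompact K →
      K ⊆ chartBall x₀ A (extChartAt (𝓡∂ n) x₀ x₀) R → (∀ x ∉ K, φ x = 0) →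
      ∫⁻ x, ‖φ x‖ₑ ∂volBoundary n M ≤ C * ∫⁻ x, ‖grad (n := n) φ x‖ₑ ∂volM n M := by
  obtain ⟨C₂, hC₂, hgrad⟩ := h.exists_lintegral_fderivWithin_le 1 one_ne_zero
  set L : ℝ≥0∞ := ((11 / 10 * ‖(A : 𝔼 n →L[ℝ] 𝔼 n)‖₊ :
    NNReal) : ℝ≥0∞) ^ (n - 1) with hL
  refine ⟨L * C₂, ENNReal.mul_ne_top (ENNReal.pow_ne_top ENNReal.coe_ne_top) hC₂,
    fun φ K hφc hK hKW hφ ↦ ?_⟩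
  rw [lintegral_eq_setLIntegral (isOpen_chartBall x₀ A (extChartAt (𝓡∂ n) x₀ x₀) R).measurableSet
      fun x hx ↦ by rw [hφ x fun hxK ↦ hx (hKW hxK), enorm_zero]]
  refine (h.lintegral_boundary_chartBall_le le_rfl _).trans ?_
  rw [mul_assoc]
  gcongr
  calc ∫⁻ y in halfBall A (extChartAt (𝓡∂ n) x₀ x₀) R ∩ {y | y 0 = 0},
        ‖φ ((extChartAt (𝓡∂ n) x₀).symm y)‖ₑ ∂(μHE[n - 1] : Measure (𝔼 n))
      = ∫⁻ y in halfBall A (extChartAt (𝓡∂ n) x₀ x₀) R ∩ {y | y 0 = 0},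
        ‖chartExtend x₀ A R φ y‖ₑ ∂(μHE[n - 1] : Measure (𝔼 n)) := by
        refine setLIntegral_congr_fun ((measurableSet_halfBall _ _ _).inter
          (isClosed_singleton.preimage continuous_coord_zero).measurableSet) fun y hy ↦ ?_
        rw [chartExtend, indicator_of_mem hy.1]
    _ ≤ ∫⁻ y in {y | y 0 = 0}, ‖chartExtend x₀ A R φ y‖ₑ
        ∂(μHE[n - 1] : Measure (𝔼 n)) := lintegral_mono_set inter_subset_right
    _ ≤ _ := lintegral_trace_halfSpace_le _ _ (h.contDiffOn_chartExtend hφc hK hKW hφ)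
        fun y _ hy ↦ chartExtend_eq_zero_of_norm φ hy
    _ ≤ _ := by simpa only [pow_one] using hgrad φ K hφc hK hKW hφ

/-- Chart balls of radius `t` have volume comparable to `t ^ n`, also those that the boundary cuts:
the centre lies in the closed half-space, so at least half of the ellipsoid remains. -/
lemma exists_volM_chartBall_bounds (h : IsAlmostFlat x₀ A R ρ) :
    ∃ C : ℝ, 0 < C ∧ ∀ p ∈ halfSpace n, ∀ t : ℝ, 0 < t →
      halfBall A p t ⊆ halfBall A (extChartAt (𝓡∂ n) x₀ x₀) R →
      volM n M (chartBall x₀ A p t) ≤ ofReal (C * t ^ n) ∧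
      ofReal (t ^ n) ≤ ofReal C * volM n M (chartBall x₀ A p t) := by
  obtain ⟨C, hC, hvol⟩ := exists_volume_halfBall_bounds A
  set a := 11 / 10 * ‖(A : 𝔼 n →L[ℝ] 𝔼 n)‖ with ha
  set b := 11 / 10 * ‖(A.symm : 𝔼 n →L[ℝ] 𝔼 n)‖ with hb
  refine ⟨max (a ^ n * C) (C * b ^ n) + 1, by positivity, fun p hp t ht hsub ↦ ⟨?_, ?_⟩⟩
  · have h1 := h.lintegral_chartBall_le hsub fun _ ↦ 1
    simp only [setLIntegral_const, one_mul, coe_mul_nnnorm, ← ha] at h1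
    refine h1.trans ((mul_le_mul_right (hvol p hp t ht).1 _).trans ?_)
    rw [← ENNReal.ofReal_pow (by positivity), ← ENNReal.ofReal_mul (by positivity), ← mul_assoc]
    refine ENNReal.ofReal_le_ofReal ?_
    gcongr
    linarith [le_max_left (a ^ n * C) (C * b ^ n)]
  · have h1 := h.lintegral_halfBall_le hsub fun _ ↦ 1
    simp only [setLIntegral_const, one_mul, coe_mul_nnnorm, ← hb] at h1
    refine ((hvol p hp t ht).2.trans (mul_le_mul_right h1 _)).trans ?_
    rw [← ENNReal.ofReal_pow (by positivity), ← mul_assoc, ← ENNReal.ofReal_mul hC.le]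
    gcongr
    linarith [le_max_right (a ^ n * C) (C * b ^ n)]

/-- The Poincaré inequality on chart balls. -/
lemma exists_poincare (h : IsAlmostFlat x₀ A R ρ) : ∃ C : ℝ, 0 < C ∧
    ∀ (φ : M → ℝ), ContMDiff (𝓡∂ n) 𝓘(ℝ, ℝ) 1 φ → ∀ p ∈ halfSpace n, ∀ t : ℝ, 0 < t →
      halfBall A p t ⊆ halfBall A (extChartAt (𝓡∂ n) x₀ x₀) R →
      ∫⁻ x in chartBall x₀ A p t, ∫⁻ z in chartBall x₀ A p t, ‖φ x - φ z‖ₑ ^ 2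
          ∂volM n M ∂volM n M ≤
        ofReal (C * t ^ (n + 2)) *
          ∫⁻ x in chartBall x₀ A p t, ‖grad (n := n) φ x‖ₑ ^ 2 ∂volM n M := by
  obtain ⟨C, hC, hvol⟩ := exists_volume_halfBall_bounds A
  set a := 11 / 10 * ‖(A : 𝔼 n →L[ℝ] 𝔼 n)‖ with ha
  set b := 11 / 10 * ‖(A.symm : 𝔼 n →L[ℝ] 𝔼 n)‖ with hb
  refine ⟨a ^ n * a ^ n * (2 ^ n * (2 * b) ^ 2 * C * a ^ 2 * b ^ n) + 1, by positivity,
    fun φ hφ p hp t ht hsub ↦ ?_⟩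
  set ψ := extChartAt (𝓡∂ n) x₀ with hψ
  set g : 𝔼 n → 𝔼 n →L[ℝ] ℝ :=
    fderivWithin ℝ (fun z ↦ φ (ψ.symm z)) (halfSpace n) with hg
  have hcd := h.contDiffOn_comp_symm hφ
  have hderiv : ∀ y ∈ halfBall A p t, HasFDerivWithinAt (fun z ↦ φ (ψ.symm z)) (g y)
      (halfSpace n) y := fun y hy ↦
    (hasFDerivWithinAt_comp_symm (h.subset_target (hsub hy))
      (hφ.mdifferentiable one_ne_zero _)).differentiableWithinAt.hasFDerivWithinAt
  have hgc : ContinuousOn g (halfBall A p t) := by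
    intro y hy
    have h1 : ContDiffWithinAt ℝ 1 (fun z ↦ φ (ψ.symm z)) (halfSpace n) y :=
      (hcd y (hsub hy)).mono_of_mem_nhdsWithin (halfBall_mem_nhdsWithin (hsub hy))
    have h2 := h1.fderivWithin_right (m := 0) uniqueDiffOn_halfSpace le_rfl hy.1
    exact h2.continuousWithinAt.mono inter_subset_left
  have hflat := lintegral_sub_sq_le_of_convex (convex_halfBall A p t)
    (measurableSet_halfBall A p t) (δ := 2 * b * t) (h := fun z ↦ φ (ψ.symm z)) (h' := g)
    (fun y hy z hz ↦ by
      have h1 := norm_sub_le_of_mem_halfBall hy.2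
      have h2 := norm_sub_le_of_mem_halfBall hz.2
      have h3 : ‖z - y‖ ≤ ‖z - p‖ + ‖y - p‖ := by
        rw [← sub_sub_sub_cancel_right z y p]; exact norm_sub_le _ _
      have h4 : 0 ≤ ‖(A.symm : 𝔼 n →L[ℝ] 𝔼 n)‖ * t := by
        positivity
      rw [hb]
      linarith) (fun y hy ↦ (hderiv y hy).mono inter_subset_left) hgc
  have hgrad : ∫⁻ y in halfBall A p t, ‖g y‖ₑ ^ 2 ≤ ofReal (a ^ 2 * b ^ n) *
      ∫⁻ x in chartBall x₀ A p t, ‖grad (n := n) φ x‖ₑ ^ 2 ∂volM n M := by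
    calc _ ≤ ∫⁻ y in halfBall A p t, ofReal (a ^ 2) *
          ‖grad (n := n) φ (ψ.symm y)‖ₑ ^ 2 := by
          refine setLIntegral_mono' (measurableSet_halfBall A p t) fun y hy ↦ ?_
          rw [ENNReal.ofReal_pow (by positivity), ← mul_pow, ← ofReal_norm, ← ofReal_norm,
            ← ENNReal.ofReal_mul (by positivity)]
          gcongr
          exact h.norm_fderivWithin_le (hsub hy) (hφ.mdifferentiable one_ne_zero _)
      _ = ofReal (a ^ 2) * ∫⁻ y in halfBall A p t,
          ‖grad (n := n) φ (ψ.symm y)‖ₑ ^ 2 := lintegral_const_mul' _ _ ENNReal.ofReal_ne_top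
      _ ≤ ofReal (a ^ 2) * (ofReal b ^ n * ∫⁻ x in chartBall x₀ A p t,
          ‖grad (n := n) φ (ψ.symm (ψ x))‖ₑ ^ 2 ∂volM n M) := by
          gcongr
          have := h.lintegral_halfBall_le hsub fun y ↦ ‖grad (n := n) φ (ψ.symm y)‖ₑ ^ 2
          rwa [coe_mul_nnnorm] at this
      _ = _ := by
          rw [← mul_assoc, ENNReal.ofReal_mul (q := b ^ n) (by positivity),
            ENNReal.ofReal_pow (p := b) (by positivity)]
          congr 1
          refine setLIntegral_congr_fun (isOpen_chartBall _ _ _ _).measurableSet fun x hx ↦ ?_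
          rw [hψ, (extChartAt (𝓡∂ n) x₀).left_inv hx.1]
  calc _ ≤ ∫⁻ x in chartBall x₀ A p t, ofReal a ^ n *
        ∫⁻ z in halfBall A p t, ‖φ x - φ (ψ.symm z)‖ₑ ^ 2 ∂volume ∂volM n M := by
        refine lintegral_mono fun x ↦ ?_
        have := h.lintegral_chartBall_le hsub fun z ↦ ‖φ x - φ z‖ₑ ^ 2
        rwa [coe_mul_nnnorm] at this
    _ = ofReal a ^ n * ∫⁻ x in chartBall x₀ A p t,
        ∫⁻ z in halfBall A p t, ‖φ x - φ (ψ.symm z)‖ₑ ^ 2 ∂volume ∂volM n M :=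
        lintegral_const_mul' _ _ (ENNReal.pow_ne_top ENNReal.ofReal_ne_top)
    _ ≤ ofReal a ^ n * (ofReal a ^ n * ∫⁻ y in halfBall A p t,
        ∫⁻ z in halfBall A p t, ‖φ (ψ.symm y) - φ (ψ.symm z)‖ₑ ^ 2) := by
        gcongr
        have := h.lintegral_chartBall_le hsub
          fun x ↦ ∫⁻ z in halfBall A p t, ‖φ x - φ (ψ.symm z)‖ₑ ^ 2
        rwa [coe_mul_nnnorm] at this
    _ ≤ ofReal a ^ n * (ofReal a ^ n * (2 ^ n *
        ofReal ((2 * b * t) ^ 2) * ofReal (C * t ^ n) *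
          (ofReal (a ^ 2 * b ^ n) *
      ∫⁻ x in chartBall x₀ A p t, ‖grad (n := n) φ x‖ₑ ^ 2 ∂volM n M))) := by
        gcongr
        refine hflat.trans ?_
        gcongr
        exact (hvol p hp t ht).1
    _ = ofReal (a ^ n * a ^ n * (2 ^ n * (2 * b) ^ 2 * C * a ^ 2 * b ^ n) * t ^ (n + 2)) *
          ∫⁻ x in chartBall x₀ A p t, ‖grad (n := n) φ x‖ₑ ^ 2 ∂volM n M := by
        have h2 : (2 : ℝ≥0∞) ^ n = ofReal (2 ^ n) := by
          rw [ENNReal.ofReal_pow (by norm_num)]; simp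
        rw [h2, ← ENNReal.ofReal_pow (by positivity)]
        simp only [← mul_assoc]
        rw [← ENNReal.ofReal_mul (by positivity), ← ENNReal.ofReal_mul (by positivity),
          ← ENNReal.ofReal_mul (by positivity), ← ENNReal.ofReal_mul (by positivity),
          ← ENNReal.ofReal_mul (by positivity)]
        congr 2
        ring
    _ ≤ _ := by
        gcongr
        linarith

end IsAlmostFlat

end LocalInequalities

/-! ### Measurability of gradients -/

section Measurability

variable {n : ℕ} [NeZero n] {M : Type*} [EMetricSpace M]
  [ChartedSpace (EuclideanHalfSpace n) M] [IsManifold (𝓡∂ n) 1 M]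
  [RiemannianBundle (fun x : M ↦ TangentSpace (𝓡∂ n) x)]
  [IsContinuousRiemannianBundle (𝔼 n) (fun x : M ↦ TangentSpace (𝓡∂ n) x)]

/-- Near a point `x₀` the length of the gradient is at least the derivative along the section whose
coordinates are those of the gradient at `x₀`, divided by the length of that section, and this
quotient is continuous. Lower semicontinuity yields measurability without a measurable frame. -/
lemma lowerSemicontinuous_norm_grad {φ : M → ℝ} (hφ : ContMDiff (𝓡∂ n) 𝓘(ℝ, ℝ) 1 φ) :
    LowerSemicontinuous fun x ↦ ‖grad (n := n) φ x‖ := by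
  intro x₀ c hc
  rcases lt_or_ge c 0 with hc0 | hc0
  · exact Eventually.of_forall fun x ↦ hc0.trans_le (norm_nonneg _)
  set g₀ := grad (n := n) φ x₀ with hg₀
  have hg0 : 0 < ‖g₀‖ := hc0.trans_lt hc
  obtain ⟨b, hcb, hbg⟩ := exists_between hc
  have hb0 : 0 < b := hc0.trans_lt hcb
  -- a factor that leaves room between `c` and `‖g₀‖`
  obtain ⟨t, ht1, hct⟩ : ∃ t : ℝ, 1 < t ∧ c * t ≤ b := by
    rcases eq_or_lt_of_le hc0 with h | h
    · exact ⟨2, by norm_num, by rw [← h]; linarith⟩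
    · exact ⟨b / c, (one_lt_div h).2 hcb, by rw [mul_div_cancel₀ _ h.ne']⟩
  set T := trivializationAt (𝔼 n)
    (fun x : M ↦ TangentSpace (𝓡∂ n) x) x₀ with hT
  have hx₀ : x₀ ∈ T.baseSet := FiberBundle.mem_baseSet_trivializationAt' x₀
  set w : 𝔼 n := T.continuousLinearMapAt ℝ x₀ g₀ with hw
  have hsource : (chartAt (EuclideanHalfSpace n) x₀).source ∈ 𝓝 x₀ := chart_source_mem_nhds _ x₀
  set f : 𝔼 n → ℝ := fun z ↦ φ ((extChartAt (𝓡∂ n) x₀).symm z) with hf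
  have hcd : ContDiffOn ℝ 1 f (extChartAt (𝓡∂ n) x₀).target :=
    contMDiffOn_iff_contDiffOn.1 (hφ.comp_contMDiffOn (contMDiffOn_extChartAt_symm x₀))
  -- the derivative of `φ` along the section with constant coordinates `w`
  have hsec : ∀ x ∈ (chartAt (EuclideanHalfSpace n) x₀).source,
      differential φ x (T.symmL ℝ x w) =
        fderivWithin ℝ f (halfSpace n) (extChartAt (𝓡∂ n) x₀ x) w := by
    intro x hxs
    have hxs' : x ∈ (extChartAt (𝓡∂ n) x₀).source := by simpa using hxs
    have hl : (extChartAt (𝓡∂ n) x₀).symm (extChartAt (𝓡∂ n) x₀ x) = x :=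
      (extChartAt (𝓡∂ n) x₀).left_inv hxs'
    have h1 := (hasFDerivWithinAt_comp_symm ((extChartAt (𝓡∂ n) x₀).map_source hxs')
      (hφ.mdifferentiable one_ne_zero _)).fderivWithin
        (uniqueDiffOn_halfSpace _ (extChartAt_mem_halfSpace hxs'))
    have h2 := DFunLike.congr_fun (TangentBundle.symmL_trivializationAt (I := 𝓡∂ n) hxs) w
    have h3 : ∀ z : M, z = x → ∀ v : 𝔼 n,
        differential φ z (show TangentSpace (𝓡∂ n) z from v) =
        differential φ x (show TangentSpace (𝓡∂ n) x from v) := by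
      rintro z rfl v; rfl
    calc _ = differential φ x _ := congrArg _ h2
      _ = _ := (h3 _ hl (chartSymmDeriv x₀ (extChartAt (𝓡∂ n) x₀ x) w)).symm
      _ = _ := (DFunLike.congr_fun h1 w).symm
  have hcont : ContinuousAt (fun x ↦ fderivWithin ℝ f (halfSpace n) (extChartAt (𝓡∂ n) x₀ x) w)
      x₀ := by
    have hc₀ : extChartAt (𝓡∂ n) x₀ x₀ ∈ halfSpace n :=
      extChartAt_mem_halfSpace (mem_extChartAt_source x₀)
    have hnhds := extChartAt_target_mem_nhdsWithin (I := 𝓡∂ n) x₀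
    rw [range_model_eq_halfSpace] at hnhds
    have h1 : ContDiffWithinAt ℝ 1 f (halfSpace n) (extChartAt (𝓡∂ n) x₀ x₀) :=
      (hcd _ (mem_extChartAt_target x₀)).mono_of_mem_nhdsWithin hnhds
    have h2 := (h1.fderivWithin_right (m := 0) uniqueDiffOn_halfSpace le_rfl
      hc₀).continuousWithinAt.clm_apply (continuousWithinAt_const (b := w))
    have h3 : ContinuousWithinAt (extChartAt (𝓡∂ n) x₀) (extChartAt (𝓡∂ n) x₀).source x₀ :=
      (continuousAt_extChartAt x₀).continuousWithinAt
    exact (h2.comp h3 fun x hx ↦ extChartAt_mem_halfSpace hx).continuousAt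
      (extChartAt_source_mem_nhds x₀)
  have hlim : b * ‖g₀‖ < fderivWithin ℝ f (halfSpace n) (extChartAt (𝓡∂ n) x₀ x₀) w := by
    rw [← hsec x₀ (mem_chart_source _ x₀), hw, T.symmL_continuousLinearMapAt hx₀,
      ← inner_grad_eq_differential, real_inner_self_eq_norm_mul_norm]
    exact mul_lt_mul_of_pos_right hbg hg0
  filter_upwards [eventually_norm_symmL_trivializationAt_comp_self_lt
      (𝔼 n) (fun x : M ↦ TangentSpace (𝓡∂ n) x) x₀ ht1, hsource,
      hcont.eventually (lt_mem_nhds hlim)] with x hx hxs hxl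
  have h1 : ‖T.symmL ℝ x w‖ ≤ t * ‖g₀‖ := ContinuousLinearMap.le_of_opNorm_le _ hx.le g₀
  rw [← hsec x hxs] at hxl
  have h2 := (le_abs_self _).trans (abs_differential_le φ x (T.symmL ℝ x w))
  by_contra hle
  have h3 : ‖grad (n := n) φ x‖ * ‖T.symmL ℝ x w‖ ≤ c * (t * ‖g₀‖) := by
    gcongr
    exact not_lt.1 hle
  nlinarith

variable [MeasurableSpace M] [BorelSpace M]

lemma measurable_norm_grad {φ : M → ℝ} (hφ : ContMDiff (𝓡∂ n) 𝓘(ℝ, ℝ) 1 φ) :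
    Measurable fun x ↦ ‖grad (n := n) φ x‖ := (lowerSemicontinuous_norm_grad hφ).measurable

lemma measurable_enorm_grad {φ : M → ℝ} (hφ : ContMDiff (𝓡∂ n) 𝓘(ℝ, ℝ) 1 φ) :
    Measurable fun x ↦ ‖grad (n := n) φ x‖ₑ := by
  simpa only [ofReal_norm] using (measurable_norm_grad hφ).ennreal_ofReal

omit [IsManifold (𝓡∂ n) 1 M] [MeasurableSpace M] [BorelSpace M]
  [IsContinuousRiemannianBundle (𝔼 n)
    (fun x : M ↦ TangentSpace (𝓡∂ n) x)] in
lemma grad_add {φ ζ : M → ℝ} {x : M} (hφ : MDifferentiableAt (𝓡∂ n) 𝓘(ℝ, ℝ) φ x)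
    (hζ : MDifferentiableAt (𝓡∂ n) 𝓘(ℝ, ℝ) ζ x) :
    grad (n := n) (fun z ↦ φ z + ζ z) x = grad (n := n) φ x + grad (n := n) ζ x := by
  have h2 := hφ.hasMFDerivAt.add hζ.hasMFDerivAt
  refine ext_inner_right ℝ fun v ↦ ?_
  rw [inner_add_left, inner_grad, inner_grad, inner_grad]
  exact DFunLike.congr_fun h2.mfderiv v

lemma measurable_inner_grad {φ ζ : M → ℝ} (hφ : ContMDiff (𝓡∂ n) 𝓘(ℝ, ℝ) 1 φ)
    (hζ : ContMDiff (𝓡∂ n) 𝓘(ℝ, ℝ) 1 ζ) :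
    Measurable fun x ↦ inner ℝ (grad (n := n) φ x) (grad (n := n) ζ x) := by
  have h1 : (fun x ↦ inner ℝ (grad (n := n) φ x) (grad (n := n) ζ x)) = fun x ↦
      (‖grad (n := n) (fun z ↦ φ z + ζ z) x‖ ^ 2 - ‖grad (n := n) φ x‖ ^ 2 -
        ‖grad (n := n) ζ x‖ ^ 2) / 2 := by
    funext x
    rw [grad_add (hφ.mdifferentiable one_ne_zero _) (hζ.mdifferentiable one_ne_zero _),
      norm_add_sq_real]
    ring
  rw [h1]
  exact ((((measurable_norm_grad (hφ.add hζ)).pow_const 2).sub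
    ((measurable_norm_grad hφ).pow_const 2)).sub ((measurable_norm_grad hζ).pow_const 2)).div_const 2

end Measurability

/-! ### Absorbing the lower order terms -/

/-- A potential `Q ∈ L^a` acts like a bounded function with a small remainder: where `Q ≤ L` it is
bounded, and where `Q > L` one has `Q ≤ L^(1 - a/b) Q^(a/b)`, to which Hölder's inequality applies.
For `b < a` the second constant is small when `L` is large. -/
lemma lintegral_mul_le_of_level {X : Type*} [MeasurableSpace X] {m : Measure X}
    {Q Y : X → ℝ≥0∞} (hQ : AEMeasurable Q m) (hY : AEMeasurable Y m) {a b b' : ℝ}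
    (hb : b.HolderConjugate b') (hab : b < a) {L : ℝ} (hL : 0 < L) :
    ∫⁻ x, Q x * Y x ∂m ≤ ofReal L * ∫⁻ x, Y x ∂m +
      ofReal (L ^ (-(a / b - 1))) *
        ((∫⁻ x, Q x ^ a ∂m) ^ (1 / b) * (∫⁻ x, Y x ^ b' ∂m) ^ (1 / b')) := by
  have hb0 : 0 < b := hb.pos
  have hθ : 0 < a / b - 1 := by rw [sub_pos, one_lt_div hb0]; exact hab
  -- where `Q` exceeds the level, it is dominated by its power
  have hpt : ∀ t : ℝ≥0∞, t ≤ ofReal L + ofReal (L ^ (-(a / b - 1))) * t ^ (a / b) := by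
    intro t
    rcases le_total t (ofReal L) with ht | ht
    · exact ht.trans le_self_add
    · refine le_add_left ?_
      rcases eq_or_ne t ⊤ with rfl | htop
      · rw [ENNReal.top_rpow_of_pos (by linarith), ENNReal.mul_top]
        simpa using Real.rpow_pos_of_pos hL _
      have ht0 : t ≠ 0 := fun h0 ↦ by
        rw [h0] at ht
        simp only [nonpos_iff_eq_zero, ENNReal.ofReal_eq_zero] at ht
        linarith
      calc t = ofReal L ^ (-(a / b - 1)) * (ofReal L ^ (a / b - 1) * t) := by
            rw [← mul_assoc, ← ENNReal.rpow_add _ _ (by simpa using hL) ENNReal.ofReal_ne_top]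
            simp
        _ ≤ ofReal L ^ (-(a / b - 1)) * (t ^ (a / b - 1) * t) := by gcongr
        _ = _ := by
            rw [ENNReal.ofReal_rpow_of_pos hL]
            congr 1
            nth_rewrite 2 [← ENNReal.rpow_one t]
            rw [← ENNReal.rpow_add _ _ ht0 htop]
            ring_nf
  calc _ ≤ ∫⁻ x, (ofReal L * Y x +
        ofReal (L ^ (-(a / b - 1))) * (Q x ^ (a / b) * Y x)) ∂m := by
        refine lintegral_mono fun x ↦ ?_
        rw [← mul_assoc, ← add_mul]
        exact mul_le_mul_left (hpt (Q x)) _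
    _ = ofReal L * ∫⁻ x, Y x ∂m +
        ofReal (L ^ (-(a / b - 1))) * ∫⁻ x, Q x ^ (a / b) * Y x ∂m := by
        rw [lintegral_add_left' (hY.const_mul _), lintegral_const_mul' _ _ ENNReal.ofReal_ne_top,
          lintegral_const_mul' _ _ ENNReal.ofReal_ne_top]
    _ ≤ _ := by
        gcongr
        have := ENNReal.lintegral_mul_le_Lp_mul_Lq m hb (hQ.pow_const (a / b)) hY
        refine this.trans_eq ?_
        congr 3
        funext x
        rw [← ENNReal.rpow_mul, div_mul_cancel₀ _ hb0.ne']

/-- A potential `Q` in a supercritical Lebesgue space is form bounded with arbitrarily small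
relative bound, uniformly over the scaling by `ρ`. -/
lemma exists_lintegral_mul_le {a b b' : ℝ} (hb : b.HolderConjugate b') (hab : b < a) (N : ℝ)
    (hN : 0 ≤ N) (S : ℝ) (hS : 0 ≤ S) :
    ∃ (C : ℝ) (ν : ℕ), 1 ≤ C ∧ ∀ {X : Type*} [MeasurableSpace X] {m : Measure X}
      {Q Y : X → ℝ≥0∞} {D : ℝ≥0∞} {ρ : ℝ}, AEMeasurable Q m → AEMeasurable Y m → 0 < ρ →
      (∫⁻ x, Q x ^ a ∂m) ^ (1 / a) ≤ ofReal (N * ρ ^ (-(1 - b / a))) →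
      (∫⁻ x, Y x ^ b' ∂m) ^ (1 / b') ≤ ofReal S * D → ∀ ε : ℝ, 0 < ε → ε ≤ 1 →
      ∫⁻ x, Q x * Y x ∂m ≤ ofReal ε * D +
        ofReal ((C / ε) ^ ν / ρ) * ∫⁻ x, Y x ∂m := by
  have hb0 : 0 < b := hb.pos
  have ha0 : 0 < a := hb0.trans hab
  set θ : ℝ := a / b - 1 with hθdef
  have hθ : 0 < θ := by rw [hθdef, sub_pos, one_lt_div hb0]; exact hab
  obtain ⟨ν, hν⟩ := exists_nat_ge (1 / θ)
  set C : ℝ := S * N ^ (a / b) + 1 with hC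
  have hC1 : 1 ≤ C := by rw [hC]; linarith [mul_nonneg hS (Real.rpow_nonneg hN (a / b))]
  refine ⟨C, ν, hC1, fun {X _ m Q Y D ρ} hQ hY hρ hQN hYD ε hε hε1 ↦ ?_⟩
  have hCε : 1 ≤ C / ε := by rw [le_div_iff₀ hε]; linarith
  set L : ℝ := (C / ε) ^ ν / ρ with hL
  have hL0 : 0 < L := by positivity
  have hQ' : (∫⁻ x, Q x ^ a ∂m) ^ (1 / b) ≤ ofReal (N ^ (a / b) * ρ ^ (-θ)) := by
    calc _ = ((∫⁻ x, Q x ^ a ∂m) ^ (1 / a)) ^ (a / b) := by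
          rw [← ENNReal.rpow_mul]; congr 1; field_simp
      _ ≤ ofReal (N * ρ ^ (-(1 - b / a))) ^ (a / b) := by gcongr
      _ = _ := by
          rw [ENNReal.ofReal_rpow_of_nonneg (by positivity) (by positivity),
            Real.mul_rpow hN (by positivity), ← Real.rpow_mul hρ.le]
          congr 3
          rw [hθdef]
          field_simp
  have hLθ : L ^ (-θ) * (N ^ (a / b) * ρ ^ (-θ)) * S ≤ ε := by
    rw [hL, Real.div_rpow (by positivity) hρ.le]
    have h1 : ((C / ε) ^ ν) ^ (-θ) ≤ ε / C := by
      rw [← Real.rpow_natCast, ← Real.rpow_mul (by positivity)]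
      calc (C / ε) ^ ((ν : ℝ) * -θ) ≤ (C / ε) ^ (-1 : ℝ) := by
            refine Real.rpow_le_rpow_of_exponent_le hCε ?_
            rw [div_le_iff₀ hθ] at hν
            linarith
        _ = _ := by rw [Real.rpow_neg_one, inv_div]
    have h2 : (0 : ℝ) < ρ ^ (-θ) := by positivity
    calc ((C / ε) ^ ν) ^ (-θ) / ρ ^ (-θ) * (N ^ (a / b) * ρ ^ (-θ)) * S
        = ((C / ε) ^ ν) ^ (-θ) * (S * N ^ (a / b)) := by field_simp
      _ ≤ ε / C * C := by
          gcongr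
          rw [hC]; linarith
      _ = ε := by field_simp
  calc _ ≤ _ := lintegral_mul_le_of_level hQ hY hb hab hL0
    _ ≤ ofReal L * ∫⁻ x, Y x ∂m + ofReal (L ^ (-θ)) *
        (ofReal (N ^ (a / b) * ρ ^ (-θ)) * (ofReal S * D)) := by gcongr
    _ = ofReal L * ∫⁻ x, Y x ∂m +
        ofReal (L ^ (-θ) * (N ^ (a / b) * ρ ^ (-θ)) * S) * D := by
        rw [ENNReal.ofReal_mul (q := S) (by positivity),
          ENNReal.ofReal_mul (p := L ^ (-θ)) (by positivity)]
        ring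
    _ ≤ ofReal L * ∫⁻ x, Y x ∂m + ofReal ε * D := by gcongr
    _ = _ := add_comm _ _

section FormBound

variable {n : ℕ} [NeZero n] {M : Type*} [EMetricSpace M]
  [ChartedSpace (EuclideanHalfSpace n) M] [IsManifold (𝓡∂ n) 1 M]
  [RiemannianBundle (fun x : M ↦ TangentSpace (𝓡∂ n) x)]
  [IsContinuousRiemannianBundle (𝔼 n) (fun x : M ↦ TangentSpace (𝓡∂ n) x)]
  [MeasurableSpace M] [BorelSpace M]
  {x₀ : M} {A : 𝔼 n ≃L[ℝ] 𝔼 n} {R ρ : ℝ}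

/-- The trace inequality in `L²` with a small constant at the gradient: it is the one in `L¹`, applied
to `φ²`, followed by Young's inequality. -/
lemma exists_trace_sq (h : IsAlmostFlat x₀ A R ρ) : ∃ C : ℝ, 0 < C ∧
    ∀ (φ : M → ℝ) (K : Set M), ContMDiff (𝓡∂ n) 𝓘(ℝ, ℝ) 1 φ → IsCompact K →
      K ⊆ chartBall x₀ A (extChartAt (𝓡∂ n) x₀ x₀) R → (∀ x ∉ K, φ x = 0) → ∀ δ : ℝ, 0 < δ →
      ∫⁻ x, ‖φ x‖ₑ ^ 2 ∂volBoundary n M ≤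
        ofReal δ * ∫⁻ x, ‖grad (n := n) φ x‖ₑ ^ 2 ∂volM n M +
          ofReal (C / δ) * ∫⁻ x, ‖φ x‖ₑ ^ 2 ∂volM n M := by
  obtain ⟨c, hc, htr⟩ := h.exists_trace
  refine ⟨c.toReal ^ 2 + 1, by positivity, fun φ K hφc hK hKW hφ δ hδ ↦ ?_⟩
  have h1 := htr (fun x ↦ φ x * φ x) K (hφc.mul hφc) hK hKW fun x hx ↦ by
    rw [hφ x hx, zero_mul]
  rw [← lintegral_const_mul' _ _ hc] at h1
  have h2 : ∀ x, c * ‖grad (n := n) (fun x ↦ φ x * φ x) x‖ₑ ≤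
      ofReal δ * ‖grad (n := n) φ x‖ₑ ^ 2 +
        ofReal ((c.toReal ^ 2 + 1) / δ) * ‖φ x‖ₑ ^ 2 := by
    intro x
    have hd := hφc.mdifferentiable one_ne_zero x
    have h3 : ‖grad (n := n) (fun x ↦ φ x * φ x) x‖ = 2 * |φ x| * ‖grad (n := n) φ x‖ := by
      rw [grad_mul hd hd, ← two_smul ℝ, norm_smul, norm_smul]
      simp [mul_assoc]
    rw [← ofReal_norm, h3, ← ofReal_norm, ← ofReal_norm, ← ENNReal.ofReal_toReal hc,
      ENNReal.toReal_ofReal ENNReal.toReal_nonneg, ← ENNReal.ofReal_pow (norm_nonneg _),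
      ← ENNReal.ofReal_pow (norm_nonneg _), ← ENNReal.ofReal_mul ENNReal.toReal_nonneg,
      ← ENNReal.ofReal_mul hδ.le, ← ENNReal.ofReal_mul (by positivity),
      ← ENNReal.ofReal_add (by positivity) (by positivity), Real.norm_eq_abs]
    refine ENNReal.ofReal_le_ofReal ?_
    set a := ‖grad (n := n) φ x‖
    set b := |φ x|
    have h4 : 0 ≤ (δ * a - c.toReal * b) ^ 2 / δ := by positivity
    have h5 : (δ * a - c.toReal * b) ^ 2 / δ =
        δ * a ^ 2 + c.toReal ^ 2 / δ * b ^ 2 - c.toReal * (2 * b * a) := by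
      field_simp
      ring
    have h6 : (c.toReal ^ 2 + 1) / δ * b ^ 2 = c.toReal ^ 2 / δ * b ^ 2 + 1 / δ * b ^ 2 := by ring
    have h7 : 0 ≤ 1 / δ * b ^ 2 := by positivity
    linarith
  calc _ = ∫⁻ x, ‖φ x * φ x‖ₑ ∂volBoundary n M := by
        refine lintegral_congr fun x ↦ ?_
        rw [enorm_mul, sq]
    _ ≤ _ := h1
    _ ≤ ∫⁻ x, (ofReal δ * ‖grad (n := n) φ x‖ₑ ^ 2 +
        ofReal ((c.toReal ^ 2 + 1) / δ) * ‖φ x‖ₑ ^ 2) ∂volM n M := lintegral_mono h2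
    _ = _ := by
        rw [lintegral_add_left (((measurable_enorm_grad hφc).pow_const 2).const_mul _),
          lintegral_const_mul' _ _ ENNReal.ofReal_ne_top,
          lintegral_const_mul' _ _ ENNReal.ofReal_ne_top]

/-- The trace inequality with the critical exponent `2 (n - 1) / (n - 2)`, which follows from
the `L¹` inequality for a power of the function and the Sobolev inequality. -/
lemma exists_trace_rpow (hn : 3 ≤ n) (h : IsAlmostFlat x₀ A R ρ) : ∃ S : ℝ, 0 ≤ S ∧
    ∀ (φ : M → ℝ) (K : Set M), ContMDiff (𝓡∂ n) 𝓘(ℝ, ℝ) 1 φ → IsCompact K →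
      K ⊆ chartBall x₀ A (extChartAt (𝓡∂ n) x₀ x₀) R → (∀ x ∉ K, φ x = 0) →
      (∫⁻ x, ‖φ x‖ₑ ^ (2 * (((n : ℝ) - 1) / ((n : ℝ) - 2))) ∂volBoundary n M) ^
          (1 / (((n : ℝ) - 1) / ((n : ℝ) - 2))) ≤
        ofReal S * ∫⁻ x, ‖grad (n := n) φ x‖ₑ ^ 2 ∂volM n M := by
  obtain ⟨c, hc, htr⟩ := h.exists_trace
  obtain ⟨S₁, hS₁, hsob⟩ := h.exists_sobolev hn
  have hn' : (3 : ℝ) ≤ n := by exact_mod_cast hn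
  set κ : ℝ := (n : ℝ) / ((n : ℝ) - 2) with hκ
  set b : ℝ := ((n : ℝ) - 1) / ((n : ℝ) - 2) with hb
  have hn2 : (0 : ℝ) < (n : ℝ) - 2 := by linarith
  have hκ0 : 0 < κ := div_pos (by linarith) hn2
  have hb1 : 1 < b := by rw [hb, one_lt_div hn2]; linarith
  have hbκ : 2 * b - 1 = κ := by rw [hb, hκ]; field_simp; ring
  set B : ℝ≥0∞ := c * (ofReal (2 * b) * S₁ ^ (κ / 2)) with hB
  have hBtop : B ^ (1 / b) ≠ ⊤ := ENNReal.rpow_ne_top_of_nonneg (by positivity)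
    (ENNReal.mul_ne_top hc (ENNReal.mul_ne_top ENNReal.ofReal_ne_top
      (ENNReal.rpow_ne_top_of_nonneg (by positivity) hS₁)))
  refine ⟨(B ^ (1 / b)).toReal, ENNReal.toReal_nonneg, fun φ K hφc hK hKW hφ ↦ ?_⟩
  rw [ENNReal.ofReal_toReal hBtop]
  set D := ∫⁻ x, ‖grad (n := n) φ x‖ₑ ^ 2 ∂volM n M with hD
  have hsob' := hsob φ K hφc hK hKW hφ
  have h1 := htr (fun x ↦ ‖φ x‖ ^ (2 * b)) K
    ((contDiff_norm_rpow (by linarith)).contMDiff.comp hφc) hK hKW fun x hx ↦ by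
      rw [hφ x hx, norm_zero, Real.zero_rpow (by linarith)]
  have h2 : ∀ x, ‖grad (n := n) (fun x ↦ ‖φ x‖ ^ (2 * b)) x‖ₑ =
      ofReal (2 * b) * (‖φ x‖ₑ ^ κ * ‖grad (n := n) φ x‖ₑ) := by
    intro x
    rw [grad_comp (hasDerivAt_norm_rpow (φ x) (p := 2 * b) (by linarith))
      (hφc.mdifferentiable one_ne_zero x), ← ofReal_norm, norm_smul, norm_mul, norm_mul,
      ENNReal.ofReal_mul (by positivity), ENNReal.ofReal_mul (by positivity),
      ENNReal.ofReal_mul (by positivity), ← ofReal_norm, ← ofReal_norm,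
      ENNReal.ofReal_rpow_of_nonneg (norm_nonneg _) hκ0.le, mul_assoc, mul_assoc,
      Real.norm_of_nonneg (show 0 ≤ 2 * b by linarith), ← mul_assoc (ofReal ‖‖_‖ ^ _‖),
      ← ENNReal.ofReal_mul (by positivity), Real.norm_of_nonneg (by positivity)]
    congr 3
    rcases eq_or_ne (φ x) 0 with h0 | h0
    · rw [h0, norm_zero, mul_zero, Real.zero_rpow hκ0.ne']
    · have : 0 < ‖φ x‖ := norm_pos_iff.2 h0
      nth_rewrite 2 [← Real.rpow_one ‖φ x‖]
      rw [← Real.rpow_add this, ← hbκ]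
      ring_nf
  have hm : Measurable fun x ↦ ‖φ x‖ₑ ^ κ := (hφc.continuous.enorm.measurable).pow_const κ
  have h3 : ∫⁻ x, ‖φ x‖ₑ ^ κ * ‖grad (n := n) φ x‖ₑ ∂volM n M ≤
      (∫⁻ x, ‖φ x‖ₑ ^ (2 * κ) ∂volM n M) ^ (1 / 2 : ℝ) * D ^ (1 / 2 : ℝ) := by
    have := ENNReal.lintegral_mul_le_Lp_mul_Lq (volM n M) Real.HolderConjugate.two_two
      hm.aemeasurable (measurable_enorm_grad hφc).aemeasurable
    refine this.trans_eq ?_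
    congr 3
    · funext x
      rw [← ENNReal.rpow_mul, mul_comm κ]
    · funext x
      exact ENNReal.rpow_two _
  have h4 : ∫⁻ x, ‖φ x‖ₑ ^ (2 * κ) ∂volM n M ≤ (S₁ * D) ^ κ := by
    rw [← ENNReal.rpow_inv_le_iff hκ0, ← one_div]
    exact hsob'
  have h5 : ∫⁻ x, ‖φ x‖ₑ ^ (2 * b) ∂volBoundary n M ≤ B * D ^ b := by
    calc _ = ∫⁻ x, ‖‖φ x‖ ^ (2 * b)‖ₑ ∂volBoundary n M := by
          refine lintegral_congr fun x ↦ ?_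
          rw [Real.enorm_rpow_of_nonneg (norm_nonneg _) (by linarith), enorm_norm]
      _ ≤ _ := h1
      _ = c * (ofReal (2 * b) *
          ∫⁻ x, ‖φ x‖ₑ ^ κ * ‖grad (n := n) φ x‖ₑ ∂volM n M) := by
          rw [← lintegral_const_mul' _ _ ENNReal.ofReal_ne_top]
          congr 1
          exact lintegral_congr h2
      _ ≤ c * (ofReal (2 * b) * (((S₁ * D) ^ κ) ^ (1 / 2 : ℝ) * D ^ (1 / 2 : ℝ))) := by
          gcongr
          exact h3.trans (by gcongr)
      _ = _ := by
          rw [← ENNReal.rpow_mul, ENNReal.mul_rpow_of_nonneg _ _ (by positivity), mul_assoc,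
            ← ENNReal.rpow_add_of_nonneg _ _ (by positivity) (by positivity), hB,
            show κ * (1 / 2) + 1 / 2 = b by rw [← hbκ]; ring, mul_one_div]
          ring
  calc _ ≤ (B * D ^ b) ^ (1 / b) := by gcongr
    _ = _ := by
        rw [ENNReal.mul_rpow_of_nonneg _ _ (by positivity), ← ENNReal.rpow_mul,
          mul_one_div_cancel (by linarith), ENNReal.rpow_one]

/-- Potentials in the Lebesgue spaces of the theorem are form bounded with arbitrarily small
relative bound, uniformly over all scales. -/
lemma exists_form_bound (hn : 3 ≤ n) (h : IsAlmostFlat x₀ A R ρ) {q s : ℝ} (hq : (n : ℝ) < q)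
    (hs : (n : ℝ) - 1 < s) {N : ℝ} (hN : 0 ≤ N) : ∃ (C : ℝ) (ν : ℕ), 1 ≤ C ∧
    ∀ {S : Set M} {Q Qb : M → ℝ≥0∞} {r : ℝ},
      S ⊆ chartBall x₀ A (extChartAt (𝓡∂ n) x₀ x₀) R →
      AEMeasurable Q ((volM n M).restrict S) → AEMeasurable Qb ((volBoundary n M).restrict S) →
      0 < r →
      (∫⁻ x in S, Q x ^ (q / 2) ∂volM n M) ^ (1 / (q / 2)) ≤
        ofReal (N * r ^ (-(2 - 2 * (n : ℝ) / q))) →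
      (∫⁻ x in S, Qb x ^ s ∂volBoundary n M) ^ (1 / s) ≤
        ofReal (N * r ^ (-(1 - ((n : ℝ) - 1) / s))) →
      ∀ (φ : M → ℝ) (K : Set M), ContMDiff (𝓡∂ n) 𝓘(ℝ, ℝ) 1 φ → IsCompact K → K ⊆ S →
        (∀ x ∉ K, φ x = 0) → ∀ ε : ℝ, 0 < ε → ε ≤ 1 →
        ∫⁻ x in S, Q x * ‖φ x‖ₑ ^ 2 ∂volM n M +
            ∫⁻ x in S, Qb x * ‖φ x‖ₑ ^ 2 ∂volBoundary n M ≤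
          ofReal ε * ∫⁻ x, ‖grad (n := n) φ x‖ₑ ^ 2 ∂volM n M +
            ofReal (C / ε ^ ν / r ^ 2) * ∫⁻ x, ‖φ x‖ₑ ^ 2 ∂volM n M := by
  have hn' : (3 : ℝ) ≤ n := by exact_mod_cast hn
  have hn2 : (0 : ℝ) < (n : ℝ) - 2 := by linarith
  have hn1 : (0 : ℝ) < (n : ℝ) - 1 := by linarith
  obtain ⟨S₁, hS₁, hsob⟩ := h.exists_sobolev hn
  obtain ⟨S₂, hS₂, htr⟩ := exists_trace_rpow hn h
  obtain ⟨c, hc, hsq⟩ := exists_trace_sq h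
  have hconj₁ : ((n : ℝ) / 2).HolderConjugate ((n : ℝ) / ((n : ℝ) - 2)) := by
    rw [Real.holderConjugate_iff]
    refine ⟨by linarith, by field_simp; ring⟩
  have hconj₂ : ((n : ℝ) - 1).HolderConjugate (((n : ℝ) - 1) / ((n : ℝ) - 2)) := by
    rw [Real.holderConjugate_iff]
    refine ⟨by linarith, by field_simp; ring⟩
  obtain ⟨C₁, ν₁, hC₁, hint⟩ := exists_lintegral_mul_le hconj₁
    (show (n : ℝ) / 2 < q / 2 by linarith) N hN S₁.toReal ENNReal.toReal_nonneg
  obtain ⟨C₂, ν₂, hC₂, hbd⟩ := exists_lintegral_mul_le hconj₂ hs N hN S₂ hS₂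
  refine ⟨(3 * C₁) ^ ν₁ + 3 * c * ((3 * C₂) ^ ν₂) ^ 2, ν₁ + 2 * ν₂ + 1, ?_,
    fun {S Q Qb r} hS hQm hQbm hr hQ hQb φ K hφc hK hKS hφ ε hε hε1 ↦ ?_⟩
  · have : 1 ≤ (3 * C₁) ^ ν₁ := one_le_pow₀ (by linarith)
    have : 0 ≤ 3 * c * ((3 * C₂) ^ ν₂) ^ 2 := by positivity
    linarith
  have hKW := hKS.trans hS
  set D := ∫⁻ x, ‖grad (n := n) φ x‖ₑ ^ 2 ∂volM n M with hD
  set Y := ∫⁻ x, ‖φ x‖ₑ ^ 2 ∂volM n M with hY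
  have hm : Measurable fun x ↦ ‖φ x‖ₑ ^ 2 := (hφc.continuous.enorm.measurable).pow_const 2
  have hε3 : 0 < ε / 3 := by positivity
  have h1 : ∫⁻ x in S, Q x * ‖φ x‖ₑ ^ 2 ∂volM n M ≤ ofReal (ε / 3) * D +
      ofReal ((C₁ / (ε / 3)) ^ ν₁ / r ^ 2) * Y := by
    refine (hint (D := D) (ρ := r ^ 2) hQm hm.aemeasurable (by positivity) ?_ ?_ (ε / 3) hε3
      (by linarith)).trans ?_
    · refine hQ.trans_eq ?_
      congr 2
      rw [← Real.rpow_natCast, ← Real.rpow_mul hr.le]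
      congr 1
      rw [div_div_div_cancel_right₀ two_ne_zero]
      push_cast
      ring
    · rw [ENNReal.ofReal_toReal hS₁]
      refine le_trans ?_ (hsob φ K hφc hK hKW hφ)
      refine ENNReal.rpow_le_rpow ?_ (by positivity)
      refine (setLIntegral_le_lintegral _ _).trans_eq (lintegral_congr fun x ↦ ?_)
      rw [ENNReal.rpow_mul, ENNReal.rpow_two]
    · exact add_le_add_right (mul_le_mul_right (setLIntegral_le_lintegral _ _) _) _
  have h2 : ∫⁻ x in S, Qb x * ‖φ x‖ₑ ^ 2 ∂volBoundary n M ≤ ofReal (ε / 3) * D +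
      ofReal ((C₂ / (ε / 3)) ^ ν₂ / r) * ∫⁻ x, ‖φ x‖ₑ ^ 2 ∂volBoundary n M := by
    refine (hbd (D := D) (ρ := r) hQbm hm.aemeasurable hr hQb ?_ (ε / 3) hε3
      (by linarith)).trans ?_
    · refine le_trans ?_ (htr φ K hφc hK hKW hφ)
      refine ENNReal.rpow_le_rpow ?_ (by positivity)
      refine (setLIntegral_le_lintegral _ _).trans_eq (lintegral_congr fun x ↦ ?_)
      rw [ENNReal.rpow_mul, ENNReal.rpow_two]
    · exact add_le_add_right (mul_le_mul_right (setLIntegral_le_lintegral _ _) _) _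
  set m := (C₂ / (ε / 3)) ^ ν₂ with hmdef
  have hm0 : 0 < m := by positivity
  -- the boundary integral left over in `h2` is absorbed by the trace inequality in `L²`, with the
  -- constant that makes its gradient term `ε / 3`
  have h3 := hsq φ K hφc hK hKW hφ (ε * r / (3 * m)) (by positivity)
  calc _ ≤ ofReal (ε / 3) * D + ofReal ((C₁ / (ε / 3)) ^ ν₁ / r ^ 2) * Y +
        (ofReal (ε / 3) * D + ofReal (m / r) *
          (ofReal (ε * r / (3 * m)) * D +
            ofReal (c / (ε * r / (3 * m))) * Y)) := by
        refine add_le_add h1 (h2.trans ?_)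
        gcongr
    _ = ofReal ε * D + ofReal (((C₁ / (ε / 3)) ^ ν₁ + 3 * c * m ^ 2 / ε) / r ^ 2) *
        Y := by
        rw [mul_add, ← mul_assoc, ← mul_assoc, ← ENNReal.ofReal_mul (by positivity),
          ← ENNReal.ofReal_mul (by positivity),
          show m / r * (ε * r / (3 * m)) = ε / 3 by field_simp,
          show m / r * (c / (ε * r / (3 * m))) = 3 * c * m ^ 2 / ε / r ^ 2 by field_simp,
          show ofReal ε = ofReal (ε / 3) + ofReal (ε / 3) +
            ofReal (ε / 3) by
              rw [← ENNReal.ofReal_add (by positivity) (by positivity),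
                ← ENNReal.ofReal_add (by positivity) (by positivity)]; ring_nf,
          add_div, ENNReal.ofReal_add (by positivity) (by positivity)]
        ring
    _ ≤ _ := by
        gcongr
        have h4 : (C₁ / (ε / 3)) ^ ν₁ = (3 * C₁) ^ ν₁ / ε ^ ν₁ := by
          rw [← div_pow]; congr 1; field_simp
        have h5 : 3 * c * m ^ 2 / ε = 3 * c * ((3 * C₂) ^ ν₂) ^ 2 / ε ^ (2 * ν₂ + 1) := by
          have : m = (3 * C₂) ^ ν₂ / ε ^ ν₂ := by
            rw [hmdef, ← div_pow]; congr 1; field_simp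
          rw [this, pow_succ ε, pow_mul', div_pow]
          field_simp
        rw [h4, h5, add_div]
        gcongr ?_ + ?_
        · refine div_le_div_of_nonneg_left (by positivity) (by positivity)
            (pow_le_pow_of_le_one hε.le hε1 (by omega))
        · refine div_le_div_of_nonneg_left (by positivity) (by positivity)
            (pow_le_pow_of_le_one hε.le hε1 (by omega))

end FormBound

/-! ### Rapidly converging approximations in `H¹` -/

section Abstract

/-- A null sequence has a summable subfamily. Rapid convergence gives convergence almost everywhere
and a common integrable majorant at the same time. -/
lemma exists_tsum_comp_lt_top {e : ℕ → ℝ≥0∞} (he : Tendsto e atTop (𝓝 0)) :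
    ∃ ns : ℕ → ℕ, ∑' j, e (ns j) < ⊤ := by
  have h : ∀ j : ℕ, ∃ N, e N ≤ (2 : ℝ≥0∞)⁻¹ ^ j := fun j ↦
    (he.eventually_le_const (ENNReal.pow_pos (by simp) j)).exists
  choose ns hns using h
  refine ⟨ns, (ENNReal.tsum_le_tsum hns).trans_lt ?_⟩
  rw [ENNReal.tsum_geometric, ENNReal.one_sub_inv_two, inv_inv]
  exact ENNReal.ofNat_lt_top

lemma tendsto_of_tsum_enorm_sq {E : Type*} [SeminormedAddCommGroup E] {f : ℕ → E} {a : E}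
    (h : ∑' j, ‖f j - a‖ₑ ^ 2 ≠ ⊤) : Tendsto f atTop (𝓝 a) := by
  have h1 := ENNReal.tendsto_atTop_zero_of_tsum_ne_top h
  rw [tendsto_iff_edist_tendsto_0]
  have h2 := (ENNReal.continuous_rpow_const (y := (1 / 2 : ℝ))).tendsto 0 |>.comp h1
  rw [ENNReal.zero_rpow_of_pos (by norm_num)] at h2
  refine h2.congr fun j ↦ ?_
  rw [Function.comp_apply, ← ENNReal.rpow_two, ← ENNReal.rpow_mul, edist_eq_enorm_sub]
  norm_num

lemma enorm_sq_le_two_mul_add {E : Type*} [SeminormedAddCommGroup E] (a b : E) :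
    ‖a‖ₑ ^ 2 ≤ 2 * (‖b‖ₑ ^ 2 + ‖a - b‖ₑ ^ 2) := by
  have h1 : ‖a‖ ^ 2 ≤ 2 * (‖b‖ ^ 2 + ‖a - b‖ ^ 2) := by
    have h2 := norm_le_norm_add_norm_sub' a b
    nlinarith [sq_nonneg (‖b‖ - ‖a - b‖), norm_nonneg a, norm_nonneg b, norm_nonneg (a - b)]
  rw [← ofReal_norm, ← ofReal_norm, ← ofReal_norm, ← ENNReal.ofReal_pow (norm_nonneg _),
    ← ENNReal.ofReal_pow (norm_nonneg _), ← ENNReal.ofReal_pow (norm_nonneg _),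
    ← ENNReal.ofReal_add (by positivity) (by positivity),
    show (2 : ℝ≥0∞) = ofReal 2 by simp, ← ENNReal.ofReal_mul (by norm_num)]
  exact ENNReal.ofReal_le_ofReal h1

lemma enorm_sq_le_of_tsum {E : Type*} [SeminormedAddCommGroup E] (f : ℕ → E) (a : E) (j : ℕ) :
    ‖f j‖ₑ ^ 2 ≤ 2 * (‖a‖ₑ ^ 2 + ∑' i, ‖f i - a‖ₑ ^ 2) :=
  (enorm_sq_le_two_mul_add (f j) a).trans (by
    gcongr
    exact ENNReal.le_tsum (f := fun i ↦ ‖f i - a‖ₑ ^ 2) j)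

lemma lintegral_le_of_ae_tendsto_of_tendsto {X : Type*} [MeasurableSpace X] {ν : Measure X}
    {F : ℕ → X → ℝ≥0∞} {f : X → ℝ≥0∞} {C : ℕ → ℝ≥0∞} {c : ℝ≥0∞}
    (hF : ∀ n, AEMeasurable (F n) ν) (h : ∀ᵐ x ∂ν, Tendsto (fun n ↦ F n x) atTop (𝓝 (f x)))
    (hC : ∀ n, ∫⁻ x, F n x ∂ν ≤ C n) (hc : Tendsto C atTop (𝓝 c)) : ∫⁻ x, f x ∂ν ≤ c :=
  calc ∫⁻ x, f x ∂ν = ∫⁻ x, liminf (fun n ↦ F n x) atTop ∂ν :=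
        lintegral_congr_ae (h.mono fun _ hx ↦ hx.liminf_eq.symm)
    _ ≤ liminf (fun n ↦ ∫⁻ x, F n x ∂ν) atTop := lintegral_liminf_le' hF
    _ ≤ liminf C atTop := liminf_le_liminf (Eventually.of_forall hC)
    _ = c := hc.liminf_eq

/-- A `C¹` function on the line with bounded derivative. -/
structure IsC1Lipschitz (F F' : ℝ → ℝ) : Prop where
  hasDerivAt : ∀ t, HasDerivAt F (F' t) t
  continuous_deriv : Continuous F'
  bounded : ∃ B, ∀ t, |F' t| ≤ B

namespace IsC1Lipschitz

variable {F F' : ℝ → ℝ}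

lemma continuous (h : IsC1Lipschitz F F') : Continuous F :=
  continuous_iff_continuousAt.2 fun t ↦ (h.hasDerivAt t).continuousAt

lemma contDiff (h : IsC1Lipschitz F F') : ContDiff ℝ 1 F := by
  rw [contDiff_one_iff_deriv]
  have h1 : deriv F = F' := funext fun t ↦ (h.hasDerivAt t).deriv
  exact ⟨fun t ↦ (h.hasDerivAt t).differentiableAt, h1 ▸ h.continuous_deriv⟩

lemma exists_bound (h : IsC1Lipschitz F F') : ∃ C : ℝ, 0 ≤ C ∧ (∀ t, |F' t| ≤ C) ∧
    ∀ t, |F t| ≤ C * (1 + |t|) := by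
  obtain ⟨B, hB⟩ := h.bounded
  have hB0 : 0 ≤ B := (abs_nonneg _).trans (hB 0)
  refine ⟨B + |F 0|, by positivity, fun t ↦ (hB t).trans (by linarith [abs_nonneg (F 0)]),
    fun t ↦ ?_⟩
  have h1 := Convex.norm_image_sub_le_of_norm_hasDerivWithin_le (C := B) (s := univ)
    (fun x _ ↦ (h.hasDerivAt x).hasDerivWithinAt) (fun x _ ↦ hB x) convex_univ
    (mem_univ 0) (mem_univ t)
  rw [Real.norm_eq_abs, Real.norm_eq_abs, sub_zero] at h1
  have h2 := abs_sub_abs_le_abs_sub (F t) (F 0)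
  nlinarith [abs_nonneg (F 0), abs_nonneg t, mul_nonneg (abs_nonneg (F 0)) (abs_nonneg t)]

lemma exists_enorm_bound (h : IsC1Lipschitz F F') : ∃ C : ℝ≥0∞, C ≠ ⊤ ∧ (∀ t, ‖F' t‖ₑ ^ 2 ≤ C) ∧
    ∀ t, ‖F t‖ₑ ^ 2 ≤ C * (1 + ‖t‖ₑ ^ 2) := by
  obtain ⟨C, hC, h1, h2⟩ := h.exists_bound
  refine ⟨ofReal (2 * C ^ 2), ENNReal.ofReal_ne_top, fun t ↦ ?_, fun t ↦ ?_⟩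
  · rw [← ofReal_norm, ← ENNReal.ofReal_pow (norm_nonneg _)]
    refine ENNReal.ofReal_le_ofReal ?_
    have := h1 t
    rw [Real.norm_eq_abs]
    nlinarith [abs_nonneg (F' t)]
  · rw [← ofReal_norm, ← ofReal_norm, ← ENNReal.ofReal_pow (norm_nonneg _),
      ← ENNReal.ofReal_pow (norm_nonneg _), ← ENNReal.ofReal_one,
      ← ENNReal.ofReal_add zero_le_one (by positivity), ← ENNReal.ofReal_mul (by positivity)]
    refine ENNReal.ofReal_le_ofReal ?_
    have h3 := h2 t
    rw [Real.norm_eq_abs, Real.norm_eq_abs]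
    calc |F t| ^ 2 ≤ (C * (1 + |t|)) ^ 2 := by gcongr
      _ ≤ _ := by nlinarith [mul_nonneg (sq_nonneg C) (sq_nonneg (1 - |t|))]

end IsC1Lipschitz

/-- A `C¹` map that is the identity on `[0, ∞)` and maps the line into `(-k / 2, ∞)`; composing
with it extends functions defined for positive arguments only. -/
def softPart (k t : ℝ) : ℝ := if 0 ≤ t then t else t / (1 - 2 * t / k)

/-- The derivative of `softPart k`. -/
def softPartDeriv (k t : ℝ) : ℝ := if 0 ≤ t then 1 else 1 / (1 - 2 * t / k) ^ 2

variable {k : ℝ}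

lemma neg_half_lt_softPart (hk : 0 < k) (t : ℝ) : -(k / 2) < softPart k t := by
  rw [softPart]
  split_ifs with h
  · linarith
  · have h1 : 0 < 1 - 2 * t / k := by
      have : 2 * t / k < 0 := div_neg_of_neg_of_pos (by linarith) hk
      linarith
    rw [lt_div_iff₀ h1]
    have : -(k / 2) * (1 - 2 * t / k) = -(k / 2) + t := by field_simp; ring
    linarith

lemma lt_softPart (hk : 0 < k) {t : ℝ} (ht : t < 0) : t < softPart k t := by
  have h0 : 2 * t / k < 0 := div_neg_of_neg_of_pos (by linarith) hk
  rw [softPart, if_neg (not_le.2 ht), lt_div_iff₀ (by linarith)]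
  nlinarith

lemma softPart_of_nonneg {t : ℝ} (ht : 0 ≤ t) : softPart k t = t := if_pos ht

lemma softPartDeriv_of_nonneg {t : ℝ} (ht : 0 ≤ t) : softPartDeriv k t = 1 := if_pos ht

lemma isC1Lipschitz_softPart (hk : 0 < k) : IsC1Lipschitz (softPart k) (softPartDeriv k) where
  hasDerivAt t := by
    have hneg : ∀ t : ℝ, t ≤ 0 → HasDerivAt (fun t ↦ t / (1 - 2 * t / k))
        (1 / (1 - 2 * t / k) ^ 2) t := by
      intro t ht
      have h1 : 0 < 1 - 2 * t / k := by
        have : 2 * t / k ≤ 0 := div_nonpos_of_nonpos_of_nonneg (by linarith) hk.le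
        linarith
      have h2 : HasDerivAt (fun t ↦ 1 - 2 * t / k) (-(2 * 1 / k)) t :=
        (((hasDerivAt_id t).const_mul 2).div_const k).const_sub 1
      have h3 := (hasDerivAt_id t).div h2 h1.ne'
      have h4 : (1 * (1 - 2 * t / k) - id t * -(2 * 1 / k)) / (1 - 2 * t / k) ^ 2 =
          1 / (1 - 2 * t / k) ^ 2 := by
        congr 1
        simp only [id]
        ring
      rw [← h4]
      exact h3
    rcases lt_trichotomy t 0 with ht | rfl | ht
    · rw [softPartDeriv, if_neg (not_le.2 ht)]
      refine (hneg t ht.le).congr_of_eventuallyEq ?_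
      filter_upwards [gt_mem_nhds ht] with z hz using if_neg (not_le.2 hz)
    · rw [softPartDeriv, if_pos le_rfl, ← hasDerivWithinAt_univ, ← Iic_union_Ici (a := (0 : ℝ))]
      refine HasDerivWithinAt.union ?_ ?_
      · have := (hneg 0 le_rfl).hasDerivWithinAt (s := Iic 0)
        rw [mul_zero, zero_div, sub_zero, one_pow, div_one] at this
        refine this.congr (fun z hz ↦ ?_) (by simp [softPart])
        rcases eq_or_lt_of_le (mem_Iic.1 hz) with rfl | hz
        · simp [softPart]
        · exact if_neg (not_le.2 hz)
      · exact (hasDerivAt_id (0 : ℝ)).hasDerivWithinAt.congr (fun z hz ↦ if_pos hz) (if_pos le_rfl)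
    · rw [softPartDeriv, if_pos ht.le]
      refine (hasDerivAt_id t).congr_of_eventuallyEq ?_
      filter_upwards [lt_mem_nhds ht] with z hz using if_pos hz.le
  continuous_deriv := by
    have h : softPartDeriv k = fun t ↦ 1 / (1 - 2 * min t 0 / k) ^ 2 := by
      funext t
      rw [softPartDeriv]
      split_ifs with ht
      · simp [min_eq_right ht]
      · rw [min_eq_left (not_le.1 ht).le]
    rw [h]
    refine continuous_const.div (by fun_prop) fun t ↦ ?_
    have : 2 * min t 0 / k ≤ 0 := div_nonpos_of_nonpos_of_nonneg
      (by linarith [min_le_right t 0]) hk.le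
    exact pow_ne_zero 2 (by linarith)
  bounded := by
    refine ⟨1, fun t ↦ ?_⟩
    rw [softPartDeriv]
    split_ifs with h
    · simp
    · have : 2 * t / k < 0 := div_neg_of_neg_of_pos (by linarith) hk
      rw [abs_of_nonneg (by positivity), div_le_one (by nlinarith)]
      nlinarith

/-- A nonlinearity defined on the positive half-line only, such as a power, becomes a globally
Lipschitz `C¹` function after composition with `softPart k`. It can then be applied to the
approximations of `u`, which need not be nonnegative. -/
lemma C1Bdd.isC1Lipschitz_comp {F F' : ℝ → ℝ} (h : C1Bdd k F F') (hk : 0 < k) :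
    IsC1Lipschitz (fun t ↦ F (softPart k t + k))
      (fun t ↦ F' (softPart k t + k) * softPartDeriv k t) where
  hasDerivAt t := by
    have h1 := neg_half_lt_softPart hk t
    exact (h.hasDerivAt _ (by linarith)).comp t
      (((isC1Lipschitz_softPart hk).hasDerivAt t).add_const k)
  continuous_deriv := by
    refine (h.continuousOn.comp_continuous ((isC1Lipschitz_softPart hk).continuous.add
      continuous_const) fun t ↦ ?_).mul (isC1Lipschitz_softPart hk).continuous_deriv
    have h1 := neg_half_lt_softPart hk t
    change 0 < softPart k t + k
    linarith
  bounded := by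
    obtain ⟨B, hB⟩ := h.bounded
    obtain ⟨C, hC⟩ := (isC1Lipschitz_softPart hk).bounded
    refine ⟨B * C, fun t ↦ ?_⟩
    have h1 := neg_half_lt_softPart hk t
    have h2 := hB (softPart k t + k) (by linarith)
    rw [abs_mul]
    exact mul_le_mul h2 (hC t) (abs_nonneg _) ((abs_nonneg _).trans h2)

/-- Dominated convergence for a bound with values in `[0, ∞]`. -/
lemma tendsto_integral_of_lintegral_bound {X : Type*} [MeasurableSpace X] {m : Measure X}
    {F : ℕ → X → ℝ} {f : X → ℝ} {b : X → ℝ≥0∞} (hF : ∀ j, AEStronglyMeasurable (F j) m)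
    (hb : AEMeasurable b m) (hfin : ∫⁻ x, b x ∂m < ⊤) (hle : ∀ j, ∀ᵐ x ∂m, ‖F j x‖ₑ ≤ b x)
    (hlim : ∀ᵐ x ∂m, Tendsto (fun j ↦ F j x) atTop (𝓝 (f x))) :
    Integrable f m ∧ Tendsto (fun j ↦ ∫ x, F j x ∂m) atTop (𝓝 (∫ x, f x ∂m)) := by
  have hbtop : ∀ᵐ x ∂m, b x < ⊤ := ae_lt_top' hb hfin.ne
  have hle' : ∀ j, ∀ᵐ x ∂m, ‖F j x‖ ≤ (b x).toReal := fun j ↦ by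
    filter_upwards [hle j, hbtop] with x hx hx'
    rw [← ofReal_norm] at hx
    exact (ENNReal.ofReal_le_iff_le_toReal hx'.ne).1 hx
  have hbint : Integrable (fun x ↦ (b x).toReal) m := integrable_toReal_of_lintegral_ne_top hb hfin.ne
  have hfm : AEStronglyMeasurable f m := aestronglyMeasurable_of_tendsto_ae atTop hF hlim
  refine ⟨hbint.mono' hfm ?_, tendsto_integral_of_dominated_convergence _ hF hbint hle' hlim⟩
  filter_upwards [ae_all_iff.2 hle', hlim] with x hx hx'
  exact le_of_tendsto hx'.norm (Eventually.of_forall hx)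

end Abstract

section Approximation

variable {n : ℕ} [NeZero n] {M : Type*} [EMetricSpace M]
  [ChartedSpace (EuclideanHalfSpace n) M]
  [RiemannianBundle (fun x : M ↦ TangentSpace (𝓡∂ n) x)]
  [MeasurableSpace M] [BorelSpace M]

/-- A sequence of `C¹` functions converging to an element of `H¹` so fast that the squared
errors are summable under the integral sign; this yields almost everywhere convergence together
with dominating functions. The traces are controlled on `S` only. -/
structure H1Approx (u : M → ℝ) (G : ∀ x : M, TangentSpace (𝓡∂ n) x) (τ : M → ℝ) (S : Set M)
    (φ : ℕ → M → ℝ) : Prop where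
  contMDiff : ∀ j, ContMDiff (𝓡∂ n) 𝓘(ℝ, ℝ) 1 (φ j)
  aemeasurable : AEMeasurable u (volM n M)
  aemeasurable_norm_grad : AEMeasurable (fun x ↦ ‖G x‖ₑ) (volM n M)
  aemeasurable_grad_sub : ∀ j, AEMeasurable (fun x ↦ ‖grad (φ j) x - G x‖ₑ) (volM n M)
  aemeasurable_trace : AEMeasurable τ ((volBoundary n M).restrict S)
  lintegral_sq_lt_top : ∫⁻ x, ‖u x‖ₑ ^ 2 ∂volM n M < ⊤
  lintegral_grad_sq_lt_top : ∫⁻ x, ‖G x‖ₑ ^ 2 ∂volM n M < ⊤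
  tsum_lt_top : ∑' j, ∫⁻ x, ‖φ j x - u x‖ₑ ^ 2 ∂volM n M < ⊤
  tsum_grad_lt_top : ∑' j, ∫⁻ x, ‖grad (φ j) x - G x‖ₑ ^ 2 ∂volM n M < ⊤
  tsum_trace_lt_top : ∑' j, ∫⁻ x in S, ‖φ j x - τ x‖ₑ ^ 2 ∂volBoundary n M < ⊤

variable {u : M → ℝ} {G : ∀ x : M, TangentSpace (𝓡∂ n) x} {τ : M → ℝ} {S : Set M}
  {φ : ℕ → M → ℝ}

lemma eLpNorm_two_sq {X E : Type*} [MeasurableSpace X] {m : Measure X} [NormedAddCommGroup E]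
    (f : X → E) :
    eLpNorm f 2 m ^ 2 = ∫⁻ x, ‖f x‖ₑ ^ 2 ∂m := by
  have := eLpNorm_nnreal_pow_eq_lintegral (f := f) (p := 2) (μ := m) two_ne_zero
  simpa only [NNReal.coe_ofNat, ENNReal.coe_ofNat, ENNReal.rpow_two] using this

lemma IsH1.exists_approx (hu : IsH1 u G τ) (hS : IsCompact S) : ∃ φ, H1Approx u G τ S φ := by
  obtain ⟨ψ, hψ, h1, hm, h2, h3⟩ := hu.approx
  have hsq : ∀ {a : ℕ → ℝ≥0∞}, Tendsto a atTop (𝓝 0) → Tendsto (fun j ↦ a j ^ 2) atTop (𝓝 0) := by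
    intro a ha
    have := ((ENNReal.continuous_pow 2).tendsto 0).comp ha
    rwa [zero_pow two_ne_zero] at this
  have h := ((hsq h1).add (hsq h2)).add (hsq (h3 S hS))
  rw [add_zero, add_zero] at h
  obtain ⟨ns, hns⟩ := exists_tsum_comp_lt_top h
  have hnorm : ∀ k, AEMeasurable (fun x ↦ ‖grad (n := n) (ψ k) x - G x‖ₑ) (volM n M) := fun k ↦ by
    simpa only [ofReal_norm] using (hm k).aemeasurable.ennreal_ofReal
  refine ⟨fun j ↦ ψ (ns j), fun j ↦ (hψ _).of_le (by exact_mod_cast le_top),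
    hu.memLp.aestronglyMeasurable.aemeasurable, ?_, fun j ↦ hnorm _,
    hu.aestronglyMeasurable_trace.aemeasurable.restrict, ?_, ?_, ?_, ?_, ?_⟩
  · simpa only [ofReal_norm] using
      hu.memLp_grad.aestronglyMeasurable.aemeasurable.ennreal_ofReal
  · rw [← eLpNorm_two_sq]
    exact ENNReal.pow_lt_top hu.memLp.eLpNorm_lt_top
  · have := ENNReal.pow_lt_top hu.memLp_grad.eLpNorm_lt_top (n := 2)
    rw [eLpNorm_two_sq] at this
    simpa only [enorm_norm] using this
  · refine lt_of_le_of_lt (ENNReal.tsum_le_tsum fun j ↦ ?_) hns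
    rw [← eLpNorm_two_sq, add_assoc]
    exact le_self_add
  · refine lt_of_le_of_lt (ENNReal.tsum_le_tsum fun j ↦ ?_) hns
    refine le_trans (le_of_eq ?_) (le_self_add.trans' (le_add_self (b :=
      eLpNorm (fun x ↦ ψ (ns j) x - u x) 2 (volM n M) ^ 2)))
    rw [eLpNorm_two_sq]
    simp only [enorm_norm]
  · refine lt_of_le_of_lt (ENNReal.tsum_le_tsum fun j ↦ ?_) hns
    rw [← eLpNorm_two_sq]
    exact le_add_self

namespace H1Approx

lemma aemeasurable_sq (h : H1Approx u G τ S φ) (j : ℕ) :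
    AEMeasurable (fun x ↦ ‖φ j x - u x‖ₑ ^ 2) (volM n M) :=
  ((h.contMDiff j).continuous.measurable.aemeasurable.sub h.aemeasurable).enorm.pow_const 2

lemma aemeasurable_trace_sq (h : H1Approx u G τ S φ) (j : ℕ) :
    AEMeasurable (fun x ↦ ‖φ j x - τ x‖ₑ ^ 2) ((volBoundary n M).restrict S) :=
  ((h.contMDiff j).continuous.measurable.aemeasurable.sub h.aemeasurable_trace).enorm.pow_const 2

lemma lintegral_tsum_lt_top (h : H1Approx u G τ S φ) :
    ∫⁻ x, ∑' j, ‖φ j x - u x‖ₑ ^ 2 ∂volM n M < ⊤ := by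
  rw [lintegral_tsum h.aemeasurable_sq]
  exact h.tsum_lt_top

lemma lintegral_tsum_grad_lt_top (h : H1Approx u G τ S φ) :
    ∫⁻ x, ∑' j, ‖grad (φ j) x - G x‖ₑ ^ 2 ∂volM n M < ⊤ := by
  rw [lintegral_tsum fun j ↦ (h.aemeasurable_grad_sub j).pow_const 2]
  exact h.tsum_grad_lt_top

lemma lintegral_tsum_trace_lt_top (h : H1Approx u G τ S φ) :
    ∫⁻ x in S, ∑' j, ‖φ j x - τ x‖ₑ ^ 2 ∂volBoundary n M < ⊤ := by
  rw [lintegral_tsum h.aemeasurable_trace_sq]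
  exact h.tsum_trace_lt_top

lemma aemeasurable_tsum (h : H1Approx u G τ S φ) :
    AEMeasurable (fun x ↦ ∑' j, ‖φ j x - u x‖ₑ ^ 2) (volM n M) :=
  AEMeasurable.tsum h.aemeasurable_sq

lemma aemeasurable_tsum_grad (h : H1Approx u G τ S φ) :
    AEMeasurable (fun x ↦ ∑' j, ‖grad (φ j) x - G x‖ₑ ^ 2) (volM n M) :=
  AEMeasurable.tsum fun j ↦ (h.aemeasurable_grad_sub j).pow_const 2

lemma aemeasurable_tsum_trace (h : H1Approx u G τ S φ) :
    AEMeasurable (fun x ↦ ∑' j, ‖φ j x - τ x‖ₑ ^ 2) ((volBoundary n M).restrict S) :=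
  AEMeasurable.tsum h.aemeasurable_trace_sq

lemma ae_tendsto (h : H1Approx u G τ S φ) :
    ∀ᵐ x ∂volM n M, Tendsto (fun j ↦ φ j x) atTop (𝓝 (u x)) :=
  (ae_lt_top' h.aemeasurable_tsum h.lintegral_tsum_lt_top.ne).mono fun _ hx ↦
    tendsto_of_tsum_enorm_sq hx.ne

lemma ae_tendsto_grad (h : H1Approx u G τ S φ) :
    ∀ᵐ x ∂volM n M, Tendsto (fun j ↦ grad (φ j) x) atTop (𝓝 (G x)) :=
  (ae_lt_top' h.aemeasurable_tsum_grad h.lintegral_tsum_grad_lt_top.ne).mono fun _ hx ↦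
    tendsto_of_tsum_enorm_sq hx.ne

lemma ae_tendsto_trace (h : H1Approx u G τ S φ) :
    ∀ᵐ x ∂((volBoundary n M).restrict S), Tendsto (fun j ↦ φ j x) atTop (𝓝 (τ x)) :=
  (ae_lt_top' h.aemeasurable_tsum_trace h.lintegral_tsum_trace_lt_top.ne).mono fun _ hx ↦
    tendsto_of_tsum_enorm_sq hx.ne

/-- The errors `u - φᵢ` are approximated by the differences `φⱼ - φᵢ`. -/
lemma sub [IsManifold (𝓡∂ n) 1 M] (h : H1Approx u G τ S φ) (i : ℕ) :
    H1Approx (fun x ↦ u x - φ i x) (fun x ↦ G x - grad (φ i) x) (fun x ↦ τ x - φ i x) S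
      (fun j x ↦ φ j x - φ i x) := by
  have hm := (h.contMDiff i).continuous.measurable.aemeasurable (μ := volM n M)
  have hmb := (h.contMDiff i).continuous.measurable.aemeasurable
    (μ := (volBoundary n M).restrict S)
  have hg : ∀ j x, grad (n := n) (fun x ↦ φ j x - φ i x) x =
      grad (φ j) x - grad (φ i) x := fun j x ↦ by
    have h2 := ((h.contMDiff j).mdifferentiable one_ne_zero x).hasMFDerivAt.sub
      ((h.contMDiff i).mdifferentiable one_ne_zero x).hasMFDerivAt
    refine ext_inner_right ℝ fun v ↦ ?_
    rw [inner_sub_left, inner_grad, inner_grad, inner_grad]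
    exact DFunLike.congr_fun h2.mfderiv v
  have hg' : ∀ j x, grad (n := n) (fun x ↦ φ j x - φ i x) x - (G x - grad (φ i) x) =
      grad (φ j) x - G x := fun j x ↦ by rw [hg]; abel
  refine ⟨fun j ↦ (h.contMDiff j).sub (h.contMDiff i), h.aemeasurable.sub hm, ?_, fun j ↦ ?_,
    h.aemeasurable_trace.sub hmb, ?_, ?_, ?_, ?_, ?_⟩
  · simpa only [enorm_sub_rev (G _)] using h.aemeasurable_grad_sub i
  · simpa only [hg'] using h.aemeasurable_grad_sub j
  · simp only [enorm_sub_rev (u _)]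
    exact (ENNReal.le_tsum i).trans_lt h.tsum_lt_top
  · simp only [enorm_sub_rev (G _)]
    exact (ENNReal.le_tsum (f := fun j ↦ ∫⁻ x, ‖grad (φ j) x - G x‖ₑ ^ 2 ∂volM n M) i).trans_lt
      h.tsum_grad_lt_top
  · simpa only [sub_sub_sub_cancel_right] using h.tsum_lt_top
  · simpa only [hg'] using h.tsum_grad_lt_top
  · simpa only [sub_sub_sub_cancel_right] using h.tsum_trace_lt_top

end H1Approx

/-- A bound for the squared gradient of `η F(u)`, if `G` is the gradient of `u`. -/
def cutoffEnergy (η : M → ℝ) (F F' : ℝ → ℝ) (u : M → ℝ) (G : ∀ x : M, TangentSpace (𝓡∂ n) x)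
    (x : M) : ℝ≥0∞ :=
  2 * (‖grad (n := n) η x‖ₑ ^ 2 * ‖F (u x)‖ₑ ^ 2 + ‖η x‖ₑ ^ 2 * (‖F' (u x)‖ₑ ^ 2 * ‖G x‖ₑ ^ 2))

variable {F F' : ℝ → ℝ} {η : M → ℝ} {S₀ U K : Set M} {L : ℝ}

lemma enorm_sq_grad_mul_comp_le {v : M → ℝ} (hF : IsC1Lipschitz F F')
    (hη : ContMDiff (𝓡∂ n) 𝓘(ℝ, ℝ) 1 η) (hv : ContMDiff (𝓡∂ n) 𝓘(ℝ, ℝ) 1 v) (x : M) :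
    ‖grad (n := n) (fun x ↦ η x * F (v x)) x‖ₑ ^ 2 ≤ cutoffEnergy η F F' v (grad (n := n) v) x := by
  have h1 := grad_mul (n := n) (hη.mdifferentiable one_ne_zero x)
    ((hF.contDiff.contMDiff.comp hv).mdifferentiable one_ne_zero x)
  have h2 : grad (n := n) (F ∘ v) x = F' (v x) • grad v x :=
    grad_comp (hF.hasDerivAt (v x)) (hv.mdifferentiable one_ne_zero x)
  have h3 : ‖grad (n := n) (fun x ↦ η x * F (v x)) x‖ ≤
      |η x| * (|F' (v x)| * ‖grad (n := n) v x‖) + |F (v x)| * ‖grad (n := n) η x‖ := by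
    have h4 : grad (n := n) (fun x ↦ η x * F (v x)) x = _ := h1
    rw [h4, h2]
    refine (norm_add_le _ _).trans_eq ?_
    rw [norm_smul, norm_smul, norm_smul]
    rfl
  rw [cutoffEnergy]
  simp only [← ofReal_norm, ← ENNReal.ofReal_pow (norm_nonneg _)]
  rw [← ENNReal.ofReal_mul (by positivity), ← ENNReal.ofReal_mul (by positivity),
    ← ENNReal.ofReal_mul (by positivity), ← ENNReal.ofReal_add (by positivity) (by positivity)]
  have h5 : ‖grad (n := n) (fun x ↦ η x * F (v x)) x‖ ^ 2 ≤
      2 * (‖grad (n := n) η x‖ ^ 2 * ‖F (v x)‖ ^ 2 +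
        ‖η x‖ ^ 2 * (‖F' (v x)‖ ^ 2 * ‖grad (n := n) v x‖ ^ 2)) := by
    simp only [Real.norm_eq_abs]
    set a := |η x| * (|F' (v x)| * ‖grad (n := n) v x‖) with ha
    set b := |F (v x)| * ‖grad (n := n) η x‖ with hb
    calc _ ≤ (a + b) ^ 2 := by gcongr
      _ ≤ 2 * (b ^ 2 + a ^ 2) := by nlinarith [sq_nonneg (a - b)]
      _ = _ := by rw [ha, hb]; ring
  refine (ENNReal.ofReal_le_ofReal h5).trans_eq ?_
  rw [ENNReal.ofReal_mul zero_le_two, ENNReal.ofReal_ofNat]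

lemma IsCutoff.enorm_le_one (hη : IsCutoff n η S₀ U K L) (x : M) : ‖η x‖ₑ ^ 2 ≤ 1 := by
  rw [← ofReal_norm, Real.norm_of_nonneg (hη.nonneg x), ← ENNReal.ofReal_pow (hη.nonneg x)]
  exact ENNReal.ofReal_le_one.2 (pow_le_one₀ (hη.nonneg x) (hη.le_one x))

lemma IsCutoff.grad_eq_zero (hη : IsCutoff n η S₀ U K L) {x : M} (hx : x ∉ K) :
    grad (n := n) η x = 0 := by
  refine RobinMoser.grad_eq_zero ?_
  filter_upwards [hη.isCompact.isClosed.isOpen_compl.mem_nhds hx] with z hz using hη.eq_zero z hz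

lemma IsCutoff.enorm_grad_le (hη : IsCutoff n η S₀ U K L) (x : M) :
    ‖grad (n := n) η x‖ₑ ^ 2 ≤ K.indicator (fun _ ↦ ofReal (L ^ 2)) x := by
  by_cases hx : x ∈ K
  · rw [indicator_of_mem hx, ← ofReal_norm, ← ENNReal.ofReal_pow (norm_nonneg _)]
    exact ENNReal.ofReal_le_ofReal (by gcongr; exact hη.norm_grad_le x)
  · rw [indicator_of_notMem hx, hη.grad_eq_zero hx]
    simp

lemma IsCutoff.enorm_sq_le_indicator (hη : IsCutoff n η S₀ U K L) (x : M) :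
    ‖η x‖ₑ ^ 2 ≤ K.indicator (fun _ ↦ 1) x := by
  by_cases hx : x ∈ K
  · rw [indicator_of_mem hx]; exact hη.enorm_le_one x
  · rw [indicator_of_notMem hx, hη.eq_zero x hx]
    simp

/-- A weighted integral of `F(φⱼ)²` converges if the weight is compatible with the dominating
function. -/
lemma tendsto_lintegral_mul_comp_sq {X : Type*} [MeasurableSpace X] {m : Measure X}
    {ζ : X → ℝ≥0∞} {f : ℕ → X → ℝ} {g : X → ℝ} (hF : IsC1Lipschitz F F')
    (hζ : AEMeasurable ζ m) (hζtop : ∀ᵐ x ∂m, ζ x ≠ ⊤) (hf : ∀ j, AEMeasurable (f j) m)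
    (hfin : ∫⁻ x, ζ x * (1 + (‖g x‖ₑ ^ 2 + ∑' j, ‖f j x - g x‖ₑ ^ 2)) ∂m < ⊤)
    (hlim : ∀ᵐ x ∂m, Tendsto (fun j ↦ f j x) atTop (𝓝 (g x))) :
    Tendsto (fun j ↦ ∫⁻ x, ζ x * ‖F (f j x)‖ₑ ^ 2 ∂m) atTop
      (𝓝 (∫⁻ x, ζ x * ‖F (g x)‖ₑ ^ 2 ∂m)) := by
  obtain ⟨C, hC, -, hC2⟩ := hF.exists_enorm_bound
  refine tendsto_lintegral_of_dominated_convergence'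
    (fun x ↦ 2 * C * (ζ x * (1 + (‖g x‖ₑ ^ 2 + ∑' j, ‖f j x - g x‖ₑ ^ 2))))
    (fun j ↦ hζ.mul ((hF.continuous.measurable.comp_aemeasurable (hf j)).enorm.pow_const 2))
    (fun j ↦ Eventually.of_forall fun x ↦ ?_) ?_ ?_
  · change ζ x * ‖F (f j x)‖ₑ ^ 2 ≤ 2 * C * (ζ x * (1 + (‖g x‖ₑ ^ 2 + ∑' j, ‖f j x - g x‖ₑ ^ 2)))
    calc ζ x * ‖F (f j x)‖ₑ ^ 2 ≤ ζ x * (C * (2 * 1 +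
          2 * (‖g x‖ₑ ^ 2 + ∑' j, ‖f j x - g x‖ₑ ^ 2))) := by
          gcongr
          refine (hC2 _).trans ?_
          gcongr
          · norm_num
          · exact enorm_sq_le_of_tsum (fun j ↦ f j x) (g x) j
      _ = _ := by ring
  · rw [lintegral_const_mul' _ _ (ENNReal.mul_ne_top (by simp) hC)]
    exact (ENNReal.mul_lt_top (ENNReal.mul_lt_top (by simp) hC.lt_top) hfin).ne
  · filter_upwards [hlim, hζtop] with x hx hx'
    refine ENNReal.Tendsto.const_mul ?_ (Or.inr hx')
    exact ((ENNReal.continuous_pow 2).tendsto _).comp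
      ((continuous_enorm.tendsto _).comp ((hF.continuous.tendsto _).comp hx))

end Approximation

/-! ### Functional inequalities for elements of `H¹` -/

lemma ENNReal_liminf_add_le (u v : ℕ → ℝ≥0∞) :
    liminf u atTop + liminf v atTop ≤ liminf (fun j ↦ u j + v j) atTop := by
  simp only [liminf_eq_iSup_iInf_of_nat]
  rw [ENNReal.iSup_add_iSup_of_monotone
    (fun i j hij ↦ biInf_mono fun k hk ↦ hij.trans hk)
    (fun i j hij ↦ biInf_mono fun k hk ↦ hij.trans hk)]
  exact iSup_mono fun j ↦ le_iInf₂ fun i hi ↦ add_le_add (iInf₂_le i hi) (iInf₂_le i hi)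

section Limits

variable {n : ℕ} [NeZero n] {M : Type*} [EMetricSpace M]
  [ChartedSpace (EuclideanHalfSpace n) M] [IsManifold (𝓡∂ n) 1 M]
  [RiemannianBundle (fun x : M ↦ TangentSpace (𝓡∂ n) x)]
  [IsContinuousRiemannianBundle (𝔼 n) (fun x : M ↦ TangentSpace (𝓡∂ n) x)]
  [MeasurableSpace M] [BorelSpace M]
  {u : M → ℝ} {G : ∀ x : M, TangentSpace (𝓡∂ n) x} {τ : M → ℝ} {S : Set M}
  {φ : ℕ → M → ℝ} {F F' : ℝ → ℝ} {η : M → ℝ} {S₀ U K : Set M} {L : ℝ}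

lemma contMDiff_mul_comp {v : M → ℝ} (hF : IsC1Lipschitz F F')
    (hη : IsCutoff n η S₀ U K L) (hv : ContMDiff (𝓡∂ n) 𝓘(ℝ, ℝ) 1 v) :
    ContMDiff (𝓡∂ n) 𝓘(ℝ, ℝ) 1 fun x ↦ η x * F (v x) :=
  hη.contMDiff.mul (hF.contDiff.contMDiff.comp hv)

namespace H1Approx

lemma lintegral_weight_lt_top (h : H1Approx u G τ S φ) {ζ : M → ℝ≥0∞} {c : ℝ≥0∞} (hc : c ≠ ⊤)
    (hK : IsCompact K) (hKμ : volM n M K < ⊤) (hζ : ∀ x, ζ x ≤ K.indicator (fun _ ↦ c) x) :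
    ∫⁻ x, ζ x * (1 + (‖u x‖ₑ ^ 2 + ∑' j, ‖φ j x - u x‖ₑ ^ 2)) ∂volM n M < ⊤ := by
  calc _ ≤ ∫⁻ x, (c * K.indicator (fun _ ↦ 1) x +
        c * (‖u x‖ₑ ^ 2 + ∑' j, ‖φ j x - u x‖ₑ ^ 2)) ∂volM n M := by
        refine lintegral_mono fun x ↦ ?_
        refine (mul_le_mul_left (hζ x) _).trans ?_
        by_cases hx : x ∈ K
        · rw [indicator_of_mem hx, indicator_of_mem hx, mul_add]
        · rw [indicator_of_notMem hx, zero_mul]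
          exact zero_le
    _ = c * volM n M K + c * (∫⁻ x, ‖u x‖ₑ ^ 2 ∂volM n M +
        ∫⁻ x, ∑' j, ‖φ j x - u x‖ₑ ^ 2 ∂volM n M) := by
        rw [lintegral_add_left ((measurable_const.indicator hK.measurableSet).const_mul _),
          lintegral_const_mul' _ _ hc, lintegral_const_mul' _ _ hc,
          lintegral_add_left' (h.aemeasurable.enorm.pow_const 2),
          lintegral_indicator_const hK.measurableSet, one_mul]
    _ < ⊤ := ENNReal.add_lt_top.2 ⟨ENNReal.mul_lt_top hc.lt_top hKμ, ENNReal.mul_lt_top hc.lt_top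
        (ENNReal.add_lt_top.2 ⟨h.lintegral_sq_lt_top, h.lintegral_tsum_lt_top⟩)⟩

lemma tendsto_lintegral_mul_sq (h : H1Approx u G τ S φ) (hF : IsC1Lipschitz F F')
    (hη : IsCutoff n η S₀ U K L) (hKμ : volM n M K < ⊤) :
    Tendsto (fun j ↦ ∫⁻ x, ‖η x * F (φ j x)‖ₑ ^ 2 ∂volM n M) atTop
      (𝓝 (∫⁻ x, ‖η x * F (u x)‖ₑ ^ 2 ∂volM n M)) := by
  simp only [enorm_mul, mul_pow]
  exact tendsto_lintegral_mul_comp_sq hF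
    (hη.contMDiff.continuous.enorm.measurable.pow_const 2).aemeasurable
    (Eventually.of_forall fun x ↦ ENNReal.pow_ne_top enorm_ne_top)
    (fun j ↦ (h.contMDiff j).continuous.measurable.aemeasurable)
    (h.lintegral_weight_lt_top ENNReal.one_ne_top hη.isCompact hKμ hη.enorm_sq_le_indicator)
    h.ae_tendsto

lemma tendsto_lintegral_grad_sq (h : H1Approx u G τ S φ) (hF : IsC1Lipschitz F F')
    {ζ : M → ℝ≥0∞} (hζ : Measurable ζ) (hζ1 : ∀ x, ζ x ≤ 1) :
    Tendsto (fun j ↦ ∫⁻ x, ζ x * (‖F' (φ j x)‖ₑ ^ 2 * ‖grad (n := n) (φ j) x‖ₑ ^ 2) ∂volM n M)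
      atTop (𝓝 (∫⁻ x, ζ x * (‖F' (u x)‖ₑ ^ 2 * ‖G x‖ₑ ^ 2) ∂volM n M)) := by
  obtain ⟨C, hC, hC1, -⟩ := hF.exists_enorm_bound
  refine tendsto_lintegral_of_dominated_convergence'
    (fun x ↦ C * 2 * (‖G x‖ₑ ^ 2 + ∑' j, ‖grad (φ j) x - G x‖ₑ ^ 2)) (fun j ↦ ?_)
    (fun j ↦ Eventually.of_forall fun x ↦ ?_) ?_ ?_
  · exact hζ.aemeasurable.mul ((((hF.continuous_deriv.comp
      (h.contMDiff j).continuous).enorm.measurable.pow_const 2).mul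
      ((measurable_enorm_grad (h.contMDiff j)).pow_const 2)).aemeasurable)
  · calc ζ x * (‖F' (φ j x)‖ₑ ^ 2 * ‖grad (n := n) (φ j) x‖ₑ ^ 2) ≤
          1 * (C * (2 * (‖G x‖ₑ ^ 2 + ∑' j, ‖grad (φ j) x - G x‖ₑ ^ 2))) := by
          gcongr
          · exact hζ1 x
          · exact hC1 _
          · exact enorm_sq_le_of_tsum (fun j ↦ grad (n := n) (φ j) x) (G x) j
      _ = _ := by ring
  · rw [lintegral_const_mul' _ _ (ENNReal.mul_ne_top hC (by simp)),
      lintegral_add_left' (h.aemeasurable_norm_grad.pow_const 2)]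
    exact (ENNReal.mul_lt_top (ENNReal.mul_lt_top hC.lt_top (by simp)) (ENNReal.add_lt_top.2
      ⟨h.lintegral_grad_sq_lt_top, h.lintegral_tsum_grad_lt_top⟩)).ne
  · filter_upwards [h.ae_tendsto, h.ae_tendsto_grad] with x hx hx'
    refine ENNReal.Tendsto.const_mul ?_ (Or.inr ((hζ1 x).trans_lt ENNReal.one_lt_top).ne)
    refine ENNReal.Tendsto.mul ?_ (Or.inr (ENNReal.pow_ne_top enorm_ne_top)) ?_
      (Or.inr (ENNReal.pow_ne_top enorm_ne_top))
    · exact ((ENNReal.continuous_pow 2).tendsto _).comp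
        ((continuous_enorm.tendsto _).comp ((hF.continuous_deriv.tendsto _).comp hx))
    · exact ((ENNReal.continuous_pow 2).tendsto _).comp
        ((continuous_enorm.tendsto _).comp hx')

lemma lintegral_cutoffEnergy_eq {v : M → ℝ} (hv : AEMeasurable v (volM n M))
    {V : ∀ x : M, TangentSpace (𝓡∂ n) x}
    (hF : IsC1Lipschitz F F') (hη : IsCutoff n η S₀ U K L) :
    ∫⁻ x, cutoffEnergy η F F' v V x ∂volM n M =
      2 * (∫⁻ x, ‖grad (n := n) η x‖ₑ ^ 2 * ‖F (v x)‖ₑ ^ 2 ∂volM n M +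
        ∫⁻ x, ‖η x‖ₑ ^ 2 * (‖F' (v x)‖ₑ ^ 2 * ‖V x‖ₑ ^ 2) ∂volM n M) := by
  simp only [cutoffEnergy]
  rw [lintegral_const_mul' _ _ (by simp), lintegral_add_left']
  exact ((measurable_enorm_grad hη.contMDiff).pow_const 2).aemeasurable.mul
    ((hF.continuous.measurable.comp_aemeasurable hv).enorm.pow_const 2)

lemma tendsto_lintegral_cutoffEnergy (h : H1Approx u G τ S φ) (hF : IsC1Lipschitz F F')
    (hη : IsCutoff n η S₀ U K L) (hKμ : volM n M K < ⊤) :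
    Tendsto (fun j ↦ ∫⁻ x, cutoffEnergy η F F' (φ j) (grad (n := n) (φ j)) x ∂volM n M) atTop
      (𝓝 (∫⁻ x, cutoffEnergy η F F' u G x ∂volM n M)) := by
  rw [lintegral_cutoffEnergy_eq h.aemeasurable hF hη]
  simp only [fun j ↦ lintegral_cutoffEnergy_eq (V := grad (n := n) (φ j))
    (h.contMDiff j).continuous.measurable.aemeasurable hF hη]
  refine ENNReal.Tendsto.const_mul (Tendsto.add ?_ ?_) (Or.inr (by simp))
  · exact tendsto_lintegral_mul_comp_sq hF
      ((measurable_enorm_grad hη.contMDiff).pow_const 2).aemeasurable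
      (Eventually.of_forall fun x ↦ ENNReal.pow_ne_top enorm_ne_top)
      (fun j ↦ (h.contMDiff j).continuous.measurable.aemeasurable)
      (h.lintegral_weight_lt_top ENNReal.ofReal_ne_top hη.isCompact hKμ hη.enorm_grad_le)
      h.ae_tendsto
  · exact h.tendsto_lintegral_grad_sq hF (hη.contMDiff.continuous.enorm.measurable.pow_const 2)
      hη.enorm_le_one

/-- The Sobolev inequality passes to the limit. -/
lemma sobolev (h : H1Approx u G τ S φ) (hF : IsC1Lipschitz F F')
    (hη : IsCutoff n η S₀ U K L) (hKμ : volM n M K < ⊤) {C : ℝ≥0∞} (hC : C ≠ ⊤) {κ : ℝ}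
    (hκ : 0 < κ)
    (hsob : ∀ v : M → ℝ, ContMDiff (𝓡∂ n) 𝓘(ℝ, ℝ) 1 v → (∀ x ∉ K, v x = 0) →
      (∫⁻ x, ‖v x‖ₑ ^ (2 * κ) ∂volM n M) ^ (1 / κ) ≤
        C * ∫⁻ x, ‖grad (n := n) v x‖ₑ ^ 2 ∂volM n M) :
    (∫⁻ x, ‖η x * F (u x)‖ₑ ^ (2 * κ) ∂volM n M) ^ (1 / κ) ≤
      C * ∫⁻ x, cutoffEnergy η F F' u G x ∂volM n M := by
  rw [one_div, ENNReal.rpow_inv_le_iff hκ]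
  refine lintegral_le_of_ae_tendsto_of_tendsto (F := fun j x ↦ ‖η x * F (φ j x)‖ₑ ^ (2 * κ))
    (fun j ↦ ((contMDiff_mul_comp hF hη
      (h.contMDiff j)).continuous.enorm.measurable.pow_const _).aemeasurable) ?_ (fun j ↦ ?_)
    ((ENNReal.continuous_rpow_const.tendsto _).comp (ENNReal.Tendsto.const_mul
      (h.tendsto_lintegral_cutoffEnergy hF hη hKμ) (Or.inr hC)))
  · filter_upwards [h.ae_tendsto] with x hx
    exact (ENNReal.continuous_rpow_const.tendsto _).comp ((continuous_enorm.tendsto _).comp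
      (((hF.continuous.tendsto _).comp hx).const_mul _))
  · rw [Function.comp_apply, ← ENNReal.rpow_inv_le_iff hκ, ← one_div]
    refine (hsob _ (contMDiff_mul_comp hF hη (h.contMDiff j)) fun x hx ↦ by
      rw [hη.eq_zero x hx, zero_mul]).trans ?_
    refine mul_le_mul_right ?_ _
    exact lintegral_mono fun x ↦ enorm_sq_grad_mul_comp_le hF hη.contMDiff (h.contMDiff j) x

end H1Approx

/-- A pair of potentials, `Q` in the interior and `Qb` on the boundary, is form bounded on `S` at
scale `r`: the quadratic form of the potentials is at most `ε` times the Dirichlet integral, at the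
cost of a constant that grows like a power of `1 / ε` and scales like `1 / r²`. -/
def FormBounded (n : ℕ) [NeZero n] {M : Type*} [EMetricSpace M]
    [ChartedSpace (EuclideanHalfSpace n) M]
    [RiemannianBundle (fun x : M ↦ TangentSpace (𝓡∂ n) x)] [MeasurableSpace M] [BorelSpace M]
    (S : Set M) (Q Qb : M → ℝ≥0∞) (C : ℝ) (ν : ℕ) (r : ℝ) : Prop :=
  ∀ (v : M → ℝ) (K : Set M), ContMDiff (𝓡∂ n) 𝓘(ℝ, ℝ) 1 v → IsCompact K → K ⊆ S →
    (∀ x ∉ K, v x = 0) → ∀ ε : ℝ, 0 < ε → ε ≤ 1 →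
    ∫⁻ x in S, Q x * ‖v x‖ₑ ^ 2 ∂volM n M +
        ∫⁻ x in S, Qb x * ‖v x‖ₑ ^ 2 ∂volBoundary n M ≤
      ofReal ε * ∫⁻ x, ‖grad (n := n) v x‖ₑ ^ 2 ∂volM n M +
        ofReal (C / ε ^ ν / r ^ 2) * ∫⁻ x, ‖v x‖ₑ ^ 2 ∂volM n M

namespace H1Approx

variable {Q Qb : M → ℝ≥0∞} {C r : ℝ} {ν : ℕ}

/-- Form boundedness passes to the limit. -/
lemma form_bound (h : H1Approx u G τ S φ) (hF : IsC1Lipschitz F F')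
    (hη : IsCutoff n η S₀ U K L) (hKμ : volM n M K < ⊤) (hKS : K ⊆ S)
    (hQ : AEMeasurable Q ((volM n M).restrict S))
    (hQb : AEMeasurable Qb ((volBoundary n M).restrict S))
    (hQtop : ∀ x, Q x ≠ ⊤) (hQbtop : ∀ x, Qb x ≠ ⊤)
    (hform : FormBounded n S Q Qb C ν r) {ε : ℝ} (hε : 0 < ε) (hε1 : ε ≤ 1) :
    ∫⁻ x in S, Q x * ‖η x * F (u x)‖ₑ ^ 2 ∂volM n M +
        ∫⁻ x in S, Qb x * ‖η x * F (τ x)‖ₑ ^ 2 ∂volBoundary n M ≤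
      ofReal ε * ∫⁻ x, cutoffEnergy η F F' u G x ∂volM n M +
        ofReal (C / ε ^ ν / r ^ 2) * ∫⁻ x, ‖η x * F (u x)‖ₑ ^ 2 ∂volM n M := by
  have hlim : Tendsto (fun j ↦ ofReal ε *
      ∫⁻ x, cutoffEnergy η F F' (φ j) (grad (n := n) (φ j)) x ∂volM n M +
        ofReal (C / ε ^ ν / r ^ 2) * ∫⁻ x, ‖η x * F (φ j x)‖ₑ ^ 2 ∂volM n M) atTop
      (𝓝 (ofReal ε * ∫⁻ x, cutoffEnergy η F F' u G x ∂volM n M +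
        ofReal (C / ε ^ ν / r ^ 2) * ∫⁻ x, ‖η x * F (u x)‖ₑ ^ 2 ∂volM n M)) :=
    (ENNReal.Tendsto.const_mul (h.tendsto_lintegral_cutoffEnergy hF hη hKμ)
      (Or.inr ENNReal.ofReal_ne_top)).add
    (ENNReal.Tendsto.const_mul (h.tendsto_lintegral_mul_sq hF hη hKμ)
      (Or.inr ENNReal.ofReal_ne_top))
  have hpt : ∀ {c : ℝ≥0∞} {x : M} {b : ℝ}, c ≠ ⊤ → Tendsto (fun j ↦ φ j x) atTop (𝓝 b) →
      Tendsto (fun j ↦ c * ‖η x * F (φ j x)‖ₑ ^ 2) atTop (𝓝 (c * ‖η x * F b‖ₑ ^ 2)) :=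
    fun hc hx ↦ ENNReal.Tendsto.const_mul (((ENNReal.continuous_pow 2).tendsto _).comp
      ((continuous_enorm.tendsto _).comp (((hF.continuous.tendsto _).comp hx).const_mul _)))
      (Or.inr hc)
  have hm : ∀ j, Measurable fun x ↦ ‖η x * F (φ j x)‖ₑ ^ 2 := fun j ↦
    (contMDiff_mul_comp hF hη (h.contMDiff j)).continuous.enorm.measurable.pow_const 2
  calc _ = ∫⁻ x in S, liminf (fun j ↦ Q x * ‖η x * F (φ j x)‖ₑ ^ 2) atTop ∂volM n M +
        ∫⁻ x in S, liminf (fun j ↦ Qb x * ‖η x * F (φ j x)‖ₑ ^ 2) atTop ∂volBoundary n M := by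
        congr 1
        · exact lintegral_congr_ae ((ae_restrict_of_ae h.ae_tendsto).mono fun x hx ↦
            (hpt (hQtop x) hx).liminf_eq.symm)
        · exact lintegral_congr_ae (h.ae_tendsto_trace.mono fun x hx ↦
            (hpt (hQbtop x) hx).liminf_eq.symm)
    _ ≤ liminf (fun j ↦ ∫⁻ x in S, Q x * ‖η x * F (φ j x)‖ₑ ^ 2 ∂volM n M) atTop +
        liminf (fun j ↦ ∫⁻ x in S, Qb x * ‖η x * F (φ j x)‖ₑ ^ 2 ∂volBoundary n M) atTop :=
        add_le_add (lintegral_liminf_le' fun j ↦ hQ.mul (hm j).aemeasurable)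
          (lintegral_liminf_le' fun j ↦ hQb.mul (hm j).aemeasurable)
    _ ≤ _ := ENNReal_liminf_add_le _ _
    _ ≤ liminf (fun j ↦ ofReal ε *
      ∫⁻ x, cutoffEnergy η F F' (φ j) (grad (n := n) (φ j)) x ∂volM n M +
        ofReal (C / ε ^ ν / r ^ 2) * ∫⁻ x, ‖η x * F (φ j x)‖ₑ ^ 2 ∂volM n M) atTop := by
        refine liminf_le_liminf (Eventually.of_forall fun j ↦ ?_)
        refine (hform _ K (contMDiff_mul_comp hF hη (h.contMDiff j)) hη.isCompact hKS
          (fun x hx ↦ by rw [hη.eq_zero x hx, zero_mul]) ε hε hε1).trans ?_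
        refine add_le_add (mul_le_mul_right ?_ _) le_rfl
        exact lintegral_mono fun x ↦ enorm_sq_grad_mul_comp_le hF hη.contMDiff (h.contMDiff j) x
    _ = _ := hlim.liminf_eq

/-- Traces of nonnegative functions are nonnegative. The trace inequality is applied to `η F(φⱼ)`,
where `F` vanishes exactly on `[0, ∞)`. -/
lemma ae_trace_nonneg (h : H1Approx u G τ S φ) (hu : ∀ᵐ x ∂volM n M, 0 ≤ u x)
    (hη : IsCutoff n η S₀ U K L) (hKμ : volM n M K < ⊤) {c : ℝ}
    (htr : ∀ v : M → ℝ, ContMDiff (𝓡∂ n) 𝓘(ℝ, ℝ) 1 v → (∀ x ∉ K, v x = 0) →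
      ∫⁻ x, ‖v x‖ₑ ^ 2 ∂volBoundary n M ≤
        ofReal 1 * ∫⁻ x, ‖grad (n := n) v x‖ₑ ^ 2 ∂volM n M +
          ofReal c * ∫⁻ x, ‖v x‖ₑ ^ 2 ∂volM n M) :
    ∀ᵐ x ∂((volBoundary n M).restrict S), η x ≠ 0 → 0 ≤ τ x := by
  -- a function that vanishes exactly on the half-line `[0, ∞)`
  set F : ℝ → ℝ := fun t ↦ softPart 1 t - t with hFdef
  have hF : IsC1Lipschitz F fun t ↦ softPartDeriv 1 t - 1 := by
    have h1 := isC1Lipschitz_softPart one_pos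
    obtain ⟨B, hB⟩ := h1.bounded
    refine ⟨fun t ↦ (h1.hasDerivAt t).sub (hasDerivAt_id t),
      h1.continuous_deriv.sub continuous_const, B + 1, fun t ↦ ?_⟩
    have := abs_sub (softPartDeriv 1 t) 1
    rw [abs_one] at this
    linarith [hB t]
  have hlim := (ENNReal.Tendsto.const_mul (a := ofReal 1)
    (h.tendsto_lintegral_cutoffEnergy hF hη hKμ) (Or.inr ENNReal.ofReal_ne_top)).add
    (ENNReal.Tendsto.const_mul (a := ofReal c) (h.tendsto_lintegral_mul_sq hF hη hKμ)
      (Or.inr ENNReal.ofReal_ne_top))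
  have hF0 : ∀ t, 0 ≤ t → F t = 0 := fun t ht ↦ by simp [hFdef, softPart_of_nonneg ht]
  have h1 : ∫⁻ x, cutoffEnergy η F (fun t ↦ softPartDeriv 1 t - 1) u G x ∂volM n M = 0 := by
    rw [lintegral_eq_zero_of_ae_eq_zero]
    filter_upwards [hu] with x hx
    simp [cutoffEnergy, hF0 _ hx, softPartDeriv_of_nonneg hx]
  have h2 : ∫⁻ x, ‖η x * F (u x)‖ₑ ^ 2 ∂volM n M = 0 := by
    rw [lintegral_eq_zero_of_ae_eq_zero]
    filter_upwards [hu] with x hx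
    simp [hF0 _ hx]
  rw [h1, h2, mul_zero, mul_zero, add_zero] at hlim
  have h3 : ∫⁻ x in S, ‖η x * F (τ x)‖ₑ ^ 2 ∂volBoundary n M ≤ 0 := by
    refine lintegral_le_of_ae_tendsto_of_tendsto (F := fun j x ↦ ‖η x * F (φ j x)‖ₑ ^ 2)
      (fun j ↦ ((contMDiff_mul_comp hF hη
        (h.contMDiff j)).continuous.enorm.measurable.pow_const _).aemeasurable) ?_ (fun j ↦ ?_) hlim
    · filter_upwards [h.ae_tendsto_trace] with x hx
      exact ((ENNReal.continuous_pow 2).tendsto _).comp ((continuous_enorm.tendsto _).comp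
        (((hF.continuous.tendsto _).comp hx).const_mul _))
    · refine (setLIntegral_le_lintegral _ _).trans
        ((htr _ (contMDiff_mul_comp hF hη (h.contMDiff j)) fun x hx ↦ by
          rw [hη.eq_zero x hx, zero_mul]).trans ?_)
      refine add_le_add (mul_le_mul_right ?_ _) le_rfl
      exact lintegral_mono fun x ↦ enorm_sq_grad_mul_comp_le hF hη.contMDiff (h.contMDiff j) x
  have hm : AEMeasurable (fun x ↦ ‖η x * F (τ x)‖ₑ ^ 2) ((volBoundary n M).restrict S) :=
    ((hη.contMDiff.continuous.measurable.aemeasurable.mul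
      (hF.continuous.measurable.comp_aemeasurable h.aemeasurable_trace)).enorm.pow_const 2)
  filter_upwards [(lintegral_eq_zero_iff' hm).1 (le_antisymm h3 zero_le)] with x hx hη0
  by_contra hneg
  have h4 : η x * F (τ x) = 0 := by simpa using hx
  rcases mul_eq_zero.1 h4 with h5 | h5
  · exact hη0 h5
  · have := lt_softPart one_pos (not_le.1 hneg)
    simp only [hFdef] at h5
    linarith

/-- The Poincaré inequality passes to the limit. -/
lemma poincare (h : H1Approx u G τ S φ) (hF : IsC1Lipschitz F F') {E : Set M}
    (hE : MeasurableSet E) (hEμ : volM n M E < ⊤) {c : ℝ≥0∞} (hc : c ≠ ⊤)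
    (hp : ∀ v : M → ℝ, ContMDiff (𝓡∂ n) 𝓘(ℝ, ℝ) 1 v →
      ∫⁻ x in E, ∫⁻ z in E, ‖v x - v z‖ₑ ^ 2 ∂volM n M ∂volM n M ≤
        c * ∫⁻ x in E, ‖grad (n := n) v x‖ₑ ^ 2 ∂volM n M) :
    ∫⁻ x in E, ∫⁻ z in E, ‖F (u x) - F (u z)‖ₑ ^ 2 ∂volM n M ∂volM n M ≤
      c * ∫⁻ x in E, ‖F' (u x)‖ₑ ^ 2 * ‖G x‖ₑ ^ 2 ∂volM n M := by
  have : IsFiniteMeasure ((volM n M).restrict E) :=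
    ⟨by rwa [Measure.restrict_apply_univ]⟩
  have hcont : ∀ j, Continuous fun x ↦ F (φ j x) := fun j ↦
    hF.continuous.comp (h.contMDiff j).continuous
  have hm : ∀ j, Measurable fun p : M × M ↦ ‖F (φ j p.1) - F (φ j p.2)‖ₑ ^ 2 := fun j ↦
    ((((hcont j).measurable.comp measurable_fst).sub
      ((hcont j).measurable.comp measurable_snd)).enorm.pow_const 2)
  have hlim : Tendsto (fun j ↦ c * ∫⁻ x in E, ‖grad (n := n) (fun x ↦ F (φ j x)) x‖ₑ ^ 2
      ∂volM n M) atTop (𝓝 (c * ∫⁻ x in E, ‖F' (u x)‖ₑ ^ 2 * ‖G x‖ₑ ^ 2 ∂volM n M)) := by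
    have h1 := h.tendsto_lintegral_grad_sq hF (ζ := E.indicator 1) (measurable_one.indicator hE)
      fun x ↦ indicator_le_self' (fun _ _ ↦ zero_le) x
    have h2 : ∀ f : M → ℝ≥0∞, ∫⁻ x, E.indicator 1 x * f x ∂volM n M =
        ∫⁻ x in E, f x ∂volM n M := fun f ↦ by
      rw [← lintegral_indicator hE]
      refine lintegral_congr fun x ↦ ?_
      by_cases hx : x ∈ E <;> simp [hx]
    simp only [h2] at h1
    refine ENNReal.Tendsto.const_mul (h1.congr fun j ↦ lintegral_congr fun x ↦ ?_) (Or.inr hc)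
    rw [grad_comp (hF.hasDerivAt _) ((h.contMDiff j).mdifferentiable one_ne_zero x), enorm_smul,
      mul_pow]
  have hae := ae_restrict_of_ae (s := E) h.ae_tendsto
  calc _ ≤ ∫⁻ x in E, liminf (fun j ↦ ∫⁻ z in E, ‖F (φ j x) - F (φ j z)‖ₑ ^ 2 ∂volM n M) atTop
        ∂volM n M := by
        refine lintegral_mono_ae (hae.mono fun x hx ↦ ?_)
        calc _ = ∫⁻ z in E, liminf (fun j ↦ ‖F (φ j x) - F (φ j z)‖ₑ ^ 2) atTop ∂volM n M :=
              lintegral_congr_ae (hae.mono fun z hz ↦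
                (((ENNReal.continuous_pow 2).tendsto _).comp ((continuous_enorm.tendsto _).comp
                  (((hF.continuous.tendsto _).comp hx).sub
                    ((hF.continuous.tendsto _).comp hz)))).liminf_eq.symm)
          _ ≤ _ := lintegral_liminf_le' fun j ↦ ((hm j).comp measurable_prodMk_left).aemeasurable
    _ ≤ liminf (fun j ↦ ∫⁻ x in E, ∫⁻ z in E, ‖F (φ j x) - F (φ j z)‖ₑ ^ 2 ∂volM n M
        ∂volM n M) atTop :=
        lintegral_liminf_le' fun j ↦ (hm j).lintegral_prod_right'.aemeasurable
    _ ≤ liminf (fun j ↦ c * ∫⁻ x in E, ‖grad (n := n) (fun x ↦ F (φ j x)) x‖ₑ ^ 2 ∂volM n M)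
        atTop := liminf_le_liminf (Eventually.of_forall fun j ↦
          hp _ (hF.contDiff.contMDiff.comp (h.contMDiff j)))
    _ = _ := hlim.liminf_eq

end H1Approx

end Limits

/-! ### Lower order terms in the weak form -/

/-- A majorant for the lower order terms of the weak form, tested with the approximating functions;
`k` lets the data be treated as part of the potential. -/
lemma enorm_lower_order_le {a b t z y Y B k : ℝ} {Z : ℝ≥0∞} (hk : 0 < k) (hB : 0 ≤ B)
    (hY : |Y| ≤ B * (1 + |y|)) (hy : ‖y‖ₑ ^ 2 ≤ 2 * (‖t‖ₑ ^ 2 + Z)) :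
    ‖-(a * t * (z * Y)) + b * (z * Y)‖ₑ ≤ ofReal (3 * B * (1 + k)) *
      (ofReal (|a| + |b| / k) * ‖z‖ₑ * (1 + (‖t‖ₑ ^ 2 + Z))) := by
  have h1 : |-(a * t * (z * Y)) + b * (z * Y)| ≤
      B * (1 + k) * ((|a| + |b| / k) * |z| * (2 + |t| ^ 2 + |y| ^ 2)) := by
    have h2 : |-(a * t) + b| ≤ (|a| + |b| / k) * (|t| + k) := by
      calc |-(a * t) + b| ≤ |a| * |t| + |b| := by
            refine (abs_add_le _ _).trans ?_
            rw [abs_neg, abs_mul]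
        _ ≤ _ := by
            have h3 : (|a| + |b| / k) * (|t| + k) = |a| * |t| + |b| + |a| * k + |b| / k * |t| := by
              field_simp
              ring
            have : 0 ≤ |a| * k + |b| / k * |t| := by positivity
            linarith
    have h3 : (|t| + k) * (1 + |y|) ≤ (1 + k) * (2 + |t| ^ 2 + |y| ^ 2) := by
      have h4 : (1 + |t|) * (1 + |y|) ≤ 2 + |t| ^ 2 + |y| ^ 2 := by
        nlinarith [sq_nonneg (1 - |t|), sq_nonneg (1 - |y|), sq_nonneg (|t| - |y|),
          sq_nonneg (|t| + |y| - 2)]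
      have h5 : |t| + k ≤ (1 + k) * (1 + |t|) := by nlinarith [abs_nonneg t]
      calc _ ≤ (1 + k) * (1 + |t|) * (1 + |y|) := by gcongr
        _ = (1 + k) * ((1 + |t|) * (1 + |y|)) := by ring
        _ ≤ _ := by gcongr
    calc _ = |-(a * t) + b| * (|z| * |Y|) := by rw [← abs_mul, ← abs_mul]; ring_nf
      _ ≤ (|a| + |b| / k) * (|t| + k) * (|z| * (B * (1 + |y|))) := by gcongr
      _ = B * ((|a| + |b| / k) * |z|) * ((|t| + k) * (1 + |y|)) := by ring
      _ ≤ B * ((|a| + |b| / k) * |z|) * ((1 + k) * (2 + |t| ^ 2 + |y| ^ 2)) := by gcongr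
      _ = _ := by ring
  calc _ ≤ ofReal (B * (1 + k) * ((|a| + |b| / k) * |z| * (2 + |t| ^ 2 + |y| ^ 2))) := by
        rw [← ofReal_norm]
        exact ENNReal.ofReal_le_ofReal h1
    _ = ofReal (B * (1 + k)) * (ofReal (|a| + |b| / k) * ‖z‖ₑ *
        (2 + ‖t‖ₑ ^ 2 + ‖y‖ₑ ^ 2)) := by
        rw [ENNReal.ofReal_mul (p := B * (1 + k)) (by positivity),
          ENNReal.ofReal_mul (p := (|a| + |b| / k) * |z|) (by positivity),
          ENNReal.ofReal_mul (p := |a| + |b| / k) (by positivity),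
          ENNReal.ofReal_add (p := 2 + |t| ^ 2) (by positivity) (by positivity),
          ENNReal.ofReal_add (p := 2) (by positivity) (by positivity), ENNReal.ofReal_pow (abs_nonneg _),
          ENNReal.ofReal_pow (abs_nonneg _), ENNReal.ofReal_ofNat]
        simp only [← ofReal_norm, Real.norm_eq_abs]
    _ ≤ ofReal (B * (1 + k)) * (ofReal (|a| + |b| / k) * ‖z‖ₑ *
        (3 * (1 + (‖t‖ₑ ^ 2 + Z)))) := by
        gcongr
        calc 2 + ‖t‖ₑ ^ 2 + ‖y‖ₑ ^ 2 ≤ 2 + ‖t‖ₑ ^ 2 + 2 * (‖t‖ₑ ^ 2 + Z) := by gcongr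
          _ ≤ (2 + ‖t‖ₑ ^ 2 + 2 * (‖t‖ₑ ^ 2 + Z)) + (1 + Z) := le_self_add
          _ = _ := by ring
    _ = _ := by
        rw [show 3 * B * (1 + k) = B * (1 + k) * 3 by ring, ENNReal.ofReal_mul (q := 3)
          (by positivity), ENNReal.ofReal_ofNat]
        ring

/-- The lower order terms for `t ≥ 0`: dividing the data by `k` turns them into a potential that
multiplies `t + k`. -/
lemma abs_lower_order_le {a b t z Y k : ℝ} (hk : 0 < k) (ht : 0 ≤ t) (hz : 0 ≤ z) (hY : 0 ≤ Y) :
    |-(a * t * (z * Y)) + b * (z * Y)| ≤ (|a| + |b| / k) * (t + k) * (z * Y) := by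
  have h1 : |-(a * t) + b| ≤ (|a| + |b| / k) * (t + k) := by
    calc |-(a * t) + b| ≤ |a| * t + |b| := by
          refine (abs_add_le _ _).trans ?_
          rw [abs_neg, abs_mul, abs_of_nonneg ht]
      _ ≤ _ := by
          have h3 : (|a| + |b| / k) * (t + k) = |a| * t + |b| + |a| * k + |b| / k * t := by
            field_simp
            ring
          have : 0 ≤ |a| * k + |b| / k * t := by positivity
          linarith
  calc _ = |-(a * t) + b| * (z * Y) := by
        rw [← abs_of_nonneg (mul_nonneg hz hY), ← abs_mul, abs_of_nonneg (mul_nonneg hz hY)]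
        ring_nf
    _ ≤ _ := by gcongr

section Energy

variable {n : ℕ} [NeZero n] {M : Type*} [EMetricSpace M]
  [ChartedSpace (EuclideanHalfSpace n) M] [IsManifold (𝓡∂ n) 1 M]
  [RiemannianBundle (fun x : M ↦ TangentSpace (𝓡∂ n) x)]
  [IsContinuousRiemannianBundle (𝔼 n) (fun x : M ↦ TangentSpace (𝓡∂ n) x)]
  [MeasurableSpace M] [BorelSpace M]
  {u : M → ℝ} {G : ∀ x : M, TangentSpace (𝓡∂ n) x} {τ : M → ℝ} {S : Set M}
  {φ : ℕ → M → ℝ} {F F' : ℝ → ℝ} {η : M → ℝ} {S₀ U K : Set M} {L : ℝ}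

lemma IsCutoff.sq (hη : IsCutoff n η S₀ U K L) :
    IsCutoff n (fun x ↦ η x * η x) S₀ U K (2 * L) where
  contMDiff := hη.contMDiff.mul hη.contMDiff
  nonneg x := mul_self_nonneg _
  le_one x := mul_le_one₀ (hη.le_one x) (hη.nonneg x) (hη.le_one x)
  eq_one x hx := by rw [hη.eq_one x hx, mul_one]
  isCompact := hη.isCompact
  subset := hη.subset
  eq_zero x hx := by rw [hη.eq_zero x hx, mul_zero]
  norm_grad_le x := by
    have hd := hη.contMDiff.mdifferentiable one_ne_zero x
    have h1 := hη.nonneg x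
    have h2 := hη.le_one x
    have h3 := hη.norm_grad_le x
    rw [grad_mul hd hd, ← two_smul ℝ, norm_smul, norm_smul, Real.norm_of_nonneg h1,
      Real.norm_of_nonneg zero_le_two]
    gcongr
    nlinarith [norm_nonneg (grad (n := n) η x)]

lemma norm_grad_mul_self (hη : ContMDiff (𝓡∂ n) 𝓘(ℝ, ℝ) 1 η) (x : M) :
    ‖grad (n := n) (fun x ↦ η x * η x) x‖ = 2 * (|η x| * ‖grad (n := n) η x‖) := by
  have hd := hη.mdifferentiable one_ne_zero x
  rw [grad_mul hd hd, ← two_smul ℝ, norm_smul, norm_smul, Real.norm_of_nonneg zero_le_two,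
    Real.norm_eq_abs]

namespace H1Approx

variable {Q Qb : M → ℝ≥0∞} {C r : ℝ} {ν : ℕ}

lemma lintegral_cutoffEnergy_lt_top (h : H1Approx u G τ S φ) (hF : IsC1Lipschitz F F')
    (hη : IsCutoff n η S₀ U K L) (hKμ : volM n M K < ⊤) :
    ∫⁻ x, cutoffEnergy η F F' u G x ∂volM n M < ⊤ := by
  obtain ⟨B, hB, hB1, hB2⟩ := hF.exists_enorm_bound
  rw [lintegral_cutoffEnergy_eq h.aemeasurable hF hη]
  refine ENNReal.mul_lt_top (by simp) (ENNReal.add_lt_top.2 ⟨?_, ?_⟩)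
  · calc _ ≤ ∫⁻ x, B * (‖grad (n := n) η x‖ₑ ^ 2 *
          (1 + (‖u x‖ₑ ^ 2 + ∑' j, ‖φ j x - u x‖ₑ ^ 2))) ∂volM n M := by
          refine lintegral_mono fun x ↦ ?_
          rw [mul_left_comm]
          gcongr
          refine (hB2 _).trans ?_
          gcongr
          exact le_self_add
      _ = B * _ := lintegral_const_mul' _ _ hB
      _ < ⊤ := ENNReal.mul_lt_top hB.lt_top (h.lintegral_weight_lt_top ENNReal.ofReal_ne_top
          hη.isCompact hKμ hη.enorm_grad_le)
  · calc _ ≤ ∫⁻ x, B * ‖G x‖ₑ ^ 2 ∂volM n M := by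
          refine lintegral_mono fun x ↦ ?_
          calc _ ≤ 1 * (B * ‖G x‖ₑ ^ 2) := by
                gcongr
                · exact hη.enorm_le_one x
                · exact hB1 _
            _ = _ := one_mul _
      _ = B * _ := lintegral_const_mul' _ _ hB
      _ < ⊤ := ENNReal.mul_lt_top hB.lt_top h.lintegral_grad_sq_lt_top

lemma lintegral_mul_sq_lt_top (h : H1Approx u G τ S φ) (hF : IsC1Lipschitz F F')
    (hη : IsCutoff n η S₀ U K L) (hKμ : volM n M K < ⊤) :
    ∫⁻ x, ‖η x * F (u x)‖ₑ ^ 2 ∂volM n M < ⊤ := by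
  obtain ⟨B, hB, -, hB2⟩ := hF.exists_enorm_bound
  calc _ ≤ ∫⁻ x, B * (‖η x‖ₑ ^ 2 *
        (1 + (‖u x‖ₑ ^ 2 + ∑' j, ‖φ j x - u x‖ₑ ^ 2))) ∂volM n M := by
        refine lintegral_mono fun x ↦ ?_
        rw [mul_left_comm, enorm_mul, mul_pow]
        gcongr
        refine (hB2 _).trans ?_
        gcongr
        exact le_self_add
    _ = B * _ := lintegral_const_mul' _ _ hB
    _ < ⊤ := ENNReal.mul_lt_top hB.lt_top (h.lintegral_weight_lt_top ENNReal.one_ne_top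
        hη.isCompact hKμ hη.enorm_sq_le_indicator)

lemma isC1Lipschitz_const : IsC1Lipschitz (fun _ ↦ 1) fun _ ↦ 0 :=
  ⟨fun t ↦ hasDerivAt_const t 1, continuous_const, 0, fun t ↦ by simp⟩

lemma isC1Lipschitz_id : IsC1Lipschitz (fun t ↦ t) fun _ ↦ 1 :=
  ⟨fun t ↦ hasDerivAt_id t, continuous_const, 1, fun t ↦ by simp⟩

/-- The approximation is also summable in the spaces weighted by form bounded potentials. -/
lemma lintegral_potential_lt_top (h : H1Approx u G τ S φ)
    (hη : IsCutoff n η S₀ U K L) (hKμ : volM n M K < ⊤) (hKS : K ⊆ S)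
    (hQ : AEMeasurable Q ((volM n M).restrict S))
    (hQb : AEMeasurable Qb ((volBoundary n M).restrict S))
    (hQtop : ∀ x, Q x ≠ ⊤) (hQbtop : ∀ x, Qb x ≠ ⊤)
    (hform : FormBounded n S Q Qb C ν r) :
    ∫⁻ x in S, Q x * ‖η x‖ₑ ^ 2 * (1 + (‖u x‖ₑ ^ 2 + ∑' j, ‖φ j x - u x‖ₑ ^ 2)) ∂volM n M < ⊤ ∧
    ∫⁻ x in S, Qb x * ‖η x‖ₑ ^ 2 * (1 + (‖τ x‖ₑ ^ 2 + ∑' j, ‖φ j x - τ x‖ₑ ^ 2))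
      ∂volBoundary n M < ⊤ := by
  have hfin : ∀ {F F' : ℝ → ℝ}, IsC1Lipschitz F F' →
      ∫⁻ x in S, Q x * ‖η x * F (u x)‖ₑ ^ 2 ∂volM n M +
        ∫⁻ x in S, Qb x * ‖η x * F (τ x)‖ₑ ^ 2 ∂volBoundary n M < ⊤ := fun hF ↦
    (h.form_bound hF hη hKμ hKS hQ hQb hQtop hQbtop hform one_pos le_rfl).trans_lt
      (ENNReal.add_lt_top.2 ⟨ENNReal.mul_lt_top ENNReal.ofReal_lt_top
        (h.lintegral_cutoffEnergy_lt_top hF hη hKμ), ENNReal.mul_lt_top ENNReal.ofReal_lt_top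
        (h.lintegral_mul_sq_lt_top hF hη hKμ)⟩)
  have h1 := ENNReal.add_lt_top.1 (hfin isC1Lipschitz_const)
  have h2 := ENNReal.add_lt_top.1 (hfin isC1Lipschitz_id)
  set D : ℝ≥0∞ := ofReal (C / 1 ^ ν / r ^ 2) with hD
  have h3 : ∀ j, ∫⁻ x in S, Q x * ‖η x * (u x - φ j x)‖ₑ ^ 2 ∂volM n M +
        ∫⁻ x in S, Qb x * ‖η x * (τ x - φ j x)‖ₑ ^ 2 ∂volBoundary n M ≤
      (2 * ofReal (L ^ 2) + D) * ∫⁻ x, ‖φ j x - u x‖ₑ ^ 2 ∂volM n M +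
        2 * ∫⁻ x, ‖grad (φ j) x - G x‖ₑ ^ 2 ∂volM n M := by
    intro j
    refine ((h.sub j).form_bound isC1Lipschitz_id hη hKμ hKS hQ hQb hQtop hQbtop hform one_pos
      le_rfl).trans ?_
    rw [ENNReal.ofReal_one, one_mul, lintegral_cutoffEnergy_eq (h.sub j).aemeasurable
      isC1Lipschitz_id hη]
    have h4 : ∫⁻ x, ‖grad (n := n) η x‖ₑ ^ 2 * ‖u x - φ j x‖ₑ ^ 2 ∂volM n M ≤
        ofReal (L ^ 2) * ∫⁻ x, ‖φ j x - u x‖ₑ ^ 2 ∂volM n M := by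
      rw [← lintegral_const_mul' _ _ ENNReal.ofReal_ne_top]
      refine lintegral_mono fun x ↦ ?_
      rw [enorm_sub_rev]
      gcongr
      refine (hη.enorm_grad_le x).trans (indicator_le_self' (fun _ _ ↦ zero_le) x)
    have h5 : ∫⁻ x, ‖η x‖ₑ ^ 2 * (‖(1 : ℝ)‖ₑ ^ 2 * ‖G x - grad (φ j) x‖ₑ ^ 2) ∂volM n M ≤
        ∫⁻ x, ‖grad (φ j) x - G x‖ₑ ^ 2 ∂volM n M := by
      refine lintegral_mono fun x ↦ ?_
      rw [enorm_sub_rev, enorm_one, one_pow, one_mul]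
      exact (mul_le_mul_left (hη.enorm_le_one x) _).trans_eq (one_mul _)
    have h6 : ∫⁻ x, ‖η x * (u x - φ j x)‖ₑ ^ 2 ∂volM n M ≤
        ∫⁻ x, ‖φ j x - u x‖ₑ ^ 2 ∂volM n M := by
      refine lintegral_mono fun x ↦ ?_
      rw [enorm_mul, mul_pow, enorm_sub_rev (u x)]
      exact (mul_le_mul_left (hη.enorm_le_one x) _).trans_eq (one_mul _)
    calc _ ≤ 2 * (ofReal (L ^ 2) * ∫⁻ x, ‖φ j x - u x‖ₑ ^ 2 ∂volM n M +
          ∫⁻ x, ‖grad (φ j) x - G x‖ₑ ^ 2 ∂volM n M) +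
          D * ∫⁻ x, ‖φ j x - u x‖ₑ ^ 2 ∂volM n M := by
          exact add_le_add (mul_le_mul_right (add_le_add h4 h5) _) (mul_le_mul_right h6 _)
      _ = _ := by ring
  have h4 : ∑' j, (∫⁻ x in S, Q x * ‖η x * (u x - φ j x)‖ₑ ^ 2 ∂volM n M +
        ∫⁻ x in S, Qb x * ‖η x * (τ x - φ j x)‖ₑ ^ 2 ∂volBoundary n M) < ⊤ := by
    refine (ENNReal.tsum_le_tsum h3).trans_lt ?_
    rw [ENNReal.tsum_add, ENNReal.tsum_mul_left, ENNReal.tsum_mul_left]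
    exact ENNReal.add_lt_top.2 ⟨ENNReal.mul_lt_top (ENNReal.add_lt_top.2
      ⟨ENNReal.mul_lt_top (by simp) ENNReal.ofReal_lt_top, ENNReal.ofReal_lt_top⟩) h.tsum_lt_top,
      ENNReal.mul_lt_top (by simp) h.tsum_grad_lt_top⟩
  rw [ENNReal.tsum_add] at h4
  have h5 := ENNReal.add_lt_top.1 h4
  have hηm : Measurable fun x ↦ ‖η x‖ₑ ^ 2 := hη.contMDiff.continuous.enorm.measurable.pow_const 2
  have hsum : ∀ {m : Measure M} {P : M → ℝ≥0∞} {g : M → ℝ}, AEMeasurable P m →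
      AEMeasurable g m → ∫⁻ x, P x * ‖η x * 1‖ₑ ^ 2 ∂m < ⊤ → ∫⁻ x, P x * ‖η x * g x‖ₑ ^ 2 ∂m < ⊤ →
      ∑' j, ∫⁻ x, P x * ‖η x * (g x - φ j x)‖ₑ ^ 2 ∂m < ⊤ →
      ∫⁻ x, P x * ‖η x‖ₑ ^ 2 * (1 + (‖g x‖ₑ ^ 2 + ∑' j, ‖φ j x - g x‖ₑ ^ 2)) ∂m < ⊤ := by
    intro m P g hP hg a1 a2 a3
    have hm : ∀ j, AEMeasurable (fun x ↦ P x * ‖η x * (g x - φ j x)‖ₑ ^ 2) m := fun j ↦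
      hP.mul ((hη.contMDiff.continuous.measurable.aemeasurable.mul
        (hg.sub (h.contMDiff j).continuous.measurable.aemeasurable)).enorm.pow_const 2)
    rw [← lintegral_tsum hm] at a3
    have a4 : ∀ x, P x * ‖η x‖ₑ ^ 2 * (1 + (‖g x‖ₑ ^ 2 + ∑' j, ‖φ j x - g x‖ₑ ^ 2)) =
        P x * ‖η x * 1‖ₑ ^ 2 + (P x * ‖η x * g x‖ₑ ^ 2 +
          ∑' j, P x * ‖η x * (g x - φ j x)‖ₑ ^ 2) := fun x ↦ by
      rw [ENNReal.tsum_mul_left]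
      simp only [enorm_mul, mul_pow, ENNReal.tsum_mul_left, enorm_one, enorm_sub_rev (g x)]
      ring
    simp only [a4]
    have hm1 : AEMeasurable (fun x ↦ P x * ‖η x * 1‖ₑ ^ 2) m :=
      hP.mul (by simpa using hηm.aemeasurable)
    have hm2 : AEMeasurable (fun x ↦ P x * ‖η x * g x‖ₑ ^ 2) m :=
      hP.mul ((hη.contMDiff.continuous.measurable.aemeasurable.mul hg).enorm.pow_const 2)
    rw [lintegral_add_left' hm1, lintegral_add_left' hm2]
    exact ENNReal.add_lt_top.2 ⟨a1, ENNReal.add_lt_top.2 ⟨a2, a3⟩⟩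
  exact ⟨hsum hQ h.aemeasurable.restrict h1.1 h2.1 h5.1, hsum hQb h.aemeasurable_trace h1.2 h2.2
    h5.2⟩

end H1Approx

end Energy

/-! ### Test functions that depend on the solution -/

section WeakForm

variable {n : ℕ} [NeZero n] {M : Type*} [EMetricSpace M]
  [ChartedSpace (EuclideanHalfSpace n) M] [IsManifold (𝓡∂ n) 1 M]
  [RiemannianBundle (fun x : M ↦ TangentSpace (𝓡∂ n) x)]
  [IsContinuousRiemannianBundle (𝔼 n) (fun x : M ↦ TangentSpace (𝓡∂ n) x)]
  [MeasurableSpace M] [BorelSpace M]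
  {u : M → ℝ} {G : ∀ x : M, TangentSpace (𝓡∂ n) x} {τ : M → ℝ} {S : Set M}
  {φ : ℕ → M → ℝ} {F F' : ℝ → ℝ} {ζ : M → ℝ} {S₀ U K : Set M} {L : ℝ}
  {P f Pb fb : M → ℝ} {k s : ℝ}

namespace H1Approx

lemma aestronglyMeasurable_inner (h : H1Approx u G τ S φ) {v : M → ℝ}
    (hv : ContMDiff (𝓡∂ n) 𝓘(ℝ, ℝ) 1 v) :
    AEStronglyMeasurable (fun x ↦ inner ℝ (G x) (grad (n := n) v x)) (volM n M) := by
  refine aestronglyMeasurable_of_tendsto_ae atTop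
    (f := fun j x ↦ inner ℝ (grad (n := n) (φ j) x) (grad (n := n) v x))
    (fun j ↦ (measurable_inner_grad (h.contMDiff j) hv).aestronglyMeasurable) ?_
  filter_upwards [h.ae_tendsto_grad] with x hx using hx.inner tendsto_const_nhds

/-- The gradient of the test function `ζ F(v)`. -/
lemma grad_mul_comp {v : M → ℝ} (hF : IsC1Lipschitz F F')
    (hζ : ContMDiff (𝓡∂ n) 𝓘(ℝ, ℝ) 1 ζ) (hv : ContMDiff (𝓡∂ n) 𝓘(ℝ, ℝ) 1 v) (x : M) :
    grad (n := n) (fun x ↦ ζ x * F (v x)) x =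
      (ζ x * F' (v x)) • grad (n := n) v x + F (v x) • grad (n := n) ζ x := by
  have h1 := grad_mul (n := n) (hζ.mdifferentiable one_ne_zero x)
    ((hF.contDiff.contMDiff.comp hv).mdifferentiable one_ne_zero x)
  have h2 : grad (n := n) (F ∘ v) x = F' (v x) • grad v x :=
    grad_comp (hF.hasDerivAt (v x)) (hv.mdifferentiable one_ne_zero x)
  rw [h2, smul_smul] at h1
  exact h1

/-- The weak inequality tested with `ζ F(u)`, obtained as the limit of the test functions
`ζ F(φⱼ)`. -/
lemma weak_inequality (h : H1Approx u G τ S φ) (hk : 0 < k) (hF : IsC1Lipschitz F F')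
    (hF0 : ∀ t, 0 ≤ F t) (hζ : IsCutoff n ζ S₀ U K L) (hKμ : volM n M K < ⊤) (hKS : K ⊆ S)
    (hP : AEMeasurable P (volM n M)) (hf : AEMeasurable f (volM n M))
    (hPb : AEMeasurable Pb (volBoundary n M)) (hfb : AEMeasurable fb (volBoundary n M))
    (hQ : ∫⁻ x in S, ofReal (|P x| + |f x| / k) * ‖ζ x‖ₑ *
      (1 + (‖u x‖ₑ ^ 2 + ∑' j, ‖φ j x - u x‖ₑ ^ 2)) ∂volM n M < ⊤)
    (hQb : ∫⁻ x in S, ofReal (|Pb x| + |fb x| / k) * ‖ζ x‖ₑ *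
      (1 + (‖τ x‖ₑ ^ 2 + ∑' j, ‖φ j x - τ x‖ₑ ^ 2)) ∂volBoundary n M < ⊤)
    (hweak : ∀ v, IsTest n v → s * weakForm P f Pb fb u G τ v ≤ 0) :
    Integrable (fun x ↦ (F (u x) * inner ℝ (G x) (grad (n := n) ζ x) +
      ζ x * F' (u x) * ‖G x‖ ^ 2) + (-(P x * u x * (ζ x * F (u x))) + f x * (ζ x * F (u x))))
      ((volM n M).restrict S) ∧
    Integrable (fun x ↦ -(Pb x * τ x * (ζ x * F (τ x))) + fb x * (ζ x * F (τ x)))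
      ((volBoundary n M).restrict S) ∧
    s * ((∫ x in S, ((F (u x) * inner ℝ (G x) (grad (n := n) ζ x) +
      ζ x * F' (u x) * ‖G x‖ ^ 2) + (-(P x * u x * (ζ x * F (u x))) + f x * (ζ x * F (u x))))
        ∂volM n M) +
      ∫ x in S, (-(Pb x * τ x * (ζ x * F (τ x))) + fb x * (ζ x * F (τ x))) ∂volBoundary n M) ≤
        0 := by
  obtain ⟨B, hB0, hB1, hB2⟩ := hF.exists_bound
  obtain ⟨C, hC, hC1, hC2⟩ := hF.exists_enorm_bound
  set v : ℕ → M → ℝ := fun j x ↦ ζ x * F (φ j x) with hv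
  have hvc : ∀ j, ContMDiff (𝓡∂ n) 𝓘(ℝ, ℝ) 1 (v j) := fun j ↦
    contMDiff_mul_comp hF hζ (h.contMDiff j)
  have hv0 : ∀ j, ∀ x ∉ S, v j x = 0 := fun j x hx ↦ by
    simp only [hv]; rw [hζ.eq_zero x fun hxK ↦ hx (hKS hxK), zero_mul]
  have hvt : ∀ j, IsTest n (v j) := fun j ↦ by
    refine ⟨hvc j, HasCompactSupport.intro hζ.isCompact fun x hx ↦ ?_, fun x ↦
      mul_nonneg (hζ.nonneg x) (hF0 _)⟩
    simp only [hv]; rw [hζ.eq_zero x hx, zero_mul]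
  have hvg : ∀ j, ∀ x ∉ S, grad (n := n) (v j) x = 0 := fun j x hx ↦ by
    have hxK : x ∉ K := fun hxK ↦ hx (hKS hxK)
    simp only [hv]
    rw [grad_mul_comp hF hζ.contMDiff (h.contMDiff j), hζ.eq_zero x hxK, hζ.grad_eq_zero hxK,
      zero_mul, zero_smul, smul_zero, add_zero]
  set Z : M → ℝ≥0∞ := fun x ↦ ∑' j, ‖φ j x - u x‖ₑ ^ 2 with hZ
  set Zb : M → ℝ≥0∞ := fun x ↦ ∑' j, ‖φ j x - τ x‖ₑ ^ 2 with hZb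
  set ZG : M → ℝ≥0∞ := fun x ↦ ∑' j, ‖grad (φ j) x - G x‖ₑ ^ 2 with hZG
  have hφm : ∀ {m : Measure M} j, AEMeasurable (φ j) m := fun j ↦
    (h.contMDiff j).continuous.measurable.aemeasurable
  have hvm : ∀ {m : Measure M} j, AEMeasurable (v j) m := fun j ↦
    (hvc j).continuous.measurable.aemeasurable
  have hζm : ∀ {m : Measure M}, AEMeasurable ζ m :=
    hζ.contMDiff.continuous.measurable.aemeasurable
  have hi : Integrable (fun x ↦ (F (u x) * inner ℝ (G x) (grad (n := n) ζ x) +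
      ζ x * F' (u x) * ‖G x‖ ^ 2) + (-(P x * u x * (ζ x * F (u x))) + f x * (ζ x * F (u x)))) ((volM n M).restrict S) ∧
      Tendsto (fun j ↦ ∫ x in S, (inner ℝ (G x) (grad (n := n) (v j) x) +
        (-(P x * u x * v j x) + f x * v j x)) ∂volM n M) atTop
      (𝓝 (∫ x in S, ((F (u x) * inner ℝ (G x) (grad (n := n) ζ x) +
      ζ x * F' (u x) * ‖G x‖ ^ 2) + (-(P x * u x * (ζ x * F (u x))) + f x * (ζ x * F (u x)))) ∂volM n M)) := by
    refine tendsto_integral_of_lintegral_bound (m := (volM n M).restrict S)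
      (F := fun j x ↦ inner ℝ (G x) (grad (n := n) (v j) x) +
        (-(P x * u x * v j x) + f x * v j x))
      (f := fun x ↦ (F (u x) * inner ℝ (G x) (grad (n := n) ζ x) + ζ x * F' (u x) * ‖G x‖ ^ 2) +
        (-(P x * u x * (ζ x * F (u x))) + f x * (ζ x * F (u x))))
      (b := fun x ↦ (‖G x‖ₑ ^ 2 + 4 * C * (‖grad (n := n) ζ x‖ₑ ^ 2 * (1 + (‖u x‖ₑ ^ 2 + Z x)) +
        (‖G x‖ₑ ^ 2 + ZG x))) + ofReal (3 * B * (1 + k)) *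
        (ofReal (|P x| + |f x| / k) * ‖ζ x‖ₑ * (1 + (‖u x‖ₑ ^ 2 + Z x))))
      (fun j ↦ ?_) ?_ ?_ (fun j ↦ Eventually.of_forall fun x ↦ ?_) ?_
    · exact ((h.aestronglyMeasurable_inner (hvc j)).add
        (((hP.mul h.aemeasurable).mul (hvm j)).neg.add
          (hf.mul (hvm j))).aestronglyMeasurable).restrict
    · refine AEMeasurable.restrict ?_
      exact ((h.aemeasurable_norm_grad.pow_const 2).add (((((measurable_enorm_grad
        hζ.contMDiff).pow_const 2).aemeasurable.mul (aemeasurable_const.add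
          ((h.aemeasurable.enorm.pow_const 2).add h.aemeasurable_tsum))).add
        ((h.aemeasurable_norm_grad.pow_const 2).add h.aemeasurable_tsum_grad)).const_mul _)).add
        ((((((measurable_norm.comp_aemeasurable hP).add
          ((measurable_norm.comp_aemeasurable hf).div_const k)).ennreal_ofReal).mul hζm.enorm).mul
          (aemeasurable_const.add ((h.aemeasurable.enorm.pow_const 2).add
            h.aemeasurable_tsum))).const_mul _)
    · have hG2 : AEMeasurable (fun x ↦ ‖G x‖ₑ ^ 2) (volM n M) := h.aemeasurable_norm_grad.pow_const 2
      have hw := h.lintegral_weight_lt_top ENNReal.ofReal_ne_top hζ.isCompact hKμ hζ.enorm_grad_le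
      have hwm : AEMeasurable (fun x ↦ ‖grad (n := n) ζ x‖ₑ ^ 2 * (1 + (‖u x‖ₑ ^ 2 + Z x)))
          (volM n M) := ((measurable_enorm_grad hζ.contMDiff).pow_const 2).aemeasurable.mul
          (aemeasurable_const.add ((h.aemeasurable.enorm.pow_const 2).add h.aemeasurable_tsum))
      have hm : AEMeasurable (fun x ↦ ‖G x‖ₑ ^ 2 + 4 * C * (‖grad (n := n) ζ x‖ₑ ^ 2 *
          (1 + (‖u x‖ₑ ^ 2 + Z x)) + (‖G x‖ₑ ^ 2 + ZG x))) (volM n M) :=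
        hG2.add ((hwm.add (hG2.add h.aemeasurable_tsum_grad)).const_mul _)
      have h4C : 4 * C ≠ ⊤ := ENNReal.mul_ne_top (by simp) hC
      rw [lintegral_add_left' hm.restrict, lintegral_const_mul' _ _ ENNReal.ofReal_ne_top]
      refine ENNReal.add_lt_top.2 ⟨(setLIntegral_le_lintegral _ _).trans_lt ?_,
        ENNReal.mul_lt_top ENNReal.ofReal_lt_top hQ⟩
      rw [lintegral_add_left' hG2, lintegral_const_mul' _ _ h4C, lintegral_add_left' hwm,
        lintegral_add_left' hG2]
      exact ENNReal.add_lt_top.2 ⟨h.lintegral_grad_sq_lt_top, ENNReal.mul_lt_top h4C.lt_top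
        (ENNReal.add_lt_top.2 ⟨hw, ENNReal.add_lt_top.2 ⟨h.lintegral_grad_sq_lt_top,
          h.lintegral_tsum_grad_lt_top⟩⟩)⟩
    · refine (enorm_add_le _ _).trans (add_le_add ?_ (enorm_lower_order_le hk hB0 (hB2 _)
        (enorm_sq_le_of_tsum (fun j ↦ φ j x) (u x) j)))
      have a1 : ‖inner ℝ (G x) (grad (n := n) (v j) x)‖ₑ ≤
          ‖G x‖ₑ ^ 2 + ‖grad (n := n) (v j) x‖ₑ ^ 2 := by
        rw [← ofReal_norm, ← ofReal_norm, ← ofReal_norm, ← ENNReal.ofReal_pow (norm_nonneg _),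
          ← ENNReal.ofReal_pow (norm_nonneg _), ← ENNReal.ofReal_add (by positivity) (by positivity)]
        refine ENNReal.ofReal_le_ofReal ((norm_inner_le_norm _ _).trans ?_)
        nlinarith [sq_nonneg (‖G x‖ - ‖grad (n := n) (v j) x‖), norm_nonneg (G x),
          norm_nonneg (grad (n := n) (v j) x)]
      refine a1.trans (add_le_add le_rfl ?_)
      refine (enorm_sq_grad_mul_comp_le hF hζ.contMDiff (h.contMDiff j) x).trans ?_
      have a2 := enorm_sq_le_of_tsum (fun j ↦ φ j x) (u x) j
      have a3 := enorm_sq_le_of_tsum (fun j ↦ grad (n := n) (φ j) x) (G x) j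
      calc cutoffEnergy ζ F F' (φ j) (grad (n := n) (φ j)) x ≤
          2 * (‖grad (n := n) ζ x‖ₑ ^ 2 * (C * (2 * 1 + 2 * (‖u x‖ₑ ^ 2 + Z x))) +
            1 * (C * (2 * (‖G x‖ₑ ^ 2 + ZG x)))) := by
            rw [cutoffEnergy]
            gcongr
            · refine (hC2 _).trans ?_
              gcongr
              norm_num
            · exact hζ.enorm_le_one x
            · exact hC1 _
        _ = _ := by ring
    · filter_upwards [ae_restrict_of_ae h.ae_tendsto, ae_restrict_of_ae h.ae_tendsto_grad]
        with x hx hx'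
      have a1 := (hF.continuous.tendsto _).comp hx
      have a2 := (hF.continuous_deriv.tendsto _).comp hx
      have a3 : Tendsto (fun j ↦ v j x) atTop (𝓝 (ζ x * F (u x))) := a1.const_mul _
      refine Tendsto.add ?_ (((a3.const_mul (P x * u x)).neg).add (a3.const_mul (f x)))
      have a4 : ∀ j, inner ℝ (G x) (grad (n := n) (v j) x) =
          F (φ j x) * inner ℝ (G x) (grad (n := n) ζ x) +
            ζ x * F' (φ j x) * inner ℝ (G x) (grad (n := n) (φ j) x) := fun j ↦ by
        simp only [hv]
        rw [grad_mul_comp hF hζ.contMDiff (h.contMDiff j), inner_add_right, inner_smul_right,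
          inner_smul_right, add_comm]
      simp only [a4]
      refine (a1.mul_const _).add ((a2.const_mul (ζ x)).mul ?_)
      rw [← real_inner_self_eq_norm_sq]
      exact (tendsto_const_nhds (x := G x)).inner hx'
  have hb : Integrable (fun x ↦ -(Pb x * τ x * (ζ x * F (τ x))) + fb x * (ζ x * F (τ x))) ((volBoundary n M).restrict S) ∧
      Tendsto (fun j ↦ ∫ x in S, (-(Pb x * τ x * v j x) + fb x * v j x) ∂volBoundary n M) atTop
      (𝓝 (∫ x in S, (-(Pb x * τ x * (ζ x * F (τ x))) + fb x * (ζ x * F (τ x))) ∂volBoundary n M)) := by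
    refine tendsto_integral_of_lintegral_bound (m := (volBoundary n M).restrict S)
      (F := fun j x ↦ -(Pb x * τ x * v j x) + fb x * v j x)
      (f := fun x ↦ -(Pb x * τ x * (ζ x * F (τ x))) + fb x * (ζ x * F (τ x)))
      (b := fun x ↦ ofReal (3 * B * (1 + k)) *
        (ofReal (|Pb x| + |fb x| / k) * ‖ζ x‖ₑ * (1 + (‖τ x‖ₑ ^ 2 + Zb x))))
      (fun j ↦ ?_) ?_ ?_ (fun j ↦ Eventually.of_forall fun x ↦ ?_) ?_
    · exact ((((hPb.restrict.mul h.aemeasurable_trace).mul (hvm j)).neg.add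
        (hfb.restrict.mul (hvm j)))).aestronglyMeasurable
    · exact ((((((measurable_norm.comp_aemeasurable hPb.restrict).add
        ((measurable_norm.comp_aemeasurable hfb.restrict).div_const k)).ennreal_ofReal).mul
          hζm.enorm).mul (aemeasurable_const.add ((h.aemeasurable_trace.enorm.pow_const 2).add
            h.aemeasurable_tsum_trace))).const_mul _)
    · rw [lintegral_const_mul' _ _ ENNReal.ofReal_ne_top]
      exact ENNReal.mul_lt_top ENNReal.ofReal_lt_top hQb
    · exact enorm_lower_order_le hk hB0 (hB2 _) (enorm_sq_le_of_tsum (fun j ↦ φ j x) (τ x) j)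
    · filter_upwards [h.ae_tendsto_trace] with x hx
      have a3 : Tendsto (fun j ↦ v j x) atTop (𝓝 (ζ x * F (τ x))) :=
        ((hF.continuous.tendsto _).comp hx).const_mul _
      exact ((a3.const_mul (Pb x * τ x)).neg).add (a3.const_mul (fb x))
  refine ⟨hi.1, hb.1, le_of_tendsto ((hi.2.add hb.2).const_mul s) (Eventually.of_forall fun j ↦ ?_)⟩
  have h1 := hweak (v j) (hvt j)
  rw [weakForm, ← setIntegral_eq_integral_of_forall_compl_eq_zero (s := S) (μ := volM n M)
    (fun x hx ↦ by rw [hvg j x hx, hv0 j x hx]; simp),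
    ← setIntegral_eq_integral_of_forall_compl_eq_zero (s := S) (μ := volBoundary n M)
    (fun x hx ↦ by rw [hv0 j x hx]; simp)] at h1
  refine le_of_eq_of_le ?_ h1
  congr 3
  funext x
  ring

end H1Approx

end WeakForm

/-! ### The energy inequality for weak solutions -/

section Caccioppoli

variable {n : ℕ} [NeZero n] {M : Type*} [EMetricSpace M]
  [ChartedSpace (EuclideanHalfSpace n) M] [IsManifold (𝓡∂ n) 1 M]
  [RiemannianBundle (fun x : M ↦ TangentSpace (𝓡∂ n) x)]
  [IsContinuousRiemannianBundle (𝔼 n) (fun x : M ↦ TangentSpace (𝓡∂ n) x)]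
  [MeasurableSpace M] [BorelSpace M]
  {u : M → ℝ} {G : ∀ x : M, TangentSpace (𝓡∂ n) x} {τ : M → ℝ} {S : Set M}
  {φ : ℕ → M → ℝ} {F F' : ℝ → ℝ} {ζ : M → ℝ} {S₀ U K : Set M} {L : ℝ}
  {P f Pb fb : M → ℝ} {k s : ℝ}

/-- If `a ≤ I + β` and `0 ≤ J + γ` pointwise, and the sum of the integrals of `I` and `J` is
nonpositive, then the integral of `a` is at most that of `β` and `γ`. -/
lemma lintegral_le_of_integral_add_nonpos {X : Type*} [MeasurableSpace X] {m m' : Measure X}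
    {a I β J γ : X → ℝ} (hI : Integrable I m) (hJ : Integrable J m')
    (hβ : AEMeasurable β m) (hγ : AEMeasurable γ m')
    (hβ0 : ∀ᵐ x ∂m, 0 ≤ β x) (hγ0 : ∀ᵐ x ∂m', 0 ≤ γ x)
    (ha0 : ∀ᵐ x ∂m, 0 ≤ a x) (ha : ∀ᵐ x ∂m, a x ≤ I x + β x) (hJγ : ∀ᵐ x ∂m', 0 ≤ J x + γ x)
    (hle : ∫ x, I x ∂m + ∫ x, J x ∂m' ≤ 0) :
    ∫⁻ x, ofReal (a x) ∂m ≤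
      ∫⁻ x, ofReal (β x) ∂m + ∫⁻ x, ofReal (γ x) ∂m' := by
  by_cases h1 : ∫⁻ x, ofReal (β x) ∂m = ⊤
  · rw [h1, top_add]; exact le_top
  by_cases h2 : ∫⁻ x, ofReal (γ x) ∂m' = ⊤
  · rw [h2, add_top]; exact le_top
  have hβi : Integrable β m := (lintegral_ofReal_ne_top_iff_integrable
    hβ.aestronglyMeasurable hβ0).1 h1
  have hγi : Integrable γ m' := (lintegral_ofReal_ne_top_iff_integrable
    hγ.aestronglyMeasurable hγ0).1 h2
  have h3 : 0 ≤ ∫ x, J x ∂m' + ∫ x, γ x ∂m' := by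
    rw [← integral_add hJ hγi]
    exact integral_nonneg_of_ae hJγ
  calc _ ≤ ∫⁻ x, ofReal (I x + β x) ∂m :=
        lintegral_mono_ae (ha.mono fun x hx ↦ ENNReal.ofReal_le_ofReal hx)
    _ = ofReal (∫ x, I x ∂m + ∫ x, β x ∂m) := by
        rw [← integral_add hI hβi]
        refine (ofReal_integral_eq_lintegral_ofReal (hI.add hβi) ?_).symm
        filter_upwards [ha0, ha] with x h h' using h.trans h'
    _ ≤ ofReal (∫ x, β x ∂m + ∫ x, γ x ∂m') := ENNReal.ofReal_le_ofReal (by linarith)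
    _ = _ := by
        rw [ENNReal.ofReal_add (integral_nonneg_of_ae hβ0) (integral_nonneg_of_ae hγ0),
          ofReal_integral_eq_lintegral_ofReal hβi hβ0, ofReal_integral_eq_lintegral_ofReal hγi hγ0]

namespace H1Approx

/-- The energy of `u` weighted by `s F'(u)` is controlled by the derivative of the cutoff and by
the lower order terms. -/
lemma energy_inequality (h : H1Approx u G τ S φ) (hk : 0 < k) (hF : IsC1Lipschitz F F')
    (hF0 : ∀ t, 0 ≤ F t) (hs : |s| = 1) (hsF : ∀ t, 0 ≤ t → 0 ≤ s * F' t)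
    (hζ : IsCutoff n ζ S₀ U K L) (hKμ : volM n M K < ⊤) (hKS : K ⊆ S)
    (hP : AEMeasurable P (volM n M)) (hf : AEMeasurable f (volM n M))
    (hPb : AEMeasurable Pb (volBoundary n M)) (hfb : AEMeasurable fb (volBoundary n M))
    (hQ : ∫⁻ x in S, ofReal (|P x| + |f x| / k) * ‖ζ x‖ₑ *
      (1 + (‖u x‖ₑ ^ 2 + ∑' j, ‖φ j x - u x‖ₑ ^ 2)) ∂volM n M < ⊤)
    (hQb : ∫⁻ x in S, ofReal (|Pb x| + |fb x| / k) * ‖ζ x‖ₑ *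
      (1 + (‖τ x‖ₑ ^ 2 + ∑' j, ‖φ j x - τ x‖ₑ ^ 2)) ∂volBoundary n M < ⊤)
    (hweak : ∀ v, IsTest n v → s * weakForm P f Pb fb u G τ v ≤ 0)
    (hu : ∀ᵐ x ∂volM n M, 0 ≤ u x)
    (hτ : ∀ᵐ x ∂((volBoundary n M).restrict S), ζ x ≠ 0 → 0 ≤ τ x) :
    ∫⁻ x in S, ofReal (ζ x * (s * F' (u x)) * ‖G x‖ ^ 2) ∂volM n M ≤
      ∫⁻ x in S, ofReal (‖grad (n := n) ζ x‖ * F (u x) * ‖G x‖ +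
        (|P x| + |f x| / k) * (u x + k) * (ζ x * F (u x))) ∂volM n M +
      ∫⁻ x in S, ofReal ((|Pb x| + |fb x| / k) * (τ x + k) * (ζ x * F (τ x)))
        ∂volBoundary n M := by
  obtain ⟨h1, h2, h3⟩ := h.weak_inequality hk hF hF0 hζ hKμ hKS hP hf hPb hfb hQ hQb hweak
  have hsb : ∀ a : ℝ, -|a| ≤ s * a := fun a ↦ by
    have := neg_abs_le (s * a)
    rwa [abs_mul, hs, one_mul] at this
  have hζm : Measurable ζ := hζ.contMDiff.continuous.measurable
  have hGm : AEMeasurable (fun x ↦ ‖G x‖) (volM n M) := by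
    have := h.aemeasurable_norm_grad.ennreal_toReal
    simpa using this
  have hζg : Measurable fun x ↦ ‖grad (n := n) ζ x‖ := measurable_norm_grad hζ.contMDiff
  have hFu : AEMeasurable (fun x ↦ F (u x)) (volM n M) :=
    hF.continuous.measurable.comp_aemeasurable h.aemeasurable
  have hFτ : AEMeasurable (fun x ↦ F (τ x)) ((volBoundary n M).restrict S) :=
    hF.continuous.measurable.comp_aemeasurable h.aemeasurable_trace
  have hζ0 := hζ.nonneg
  refine lintegral_le_of_integral_add_nonpos (h1.const_mul s) (h2.const_mul s) ?_ ?_ ?_ ?_ ?_ ?_ ?_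
    ?_
  · exact AEMeasurable.restrict (((hζg.aemeasurable.mul hFu).mul hGm).add
      ((((measurable_norm.comp_aemeasurable hP).add
        ((measurable_norm.comp_aemeasurable hf).div_const k)).mul
        (h.aemeasurable.add_const k)).mul (hζm.aemeasurable.mul hFu)))
  · exact (((measurable_norm.comp_aemeasurable hPb.restrict).add
        ((measurable_norm.comp_aemeasurable hfb.restrict).div_const k)).mul
        (h.aemeasurable_trace.add_const k)).mul (hζm.aemeasurable.mul hFτ)
  · filter_upwards [ae_restrict_of_ae hu] with x hx
    have := hF0 (u x)
    have := hζ0 x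
    positivity
  · filter_upwards [hτ] with x hx
    by_cases hz : ζ x = 0
    · simp [hz]
    · have := hF0 (τ x)
      have := hζ0 x
      have := hx hz
      positivity
  · filter_upwards [ae_restrict_of_ae hu] with x hx
    have := hsF _ hx
    have := hζ0 x
    positivity
  · filter_upwards [ae_restrict_of_ae hu] with x hx
    have a1 := hsb (-(P x * u x * (ζ x * F (u x))) + f x * (ζ x * F (u x)))
    have a2 := abs_lower_order_le (a := P x) (b := f x) hk hx (hζ0 x) (hF0 (u x))
    have a3 := hsb (F (u x) * inner ℝ (G x) (grad (n := n) ζ x))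
    have a4 : |F (u x) * inner ℝ (G x) (grad (n := n) ζ x)| ≤
        ‖grad (n := n) ζ x‖ * F (u x) * ‖G x‖ := by
      rw [abs_mul, abs_of_nonneg (hF0 _)]
      calc _ ≤ F (u x) * (‖G x‖ * ‖grad (n := n) ζ x‖) :=
            mul_le_mul_of_nonneg_left (abs_real_inner_le_norm _ _) (hF0 _)
        _ = _ := by ring
    linarith
  · filter_upwards [hτ] with x hx
    by_cases hz : ζ x = 0
    · simp [hz]
    · have a1 := hsb (-(Pb x * τ x * (ζ x * F (τ x))) + fb x * (ζ x * F (τ x)))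
      have a2 := abs_lower_order_le (a := Pb x) (b := fb x) hk (hx hz) (hζ0 x) (hF0 (τ x))
      linarith
  · rw [integral_const_mul, integral_const_mul, ← mul_add]
    exact h3

end H1Approx

end Caccioppoli

/-! ### The Caccioppoli inequality -/

/-- Absorption of the energy `X` of the test function into the left-hand side, with the choice
`ε = 1 / (8 T)` in the form bound for the lower order terms `E`. -/
lemma mul_le_of_absorb {X D N E : ℝ≥0∞} {a b c T C r : ℝ} {ν : ℕ} (hX : X ≠ ⊤) (hD : D ≠ ⊤)
    (hN : N ≠ ⊤) (ha : 0 < a) (hb : 0 ≤ b) (hc : 0 ≤ c) (hT : 1 ≤ T) (hab : a * b ≤ T)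
    (hac : a * c ≤ T) (hC : 1 ≤ C) (hr : 0 < r)
    (h1 : 2 * X ≤ X + (ofReal (4 * b) * D + ofReal (2 * c) * E))
    (h2 : E ≤ ofReal (1 / (8 * T)) * (2 * (D + ofReal a * X)) +
      ofReal (C / (1 / (8 * T)) ^ ν / r ^ 2) * N) :
    ofReal a * X ≤ ofReal (9 * 8 ^ ν * C * T ^ (ν + 1)) *
      (D + ofReal (1 / r ^ 2) * N) := by
  have hT0 : 0 < T := by linarith
  have hE : E ≠ ⊤ := by
    refine ne_top_of_le_ne_top ?_ h2
    exact ENNReal.add_ne_top.2 ⟨ENNReal.mul_ne_top ENNReal.ofReal_ne_top (ENNReal.mul_ne_top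
      (by simp) (ENNReal.add_ne_top.2 ⟨hD, ENNReal.mul_ne_top ENNReal.ofReal_ne_top hX⟩)),
      ENNReal.mul_ne_top ENNReal.ofReal_ne_top hN⟩
  obtain ⟨x, hx, rfl⟩ : ∃ x : ℝ, 0 ≤ x ∧ X = ofReal x :=
    ⟨X.toReal, ENNReal.toReal_nonneg, (ENNReal.ofReal_toReal hX).symm⟩
  obtain ⟨d, hd, rfl⟩ : ∃ x : ℝ, 0 ≤ x ∧ D = ofReal x :=
    ⟨D.toReal, ENNReal.toReal_nonneg, (ENNReal.ofReal_toReal hD).symm⟩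
  obtain ⟨m, hm, rfl⟩ : ∃ x : ℝ, 0 ≤ x ∧ N = ofReal x :=
    ⟨N.toReal, ENNReal.toReal_nonneg, (ENNReal.ofReal_toReal hN).symm⟩
  obtain ⟨e, he, rfl⟩ : ∃ x : ℝ, 0 ≤ x ∧ E = ofReal x :=
    ⟨E.toReal, ENNReal.toReal_nonneg, (ENNReal.ofReal_toReal hE).symm⟩
  have h2' : (2 : ℝ≥0∞) = ofReal 2 := by simp
  rw [h2'] at h1 h2
  have hpow : C / (1 / (8 * T)) ^ ν / r ^ 2 = 8 ^ ν * C * T ^ ν * (1 / r ^ 2) := by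
    rw [one_div, inv_pow, div_inv_eq_mul, mul_pow]
    ring
  rw [hpow] at h2
  rw [← ENNReal.ofReal_mul (by positivity), ← ENNReal.ofReal_mul (by positivity),
    ← ENNReal.ofReal_mul (by positivity), ← ENNReal.ofReal_add (by positivity) (by positivity),
    ← ENNReal.ofReal_add (by positivity) (by positivity),
    ENNReal.ofReal_le_ofReal_iff (by positivity)] at h1
  rw [← ENNReal.ofReal_mul (by positivity), ← ENNReal.ofReal_add (by positivity) (by positivity),
    ← ENNReal.ofReal_mul (by positivity), ← ENNReal.ofReal_mul (by positivity),
    ← ENNReal.ofReal_mul (by positivity), ← ENNReal.ofReal_add (by positivity) (by positivity),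
    ENNReal.ofReal_le_ofReal_iff (by positivity)] at h2
  rw [← ENNReal.ofReal_mul (by positivity), ← ENNReal.ofReal_mul (by positivity),
    ← ENNReal.ofReal_add (by positivity) (by positivity), ← ENNReal.ofReal_mul (by positivity)]
  refine ENNReal.ofReal_le_ofReal ?_
  set y : ℝ := 1 / r ^ 2 * m with hy
  have hy0 : 0 ≤ y := by positivity
  have h3 : a * x ≤ 4 * (a * b) * d + 2 * (a * c) * e := by nlinarith
  have h4 : a * x ≤ 4 * T * d + 2 * T * e := by
    refine h3.trans ?_
    gcongr
  have h5 : 2 * T * e ≤ (d + a * x) / 2 + 2 * T * (8 ^ ν * C * T ^ ν * y) := by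
    have := mul_le_mul_of_nonneg_left h2 (show 0 ≤ 2 * T by positivity)
    refine this.trans_eq ?_
    rw [hy]
    field_simp
    ring
  have h6 : 1 ≤ 8 ^ ν * C * T ^ ν :=
    one_le_mul_of_one_le_of_one_le (one_le_mul_of_one_le_of_one_le (one_le_pow₀ (by norm_num)) hC)
      (one_le_pow₀ hT)
  have h7 : 9 * 8 ^ ν * C * T ^ (ν + 1) = 9 * (T * (8 ^ ν * C * T ^ ν)) := by ring
  rw [h7]
  set Y := 8 ^ ν * C * T ^ ν with hY
  have h8 : T ≤ T * Y := le_mul_of_one_le_right hT0.le h6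
  have h9 : T * d ≤ T * Y * d := by gcongr
  have h10 : d ≤ T * d := le_mul_of_one_le_left hd hT
  have h11 : 0 ≤ T * Y * y := by positivity
  nlinarith

section Caccioppoli

variable {n : ℕ} [NeZero n] {M : Type*} [EMetricSpace M]
  [ChartedSpace (EuclideanHalfSpace n) M]
  [RiemannianBundle (fun x : M ↦ TangentSpace (𝓡∂ n) x)]
  [MeasurableSpace M] [BorelSpace M]
  {u : M → ℝ} {G : ∀ x : M, TangentSpace (𝓡∂ n) x} {τ : M → ℝ} {S : Set M}
  {φ : ℕ → M → ℝ} {η : M → ℝ} {S₀ U K : Set M} {L : ℝ}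
  {P f Pb fb : M → ℝ} {k s C r : ℝ} {ν : ℕ}

/-- A nonnegative `u ∈ H¹` that is a subsolution (`s = 1`) or a supersolution (`s = -1`), together
with what is known on the set `S`: an approximation of `u`, the form boundedness at scale `r` of
the potentials `|P| + |f| / k` and `|Pb| + |fb| / k`, and a trace inequality. -/
structure LocalSolution (s k : ℝ) (P f Pb fb u : M → ℝ) (G : ∀ x : M, TangentSpace (𝓡∂ n) x)
    (τ : M → ℝ) (S : Set M) (φ : ℕ → M → ℝ) (C : ℝ) (ν : ℕ) (r : ℝ) : Prop where
  approx : H1Approx u G τ S φ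
  k_pos : 0 < k
  abs_eq_one : |s| = 1
  one_le : 1 ≤ C
  r_pos : 0 < r
  nonneg : ∀ᵐ x ∂volM n M, 0 ≤ u x
  measurableSet : MeasurableSet S
  measure_lt_top : volM n M S < ⊤
  aemeasurable_P : AEMeasurable P (volM n M)
  aemeasurable_f : AEMeasurable f (volM n M)
  aemeasurable_Pb : AEMeasurable Pb (volBoundary n M)
  aemeasurable_fb : AEMeasurable fb (volBoundary n M)
  form : FormBounded n S (fun x ↦ ofReal (|P x| + |f x| / k))
    (fun x ↦ ofReal (|Pb x| + |fb x| / k)) C ν r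
  trace : ∃ c : ℝ, ∀ (v : M → ℝ) (K : Set M), ContMDiff (𝓡∂ n) 𝓘(ℝ, ℝ) 1 v → IsCompact K →
    K ⊆ S → (∀ x ∉ K, v x = 0) → ∫⁻ x, ‖v x‖ₑ ^ 2 ∂volBoundary n M ≤
        ofReal 1 * ∫⁻ x, ‖grad (n := n) v x‖ₑ ^ 2 ∂volM n M +
          ofReal c * ∫⁻ x, ‖v x‖ₑ ^ 2 ∂volM n M
  weak : ∀ v, IsTest n v → s * weakForm P f Pb fb u G τ v ≤ 0

variable [IsManifold (𝓡∂ n) 1 M]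
  [IsContinuousRiemannianBundle (𝔼 n) (fun x : M ↦ TangentSpace (𝓡∂ n) x)]

namespace LocalSolution

variable {a b c T : ℝ} {Φ Φ' H H' : ℝ → ℝ}

/-- The energy of `η H(u + k)` is controlled by the energy produced by the test function. -/
lemma lintegral_sq_deriv_le (h : LocalSolution s k P f Pb fb u G τ S φ C ν r)
    (hT : TestPair s k a b c T Φ Φ' H H') (hη : IsCutoff n η S₀ U K L) (hKS : K ⊆ S) :
    ∫⁻ x, ‖η x‖ₑ ^ 2 * (‖H' (softPart k (u x) + k) * softPartDeriv k (u x)‖ₑ ^ 2 * ‖G x‖ₑ ^ 2)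
        ∂volM n M ≤
      ofReal a * ∫⁻ x in S, ofReal (η x * η x * (s * Φ' (u x + k)) * ‖G x‖ ^ 2)
        ∂volM n M := by
  rw [IsAlmostFlat.lintegral_eq_setLIntegral h.measurableSet (fun x hx ↦ by
    rw [hη.eq_zero x fun hxK ↦ hx (hKS hxK)]; simp),
    ← lintegral_const_mul' _ _ ENNReal.ofReal_ne_top]
  refine lintegral_mono_ae ?_
  filter_upwards [ae_restrict_of_ae h.nonneg] with x hx
  rw [softPart_of_nonneg hx, softPartDeriv_of_nonneg hx, mul_one]
  simp only [← ofReal_norm]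
  rw [← ENNReal.ofReal_pow (norm_nonneg _), ← ENNReal.ofReal_pow (norm_nonneg _),
    ← ENNReal.ofReal_pow (norm_nonneg _), ← ENNReal.ofReal_mul (by positivity),
    ← ENNReal.ofReal_mul (by positivity), ← ENNReal.ofReal_mul hT.a_pos.le]
  refine ENNReal.ofReal_le_ofReal ?_
  rw [Real.norm_eq_abs, Real.norm_eq_abs, sq_abs, sq_abs]
  have := hT.sq_deriv_le (u x + k) (by linarith [h.k_pos])
  calc η x ^ 2 * (H' (u x + k) ^ 2 * ‖G x‖ ^ 2) ≤
      η x ^ 2 * ((a * (s * Φ' (u x + k))) * ‖G x‖ ^ 2) := by gcongr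
    _ = _ := by ring

/-- The Caccioppoli inequality for the powers of `u + k`. -/
lemma caccioppoli (h : LocalSolution s k P f Pb fb u G τ S φ C ν r)
    (hT : TestPair s k a b c T Φ Φ' H H') (hη : IsCutoff n η S₀ U K L) (hKS : K ⊆ S) :
    ofReal a * ∫⁻ x in S, ofReal (η x * η x * (s * Φ' (u x + k)) * ‖G x‖ ^ 2)
        ∂volM n M ≤
      ofReal (9 * 8 ^ ν * C * T ^ (ν + 1)) *
        (∫⁻ x, ‖grad (n := n) η x‖ₑ ^ 2 * ‖H (softPart k (u x) + k)‖ₑ ^ 2 ∂volM n M +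
          ofReal (1 / r ^ 2) *
            ∫⁻ x, ‖η x * H (softPart k (u x) + k)‖ₑ ^ 2 ∂volM n M) := by
  have hk := h.k_pos
  have hKμ : volM n M K < ⊤ := (measure_mono hKS).trans_lt h.measure_lt_top
  have hw : ∀ t, 0 < softPart k t + k := fun t ↦ by linarith [neg_half_lt_softPart hk t]
  have hHF := hT.power.isC1Lipschitz_comp hk
  have hΦF := hT.test.isC1Lipschitz_comp hk
  have hnn := h.nonneg
  set Q : M → ℝ≥0∞ := fun x ↦ ofReal (|P x| + |f x| / k) with hQdef
  set Qb : M → ℝ≥0∞ := fun x ↦ ofReal (|Pb x| + |fb x| / k) with hQbdef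
  have hQ : AEMeasurable Q ((volM n M).restrict S) :=
    ((measurable_norm.comp_aemeasurable h.aemeasurable_P).add
      ((measurable_norm.comp_aemeasurable h.aemeasurable_f).div_const k)).ennreal_ofReal.restrict
  have hQb : AEMeasurable Qb ((volBoundary n M).restrict S) :=
    ((measurable_norm.comp_aemeasurable h.aemeasurable_Pb).add
      ((measurable_norm.comp_aemeasurable h.aemeasurable_fb).div_const k)).ennreal_ofReal.restrict
  obtain ⟨hpot, hpotb⟩ := h.approx.lintegral_potential_lt_top hη hKμ hKS hQ hQb
    (fun x ↦ ENNReal.ofReal_ne_top) (fun x ↦ ENNReal.ofReal_ne_top) h.form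
  have hηη : ∀ x, ‖η x * η x‖ₑ = ‖η x‖ₑ ^ 2 := fun x ↦ by rw [enorm_mul, sq]
  have hτ : ∀ᵐ x ∂((volBoundary n M).restrict S), η x ≠ 0 → 0 ≤ τ x := by
    obtain ⟨c', hc'⟩ := h.trace
    exact h.approx.ae_trace_nonneg hnn hη hKμ fun v hv hv0 ↦ hc' v K hv hη.isCompact hKS hv0
  have henergy := h.approx.energy_inequality (ζ := fun x ↦ η x * η x) hk hΦF
    (fun t ↦ hT.nonneg _ (hw t)) h.abs_eq_one (fun t ht ↦ by
      rw [softPart_of_nonneg ht, softPartDeriv_of_nonneg ht, mul_one]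
      exact hT.sign _ (by linarith)) hη.sq hKμ hKS h.aemeasurable_P h.aemeasurable_f
    h.aemeasurable_Pb h.aemeasurable_fb (by simpa only [hηη] using hpot)
    (by simpa only [hηη] using hpotb) h.weak hnn (hτ.mono fun x hx hx' ↦ hx fun h0 ↦ hx' (by
      rw [h0, mul_zero]))
  have hform := h.approx.form_bound hHF hη hKμ hKS hQ hQb (fun x ↦ ENNReal.ofReal_ne_top)
    (fun x ↦ ENNReal.ofReal_ne_top) h.form (ε := 1 / (8 * T))
    (by have := hT.one_le; positivity)
    (by
      have := hT.one_le
      rw [div_le_one (by positivity)]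
      linarith)
  have hce := h.approx.lintegral_cutoffEnergy_lt_top hHF hη hKμ
  rw [H1Approx.lintegral_cutoffEnergy_eq h.approx.aemeasurable hHF hη] at hform hce
  have hD := (ENNReal.add_lt_top.1 (lt_of_le_of_lt (le_mul_of_one_le_left zero_le
    (by norm_num : (1 : ℝ≥0∞) ≤ 2)) hce)).1
  have hN := h.approx.lintegral_mul_sq_lt_top hHF hη hKμ
  have hX : ∫⁻ x in S, ofReal (η x * η x * (s * Φ' (u x + k)) * ‖G x‖ ^ 2)
      ∂volM n M < ⊤ := by
    obtain ⟨B, hB⟩ := hT.test.bounded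
    calc _ ≤ ∫⁻ x in S, ofReal B * ‖G x‖ₑ ^ 2 ∂volM n M := by
          refine lintegral_mono_ae ?_
          filter_upwards [ae_restrict_of_ae hnn] with x hx
          have hB' := hB (u x + k) (by linarith)
          have h1 : s * Φ' (u x + k) ≤ B := by
            refine (le_abs_self _).trans ?_
            rw [abs_mul, h.abs_eq_one, one_mul]
            exact hB'
          have hB0 : 0 ≤ B := (abs_nonneg _).trans hB'
          rw [← ofReal_norm, ← ENNReal.ofReal_pow (norm_nonneg _), ← ENNReal.ofReal_mul hB0]
          refine ENNReal.ofReal_le_ofReal ?_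
          have h2 : η x * η x ≤ 1 := mul_le_one₀ (hη.le_one x) (hη.nonneg x) (hη.le_one x)
          have h3 : 0 ≤ s * Φ' (u x + k) := hT.sign _ (by linarith)
          calc _ ≤ 1 * B * ‖G x‖ ^ 2 := by gcongr
            _ = _ := by ring
      _ ≤ ∫⁻ x, ofReal B * ‖G x‖ₑ ^ 2 ∂volM n M := setLIntegral_le_lintegral _ _
      _ = _ := lintegral_const_mul' _ _ ENNReal.ofReal_ne_top
      _ < ⊤ := ENNReal.mul_lt_top ENNReal.ofReal_lt_top h.approx.lintegral_grad_sq_lt_top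
  refine mul_le_of_absorb hX.ne hD.ne hN.ne hT.a_pos hT.b_nonneg hT.c_nonneg hT.one_le hT.ab_le
    hT.ac_le h.one_le h.r_pos ?_ (hform.trans ?_)
  · have hXe : ∫⁻ x in S, ofReal (η x * η x * (s * Φ' (u x + k)) * ‖G x‖ ^ 2)
        ∂volM n M = ∫⁻ x in S, ofReal (η x * η x * (s * (Φ' (softPart k (u x) + k) *
          softPartDeriv k (u x))) * ‖G x‖ ^ 2) ∂volM n M := by
      refine lintegral_congr_ae ?_
      filter_upwards [ae_restrict_of_ae hnn] with x hx
      rw [softPart_of_nonneg hx, softPartDeriv_of_nonneg hx, mul_one]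
    refine (mul_le_mul_right (hXe.le.trans henergy) 2).trans ?_
    set Fu : M → ℝ := fun x ↦ H (softPart k (u x) + k) with hFu
    have hFum : AEMeasurable Fu (volM n M) :=
      hHF.continuous.measurable.comp_aemeasurable h.approx.aemeasurable
    have hηm : Measurable η := hη.contMDiff.continuous.measurable
    have hDm : AEMeasurable (fun x ↦ ofReal (4 * b) *
        (‖grad (n := n) η x‖ₑ ^ 2 * ‖Fu x‖ₑ ^ 2)) ((volM n M).restrict S) :=
      AEMeasurable.restrict ((((measurable_enorm_grad hη.contMDiff).pow_const 2).aemeasurable.mul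
        (hFum.enorm.pow_const 2)).const_mul _)
    have hEm : AEMeasurable (fun x ↦ ofReal (2 * c) * (Q x * ‖η x * Fu x‖ₑ ^ 2))
        ((volM n M).restrict S) :=
      (hQ.mul ((hηm.aemeasurable.mul hFum).enorm.pow_const 2).restrict).const_mul _
    have hDEm : AEMeasurable (fun x ↦ ofReal (4 * b) *
        (‖grad (n := n) η x‖ₑ ^ 2 * ‖Fu x‖ₑ ^ 2) +
          ofReal (2 * c) * (Q x * ‖η x * Fu x‖ₑ ^ 2)) ((volM n M).restrict S) :=
      hDm.add hEm
    have hint : 2 * ∫⁻ x in S, ofReal (‖grad (n := n) (fun x ↦ η x * η x) x‖ *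
        Φ (softPart k (u x) + k) * ‖G x‖ + (|P x| + |f x| / k) * (u x + k) *
          (η x * η x * Φ (softPart k (u x) + k))) ∂volM n M ≤
        ∫⁻ x in S, ofReal (η x * η x * (s * Φ' (u x + k)) * ‖G x‖ ^ 2) ∂volM n M +
        (ofReal (4 * b) * ∫⁻ x, ‖grad (n := n) η x‖ₑ ^ 2 * ‖Fu x‖ₑ ^ 2 ∂volM n M +
        ofReal (2 * c) * ∫⁻ x in S, Q x * ‖η x * Fu x‖ₑ ^ 2 ∂volM n M) := by
      refine le_trans ?_ (add_le_add le_rfl (add_le_add (mul_le_mul_right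
        (setLIntegral_le_lintegral S _) _) le_rfl))
      rw [← lintegral_const_mul' _ _ ENNReal.ofReal_ne_top,
        ← lintegral_const_mul' _ _ ENNReal.ofReal_ne_top,
        ← lintegral_const_mul' _ _ (by simp : (2 : ℝ≥0∞) ≠ ⊤), ← lintegral_add_left' hDm,
        ← lintegral_add_right' _ hDEm]
      refine lintegral_mono_ae ?_
      filter_upwards [ae_restrict_of_ae hnn] with x hx
      have hkx : k ≤ u x + k := by linarith
      have hη0 := hη.nonneg x
      have hΦ0 := hT.nonneg (u x + k) (by linarith)
      have hsΦ := hT.sign (u x + k) hkx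
      have a1 := hT.sq_test_le _ hkx
      have a2 := hT.mul_test_le _ hkx
      have hb0 := hT.b_nonneg
      have hc0 := hT.c_nonneg
      simp only [hFu, hQdef]
      rw [softPart_of_nonneg hx, norm_grad_mul_self hη.contMDiff, abs_of_nonneg hη0]
      simp only [← ofReal_norm]
      set g := ‖G x‖ with hg
      set e := ‖grad (n := n) η x‖ with he
      have hg0 : 0 ≤ g := norm_nonneg _
      have he0 : 0 ≤ e := norm_nonneg _
      have h2 : (2 : ℝ≥0∞) = ofReal 2 := by simp
      rw [h2, ← ENNReal.ofReal_pow he0, ← ENNReal.ofReal_pow (norm_nonneg _),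
        ← ENNReal.ofReal_pow (norm_nonneg _), ← ENNReal.ofReal_mul zero_le_two,
        ← ENNReal.ofReal_mul (by positivity), ← ENNReal.ofReal_mul (by positivity),
        ← ENNReal.ofReal_mul (by positivity), ← ENNReal.ofReal_mul (by positivity),
        ← ENNReal.ofReal_add (by positivity) (by positivity),
        ← ENNReal.ofReal_add (by positivity) (by positivity)]
      refine ENNReal.ofReal_le_ofReal ?_
      rw [Real.norm_eq_abs, Real.norm_eq_abs, sq_abs, sq_abs]
      set Y := s * Φ' (u x + k) with hY
      set h' := H (u x + k) with hh
      set y := Φ (u x + k) with hy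
      set w := u x + k with hw'
      set p := |P x| + |f x| / k with hp
      have hp0 : 0 ≤ p := by positivity
      -- Young's inequality for the term containing the gradient of the cutoff
      have a3 : 4 * (η x * e * y * g) ≤ η x * η x * Y * g ^ 2 + 4 * b * (e ^ 2 * h' ^ 2) := by
        refine abs_le_of_sq_le_sq' ?_ (by positivity) |>.2
        have a4 : (η x * e * g) ^ 2 * y ^ 2 ≤ (η x * e * g) ^ 2 * (b * Y * h' ^ 2) := by gcongr
        nlinarith [sq_nonneg (η x * η x * Y * g ^ 2 - 4 * b * (e ^ 2 * h' ^ 2))]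
      have a5 : p * w * (η x * η x * y) ≤ c * (p * (η x * h') ^ 2) := by
        calc p * w * (η x * η x * y) = p * (η x * η x) * (w * y) := by ring
          _ ≤ p * (η x * η x) * (c * h' ^ 2) := by gcongr
          _ = _ := by ring
      linarith
    have hbd : ∫⁻ x in S, ofReal ((|Pb x| + |fb x| / k) * (τ x + k) *
          (η x * η x * Φ (softPart k (τ x) + k))) ∂volBoundary n M ≤
        ofReal c * ∫⁻ x in S, Qb x * ‖η x * H (softPart k (τ x) + k)‖ₑ ^ 2
          ∂volBoundary n M := by
      rw [← lintegral_const_mul' _ _ ENNReal.ofReal_ne_top]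
      refine lintegral_mono_ae ?_
      filter_upwards [hτ] with x hx
      by_cases hz : η x = 0
      · simp [hz]
      have hx0 := hx hz
      have hc0 := hT.c_nonneg
      have a2 := hT.mul_test_le (τ x + k) (by linarith)
      rw [softPart_of_nonneg hx0, ← ofReal_norm, ← ENNReal.ofReal_pow (norm_nonneg _),
        ← ENNReal.ofReal_mul (by positivity), ← ENNReal.ofReal_mul hc0]
      refine ENNReal.ofReal_le_ofReal ?_
      rw [Real.norm_eq_abs, sq_abs]
      have hp0 : 0 ≤ |Pb x| + |fb x| / k := by positivity
      have hη0 : 0 ≤ η x * η x := mul_self_nonneg _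
      calc _ = (|Pb x| + |fb x| / k) * (η x * η x) * ((τ x + k) * Φ (τ x + k)) := by ring
        _ ≤ (|Pb x| + |fb x| / k) * (η x * η x) * (c * H (τ x + k) ^ 2) := by gcongr
        _ = _ := by ring
    rw [mul_add]
    refine (add_le_add hint (mul_le_mul_right hbd 2)).trans_eq ?_
    rw [ENNReal.ofReal_mul zero_le_two, ENNReal.ofReal_ofNat]
    ring
  · refine add_le_add (mul_le_mul_right (mul_le_mul_right (add_le_add le_rfl ?_) _) _) le_rfl
    exact h.lintegral_sq_deriv_le hT hη hKS

end LocalSolution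

end Caccioppoli

/-! ### Reverse Hölder inequalities at scale `r` -/

section Scaling

variable {n : ℕ} [NeZero n] {M : Type*} [EMetricSpace M]
  [ChartedSpace (EuclideanHalfSpace n) M] [IsManifold (𝓡∂ n) 1 M]
  [RiemannianBundle (fun x : M ↦ TangentSpace (𝓡∂ n) x)]
  [IsContinuousRiemannianBundle (𝔼 n) (fun x : M ↦ TangentSpace (𝓡∂ n) x)]
  [MeasurableSpace M] [BorelSpace M]
  {u : M → ℝ} {G : ∀ x : M, TangentSpace (𝓡∂ n) x} {τ : M → ℝ} {S : Set M}
  {φ : ℕ → M → ℝ} {η : M → ℝ} {S₀ U K : Set M} {L : ℝ}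
  {P f Pb fb : M → ℝ} {k s C r : ℝ} {ν : ℕ}

namespace LocalSolution

variable {a b c T : ℝ} {Φ Φ' H H' : ℝ → ℝ}

/-- The right-hand side of the Caccioppoli inequality in terms of the integral over `U` alone. -/
lemma cutoff_terms_le (h : LocalSolution s k P f Pb fb u G τ S φ C ν r)
    (hη : IsCutoff n η S₀ U K L) (hU : MeasurableSet U) :
    ∫⁻ x, ‖grad (n := n) η x‖ₑ ^ 2 * ‖H (softPart k (u x) + k)‖ₑ ^ 2 ∂volM n M +
          ofReal (1 / r ^ 2) *
            ∫⁻ x, ‖η x * H (softPart k (u x) + k)‖ₑ ^ 2 ∂volM n M ≤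
      ofReal (L ^ 2 + 1 / r ^ 2) * ∫⁻ x in U, ofReal (H (u x + k) ^ 2)
        ∂volM n M := by
  rw [IsAlmostFlat.lintegral_eq_setLIntegral hU
    (f := fun x ↦ ‖grad (n := n) η x‖ₑ ^ 2 * ‖H (softPart k (u x) + k)‖ₑ ^ 2) (fun x hx ↦ by
    rw [hη.grad_eq_zero fun hxK ↦ hx (hη.subset hxK)]; simp),
    IsAlmostFlat.lintegral_eq_setLIntegral hU
    (f := fun x ↦ ‖η x * H (softPart k (u x) + k)‖ₑ ^ 2) (fun x hx ↦ by
    rw [hη.eq_zero x fun hxK ↦ hx (hη.subset hxK)]; simp),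
    ENNReal.ofReal_add (by positivity) (by positivity), add_mul]
  refine add_le_add ?_ (mul_le_mul_right ?_ _)
  · rw [← lintegral_const_mul' _ _ ENNReal.ofReal_ne_top]
    refine lintegral_mono_ae ?_
    filter_upwards [ae_restrict_of_ae h.nonneg] with x hx
    rw [softPart_of_nonneg hx]
    refine mul_le_mul' ((hη.enorm_grad_le x).trans (indicator_le_self' (fun _ _ ↦ zero_le) x)) ?_
    rw [← ofReal_norm, ← ENNReal.ofReal_pow (norm_nonneg _), Real.norm_eq_abs, sq_abs]
  · refine lintegral_mono_ae ?_
    filter_upwards [ae_restrict_of_ae h.nonneg] with x hx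
    rw [softPart_of_nonneg hx, enorm_mul, mul_pow]
    refine (mul_le_mul_left (hη.enorm_le_one x) _).trans ?_
    rw [one_mul, ← ofReal_norm, ← ENNReal.ofReal_pow (norm_nonneg _), Real.norm_eq_abs, sq_abs]

/-- The Caccioppoli inequality between the sets `S₀ ⊆ U` of a cutoff function. -/
lemma energy_le (h : LocalSolution s k P f Pb fb u G τ S φ C ν r)
    (hT : TestPair s k a b c T Φ Φ' H H') (hη : IsCutoff n η S₀ U K L) (hU : MeasurableSet U)
    (hUS : U ⊆ S) (hS₀ : MeasurableSet S₀) (hS₀S : S₀ ⊆ S) :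
    ofReal a * ∫⁻ x in S₀, ofReal (s * Φ' (u x + k) * ‖G x‖ ^ 2) ∂volM n M ≤
      ofReal (9 * 8 ^ ν * C * T ^ (ν + 1)) * (ofReal (L ^ 2 + 1 / r ^ 2) *
        ∫⁻ x in U, ofReal (H (u x + k) ^ 2) ∂volM n M) := by
  refine le_trans (mul_le_mul_right ?_ _) ((h.caccioppoli hT hη (hη.subset.trans hUS)).trans
    (mul_le_mul_right (h.cutoff_terms_le hη hU) _))
  refine le_trans (le_of_eq ?_) (lintegral_mono_set hS₀S)
  refine setLIntegral_congr_fun hS₀ fun x hx ↦ ?_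
  simp only [hη.eq_one x hx, mul_one, one_mul]

/-- The Sobolev inequality for `η H(u + k)`, combined with the Caccioppoli inequality. -/
lemma reverse_holder_le (h : LocalSolution s k P f Pb fb u G τ S φ C ν r)
    (hT : TestPair s k a b c T Φ Φ' H H') (hη : IsCutoff n η S₀ U K L) (hU : MeasurableSet U)
    (hUS : U ⊆ S) (hS₀ : MeasurableSet S₀) {D : ℝ≥0∞} (hD : D ≠ ⊤) {κ : ℝ} (hκ : 0 < κ)
    (hsob : ∀ v : M → ℝ, ContMDiff (𝓡∂ n) 𝓘(ℝ, ℝ) 1 v → (∀ x ∉ K, v x = 0) →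
      (∫⁻ x, ‖v x‖ₑ ^ (2 * κ) ∂volM n M) ^ (1 / κ) ≤
        D * ∫⁻ x, ‖grad (n := n) v x‖ₑ ^ 2 ∂volM n M) :
    (∫⁻ x in S₀, ofReal |H (u x + k)| ^ (2 * κ) ∂volM n M) ^ (1 / κ) ≤
      D * (ofReal (36 * 8 ^ ν * C * T ^ (ν + 1)) * (ofReal (L ^ 2 + 1 / r ^ 2) *
        ∫⁻ x in U, ofReal (H (u x + k) ^ 2) ∂volM n M)) := by
  have hHF := hT.power.isC1Lipschitz_comp h.k_pos
  have hKμ : volM n M K < ⊤ :=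
    (measure_mono (hη.subset.trans hUS)).trans_lt h.measure_lt_top
  have h1 := h.approx.sobolev hHF hη hKμ hD hκ hsob
  have h2 := h.lintegral_sq_deriv_le hT hη (hη.subset.trans hUS)
  have h3 := h.caccioppoli hT hη (hη.subset.trans hUS)
  have h4 := h.cutoff_terms_le (H := H) hη hU
  rw [H1Approx.lintegral_cutoffEnergy_eq h.approx.aemeasurable hHF hη] at h1
  calc _ ≤ (∫⁻ x, ‖η x * H (softPart k (u x) + k)‖ₑ ^ (2 * κ) ∂volM n M) ^ (1 / κ) := by
        refine ENNReal.rpow_le_rpow ?_ (by positivity)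
        refine le_trans (lintegral_mono_ae ?_) (setLIntegral_le_lintegral S₀ _)
        filter_upwards [ae_restrict_mem hS₀, ae_restrict_of_ae h.nonneg] with x hx hx'
        rw [hη.eq_one x hx, one_mul, softPart_of_nonneg hx', ← Real.norm_eq_abs, ofReal_norm]
    _ ≤ _ := h1
    _ ≤ D * (ofReal (36 * 8 ^ ν * C * T ^ (ν + 1)) * (∫⁻ x,
        ‖grad (n := n) η x‖ₑ ^ 2 * ‖H (softPart k (u x) + k)‖ₑ ^ 2 ∂volM n M +
          ofReal (1 / r ^ 2) *
            ∫⁻ x, ‖η x * H (softPart k (u x) + k)‖ₑ ^ 2 ∂volM n M)) := by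
        refine mul_le_mul_right ?_ _
        have h5 := h2.trans h3
        set Y := ∫⁻ x, ‖grad (n := n) η x‖ₑ ^ 2 * ‖H (softPart k (u x) + k)‖ₑ ^ 2 ∂volM n M
        set Z := ofReal (1 / r ^ 2) *
            ∫⁻ x, ‖η x * H (softPart k (u x) + k)‖ₑ ^ 2 ∂volM n M
        set q : ℝ := 9 * 8 ^ ν * C * T ^ (ν + 1) with hq
        have hC := h.one_le
        have hq1 : 1 ≤ q := by
          rw [hq]
          exact one_le_mul_of_one_le_of_one_le (one_le_mul_of_one_le_of_one_le
            (one_le_mul_of_one_le_of_one_le (by norm_num) (one_le_pow₀ (by norm_num))) hC)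
            (one_le_pow₀ hT.one_le)
        have h6 : Y ≤ ofReal q * (Y + Z) :=
          (le_self_add (b := Z)).trans (le_mul_of_one_le_left zero_le (ENNReal.one_le_ofReal.2 hq1))
        refine (mul_le_mul_right (add_le_add h6 h5) _).trans_eq ?_
        rw [show 36 * 8 ^ ν * C * T ^ (ν + 1) = 4 * q by rw [hq]; ring,
          ENNReal.ofReal_mul (p := 4) (by norm_num), ENNReal.ofReal_ofNat]
        ring
    _ ≤ _ := mul_le_mul_right (mul_le_mul_right h4 _) _

end LocalSolution

end Scaling

section ScaledVolume

variable {n : ℕ} {M : Type*} [EMetricSpace M] [MeasurableSpace M] [BorelSpace M] {r : ℝ}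

/-- The volume in units of the radius `r`. The length of gradients is to be multiplied by `r`
accordingly. -/
def scaledVolume (n : ℕ) (M : Type*) [EMetricSpace M] [MeasurableSpace M] [BorelSpace M] (r : ℝ) :
    Measure M :=
  ofReal (r ^ n)⁻¹ • volM n M

lemma ae_scaledVolume_restrict {p : M → Prop} {E : Set M}
    (h : ∀ᵐ x ∂((volM n M).restrict E), p x) : ∀ᵐ x ∂((scaledVolume n M r).restrict E), p x := by
  rw [scaledVolume, Measure.restrict_smul]
  exact Measure.ae_smul_measure h _

lemma setLIntegral_scaledVolume (E : Set M) (g : M → ℝ≥0∞) :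
    ∫⁻ x in E, g x ∂scaledVolume n M r =
      ofReal (r ^ n)⁻¹ * ∫⁻ x in E, g x ∂volM n M := by
  rw [scaledVolume, Measure.restrict_smul, lintegral_smul_measure, smul_eq_mul]

end ScaledVolume

/-! ### The hypotheses of the abstract iteration in a chart -/

section HarnackData

variable {n : ℕ} [NeZero n] {M : Type*} [EMetricSpace M]
  [ChartedSpace (EuclideanHalfSpace n) M] [IsManifold (𝓡∂ n) 1 M]
  [RiemannianBundle (fun x : M ↦ TangentSpace (𝓡∂ n) x)]
  [IsContinuousRiemannianBundle (𝔼 n) (fun x : M ↦ TangentSpace (𝓡∂ n) x)]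
  [MeasurableSpace M] [BorelSpace M]
  {x₀ : M} {A : 𝔼 n ≃L[ℝ] 𝔼 n} {R ρ₀ : ℝ}

lemma ofReal_mul_sq_scale {a r g : ℝ} :
    ofReal (a * (r * g) ^ 2) = ofReal (r ^ 2) * ofReal (a * g ^ 2) := by
  rw [← ENNReal.ofReal_mul (by positivity)]
  ring_nf

/-- Scaling of the constant `(B / ((ρ' - ρ) r))² + r⁻²` from the cutoff. -/
lemma cutoff_const_le {B q r : ℝ} (hq : 0 < q) (hq' : q ≤ 13 / 5) (hr : 0 < r) :
    (B / (q * r)) ^ 2 + 1 / r ^ 2 ≤ (B ^ 2 + 7) / q ^ 2 * (1 / r ^ 2) := by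
  have h1 : 1 ≤ 7 / q ^ 2 := by
    rw [le_div_iff₀ (by positivity)]
    nlinarith
  have h2 : (B / (q * r)) ^ 2 = B ^ 2 / q ^ 2 * (1 / r ^ 2) := by
    field_simp
  rw [h2, add_div, add_mul]
  have : 1 * (1 / r ^ 2) ≤ 7 / q ^ 2 * (1 / r ^ 2) := by gcongr
  linarith

/-- On an almost flat chart ball, a local solution satisfies all the hypotheses of the abstract
iteration, with constants that do not depend on the solution, the centre and the radius. -/
theorem IsAlmostFlat.exists_harnackData (hn : 3 ≤ n) (h : IsAlmostFlat x₀ A R ρ₀) {C : ℝ}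
    (hC : 1 ≤ C) (ν : ℕ) : ∃ D : ℝ, 0 < D ∧
    ∀ p ∈ halfSpace n, ∀ r : ℝ, 0 < r →
      halfBall A p (18 / 5 * r) ⊆ halfBall A (extChartAt (𝓡∂ n) x₀ x₀) R →
      ∀ {s k : ℝ} {P f Pb fb u : M → ℝ} {G : ∀ x : M, TangentSpace (𝓡∂ n) x} {τ : M → ℝ}
        {φ : ℕ → M → ℝ},
        LocalSolution s k P f Pb fb u G τ (chartBall x₀ A p (18 / 5 * r)) φ C ν r →
        HarnackData (scaledVolume n M r) (fun ρ ↦ chartBall x₀ A p (ρ * r)) s k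
          ((n : ℝ) / ((n : ℝ) - 2)) D (ν + 1) (fun x ↦ u x + k) (fun x ↦ r * ‖G x‖) := by
  obtain ⟨B, hB, hcut⟩ := IsAlmostFlat.exists_cutoff (n := n) (M := M)
  obtain ⟨Cs, hCs, hsob⟩ := h.exists_sobolev hn
  obtain ⟨Cv, hCv, hvol⟩ := h.exists_volM_chartBall_bounds
  obtain ⟨Cp, hCp, hpoi⟩ := h.exists_poincare
  have hn' : (3 : ℝ) ≤ n := by exact_mod_cast hn
  set κ : ℝ := (n : ℝ) / ((n : ℝ) - 2) with hκ
  have hκ0 : 0 < κ := div_pos (by linarith) (by linarith)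
  set N : ℝ := 36 * 8 ^ ν * C * (B ^ 2 + 7) with hN
  have hN0 : 0 < N := by positivity
  set D : ℝ := Cv * (18 / 5) ^ n + Cv + N * (Cs.toReal + 1) + Cp * 3 ^ (n + 2) with hD
  have hD0 : 0 < D := by positivity
  refine ⟨D, hD0, fun p hp r hr hsub s k P f Pb fb u G τ φ hu ↦ ?_⟩
  have hk := hu.k_pos
  have hrn : 0 < r ^ n := by positivity
  have hmeas : ∀ ρ, MeasurableSet (chartBall x₀ A p (ρ * r)) := fun ρ ↦
    (isOpen_chartBall x₀ A p _).measurableSet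
  have hmono : Monotone fun ρ ↦ chartBall x₀ A p (ρ * r) := fun ρ ρ' hρ ↦
    chartBall_mono x₀ A p (by gcongr)
  have hsub' : ∀ ρ, ρ ≤ 18 / 5 → halfBall A p (ρ * r) ⊆ halfBall A (extChartAt (𝓡∂ n) x₀ x₀) R :=
    fun ρ hρ y hy ↦ hsub ⟨hy.1, hy.2.trans_le (mul_le_mul_of_nonneg_right hρ hr.le)⟩
  have hSR : chartBall x₀ A p (18 / 5 * r) ⊆ chartBall x₀ A (extChartAt (𝓡∂ n) x₀ x₀) R :=
    fun x hx ↦ ⟨hx.1, (hsub (extChartAt_mem_halfBall hx)).2⟩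
  have hconst : ∀ {T ρ ρ' : ℝ}, 1 ≤ T → 1 ≤ ρ → ρ < ρ' → ρ' ≤ 18 / 5 →
      36 * 8 ^ ν * C * T ^ (ν + 1) * ((B / (ρ' * r - ρ * r)) ^ 2 + 1 / r ^ 2) ≤
        N * T ^ (ν + 1) / (ρ' - ρ) ^ 2 * (1 / r ^ 2) := fun {T ρ ρ'} hT h1 h2 h3 ↦ by
    rw [← sub_mul]
    refine (mul_le_mul_of_nonneg_left (cutoff_const_le (B := B) (sub_pos.2 h2) (by linarith) hr)
      (by positivity)).trans_eq ?_
    rw [hN]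
    ring
  refine ⟨hmono, ?_, ?_, ?_, ?_, ?_, ?_, ?_, ?_⟩
  · rw [scaledVolume, Measure.smul_apply, smul_eq_mul]
    refine (mul_le_mul_right (hvol p hp _ (by positivity) hsub).1 _).trans ?_
    rw [← ENNReal.ofReal_mul (by positivity)]
    refine ENNReal.ofReal_le_ofReal ?_
    calc (r ^ n)⁻¹ * (Cv * (18 / 5 * r) ^ n) = Cv * (18 / 5) ^ n := by
          rw [mul_pow]
          field_simp
      _ ≤ D := by
          have : 0 ≤ Cv + N * (Cs.toReal + 1) + Cp * 3 ^ (n + 2) := by positivity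
          rw [hD]
          linarith
  · rw [scaledVolume, Measure.smul_apply, smul_eq_mul, one_mul]
    have h1 := (hvol p hp r hr (by simpa using hsub' 1 (by norm_num))).2
    calc (1 : ℝ≥0∞) = ofReal (r ^ n)⁻¹ * ofReal (r ^ n) := by
          rw [← ENNReal.ofReal_mul (by positivity), inv_mul_cancel₀ hrn.ne', ENNReal.ofReal_one]
      _ ≤ ofReal (r ^ n)⁻¹ * (ofReal Cv * volM n M (chartBall x₀ A p r)) := by
          gcongr
      _ ≤ ofReal (r ^ n)⁻¹ * (ofReal D * volM n M (chartBall x₀ A p r)) := by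
          gcongr
          have : 0 ≤ Cv * (18 / 5) ^ n + N * (Cs.toReal + 1) + Cp * 3 ^ (n + 2) := by positivity
          rw [hD]
          linarith
      _ = _ := by ring
  · exact ae_scaledVolume_restrict ((ae_restrict_of_ae hu.nonneg).mono fun x hx ↦ by linarith)
  · rw [scaledVolume, Measure.restrict_smul]
    exact ((hu.approx.aemeasurable.add_const k).restrict).smul_measure _
  · rw [setLIntegral_scaledVolume]
    refine ENNReal.mul_lt_top ENNReal.ofReal_lt_top ?_
    calc _ ≤ ∫⁻ x in chartBall x₀ A p (18 / 5 * r), (2 * ‖u x‖ₑ ^ 2 + ofReal (2 * k ^ 2))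
          ∂volM n M := by
          refine lintegral_mono fun x ↦ ?_
          have h2 : (2 : ℝ≥0∞) = ofReal 2 := by simp
          rw [← ofReal_norm, h2, ← ENNReal.ofReal_pow (norm_nonneg _),
            ← ENNReal.ofReal_mul zero_le_two, ← ENNReal.ofReal_add (by positivity) (by positivity),
            Real.norm_eq_abs, sq_abs]
          refine ENNReal.ofReal_le_ofReal ?_
          nlinarith [sq_nonneg (u x - k)]
      _ < ⊤ := by
          rw [lintegral_add_right _ measurable_const, lintegral_const_mul' _ _ (by simp),
            lintegral_const, Measure.restrict_apply_univ]
          exact ENNReal.add_lt_top.2 ⟨ENNReal.mul_lt_top (by simp)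
            ((setLIntegral_le_lintegral _ _).trans_lt hu.approx.lintegral_sq_lt_top),
            ENNReal.mul_lt_top ENNReal.ofReal_lt_top hu.measure_lt_top⟩
  · intro a b c T Φ Φ' H H' hT ρ ρ' hρ hρρ' hρ'
    obtain ⟨η, K, hη⟩ := hcut h p (ρ * r) (ρ' * r) (by positivity) (by gcongr) (hsub' ρ' hρ')
    have hUS : chartBall x₀ A p (ρ' * r) ⊆ chartBall x₀ A p (18 / 5 * r) := hmono hρ'
    have h1 := hu.reverse_holder_le hT hη (hmeas _) hUS (hmeas _) hCs hκ0 fun v hv hv0 ↦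
      hsob v K hv hη.isCompact ((hη.subset.trans hUS).trans hSR) hv0
    rw [setLIntegral_scaledVolume, setLIntegral_scaledVolume,
      ENNReal.mul_rpow_of_nonneg _ _ (by positivity)]
    refine (mul_le_mul_right h1 _).trans ?_
    -- the powers of `r` match because `n / κ = n - 2`
    have hpow : ofReal (r ^ n)⁻¹ ^ (1 / κ) = ofReal (r ^ 2 * (r ^ n)⁻¹) := by
      rw [ENNReal.ofReal_rpow_of_pos (by positivity)]
      congr 1
      rw [← Real.rpow_natCast, ← Real.rpow_neg hr.le, ← Real.rpow_mul hr.le, ← Real.rpow_natCast,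
        ← Real.rpow_add hr]
      congr 1
      rw [hκ]
      push_cast
      have : (n : ℝ) - 2 ≠ 0 := by linarith
      field_simp
      ring
    rw [hpow, ← ENNReal.ofReal_toReal hCs, ← mul_assoc, ← mul_assoc, ← mul_assoc, ← mul_assoc,
      ← ENNReal.ofReal_mul (by positivity), ← ENNReal.ofReal_mul (by positivity),
      ← ENNReal.ofReal_mul (by have := hT.one_le; positivity),
      ← ENNReal.ofReal_mul (by have := hT.one_le; positivity)]
    refine mul_le_mul_left (ENNReal.ofReal_le_ofReal ?_) _
    have hT1 := hT.one_le
    have h2 := hconst hT1 hρ hρρ' hρ'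
    have hρρ : 0 < ρ' - ρ := sub_pos.2 hρρ'
    calc _ = r ^ 2 * (r ^ n)⁻¹ * Cs.toReal * (36 * 8 ^ ν * C * T ^ (ν + 1) *
          ((B / (ρ' * r - ρ * r)) ^ 2 + 1 / r ^ 2)) := by ring
      _ ≤ r ^ 2 * (r ^ n)⁻¹ * Cs.toReal * (N * T ^ (ν + 1) / (ρ' - ρ) ^ 2 * (1 / r ^ 2)) := by
          gcongr
      _ = N * Cs.toReal * T ^ (ν + 1) / (ρ' - ρ) ^ 2 * (r ^ n)⁻¹ := by
          field_simp
      _ ≤ D * T ^ (ν + 1) / (ρ' - ρ) ^ 2 * (r ^ n)⁻¹ := by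
          gcongr
          have : 0 ≤ Cv * (18 / 5) ^ n + Cv + N + Cp * 3 ^ (n + 2) := by positivity
          rw [hD]
          linarith
  · intro a b c T Φ Φ' H H' hT ρ ρ' hρ hρρ' hρ'
    obtain ⟨η, K, hη⟩ := hcut h p (ρ * r) (ρ' * r) (by positivity) (by gcongr) (hsub' ρ' hρ')
    have hUS : chartBall x₀ A p (ρ' * r) ⊆ chartBall x₀ A p (18 / 5 * r) := hmono hρ'
    have h1 := hu.energy_le hT hη (hmeas _) hUS (hmeas _) (hmono (hρρ'.le.trans hρ'))
    rw [setLIntegral_scaledVolume, setLIntegral_scaledVolume]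
    simp only [ofReal_mul_sq_scale]
    rw [lintegral_const_mul' _ _ ENNReal.ofReal_ne_top]
    have hT1 := hT.one_le
    have h2 := hconst hT1 hρ hρρ' hρ'
    have hρρ : 0 < ρ' - ρ := sub_pos.2 hρρ'
    set X := ∫⁻ x in chartBall x₀ A p (ρ * r), ofReal (s * Φ' (u x + k) * ‖G x‖ ^ 2)
      ∂volM n M
    set Y := ∫⁻ x in chartBall x₀ A p (ρ' * r), ofReal (H (u x + k) ^ 2) ∂volM n M
    calc _ = ofReal (r ^ n)⁻¹ * ofReal (r ^ 2) * (ofReal a * X) := by ring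
      _ ≤ ofReal (r ^ n)⁻¹ * ofReal (r ^ 2) * (ofReal
          (9 * 8 ^ ν * C * T ^ (ν + 1)) * (ofReal ((B / (ρ' * r - ρ * r)) ^ 2 +
            1 / r ^ 2) * Y)) := mul_le_mul_right h1 _
      _ = ofReal ((r ^ n)⁻¹ * r ^ 2 * (9 * 8 ^ ν * C * T ^ (ν + 1) *
          ((B / (ρ' * r - ρ * r)) ^ 2 + 1 / r ^ 2))) * Y := by
          rw [ENNReal.ofReal_mul (p := (r ^ n)⁻¹ * r ^ 2) (by positivity),
            ENNReal.ofReal_mul (p := (r ^ n)⁻¹) (by positivity),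
            ENNReal.ofReal_mul (p := 9 * 8 ^ ν * C * T ^ (ν + 1)) (by positivity)]
          ring
      _ ≤ ofReal (D * T ^ (ν + 1) / (ρ' - ρ) ^ 2 * (r ^ n)⁻¹) * Y := by
          refine mul_le_mul_left (ENNReal.ofReal_le_ofReal ?_) _
          calc _ ≤ (r ^ n)⁻¹ * r ^ 2 * (36 * 8 ^ ν * C * T ^ (ν + 1) *
                ((B / (ρ' * r - ρ * r)) ^ 2 + 1 / r ^ 2)) := by
                gcongr
                norm_num
            _ ≤ (r ^ n)⁻¹ * r ^ 2 * (N * T ^ (ν + 1) / (ρ' - ρ) ^ 2 * (1 / r ^ 2)) := by gcongr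
            _ = N * T ^ (ν + 1) / (ρ' - ρ) ^ 2 * (r ^ n)⁻¹ := by field_simp
            _ ≤ _ := by
                gcongr
                have : 0 ≤ Cv * (18 / 5) ^ n + Cv + N * Cs.toReal + Cp * 3 ^ (n + 2) := by
                  positivity
                rw [hD]
                linarith
      _ = _ := by
          rw [ENNReal.ofReal_mul (q := (r ^ n)⁻¹) (by positivity), mul_assoc]
  · intro F F' hF
    have hFF := hF.isC1Lipschitz_comp hk
    set E := chartBall x₀ A p (3 * r) with hE
    have hES : E ⊆ chartBall x₀ A p (18 / 5 * r) := hmono (by norm_num)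
    have h1 := hu.approx.poincare hFF (hmeas 3) ((measure_mono hES).trans_lt hu.measure_lt_top)
      (c := ofReal (Cp * (3 * r) ^ (n + 2))) ENNReal.ofReal_ne_top fun v hv ↦
        hpoi v hv p hp (3 * r) (by positivity) (hsub' 3 (by norm_num))
    have hnn : ∀ᵐ x ∂((volM n M).restrict E), 0 ≤ u x := ae_restrict_of_ae hu.nonneg
    have hl : ∫⁻ y in E, ∫⁻ z in E, ofReal ((F (u y + k) - F (u z + k)) ^ 2)
        ∂volM n M ∂volM n M = ∫⁻ y in E, ∫⁻ z in E,
          ‖F (softPart k (u y) + k) - F (softPart k (u z) + k)‖ₑ ^ 2 ∂volM n M ∂volM n M := by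
      refine lintegral_congr_ae ?_
      filter_upwards [hnn] with y hy
      refine lintegral_congr_ae ?_
      filter_upwards [hnn] with z hz
      rw [softPart_of_nonneg hy, softPart_of_nonneg hz, ← ofReal_norm,
        ← ENNReal.ofReal_pow (norm_nonneg _), Real.norm_eq_abs, sq_abs]
    have hr' : ∫⁻ x in E, ofReal (F' (u x + k) ^ 2 * ‖G x‖ ^ 2) ∂volM n M =
        ∫⁻ x in E, ‖F' (softPart k (u x) + k) * softPartDeriv k (u x)‖ₑ ^ 2 * ‖G x‖ₑ ^ 2
          ∂volM n M := by
      refine lintegral_congr_ae ?_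
      filter_upwards [hnn] with x hx
      rw [softPart_of_nonneg hx, softPartDeriv_of_nonneg hx, mul_one]
      simp only [← ofReal_norm]
      rw [← ENNReal.ofReal_pow (norm_nonneg _), ← ENNReal.ofReal_pow (norm_nonneg _),
        ← ENNReal.ofReal_mul (by positivity), Real.norm_eq_abs, sq_abs]
    simp only [setLIntegral_scaledVolume, ofReal_mul_sq_scale]
    rw [lintegral_const_mul' _ _ ENNReal.ofReal_ne_top,
      lintegral_const_mul' _ _ ENNReal.ofReal_ne_top, hl, hr']
    set X := ∫⁻ x in E, ‖F' (softPart k (u x) + k) * softPartDeriv k (u x)‖ₑ ^ 2 * ‖G x‖ₑ ^ 2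
          ∂volM n M
    refine (mul_le_mul_right (mul_le_mul_right h1 _) _).trans ?_
    calc _ = ofReal ((r ^ n)⁻¹ * ((r ^ n)⁻¹ * (Cp * (3 * r) ^ (n + 2)))) * X := by
          rw [ENNReal.ofReal_mul (p := (r ^ n)⁻¹) (by positivity),
            ENNReal.ofReal_mul (p := (r ^ n)⁻¹) (by positivity)]
          ring
      _ = ofReal (Cp * 3 ^ (n + 2) * ((r ^ n)⁻¹ * r ^ 2)) * X := by
          congr 2
          rw [mul_pow, pow_add r]
          field_simp
      _ ≤ ofReal (D * ((r ^ n)⁻¹ * r ^ 2)) * X := by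
          refine mul_le_mul_left (ENNReal.ofReal_le_ofReal ?_) _
          gcongr
          have : 0 ≤ Cv * (18 / 5) ^ n + Cv + N * (Cs.toReal + 1) := by positivity
          rw [hD]
          linarith
      _ = _ := by
          rw [ENNReal.ofReal_mul hD0.le, ENNReal.ofReal_mul (by positivity)]
          ring

end HarnackData

/-! ### Balls, norms and approximations near a point -/

section Localization

variable {n : ℕ} [NeZero n] {M : Type*} [EMetricSpace M]
  [ChartedSpace (EuclideanHalfSpace n) M]
  [RiemannianBundle (fun x : M ↦ TangentSpace (𝓡∂ n) x)]
  {x₀ : M} {A : 𝔼 n ≃L[ℝ] 𝔼 n} {R ρ₀ : ℝ} {x : M}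

namespace IsAlmostFlat

lemma eball_subset_eball (h : IsAlmostFlat x₀ A R ρ₀)
    (hx : x ∈ Metric.eball x₀ (ofReal (R / 10))) {t : ℝ} (ht : t ≤ R) :
    ballPlus x t ⊆ Metric.eball x₀ (ofReal ρ₀) := by
  intro y hy
  have hR := h.radius_pos
  have hρ := h.radius_le
  rw [ballPlus, Metric.mem_eball] at hy
  rw [Metric.mem_eball] at hx ⊢
  calc edist y x₀ ≤ edist y x + edist x x₀ := edist_triangle _ _ _
    _ < ofReal R + ofReal (R / 10) :=
        ENNReal.add_lt_add (hy.trans_le (ENNReal.ofReal_le_ofReal ht)) hx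
    _ ≤ ofReal ρ₀ := by
        rw [← ENNReal.ofReal_add (by positivity) (by positivity)]
        exact ENNReal.ofReal_le_ofReal (by linarith)

lemma mem_eball_self (h : IsAlmostFlat x₀ A R ρ₀)
    (hx : x ∈ Metric.eball x₀ (ofReal (R / 10))) :
    x ∈ Metric.eball x₀ (ofReal ρ₀) :=
  h.eball_subset_eball hx le_rfl (by
    rw [ballPlus, Metric.mem_eball, edist_self]
    exact ENNReal.ofReal_pos.2 h.radius_pos)

/-- The bound `37/100` allows the radius `37/10 · r` for every `r < R/10`. -/
lemma halfBall_subset_halfBall (h : IsAlmostFlat x₀ A R ρ₀)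
    (hx : x ∈ Metric.eball x₀ (ofReal (R / 10))) {t : ℝ} (ht : t ≤ 37 / 100 * R) :
    halfBall A (extChartAt (𝓡∂ n) x₀ x) t ⊆ halfBall A (extChartAt (𝓡∂ n) x₀ x₀) R := by
  have hR := h.radius_pos
  have hρ := h.radius_le
  have h1 := h.le_edist x₀ (Metric.mem_eball_self (ENNReal.ofReal_pos.2 (by linarith))) x
    (h.mem_eball_self hx)
  rw [Metric.mem_eball] at hx
  have h2 : ‖A (extChartAt (𝓡∂ n) x₀ x - extChartAt (𝓡∂ n) x₀ x₀)‖ ≤ 11 / 100 * R := by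
    have h3 := h1.trans (mul_le_mul_right (edist_comm x x₀ ▸ hx.le) _)
    rw [← ENNReal.ofReal_mul (by norm_num), ENNReal.ofReal_le_ofReal_iff (by positivity)] at h3
    linarith
  intro y hy
  refine ⟨hy.1, ?_⟩
  have h4 : ‖A (y - extChartAt (𝓡∂ n) x₀ x)‖ < t := hy.2
  change ‖A (y - extChartAt (𝓡∂ n) x₀ x₀)‖ < R
  have h5 : A (y - extChartAt (𝓡∂ n) x₀ x₀) = A (y - extChartAt (𝓡∂ n) x₀ x) +
      A (extChartAt (𝓡∂ n) x₀ x - extChartAt (𝓡∂ n) x₀ x₀) := by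
    rw [← map_add, sub_add_sub_cancel]
  rw [h5]
  refine (norm_add_le _ _).trans_lt ?_
  linarith

/-- In an almost flat chart the distance and the chart norm differ by a factor of at most `11/10`. -/
lemma ballPlus_subset_chartBall (h : IsAlmostFlat x₀ A R ρ₀)
    (hx : x ∈ Metric.eball x₀ (ofReal (R / 10))) {t : ℝ} (ht0 : 0 < t) (ht : t ≤ R) :
    ballPlus x t ⊆ chartBall x₀ A (extChartAt (𝓡∂ n) x₀ x) (11 / 10 * t) := by
  intro y hy
  have hy' := h.eball_subset_eball hx ht hy
  refine ⟨h.mem_source y hy', ?_⟩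
  have h1 := h.le_edist x (h.mem_eball_self hx) y hy'
  rw [ballPlus, Metric.mem_eball, edist_comm] at hy
  have h2 := h1.trans_lt (ENNReal.mul_lt_mul_right (by simp) (by simp) hy)
  rw [← ENNReal.ofReal_mul (by norm_num), ENNReal.ofReal_lt_ofReal_iff (by positivity)] at h2
  exact h2

lemma chartBall_subset_ballPlus (h : IsAlmostFlat x₀ A R ρ₀)
    (hx : x ∈ Metric.eball x₀ (ofReal (R / 10))) {t : ℝ} (ht0 : 0 < t)
    (ht : t ≤ 37 / 100 * R) :
    chartBall x₀ A (extChartAt (𝓡∂ n) x₀ x) t ⊆ ballPlus x (11 / 10 * t) := by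
  intro y hy
  have hsub := h.halfBall_subset_halfBall hx ht
  have hxs := h.mem_source x (h.mem_eball_self hx)
  have h1 := h.edist_le _ (hsub (extChartAt_mem_halfBall hy)) _
    (hsub ⟨extChartAt_mem_halfSpace hxs, by simpa using ht0⟩)
  rw [(extChartAt (𝓡∂ n) x₀).left_inv hy.1, (extChartAt (𝓡∂ n) x₀).left_inv hxs] at h1
  rw [ballPlus, Metric.mem_eball]
  refine h1.trans_lt ((ENNReal.ofReal_lt_ofReal_iff (by positivity)).2 ?_)
  have h2 : ‖A (extChartAt (𝓡∂ n) x₀ y - extChartAt (𝓡∂ n) x₀ x)‖ < t := hy.2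
  rw [← neg_sub, map_neg, norm_neg]
  linarith

end IsAlmostFlat

end Localization

section Norms

lemma eLpNorm_ofReal_eq_lintegral {X : Type*} [MeasurableSpace X] {m : Measure X} (h : X → ℝ)
    {p : ℝ} (hp : 0 < p) :
    eLpNorm h (ofReal p) m = (∫⁻ x, ‖h x‖ₑ ^ p ∂m) ^ (1 / p) := by
  rw [eLpNorm_eq_lintegral_rpow_enorm_toReal (by simpa using hp) ENNReal.ofReal_ne_top,
    ENNReal.toReal_ofReal hp.le]

/-- The `L^p` norm of the potential `|a| + |b| / k`, where `k` dominates the scaled norm of `b`. -/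
lemma lintegral_potential_le {X : Type*} [MeasurableSpace X] {m : Measure X} {a b : X → ℝ}
    {p k Λ r e : ℝ} (hp : 1 ≤ p) (hk : 0 < k) (ha : AEMeasurable a m) (hb : AEMeasurable b m)
    (hr : 0 < r) (hr1 : r ≤ 1) (he : 0 ≤ e)
    (haΛ : eLpNorm a (ofReal p) m ≤ ofReal Λ)
    (hbk : ofReal (r ^ e) * eLpNorm b (ofReal p) m ≤ ofReal k) :
    (∫⁻ x, ofReal (|a x| + |b x| / k) ^ p ∂m) ^ (1 / p) ≤
      ofReal ((|Λ| + 1) * r ^ (-e)) := by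
  have hp0 : 0 < p := by linarith
  have hre : 0 < r ^ e := Real.rpow_pos_of_pos hr _
  have h1 : (∫⁻ x, ofReal (|a x| + |b x| / k) ^ p ∂m) ^ (1 / p) ≤
      eLpNorm a (ofReal p) m + ofReal k⁻¹ * eLpNorm b (ofReal p) m := by
    have h2 : ∀ x, ofReal (|a x| + |b x| / k) = ‖a x‖ₑ + ofReal k⁻¹ * ‖b x‖ₑ :=
      fun x ↦ by
        rw [ENNReal.ofReal_add (abs_nonneg _) (by positivity), div_eq_inv_mul,
          ENNReal.ofReal_mul (by positivity), ← Real.norm_eq_abs, ← Real.norm_eq_abs, ofReal_norm,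
          ofReal_norm]
    simp only [h2]
    refine (ENNReal.lintegral_Lp_add_le ha.enorm (hb.enorm.const_mul _) hp).trans ?_
    rw [eLpNorm_ofReal_eq_lintegral a hp0, eLpNorm_ofReal_eq_lintegral b hp0]
    refine add_le_add le_rfl (le_of_eq ?_)
    simp only [ENNReal.mul_rpow_of_nonneg _ _ hp0.le]
    rw [lintegral_const_mul' _ _ (ENNReal.rpow_ne_top_of_nonneg hp0.le ENNReal.ofReal_ne_top),
      ENNReal.mul_rpow_of_nonneg _ _ (by positivity), ← ENNReal.rpow_mul,
      mul_one_div_cancel hp0.ne', ENNReal.rpow_one]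
  have h3 : ofReal k⁻¹ * eLpNorm b (ofReal p) m ≤ ofReal (r ^ (-e)) := by
    calc _ = ofReal (k⁻¹ * r ^ (-e)) *
          (ofReal (r ^ e) * eLpNorm b (ofReal p) m) := by
          rw [← mul_assoc, ← ENNReal.ofReal_mul (by positivity), mul_assoc, Real.rpow_neg hr.le,
            inv_mul_cancel₀ hre.ne', mul_one]
      _ ≤ ofReal (k⁻¹ * r ^ (-e)) * ofReal k := mul_le_mul_right hbk _
      _ = _ := by
          rw [← ENNReal.ofReal_mul (by positivity)]
          congr 1
          field_simp
  have h4 : 1 ≤ r ^ (-e) := Real.one_le_rpow_of_pos_of_le_one_of_nonpos hr hr1 (by linarith)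
  refine (h1.trans (add_le_add haΛ h3)).trans ?_
  rw [add_mul, one_mul, ENNReal.ofReal_add (by positivity) (by positivity)]
  refine add_le_add (ENNReal.ofReal_le_ofReal ?_) le_rfl
  calc Λ ≤ |Λ| * 1 := by rw [mul_one]; exact le_abs_self Λ
    _ ≤ _ := by gcongr

end Norms

section Approximation

variable {n : ℕ} [NeZero n] {M : Type*} [EMetricSpace M]
  [ChartedSpace (EuclideanHalfSpace n) M]
  [RiemannianBundle (fun x : M ↦ TangentSpace (𝓡∂ n) x)]
  [MeasurableSpace M] [BorelSpace M]
  {u : M → ℝ} {G : ∀ x : M, TangentSpace (𝓡∂ n) x} {τ : M → ℝ} {S S' : Set M}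
  {φ : ℕ → M → ℝ}

lemma H1Approx.mono_set (h : H1Approx u G τ S φ) (hS : S' ⊆ S) : H1Approx u G τ S' φ :=
  { h with
    aemeasurable_trace := h.aemeasurable_trace.mono_set hS
    tsum_trace_lt_top := lt_of_le_of_lt (ENNReal.tsum_le_tsum fun _ ↦ lintegral_mono_set hS)
      h.tsum_trace_lt_top }

/-- The boundary measure on `S` lives on the points of `S` that belong to the boundary. -/
lemma volBoundary_restrict_le {x : M} {r : ℝ} (hS : MeasurableSet S) (hSr : S ⊆ ballPlus x r) :
    (volBoundary n M).restrict S ≤ (volBoundary n M).restrict (ballBoundary n x r) := by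
  refine Measure.le_iff.2 fun T hT ↦ ?_
  rw [Measure.restrict_apply hT, Measure.restrict_apply hT, volBoundary,
    Measure.restrict_apply (hT.inter hS)]
  refine le_trans (measure_mono ?_) (Measure.le_restrict_apply _ _)
  intro y hy
  exact ⟨⟨hy.1.1, hSr hy.1.2, hy.2⟩, hy.2⟩

end Approximation

/-- An estimate for all positive `k` not below `d` holds for `d` itself, also when `d = 0`. -/
lemma ENNReal_le_of_forall_ofReal_le {a b : ℝ≥0∞} {c : ℝ} {d : ℝ≥0∞} (hd : d ≠ ⊤) (hc : 0 < c)
    (h : ∀ k : ℝ, 0 < k → d ≤ ofReal k → a ≤ b + ofReal c * ofReal k) :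
    a ≤ b + ofReal c * d := by
  refine ENNReal.le_of_forall_pos_le_add fun ε hε hlt ↦ ?_
  have hε' : 0 < (ε : ℝ) := hε
  refine (h (d.toReal + ε / c) (by positivity) ?_).trans_eq ?_
  · exact (ENNReal.ofReal_toReal hd).ge.trans (ENNReal.ofReal_le_ofReal (by
      linarith [show 0 < (ε : ℝ) / c by positivity]))
  · rw [ENNReal.ofReal_add ENNReal.toReal_nonneg (by positivity), ENNReal.ofReal_toReal hd,
      mul_add, ← ENNReal.ofReal_mul hc.le, mul_div_cancel₀ _ hc.ne', ENNReal.ofReal_coe_nnreal,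
      add_assoc]

/-! ### Local estimates with uniform constants -/

section Scale

variable {n : ℕ} {M : Type*} [EMetricSpace M] [MeasurableSpace M] [BorelSpace M]

/-- The `L^p` norm with respect to the rescaled volume. -/
lemma lintegral_scaledVolume_rpow (S : Set M) {u : M → ℝ} {p r : ℝ} (hp : 0 < p) (hr : 0 < r)
    (hu : ∀ᵐ y ∂volM n M, 0 ≤ u y) :
    (∫⁻ x in S, ofReal (u x) ^ p ∂scaledVolume n M r) ^ (1 / p) =
      ofReal (r ^ (-((n : ℝ) / p))) * normM n u p S := by
  have h1 : ∫⁻ x in S, ofReal (u x) ^ p ∂volM n M =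
      ∫⁻ x in S, ‖u x‖ₑ ^ p ∂volM n M := by
    refine lintegral_congr_ae ?_
    filter_upwards [ae_restrict_of_ae hu] with x hx
    rw [← ofReal_norm, Real.norm_of_nonneg hx]
  rw [setLIntegral_scaledVolume, h1, ENNReal.mul_rpow_of_nonneg _ _ (by positivity), normM,
    eLpNorm_ofReal_eq_lintegral u hp, ENNReal.ofReal_rpow_of_pos (by positivity)]
  congr 2
  rw [← Real.rpow_natCast, ← Real.rpow_neg hr.le, ← Real.rpow_mul hr.le]
  congr 1
  ring

lemma ae_restrict_of_ae_scaledVolume {p : M → Prop} {E : Set M} {r : ℝ} (hr : 0 < r)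
    (h : ∀ᵐ x ∂((scaledVolume n M r).restrict E), p x) : ∀ᵐ x ∂((volM n M).restrict E), p x := by
  rw [scaledVolume, Measure.restrict_smul] at h
  exact (Measure.ae_ennreal_smul_measure_iff (by simpa using by positivity)).1 h

/-- The sum of the scaled norms of the data `f` and `fb` on the ball of radius `4 r`. -/
def dataSize (n : ℕ) [NeZero n] {M : Type*} [EMetricSpace M] [MeasurableSpace M] [BorelSpace M]
    [ChartedSpace (EuclideanHalfSpace n) M] (q s r : ℝ) (f fb : M → ℝ) (x : M) : ℝ≥0∞ :=
  ofReal (r ^ (2 - 2 * (n : ℝ) / q)) * normM n f (q / 2) (ballPlus x (4 * r)) +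
    ofReal (r ^ (1 - ((n : ℝ) - 1) / s)) *
      normBoundary n fb s (ballBoundary n x (4 * r))

lemma dataTerm_eq [NeZero n] [ChartedSpace (EuclideanHalfSpace n) M] {q s C r : ℝ} (hC : 0 ≤ C) (f fb : M → ℝ) (x : M) :
    dataTerm n q s C r f fb x = ofReal C * dataSize n q s r f fb x := by
  rw [dataTerm, dataSize, ENNReal.ofReal_mul hC, ENNReal.ofReal_mul hC]
  ring

end Scale

section Estimates

variable {n : ℕ} [NeZero n] {M : Type*} [EMetricSpace M] [SecondCountableTopology M]
  [ChartedSpace (EuclideanHalfSpace n) M] [IsManifold (𝓡∂ n) 1 M]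
  [RiemannianBundle (fun x : M ↦ TangentSpace (𝓡∂ n) x)]
  [IsContinuousRiemannianBundle (𝔼 n) (fun x : M ↦ TangentSpace (𝓡∂ n) x)]
  [MeasurableSpace M] [BorelSpace M]
  {x₀ : M} {A : 𝔼 n ≃L[ℝ] 𝔼 n} {R ρ₀ : ℝ}

/-- Near `x₀`, a nonnegative sub- or supersolution satisfies the hypotheses of the abstract
iteration, for every `k > 0` that dominates the data. -/
lemma IsAlmostFlat.exists_forall_harnackData (hn : 3 ≤ n) (h : IsAlmostFlat x₀ A R ρ₀)
    {q s : ℝ} (hq : (n : ℝ) < q) (hs : (n : ℝ) - 1 < s) (Λ : ℝ) :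
    ∃ (D : ℝ) (d : ℕ), 0 < D ∧ ∀ P f Pb fb : M → ℝ, Admissible n q s Λ P f Pb fb →
      ∀ x ∈ Metric.eball x₀ (ofReal (R / 10)), ∀ r : ℝ, 0 < r → r < R / 10 → r ≤ 1 →
      ∀ k : ℝ, 0 < k → dataSize n q s r f fb x ≤ ofReal k →
      ∀ (u : M → ℝ) (G : ∀ x : M, TangentSpace (𝓡∂ n) x) (τ : M → ℝ) (σ : ℝ),
        (∀ᵐ y ∂volM n M, 0 ≤ u y) → IsH1 u G τ → |σ| = 1 →
        (∀ v, IsTest n v → σ * weakForm P f Pb fb u G τ v ≤ 0) →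
        HarnackData (scaledVolume n M r)
          (fun ρ ↦ chartBall x₀ A (extChartAt (𝓡∂ n) x₀ x) (ρ * r)) σ k
          ((n : ℝ) / ((n : ℝ) - 2)) D d (fun x ↦ u x + k) (fun x ↦ r * ‖G x‖) := by
  have hn' : (3 : ℝ) ≤ n := by exact_mod_cast hn
  obtain ⟨C, ν, hC, hform⟩ := exists_form_bound hn h hq hs (N := |Λ| + 1) (by positivity)
  obtain ⟨D, hD, hdata⟩ := h.exists_harnackData hn hC ν
  obtain ⟨Cv, hCv, hvol⟩ := h.exists_volM_chartBall_bounds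
  obtain ⟨c, hc, htr⟩ := exists_trace_sq h
  refine ⟨D, ν + 1, hD, fun P f Pb fb hadm x hx r hr hrR hr1 k hk hdk u G τ σ hu hH1 hσ hweak ↦ ?_⟩
  set p := extChartAt (𝓡∂ n) x₀ x with hp
  have hps : p ∈ halfSpace n := extChartAt_mem_halfSpace (h.mem_source x (h.mem_eball_self hx))
  -- the largest chart ball of the iteration; as `18/5 · 11/10 < 4`, it lies in the ball of radius
  -- `4 r`, on which the norms of the data are taken
  set S := chartBall x₀ A p (18 / 5 * r) with hS
  have hSm : MeasurableSet S := (isOpen_chartBall x₀ A p _).measurableSet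
  have hsub : halfBall A p (18 / 5 * r) ⊆ halfBall A (extChartAt (𝓡∂ n) x₀ x₀) R :=
    h.halfBall_subset_halfBall hx (by linarith)
  have hSR : S ⊆ chartBall x₀ A (extChartAt (𝓡∂ n) x₀ x₀) R :=
    fun x hx ↦ ⟨hx.1, (hsub (extChartAt_mem_halfBall hx)).2⟩
  have hSball : S ⊆ ballPlus x (4 * r) :=
    (h.chartBall_subset_ballPlus hx (by positivity) (by linarith)).trans
      (Metric.eball_subset_eball (ENNReal.ofReal_le_ofReal (by linarith)))
  have hcomp := h.isCompact_closedChartBall (p := p) (t := 18 / 5 * r) (t' := 37 / 10 * r)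
    (by linarith) (h.halfBall_subset_halfBall hx (by linarith))
  obtain ⟨φ, hφ⟩ := hH1.exists_approx hcomp
  have hPm := hadm.memLp.aestronglyMeasurable.aemeasurable
  have hfm := hadm.locallyIntegrable.aestronglyMeasurable.aemeasurable
  have hPbm := hadm.memLp_boundary.aestronglyMeasurable.aemeasurable
  have hfbm := hadm.locallyIntegrable_boundary.aestronglyMeasurable.aemeasurable
  have hq0 : 0 < q := by linarith
  have hs0 : 0 < s := by linarith
  refine hdata p hps r hr hsub (φ := φ) (P := P) (f := f) (Pb := Pb) (fb := fb) (τ := τ)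
    ⟨hφ.mono_set fun y hy ↦ ⟨hy.1, LT.lt.le (b := 18 / 5 * r) hy.2⟩, hk, hσ, hC, hr, hu, hSm,
    (hvol p hps _ (by positivity) hsub).1.trans_lt ENNReal.ofReal_lt_top, hPm, hfm, hPbm, hfbm,
    hform hSR ?_ ?_ hr ?_ ?_, ⟨c / 1, fun v K hv hK hKS hv0 ↦ htr v K hv hK (hKS.trans hSR) hv0 1
      one_pos⟩, hweak⟩
  · exact ((measurable_norm.comp_aemeasurable hPm).add
      ((measurable_norm.comp_aemeasurable hfm).div_const k)).ennreal_ofReal.restrict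
  · exact ((measurable_norm.comp_aemeasurable hPbm).add
      ((measurable_norm.comp_aemeasurable hfbm).div_const k)).ennreal_ofReal.restrict
  · refine lintegral_potential_le (by linarith) hk hPm.restrict hfm.restrict hr hr1 ?_ ?_ ?_
    · rw [sub_nonneg, div_le_iff₀ hq0]
      linarith
    · refine le_trans ?_ ((le_self_add).trans hadm.norm_le)
      exact eLpNorm_mono_measure _ (Measure.restrict_mono (subset_univ S) le_rfl)
    · refine le_trans (mul_le_mul_right ?_ _) ((le_self_add).trans hdk)
      exact eLpNorm_mono_measure _ (Measure.restrict_mono hSball le_rfl)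
  · refine lintegral_potential_le (by linarith) hk hPbm.restrict hfbm.restrict hr hr1 ?_ ?_ ?_
    · rw [sub_nonneg, div_le_iff₀ hs0]
      linarith
    · refine le_trans ?_ ((le_add_self).trans hadm.norm_le)
      exact eLpNorm_mono_measure _ (Measure.restrict_mono (subset_univ S) le_rfl)
    · refine le_trans (mul_le_mul_right ?_ _) ((le_add_self).trans hdk)
      exact eLpNorm_mono_measure _ (volBoundary_restrict_le hSm hSball)

/-- The local maximum principle near `x₀`. -/
theorem IsAlmostFlat.exists_sub_estimate (hn : 3 ≤ n) (h : IsAlmostFlat x₀ A R ρ₀)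
    {q s : ℝ} (hq : (n : ℝ) < q) (hs : (n : ℝ) - 1 < s) (Λ : ℝ) {p : ℝ} (hp : 1 < p) :
    ∃ C : ℝ, 0 < C ∧ ∀ P f Pb fb : M → ℝ, Admissible n q s Λ P f Pb fb →
      ∀ x ∈ Metric.eball x₀ (ofReal (R / 10)), ∀ r : ℝ, 0 < r → r < R / 10 → r ≤ 1 →
      ∀ u : M → ℝ, (∀ᵐ y ∂volM n M, 0 ≤ u y) → IsSubsolution n P f Pb fb u →
        essSup (fun y ↦ ofReal (u y)) ((volM n M).restrict (ballPlus x r)) ≤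
          ofReal (C * r ^ (-((n : ℝ) / p))) * normM n u p (ballPlus x (2 * r)) +
            dataTerm n q s C r f fb x := by
  have hn' : (3 : ℝ) ≤ n := by exact_mod_cast hn
  have hp0 : 0 < p := by linarith
  obtain ⟨D, d, hD, hdata⟩ := h.exists_forall_harnackData hn hq hs Λ
  have hκ : 1 < (n : ℝ) / ((n : ℝ) - 2) := by
    rw [one_lt_div (by linarith)]
    linarith
  obtain ⟨C, hC, hmain⟩ := HarnackData.exists_sub_bound (X := M) (p := p) d hκ hD hp
  set C' : ℝ := C * (1 + D ^ (1 / p)) with hC'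
  have hDp : 0 < D ^ (1 / p) := Real.rpow_pos_of_pos hD _
  have hC'0 : 0 < C' := by positivity
  have hCC' : C ≤ C' := by
    rw [hC']
    nlinarith
  refine ⟨C', hC'0, fun P f Pb fb hadm x hx r hr hrR hr1 u hu ⟨G, τ, hH1, hweak⟩ ↦ ?_⟩
  rw [dataTerm_eq hC'0.le]
  by_cases hd : dataSize n q s r f fb x = ⊤
  · rw [hd, ENNReal.mul_top (by simpa using hC'0), add_top]
    exact le_top
  -- the iteration needs `k > 0`; it decreases to the size of the data afterwards
  refine ENNReal_le_of_forall_ofReal_le hd hC'0 fun k hk hdk ↦ ?_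
  have hH := hdata P f Pb fb hadm x hx r hr hrR hr1 k hk hdk u G τ 1 hu hH1 abs_one
    (fun v hv ↦ by rw [one_mul]; exact hweak v hv)
  have h1 := ae_restrict_of_ae_scaledVolume hr (hmain _ _ k _ _ hk hH)
  set E : ℝ → Set M := fun ρ ↦ chartBall x₀ A (extChartAt (𝓡∂ n) x₀ x) (ρ * r) with hE
  have hsub1 : ballPlus x r ⊆ E (11 / 10) := h.ballPlus_subset_chartBall hx hr (by linarith)
  have hsub2 : E (9 / 5) ⊆ ballPlus x (2 * r) :=
    (h.chartBall_subset_ballPlus hx (by positivity) (by linarith)).trans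
      (Metric.eball_subset_eball (ENNReal.ofReal_le_ofReal (by linarith)))
  have hum : AEMeasurable (fun x ↦ ofReal (u x)) ((scaledVolume n M r).restrict
      (E (9 / 5))) := by
    rw [scaledVolume, Measure.restrict_smul]
    exact hH1.memLp.aestronglyMeasurable.aemeasurable.ennreal_ofReal.restrict.smul_measure _
  have h2 : (∫⁻ x in E (9 / 5), ofReal (u x + k) ^ p ∂scaledVolume n M r) ^ (1 / p) ≤
      ofReal (r ^ (-((n : ℝ) / p))) * normM n u p (ballPlus x (2 * r)) +
        ofReal (D ^ (1 / p)) * ofReal k := by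
    calc _ ≤ (∫⁻ x in E (9 / 5), (ofReal (u x) +
          ofReal k) ^ p ∂scaledVolume n M r) ^ (1 / p) := by
          refine ENNReal.rpow_le_rpow (lintegral_mono fun x ↦ ?_) (by positivity)
          exact ENNReal.rpow_le_rpow ENNReal.ofReal_add_le hp0.le
      _ ≤ _ := ENNReal.lintegral_Lp_add_le hum aemeasurable_const hp.le
      _ ≤ _ := by
          rw [lintegral_scaledVolume_rpow _ hp0 hr hu]
          refine add_le_add (mul_le_mul_right ?_ _) ?_
          · exact eLpNorm_mono_measure _ (Measure.restrict_mono hsub2 le_rfl)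
          · rw [lintegral_const, Measure.restrict_apply_univ, ENNReal.mul_rpow_of_nonneg _ _
              (by positivity), ← ENNReal.rpow_mul, mul_one_div_cancel hp0.ne', ENNReal.rpow_one,
              mul_comm, ← ENNReal.ofReal_rpow_of_pos hD]
            refine mul_le_mul_left (ENNReal.rpow_le_rpow ?_ (by positivity)) _
            exact (measure_mono (hH.mono (by norm_num))).trans hH.measure_le
  refine essSup_le_of_ae_le _ ?_
  filter_upwards [ae_restrict_of_ae_restrict_of_subset hsub1 h1] with y hy
  calc ofReal (u y) ≤ ofReal (u y + k) :=
        ENNReal.ofReal_le_ofReal (by linarith)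
    _ ≤ ofReal C * (ofReal (r ^ (-((n : ℝ) / p))) *
        normM n u p (ballPlus x (2 * r)) + ofReal (D ^ (1 / p)) * ofReal k) :=
        hy.trans (mul_le_mul_right h2 _)
    _ = ofReal (C * r ^ (-((n : ℝ) / p))) * normM n u p (ballPlus x (2 * r)) +
        ofReal (C * D ^ (1 / p)) * ofReal k := by
        rw [ENNReal.ofReal_mul hC.le, ENNReal.ofReal_mul hC.le]
        ring
    _ ≤ _ := by
        gcongr
        rw [hC']
        nlinarith

/-- The weak Harnack inequality near `x₀`. -/
theorem IsAlmostFlat.exists_super_estimate (hn : 3 ≤ n) (h : IsAlmostFlat x₀ A R ρ₀)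
    {q s : ℝ} (hq : (n : ℝ) < q) (hs : (n : ℝ) - 1 < s) (Λ : ℝ) {p : ℝ} (hp : 1 ≤ p)
    (hpn : p < (n : ℝ) / ((n : ℝ) - 2)) :
    ∃ C : ℝ, 0 < C ∧ ∀ P f Pb fb : M → ℝ, Admissible n q s Λ P f Pb fb →
      ∀ x ∈ Metric.eball x₀ (ofReal (R / 10)), ∀ r : ℝ, 0 < r → r < R / 10 → r ≤ 1 →
      ∀ u : M → ℝ, (∀ᵐ y ∂volM n M, 0 ≤ u y) → IsSupersolution n P f Pb fb u →
        ofReal (r ^ (-((n : ℝ) / p))) * normM n u p (ballPlus x (2 * r)) ≤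
          ofReal C * essInf (fun y ↦ ofReal (u y))
            ((volM n M).restrict (ballPlus x r)) + dataTerm n q s C r f fb x := by
  have hn' : (3 : ℝ) ≤ n := by exact_mod_cast hn
  have hp0 : 0 < p := by linarith
  obtain ⟨D, d, hD, hdata⟩ := h.exists_forall_harnackData hn hq hs Λ
  have hκ : 1 < (n : ℝ) / ((n : ℝ) - 2) := by
    rw [one_lt_div (by linarith)]
    linarith
  obtain ⟨C, hC, hmain⟩ := HarnackData.exists_super_bound (X := M) (p := p) d hκ hD hp0 hpn
  have hC2 : 0 < C * C := by positivity
  refine ⟨C * C, hC2, fun P f Pb fb hadm x hx r hr hrR hr1 u hu ⟨G, τ, hH1, hweak⟩ ↦ ?_⟩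
  rw [dataTerm_eq hC2.le]
  by_cases hd : dataSize n q s r f fb x = ⊤
  · rw [hd, ENNReal.mul_top (by simpa using hC2), add_top]
    exact le_top
  refine ENNReal_le_of_forall_ofReal_le hd hC2 fun k hk hdk ↦ ?_
  have hH := hdata P f Pb fb hadm x hx r hr hrR hr1 k hk hdk u G τ (-1) hu hH1 (by simp)
    (fun v hv ↦ by linarith [hweak v hv])
  obtain ⟨m, hm, h1, h2⟩ := hmain _ _ k _ _ hk hH
  replace h1 := ae_restrict_of_ae_scaledVolume hr h1
  set E : ℝ → Set M := fun ρ ↦ chartBall x₀ A (extChartAt (𝓡∂ n) x₀ x) (ρ * r) with hE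
  have hsub1 : ballPlus x r ⊆ E (11 / 10) := h.ballPlus_subset_chartBall hx hr (by linarith)
  have hsub2 : ballPlus x (2 * r) ⊆ E (11 / 5) := by
    have := h.ballPlus_subset_chartBall hx (t := 2 * r) (by positivity) (by linarith)
    rwa [← mul_assoc, show (11 / 10 * 2 : ℝ) = 11 / 5 by norm_num] at this
  have h3 : ofReal m ≤ ofReal C * (essInf (fun y ↦ ofReal (u y))
      ((volM n M).restrict (ballPlus x r)) + ofReal k) := by
    have hC0 : ofReal C ≠ 0 := by simpa using hC
    rw [mul_comm, ← ENNReal.div_le_iff hC0 ENNReal.ofReal_ne_top, ← tsub_le_iff_right]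
    refine le_essInf_of_ae_le _ ?_
    filter_upwards [ae_restrict_of_ae_restrict_of_subset hsub1 h1] with y hy
    rw [tsub_le_iff_right, ENNReal.div_le_iff hC0 ENNReal.ofReal_ne_top]
    calc ofReal m ≤ ofReal (C * (u y + k)) := ENNReal.ofReal_le_ofReal hy
      _ = ofReal (u y + k) * ofReal C := by
          rw [mul_comm, ENNReal.ofReal_mul' hC.le]
      _ ≤ _ := mul_le_mul_left ENNReal.ofReal_add_le _
  rw [← lintegral_scaledVolume_rpow _ hp0 hr hu]
  calc _ ≤ (∫⁻ x in E (11 / 5), ofReal (u x + k) ^ p ∂scaledVolume n M r) ^ (1 / p) := by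
        refine ENNReal.rpow_le_rpow ((lintegral_mono_set hsub2).trans (lintegral_mono fun y ↦ ?_))
          (by positivity)
        exact ENNReal.rpow_le_rpow (ENNReal.ofReal_le_ofReal (by linarith)) hp0.le
    _ ≤ ofReal C * ofReal m := h2.trans_eq (ENNReal.ofReal_mul hC.le)
    _ ≤ _ := mul_le_mul_right h3 _
    _ = _ := by
        rw [ENNReal.ofReal_mul hC.le]
        ring

end Estimates

/-- Constants for the points of a cover can be replaced by one constant on a compact set. -/
lemma exists_pos_of_finset {ι : Type*} (t : Finset ι) {Q : ι → ℝ → Prop}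
    (hmono : ∀ i c c', c ≤ c' → Q i c → Q i c') (h : ∀ i ∈ t, ∃ c, 0 < c ∧ Q i c) :
    ∃ c, 0 < c ∧ ∀ i ∈ t, Q i c := by
  classical
  induction t using Finset.induction_on with
  | empty => exact ⟨1, one_pos, by simp⟩
  | insert a t ha ih =>
    obtain ⟨c₁, hc₁, h₁⟩ := h a (Finset.mem_insert_self a t)
    obtain ⟨c₂, hc₂, h₂⟩ := ih fun i hi ↦ h i (Finset.mem_insert_of_mem hi)
    refine ⟨max c₁ c₂, lt_max_of_lt_left hc₁, fun i hi ↦ ?_⟩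
    rcases Finset.mem_insert.1 hi with rfl | hi
    · exact hmono _ _ _ (le_max_left _ _) h₁
    · exact hmono _ _ _ (le_max_right _ _) (h₂ i hi)

end RobinMoser

end

theorem mainTheorem10 (n : ℕ) [NeZero n] (hn : 3 ≤ n)
    {M : Type*} [EMetricSpace M] [MeasurableSpace M] [BorelSpace M]
    [SecondCountableTopology M] [ChartedSpace (EuclideanHalfSpace n) M]
    [IsManifold (𝓡∂ n) ∞ M]
    [RiemannianBundle (fun x : M ↦ TangentSpace (𝓡∂ n) x)]
    [IsContMDiffRiemannianBundle (𝓡∂ n) ∞ (EuclideanSpace ℝ (Fin n))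
      (fun x : M ↦ TangentSpace (𝓡∂ n) x)]
    [IsRiemannianManifold (𝓡∂ n) M] [CompleteSpace M]
    (K : Set M) (hK : IsCompact K) (hKM : K ⊆ (𝓡∂ n).boundary M) :
    ∃ r₀ : ℝ, 0 < r₀ ∧ ∀ q s Λ : ℝ, (n : ℝ) < q → (n : ℝ) - 1 < s →
      (∀ p : ℝ, 1 < p → ∃ C : ℝ, 0 < C ∧
        ∀ P f Pb fb : M → ℝ, RobinMoser.Admissible n q s Λ P f Pb fb →
        ∀ x ∈ K, ∀ r : ℝ, 0 < r → r < r₀ →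
        ∀ u : M → ℝ, (∀ᵐ y ∂(RobinMoser.volM n M), 0 ≤ u y) →
          RobinMoser.IsSubsolution n P f Pb fb u →
          essSup (fun y ↦ ENNReal.ofReal (u y))
              ((RobinMoser.volM n M).restrict (RobinMoser.ballPlus x r)) ≤
            ENNReal.ofReal (C * r ^ (-((n : ℝ) / p))) *
                RobinMoser.normM n u p (RobinMoser.ballPlus x (2 * r)) +
              RobinMoser.dataTerm n q s C r f fb x) ∧
      (∀ p : ℝ, 1 ≤ p → p < (n : ℝ) / ((n : ℝ) - 2) → ∃ C : ℝ, 0 < C ∧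
        ∀ P f Pb fb : M → ℝ, RobinMoser.Admissible n q s Λ P f Pb fb →
        ∀ x ∈ K, ∀ r : ℝ, 0 < r → r < r₀ →
        ∀ u : M → ℝ, (∀ᵐ y ∂(RobinMoser.volM n M), 0 ≤ u y) →
          RobinMoser.IsSupersolution n P f Pb fb u →
          ENNReal.ofReal (r ^ (-((n : ℝ) / p))) *
              RobinMoser.normM n u p (RobinMoser.ballPlus x (2 * r)) ≤
            ENNReal.ofReal C *
                essInf (fun y ↦ ENNReal.ofReal (u y))
                  ((RobinMoser.volM n M).restrict (RobinMoser.ballPlus x r)) +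
              RobinMoser.dataTerm n q s C r f fb x) := by
  have : IsManifold (𝓡∂ n) 1 M := inferInstance
  have : IsContinuousRiemannianBundle (EuclideanSpace ℝ (Fin n))
      (fun x : M ↦ TangentSpace (𝓡∂ n) x) := by
    obtain ⟨g, hg, hg'⟩ := IsContMDiffRiemannianBundle.exists_contMDiff (IB := 𝓡∂ n) (n := ∞)
      (F := EuclideanSpace ℝ (Fin n)) (E := fun x : M ↦ TangentSpace (𝓡∂ n) x)
    exact ⟨g, hg.continuous, hg'⟩
  choose A R ρ h using fun x₀ : M ↦ RobinMoser.exists_isAlmostFlat (n := n) x₀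
  have hR : ∀ x₀, 0 < ENNReal.ofReal (R x₀ / 10) := fun x₀ ↦
    ENNReal.ofReal_pos.2 (by have := (h x₀).radius_pos; positivity)
  -- finitely many almost flat charts cover `K`; `10 / R x₀ ≤ c` for each of them, so radii below
  -- `1 / c` are small enough for all, and radii below `1` keep the scaled norms of `P` bounded
  obtain ⟨t, -, ht⟩ := hK.elim_nhds_subcover
    (fun x₀ ↦ Metric.eball x₀ (ENNReal.ofReal (R x₀ / 10)))
    (fun x₀ _ ↦ Metric.eball_mem_nhds x₀ (hR x₀))
  obtain ⟨c, hc, hct⟩ := RobinMoser.exists_pos_of_finset t (Q := fun x₀ c ↦ 10 / R x₀ ≤ c)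
    (fun _ _ _ hc h ↦ h.trans hc) fun x₀ _ ↦ ⟨10 / R x₀, by have := (h x₀).radius_pos; positivity,
      le_rfl⟩
  have hsmall : ∀ {r : ℝ}, r < min 1 c⁻¹ → ∀ x₀ ∈ t, r < R x₀ / 10 := fun {r} hr x₀ hx₀ ↦ by
    have hR := (h x₀).radius_pos
    refine (hr.trans_le (min_le_right _ _)).trans_le ?_
    rw [inv_le_comm₀ hc (by positivity), inv_div]
    exact hct x₀ hx₀
  have hdata : ∀ {q s C C' r : ℝ} {f fb : M → ℝ} {x : M}, 0 < r → C ≤ C' →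
      RobinMoser.dataTerm n q s C r f fb x ≤ RobinMoser.dataTerm n q s C' r f fb x := by
    intro q s C C' r f fb x hr hC
    rw [RobinMoser.dataTerm, RobinMoser.dataTerm]
    gcongr
  refine ⟨min 1 c⁻¹, lt_min one_pos (inv_pos.2 hc), fun q s Λ hq hs ↦
    ⟨fun p hp ↦ ?_, fun p hp hpn ↦ ?_⟩⟩
  · obtain ⟨C, hC, hCt⟩ := RobinMoser.exists_pos_of_finset t (Q := fun x₀ C ↦
      ∀ P f Pb fb : M → ℝ, RobinMoser.Admissible n q s Λ P f Pb fb →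
      ∀ x ∈ Metric.eball x₀ (ENNReal.ofReal (R x₀ / 10)), ∀ r : ℝ, 0 < r → r < R x₀ / 10 → r ≤ 1 →
      ∀ u : M → ℝ, (∀ᵐ y ∂(RobinMoser.volM n M), 0 ≤ u y) →
        RobinMoser.IsSubsolution n P f Pb fb u →
        essSup (fun y ↦ ENNReal.ofReal (u y))
            ((RobinMoser.volM n M).restrict (RobinMoser.ballPlus x r)) ≤
          ENNReal.ofReal (C * r ^ (-((n : ℝ) / p))) *
              RobinMoser.normM n u p (RobinMoser.ballPlus x (2 * r)) +
            RobinMoser.dataTerm n q s C r f fb x)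
      (fun x₀ C C' hC hQ P f Pb fb hadm x hx r hr hrR hr1 u hu hsub ↦
        (hQ P f Pb fb hadm x hx r hr hrR hr1 u hu hsub).trans (by
          refine add_le_add (mul_le_mul_left (ENNReal.ofReal_le_ofReal ?_) _) (hdata hr hC)
          gcongr))
      fun x₀ _ ↦ (h x₀).exists_sub_estimate hn hq hs Λ hp
    refine ⟨C, hC, fun P f Pb fb hadm x hx r hr hr₀ u hu hsub ↦ ?_⟩
    obtain ⟨x₀, hx₀, hxx₀⟩ := mem_iUnion₂.1 (ht hx)
    exact hCt x₀ hx₀ P f Pb fb hadm x hxx₀ r hr (hsmall hr₀ x₀ hx₀)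
      (hr₀.le.trans (min_le_left _ _)) u hu hsub
  · obtain ⟨C, hC, hCt⟩ := RobinMoser.exists_pos_of_finset t (Q := fun x₀ C ↦
      ∀ P f Pb fb : M → ℝ, RobinMoser.Admissible n q s Λ P f Pb fb →
      ∀ x ∈ Metric.eball x₀ (ENNReal.ofReal (R x₀ / 10)), ∀ r : ℝ, 0 < r → r < R x₀ / 10 → r ≤ 1 →
      ∀ u : M → ℝ, (∀ᵐ y ∂(RobinMoser.volM n M), 0 ≤ u y) →
        RobinMoser.IsSupersolution n P f Pb fb u →
        ENNReal.ofReal (r ^ (-((n : ℝ) / p))) *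
            RobinMoser.normM n u p (RobinMoser.ballPlus x (2 * r)) ≤
          ENNReal.ofReal C *
              essInf (fun y ↦ ENNReal.ofReal (u y))
                ((RobinMoser.volM n M).restrict (RobinMoser.ballPlus x r)) +
            RobinMoser.dataTerm n q s C r f fb x)
      (fun x₀ C C' hC hQ P f Pb fb hadm x hx r hr hrR hr1 u hu hsup ↦
        (hQ P f Pb fb hadm x hx r hr hrR hr1 u hu hsup).trans
          (add_le_add (mul_le_mul_left (ENNReal.ofReal_le_ofReal hC) _) (hdata hr hC)))
      fun x₀ _ ↦ (h x₀).exists_super_estimate hn hq hs Λ hp hpn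
    refine ⟨C, hC, fun P f Pb fb hadm x hx r hr hr₀ u hu hsup ↦ ?_⟩
    obtain ⟨x₀, hx₀, hxx₀⟩ := mem_iUnion₂.1 (ht hx)
    exact hCt x₀ hx₀ P f Pb fb hadm x hxx₀ r hr (hsmall hr₀ x₀ hx₀)
      (hr₀.le.trans (min_le_left _ _)) u hu hsup
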